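/- Let $F$ be a number field with Galois group $\Gamma=\mathrm{Gal}(\overline F/F)$, let $G_2$ be the split group of type $G_2$ over $F$, and let $\widehat{G}=G_2(\mathbb C)$ be its dual group (which has trivial centre and trivial $\Gamma$-action). *Definitions.* An endoscopic pair $(s,\rho)$ consists of a semisimple $s\in\widehat G$, with $\widehat H:=Z_{\widehat G}(s)^0$, and a continuous homomorphism $\rho:\Gamma\to\mathrm{Out}(\widehat H)$ such that each $\rho(\sigma)$ is induced by an element of $\widehat G$ normalizing $\widehat H$ and fixing $s$. It is elliptic if $(Z(\widehat H)^{\Gamma})^0\subseteq Z(\widehat G)$. An endoscopic group attached to $(s,\rho)$ is the quasi-split connected reductive $F$-group $H$ (determined up to isomorphism) with dual group $\widehat H$ and Galois action given by $\rho$: the based root datum of $H$ with its $\Gamma$-action is dual to that of $\widehat H$ with the action defined by $\rho$. An isomorphism $(s,\rho)\to(s',\rho')$ is an element $g\in\widehat G$ that conjugates $\widehat H$ to $\widehat H'$ and $\rho$ to $\rho'$ (no condition is imposed on $s,s'$), and $\Lambda(s,\rho)\subseteq\mathrm{Out}(\widehat H)$ is the group of outer automorphisms induced by automorphisms of $(s,\rho)$,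 i.e. of those outer automorphisms that are induced by elements of $\widehat G$ normalizing $\widehat H$ and that commute with $\rho$. *Theorem.* 1. Every elliptic endoscopic pair of $G_2$ over $F$ has trivial $\rho$, and its endoscopic group is exactly one of the split groups $G_2$, $\mathrm{PGL}_3$ (realized as the automorphism group of the algebra of $3\times 3$ matrices; on $\overline F$-points it is $\mathrm{GL}_3$ modulo scalars, acting by conjugation) and $\mathrm{SO}_4=(\mathrm{SL}_2\times\mathrm{SL}_2)/\{\pm1\}$ (realized on $2\times2$ matrices with the quadratic form $\det$; on $\overline F$-points it is the image of $\mathrm{SL}_2\times\mathrm{SL}_2$ acting by $X\mapsto gXh^{-1}$, with kernel $\{\pm(1,1)\}$). 2. Each of the three groups occurs, and for exactly one isomorphism class of elliptic pairs; an isomorphism between two elliptic pairs $(s,\rho)$, $(s',\rho')$ with the same group can moreover be chosen with $gsg^{-1}=s'$. 3. No elliptic endoscopic group of $G_2$ is a torus, and none is isomorphic to $\mathrm{GL}_2$ over $\overline F$. 4. For elliptic pairs with endoscopic group $G_2$, $\mathrm{PGL}_3$, $\mathrm{SO}_4$, the group $\Lambda$ is trivial, of order $2$, and trivial, respectively. 5.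 Let $F=\mathbb Q$. Among the elliptic endoscopic groups of $G_2$, those which can contribute to the stabilization of the trace formula at level $1$ with discrete series at infinity, in the sense that they are unramified at every prime (with $\rho$ trivial on all inertia groups) and have an elliptic maximal torus over $\mathbb R$ (one whose real points are compact modulo the centre), are exactly $G_2$ and $\mathrm{SO}_4=(\mathrm{SL}_2\times\mathrm{SL}_2)/\{\pm1\}$. -/

import Mathlib

open Matrix

universe u

/-! ### Linear algebraic groups as closed matrix groups -/

section Algebraic

variable {ι κ : Type} [Fintype ι] [DecidableEq ι] [Fintype κ] [DecidableEq κ]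
variable {K : Type*} [Field K]

/-- A subgroup of `GL_ι(K)` is Zariski closed if it is cut out by polynomials in the entries. -/
def IsZClosed (H : Subgroup (GL ι K)) : Prop :=
  ∃ S : Set (MvPolynomial (ι × ι) K),
    ∀ g : GL ι K, g ∈ H ↔ ∀ p ∈ S, MvPolynomial.eval (fun ij => g.1 ij.1 ij.2) p = 0

/-- The identity component: the smallest closed subgroup of finite index. -/
def idComp (H : Subgroup (GL ι K)) : Subgroup (GL ι K) :=
  sInf {N | N ≤ H ∧ IsZClosed N ∧ N.relIndex H ≠ 0}

def IsZConnected (H : Subgroup (GL ι K)) : Prop := idComp H = H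

/-- Regular functions on a closed subgroup: polynomials in the entries and `1 / det`. -/
def IsRegularOn (H : Subgroup (GL ι K)) (f : H → K) : Prop :=
  ∃ (p : MvPolynomial (ι × ι) K) (k : ℕ), ∀ h : H,
    f h * (h.1.1.det) ^ k = MvPolynomial.eval (fun ij => h.1.1 ij.1 ij.2) p

/-- Two closed matrix groups are isomorphic as algebraic groups. -/
def AlgIsomorphic (H : Subgroup (GL ι K)) (H' : Subgroup (GL κ K)) : Prop :=
  ∃ f : H ≃* H',
    (∀ i j, IsRegularOn H fun h => (f h).1.1 i j) ∧
    (∀ i j, IsRegularOn H' fun h => (f.symm h).1.1 i j)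

/-- A torus: closed, connected and diagonalizable. -/
def IsTorus (T : Subgroup (GL ι K)) : Prop :=
  IsZClosed T ∧ IsZConnected T ∧
    ∃ P : GL ι K, ∀ t ∈ T, (P * t * P⁻¹).1.IsDiag

def IsMaximalTorus (H T : Subgroup (GL ι K)) : Prop :=
  T ≤ H ∧ IsTorus T ∧ ∀ T', T' ≤ H → IsTorus T' → T ≤ T' → T' = T

/-- Connected reductive: closed, connected, with trivial unipotent radical. -/
def IsConnectedReductive (H : Subgroup (GL ι K)) : Prop :=
  IsZClosed H ∧ IsZConnected H ∧
    ∀ U ≤ H, IsZClosed U → IsZConnected U →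
      (∀ h ∈ H, ∀ n ∈ U, h * n * h⁻¹ ∈ U) → (∀ n ∈ U, IsNilpotent (n.1 - 1)) → U = ⊥

/-- A homomorphism `𝔾_m ^ r → GL_ι` of algebraic groups (entries are Laurent polynomials). -/
def IsAlgTorusHom {r : ℕ} (a : (Fin r → Kˣ) →* GL ι K) : Prop :=
  ∀ i j, ∃ (p : MvPolynomial (Fin r) K) (k : ℕ), ∀ z : Fin r → Kˣ,
    (a z).1 i j * (∏ l, (z l : K)) ^ k = MvPolynomial.eval (fun l => (z l : K)) p

/-- A homomorphism `SL_2 → GL_ι` of algebraic groups. -/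
def IsAlgSL2Hom (f : SpecialLinearGroup (Fin 2) K →* GL ι K) : Prop :=
  ∀ i j, ∃ p : MvPolynomial (Fin 2 × Fin 2) K, ∀ g,
    (f g).1 i j = MvPolynomial.eval (fun kl => g.1 kl.1 kl.2) p

/-- A parametrization `a : 𝔾_m ^ r ≃ T` of a maximal torus `T` of `H` (used in characteristic `0`,
where a bijective homomorphism of algebraic groups is an isomorphism). It identifies `X^*(T)`
with `ℤ ^ r` (`m` is the character `a z ↦ ∏ z_i ^ m_i`) and `X_*(T)` with `ℤ ^ r` (`n` is the
cocharacter `c ↦ a (c ^ n_1, …, c ^ n_r)`). -/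
def IsMaxTorusParam {r : ℕ} (H : Subgroup (GL ι K)) (a : (Fin r → Kˣ) →* GL ι K) : Prop :=
  IsAlgTorusHom a ∧ Function.Injective a ∧ IsMaximalTorus H a.range

def upperUni (x : K) : SpecialLinearGroup (Fin 2) K := ⟨!![1, x; 0, 1], by simp⟩
def lowerUni (x : K) : SpecialLinearGroup (Fin 2) K := ⟨!![1, 0; x, 1], by simp⟩
def diagSL2 (c : Kˣ) : SpecialLinearGroup (Fin 2) K :=
  ⟨!![(c : K), 0; 0, ((c⁻¹ : Kˣ) : K)], by simp⟩

/-- The character with exponent vector `m`. -/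
def monomialChar {r : ℕ} (m : Fin r → ℤ) (z : Fin r → Kˣ) : Kˣ := ∏ i, z i ^ m i

/-- The pairs `(root, coroot)` of `H` with respect to the maximal torus parametrized by `a`, in the
coordinates of `X^*` and `X_*` given by `a`: `m` is a root with coroot `n` if there is a
nontrivial homomorphism `SL_2 → H` which sends the upper (lower) unipotents to the root subgroup
of `m` (of `-m`), and restricts to `n` on the diagonal torus. -/
def rootPairs {r : ℕ} (H : Subgroup (GL ι K)) (a : (Fin r → Kˣ) →* GL ι K) :
    Set ((Fin r → ℤ) × (Fin r → ℤ)) :=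
  {mn | ∃ f : SpecialLinearGroup (Fin 2) K →* GL ι K,
    IsAlgSL2Hom f ∧ f ≠ 1 ∧ f.range ≤ H ∧
    (∀ z x, a z * f (upperUni x) * (a z)⁻¹ =
      f (upperUni ((monomialChar mn.1 z : Kˣ) * x))) ∧
    (∀ z x, a z * f (lowerUni x) * (a z)⁻¹ =
      f (lowerUni (((monomialChar mn.1 z)⁻¹ : Kˣ) * x))) ∧
    (∀ c : Kˣ, f (diagSL2 c) = a fun i => c ^ mn.2 i)}

/-- `Δ` is a base (a system of simple roots) of the set of roots `R`. -/
def IsRootBase {r : ℕ} (R Δ : Set (Fin r → ℤ)) : Prop :=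
  Δ ⊆ R ∧ LinearIndependent ℤ (fun x : Δ => (x : Fin r → ℤ)) ∧
    ∀ m ∈ R, m ∈ AddSubmonoid.closure Δ ∨ -m ∈ AddSubmonoid.closure Δ

/-- The endomorphism of `𝔾_m ^ r` which acts on cocharacters by the integral matrix `B`. -/
def matTorus {r : ℕ} (B : Matrix (Fin r) (Fin r) ℤ) (z : Fin r → Kˣ) : Fin r → Kˣ :=
  fun i => ∏ j, z j ^ B i j

end Algebraic

/-! ### Algebraic groups over a field -/

/-- A linear algebraic group over `F`, as a group functor cut out in `GL_ι` by polynomials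
over `F`. -/
structure AlgGrp (F : Type u) [Field F] where
  ι : Type
  [fintype : Fintype ι]
  [decEq : DecidableEq ι]
  pts : ∀ (R : Type u) [CommRing R] [Algebra F R], Subgroup (GL ι R)
  eqs : Set (MvPolynomial (ι × ι) F)
  mem_pts : ∀ (R : Type u) [CommRing R] [Algebra F R] (g : GL ι R),
    g ∈ pts R ↔ ∀ p ∈ eqs, MvPolynomial.aeval (fun ij : ι × ι => g.1 ij.1 ij.2) p = 0

attribute [instance] AlgGrp.fintype AlgGrp.decEq

section Models

variable {ι : Type} [Fintype ι] [DecidableEq ι]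

/-- The bilinear product on `R ^ ι` with integral structure constants `c`. -/
def scMul (c : ι → ι → ι → ℤ) {R : Type*} [CommRing R] (x y : ι → R) : ι → R :=
  fun k => ∑ i, ∑ j, (c i j k : R) * (x i * y j)

/-- The automorphism group of the algebra `R ^ ι` with structure constants `c`. -/
def autPts (c : ι → ι → ι → ℤ) (R : Type*) [CommRing R] : Subgroup (GL ι R) where
  carrier := {g | ∀ x y, g.1 *ᵥ scMul c x y = scMul c (g.1 *ᵥ x) (g.1 *ᵥ y)}
  one_mem' := by simp
  mul_mem' := by
    intro g h hg hh x y
    simp only [Set.mem_ofPred_eq, Units.val_mul, ← mulVec_mulVec] at *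
    rw [hh, hg]
  inv_mem' := by
    intro g hg x y
    simp only [Set.mem_ofPred_eq] at *
    have key : ∀ v : ι → R, g.1 *ᵥ ((g⁻¹).1 *ᵥ v) = v := fun v => by
      rw [mulVec_mulVec, ← Units.val_mul]; simp
    have key' : ∀ v : ι → R, (g⁻¹).1 *ᵥ (g.1 *ᵥ v) = v := fun v => by
      rw [mulVec_mulVec, ← Units.val_mul]; simp
    have h := hg ((g⁻¹).1 *ᵥ x) ((g⁻¹).1 *ᵥ y)
    rw [key, key] at h
    rw [← h, key']

lemma scMul_single (c : ι → ι → ι → ℤ) {R : Type*} [CommRing R] (i j : ι) :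
    scMul c (Pi.single i (1 : R)) (Pi.single j 1) = fun k => (c i j k : R) := by
  funext k
  simp [scMul, Pi.single_apply]

lemma scMul_expand (c : ι → ι → ι → ℤ) {R : Type*} [CommRing R] (M : Matrix ι ι R) (x y : ι → R)
    (k : ι) : scMul c (M *ᵥ x) (M *ᵥ y) k =
      ∑ i, ∑ j, (∑ a, ∑ b, (c a b k : R) * (M a i * M b j)) * (x i * y j) := by
  simp only [scMul, mulVec, dotProduct, Finset.sum_mul, Finset.mul_sum]
  have h1 : ∀ f : ι → ι → ι → ι → R, ∑ a, ∑ b, ∑ j, ∑ i, f a b i j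
      = ∑ i, ∑ j, ∑ a, ∑ b, f a b i j := by
    intro f
    calc ∑ a, ∑ b, ∑ j, ∑ i, f a b i j
        = ∑ a, ∑ b, ∑ i, ∑ j, f a b i j :=
          Finset.sum_congr rfl fun a _ => Finset.sum_congr rfl fun b _ => Finset.sum_comm
      _ = ∑ a, ∑ i, ∑ b, ∑ j, f a b i j := Finset.sum_congr rfl fun a _ => Finset.sum_comm
      _ = ∑ i, ∑ a, ∑ b, ∑ j, f a b i j := Finset.sum_comm
      _ = ∑ i, ∑ a, ∑ j, ∑ b, f a b i j :=
          Finset.sum_congr rfl fun i _ => Finset.sum_congr rfl fun a _ => Finset.sum_comm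
      _ = _ := Finset.sum_congr rfl fun i _ => Finset.sum_comm
  refine Eq.trans ?_ (h1 _)
  refine Finset.sum_congr rfl fun a _ => Finset.sum_congr rfl fun b _ =>
    Finset.sum_congr rfl fun j _ => Finset.sum_congr rfl fun i _ => ?_
  ring

lemma mem_autPts_iff (c : ι → ι → ι → ℤ) {R : Type*} [CommRing R] (g : GL ι R) :
    g ∈ autPts c R ↔ ∀ i j k, ∑ l, (c i j l : R) * g.1 k l
      = ∑ a, ∑ b, (c a b k : R) * (g.1 a i * g.1 b j) := by
  constructor
  · intro h i j k
    have := congrFun (h (Pi.single i 1) (Pi.single j 1)) k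
    rw [scMul_single, scMul_expand] at this
    simp [Pi.single_apply] at this
    rw [← this]
    simp [mulVec, dotProduct, mul_comm]
  · intro h x y
    funext k
    rw [scMul_expand]
    simp_rw [← h]
    simp only [scMul, mulVec, dotProduct, Finset.sum_mul, Finset.mul_sum]
    calc ∑ l, ∑ i, ∑ j, g.1 k l * ((c i j l : R) * (x i * y j))
        = ∑ i, ∑ l, ∑ j, g.1 k l * ((c i j l : R) * (x i * y j)) := Finset.sum_comm
      _ = ∑ i, ∑ j, ∑ l, g.1 k l * ((c i j l : R) * (x i * y j)) :=
          Finset.sum_congr rfl fun i _ => Finset.sum_comm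
      _ = _ := Finset.sum_congr rfl fun i _ => Finset.sum_congr rfl fun j _ =>
          Finset.sum_congr rfl fun l _ => by ring

noncomputable section

/-- The automorphism group scheme of an algebra with integral structure constants. -/
def autGrp (c : ι → ι → ι → ℤ) (F : Type u) [Field F] : AlgGrp F where
  ι := ι
  pts R _ _ := autPts c R
  eqs := {p | ∃ i j k, p = ∑ l, MvPolynomial.C (c i j l : F) * MvPolynomial.X (k, l)
    - ∑ a, ∑ b, MvPolynomial.C (c a b k : F) * (MvPolynomial.X (a, i) * MvPolynomial.X (b, j))}
  mem_pts R _ _ g := by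
    rw [mem_autPts_iff]
    constructor
    · rintro h p ⟨i, j, k, rfl⟩
      simp [h i j k]
    · intro h i j k
      have := h _ ⟨i, j, k, rfl⟩
      simpa [sub_eq_zero] using this

/-- The product of the split octonions (vector matrices): coordinates `0, 1` are the
diagonal entries `a, b`, coordinates `2, 3, 4` the vector `v` and `5, 6, 7` the vector `w`, and
`(a, v, w, b) (a', v', w', b') =
  (a a' + v ⬝ w', a v' + b' v + w × w', a' w + b w' - v × v', b b' + v' ⬝ w)`. -/
def zornMul (x y : Fin 8 → ℤ) : Fin 8 → ℤ :=
  let v : Fin 3 → ℤ := ![x 2, x 3, x 4]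
  let w : Fin 3 → ℤ := ![x 5, x 6, x 7]
  let v' : Fin 3 → ℤ := ![y 2, y 3, y 4]
  let w' : Fin 3 → ℤ := ![y 5, y 6, y 7]
  let p : Fin 3 → ℤ := x 0 • v' + y 1 • v + crossProduct w w'
  let q : Fin 3 → ℤ := y 0 • w + x 1 • w' - crossProduct v v'
  ![x 0 * y 0 + v ⬝ᵥ w', x 1 * y 1 + v' ⬝ᵥ w, p 0, p 1, p 2, q 0, q 1, q 2]

/-- Structure constants of the split octonions. -/
def zornConst (i j k : Fin 8) : ℤ := zornMul (Pi.single i 1) (Pi.single j 1) k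

/-- Structure constants of the algebra of `3 × 3` matrices. -/
def mat3Const (i j k : Fin 3 × Fin 3) : ℤ :=
  (Matrix.single i.1 i.2 1 * Matrix.single j.1 j.2 1 : Matrix (Fin 3) (Fin 3) ℤ) k.1 k.2

/-- The split group `G_2`: automorphisms of the split octonions. -/
def grpG2 (F : Type u) [Field F] : AlgGrp F := autGrp zornConst F

/-- `PGL_3`: automorphisms of the algebra of `3 × 3` matrices. -/
def grpPGL3 (F : Type u) [Field F] : AlgGrp F := autGrp mat3Const F

/-- The symmetric matrix of the polar form of the quadratic form `det` on `2 × 2` matrices. -/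
def detForm : Matrix (Fin 2 × Fin 2) (Fin 2 × Fin 2) ℤ := fun i j =>
  if j = (i.1 + 1, i.2 + 1) then (if i.1 = i.2 then 1 else -1) else 0

/-- The special orthogonal group of the (split) quadratic space of `2 × 2` matrices with `det`. -/
def so4Pts (R : Type*) [CommRing R] : Subgroup (GL (Fin 2 × Fin 2) R) where
  carrier := {g | (g.1)ᵀ * detForm.map (Int.cast : ℤ → R) * g.1 = detForm.map (Int.cast : ℤ → R) ∧
    g.1.det = 1}
  one_mem' := by simp
  mul_mem' := by
    rintro g h ⟨hg, hg'⟩ ⟨hh, hh'⟩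
    refine ⟨?_, by simp [hg', hh']⟩
    calc ((g * h).1)ᵀ * detForm.map (Int.cast : ℤ → R) * (g * h).1
        = (h.1)ᵀ * ((g.1)ᵀ * detForm.map (Int.cast : ℤ → R) * g.1) * h.1 := by
          simp only [Units.val_mul, transpose_mul, Matrix.mul_assoc]
      _ = _ := by rw [hg, hh]
  inv_mem' := by
    rintro g ⟨hg, hg'⟩
    have e : g.1 * (g⁻¹).1 = 1 := by rw [← Units.val_mul]; simp
    have e' : ((g⁻¹).1)ᵀ * (g.1)ᵀ = 1 := by rw [← transpose_mul, e, transpose_one]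
    refine ⟨?_, ?_⟩
    · calc ((g⁻¹).1)ᵀ * detForm.map (Int.cast : ℤ → R) * (g⁻¹).1
          = ((g⁻¹).1)ᵀ * ((g.1)ᵀ * detForm.map (Int.cast : ℤ → R) * g.1) * (g⁻¹).1 := by rw [hg]
        _ = (((g⁻¹).1)ᵀ * (g.1)ᵀ) * detForm.map (Int.cast : ℤ → R) * (g.1 * (g⁻¹).1) := by
          simp only [Matrix.mul_assoc]
        _ = _ := by rw [e, e']; simp
    · have := congrArg Matrix.det e
      rw [det_mul, hg', det_one, one_mul] at this
      exact this

/-- The split group `SO_4 = (SL_2 × SL_2) / {±1}`. -/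
def grpSO4 (F : Type u) [Field F] : AlgGrp F where
  ι := Fin 2 × Fin 2
  pts R _ _ := so4Pts R
  eqs := {p | (∃ i j, p = ∑ b, (∑ a, MvPolynomial.X (a, i) * MvPolynomial.C (detForm a b : F)) *
        MvPolynomial.X (b, j) - MvPolynomial.C (detForm i j : F)) ∨
      p = Matrix.det (Matrix.of fun i j => MvPolynomial.X (i, j)) - 1}
  mem_pts R _ _ g := by
    have hdet : MvPolynomial.aeval (fun ij : (Fin 2 × Fin 2) × (Fin 2 × Fin 2) => g.1 ij.1 ij.2)
        (Matrix.det (Matrix.of fun i j => (MvPolynomial.X (i, j) : MvPolynomial _ F))) =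
        g.1.det := by
      rw [AlgHom.map_det]
      congr 1
      ext i j
      simp
    constructor
    · rintro ⟨h, h'⟩ p (⟨i, j, rfl⟩ | rfl)
      · have := congrFun (congrFun h i) j
        simp only [Matrix.mul_apply, Matrix.map_apply, Matrix.transpose_apply] at this
        simpa [sub_eq_zero] using this
      · rw [map_sub, hdet, h']; simp
    · intro h
      refine ⟨?_, ?_⟩
      · ext i j
        have := h _ (Or.inl ⟨i, j, rfl⟩)
        simp only [Matrix.mul_apply, Matrix.map_apply, Matrix.transpose_apply]
        simpa [sub_eq_zero] using this
      · have := h _ (Or.inr rfl)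
        rw [map_sub, hdet] at this
        simpa [sub_eq_zero] using this

end

end Models

/-! ### Endoscopy of `G_2` -/

noncomputable section

/-- The dual group `G_2(ℂ)` of the split group `G_2`. Its centre is trivial. -/
def G2Dual : Subgroup (GL (Fin 8) ℂ) := autPts zornConst ℂ

section Outer

variable {ι : Type} [Fintype ι] [DecidableEq ι]

instance innerNormal (G : Type*) [Group G] : (MulAut.conj : G →* MulAut G).range.Normal where
  conj_mem := by
    rintro _ ⟨g, rfl⟩ f
    exact ⟨f g, by ext x; simp⟩

/-- The outer automorphism group. -/
abbrev OutAut (G : Type*) [Group G] : Type _ := MulAut G ⧸ (MulAut.conj : G →* MulAut G).range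

/-- `g` normalizes `H`, and conjugation by `g` on `H` represents the outer automorphism `x`. -/
def InducesOut {G : Type*} [Group G] (H : Subgroup G) (g : G) (x : OutAut H) : Prop :=
  ∃ f : MulAut H, (∀ h : H, (f h : G) = g * h * g⁻¹) ∧ (QuotientGroup.mk f : OutAut H) = x

lemma InducesOut.one {G : Type*} [Group G] (H : Subgroup G) : InducesOut H 1 1 :=
  ⟨1, by simp, rfl⟩

lemma InducesOut.mul {G : Type*} [Group G] {H : Subgroup G} {g g' : G} {x x' : OutAut H}
    (h : InducesOut H g x) (h' : InducesOut H g' x') : InducesOut H (g * g') (x * x') := by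
  obtain ⟨f, hf, rfl⟩ := h
  obtain ⟨f', hf', rfl⟩ := h'
  exact ⟨f * f', fun k => by simp [hf, hf', mul_assoc], rfl⟩

lemma InducesOut.inv {G : Type*} [Group G] {H : Subgroup G} {g : G} {x : OutAut H}
    (h : InducesOut H g x) : InducesOut H g⁻¹ x⁻¹ := by
  obtain ⟨f, hf, rfl⟩ := h
  refine ⟨f⁻¹, fun k => ?_, rfl⟩
  have := hf (f⁻¹ k)
  rw [MulAut.apply_inv_self] at this
  rw [this]
  group

end Outer

/-- The connected centralizer of `s` in the dual group. -/
def connCentralizer (s : GL (Fin 8) ℂ) : Subgroup (GL (Fin 8) ℂ) :=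
  idComp (G2Dual ⊓ Subgroup.centralizer {s})

/-- An endoscopic pair `(s, ρ)` for the split group `G_2` over `F`: a semisimple element `s` of the
dual group with connected centralizer `Ĥ`, and a continuous homomorphism `ρ` from the Galois group
to `Out Ĥ`, where every `ρ σ` is realized by an element of the dual group and fixes `s` (the Galois
group acts trivially on the dual group, and there is no condition on cohomology classes with values
in the centre of the dual group, since this centre is trivial). -/
structure EndoPair (F : Type u) [Field F] where
  s : GL (Fin 8) ℂ
  s_mem : s ∈ G2Dual
  s_semisimple : Module.End.IsSemisimple (Matrix.toLin' s.1)
  ρ : (AlgebraicClosure F ≃ₐ[F] AlgebraicClosure F) →* OutAut (connCentralizer s)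
  ρ_continuous : IsOpen (ρ.ker : Set (AlgebraicClosure F ≃ₐ[F] AlgebraicClosure F))
  ρ_realized : ∀ σ, ∃ g ∈ G2Dual, InducesOut (connCentralizer s) g (ρ σ) ∧ g * s * g⁻¹ = s

namespace EndoPair

variable {F : Type u} [Field F] (d : EndoPair F)

/-- The group `Ĥ`. -/
abbrev dual : Subgroup (GL (Fin 8) ℂ) := connCentralizer d.s

/-- The Galois invariants of the centre of `Ĥ`. -/
def fixedCenter : Subgroup (GL (Fin 8) ℂ) where
  carrier := {z | z ∈ d.dual ∧ (∀ h ∈ d.dual, h * z = z * h) ∧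
    ∀ σ, ∀ g, InducesOut d.dual g (d.ρ σ) → g * z * g⁻¹ = z}
  one_mem' := ⟨one_mem _, by simp, by simp⟩
  mul_mem' := by
    rintro x y ⟨hx, hx', hx''⟩ ⟨hy, hy', hy''⟩
    refine ⟨mul_mem hx hy, fun h hh => ?_, fun σ g hg => ?_⟩
    · rw [← mul_assoc, hx' h hh, mul_assoc, hy' h hh, mul_assoc]
    · calc g * (x * y) * g⁻¹ = (g * x * g⁻¹) * (g * y * g⁻¹) := by group
        _ = x * y := by rw [hx'' σ g hg, hy'' σ g hg]
  inv_mem' := by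
    rintro x ⟨hx, hx', hx''⟩
    refine ⟨inv_mem hx, fun h hh => ?_, fun σ g hg => ?_⟩
    · exact ((Commute.inv_right (show Commute h x from hx' h hh)))
    · calc g * x⁻¹ * g⁻¹ = (g * x * g⁻¹)⁻¹ := by group
        _ = x⁻¹ := by rw [hx'' σ g hg]

/-- The pair is elliptic: the identity component of `Z(Ĥ)^Γ` is contained in the centre of the dual
group. -/
def IsElliptic : Prop :=
  ∀ z ∈ idComp d.fixedCenter, z ∈ G2Dual ∧ ∀ g ∈ G2Dual, g * z = z * g

/-- The element `g` of the dual group is an isomorphism of endoscopic pairs: it conjugates `Ĥ` to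
`Ĥ'` and `ρ` to `ρ'`. -/
def IsIso (d d' : EndoPair F) (g : GL (Fin 8) ℂ) : Prop :=
  g ∈ G2Dual ∧ d.dual.map (MulAut.conj g).toMonoidHom = d'.dual ∧
    ∀ σ, ∃ n ∈ G2Dual, InducesOut d.dual n (d.ρ σ) ∧ InducesOut d'.dual (g * n * g⁻¹) (d'.ρ σ)

/-- `Λ`: the image in `Out Ĥ` of the automorphisms of the pair, i.e. the outer automorphisms of `Ĥ`
which are realized by the dual group and commute with `ρ`. -/
def outerAut : Subgroup (OutAut d.dual) where
  carrier := {x | (∃ g ∈ G2Dual, InducesOut d.dual g x) ∧ ∀ σ, x * d.ρ σ = d.ρ σ * x}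
  one_mem' := ⟨⟨1, one_mem _, InducesOut.one _⟩, by simp⟩
  mul_mem' := by
    rintro x y ⟨⟨g, hg, hx⟩, hx'⟩ ⟨⟨g', hg', hy⟩, hy'⟩
    refine ⟨⟨g * g', mul_mem hg hg', hx.mul hy⟩, fun σ => ?_⟩
    rw [mul_assoc, hy' σ, ← mul_assoc, hx' σ, mul_assoc]
  inv_mem' := by
    rintro x ⟨⟨g, hg, hx⟩, hx'⟩
    exact ⟨⟨g⁻¹, inv_mem hg, hx.inv⟩, fun σ =>
      (Commute.inv_left (show Commute x (d.ρ σ) from hx' σ))⟩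

/-- The pair is unramified at all finite places: `ρ` is trivial on the inertia groups of all
nonzero primes of the ring of all algebraic integers. -/
def IsUnramified : Prop :=
  ∀ P : Ideal (integralClosure ℤ (AlgebraicClosure F)), P.IsPrime → P ≠ ⊥ →
    ∀ σ : AlgebraicClosure F ≃ₐ[F] AlgebraicClosure F,
      (∀ x y : integralClosure ℤ (AlgebraicClosure F),
        (y : AlgebraicClosure F) = σ x - x → y ∈ P) → d.ρ σ = 1

end EndoPair

/-- `H` is an endoscopic group attached to the pair `d`, that is, a quasi-split connected reductive
group over `F` with dual group `Ĥ` on which the Galois action is given by `ρ`. Explicitly, there are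
* a maximal torus `T` of `H` defined over `F`, with parametrization `a` over `F̄`,
* a maximal torus `T̂` of `Ĥ`, with parametrization `b`,

such that the resulting identifications `X^*(T) = ℤ ^ r = X_*(T̂)` and `X_*(T) = ℤ ^ r = X^*(T̂)`
exchange roots and coroots, and a base `Δ` of the roots of `T` such that for every `σ`
the action of `σ` on `X^*(T)`, given by a matrix `B`, preserves `Δ` (so that the Borel subgroup of
`H` given by `T` and `Δ` is defined over `F`) and is, as an action on `X_*(T̂)`, induced by an
element of the dual group which represents `ρ σ`. -/
def IsEndoscopicGroup {F : Type u} [Field F] (H : AlgGrp F) (d : EndoPair F) : Prop :=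
  IsConnectedReductive (H.pts (AlgebraicClosure F)) ∧
  ∃ (r : ℕ) (a : (Fin r → (AlgebraicClosure F)ˣ) →* GL H.ι (AlgebraicClosure F))
    (b : (Fin r → ℂˣ) →* GL (Fin 8) ℂ) (Δ : Set (Fin r → ℤ)),
    IsMaxTorusParam (H.pts (AlgebraicClosure F)) a ∧
    IsMaxTorusParam d.dual b ∧
    (∀ m n, (m, n) ∈ rootPairs (H.pts (AlgebraicClosure F)) a ↔ (n, m) ∈ rootPairs d.dual b) ∧
    IsRootBase (Prod.fst '' rootPairs (H.pts (AlgebraicClosure F)) a) Δ ∧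
    ∀ σ : AlgebraicClosure F ≃ₐ[F] AlgebraicClosure F, ∃ B : Matrix (Fin r) (Fin r) ℤ,
      (fun m => B *ᵥ m) '' Δ = Δ ∧
      (∀ z, Matrix.GeneralLinearGroup.map (σ : AlgebraicClosure F →+* AlgebraicClosure F)
        (a (matTorus Bᵀ z)) =
          a fun i => Units.map (σ : AlgebraicClosure F →* AlgebraicClosure F) (z i)) ∧
      ∃ g ∈ G2Dual, InducesOut d.dual g (d.ρ σ) ∧ ∀ z, g * b z * g⁻¹ = b (matTorus B z)

/-- The group `H` over `ℚ` has a maximal torus over `ℝ` which is elliptic, i.e. the real points of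
which are compact modulo the centre. -/
def HasRealEllipticMaximalTorus (H : AlgGrp ℚ) : Prop :=
  ∃ T : Subgroup (GL H.ι ℂ), IsMaximalTorus (H.pts ℂ) T ∧
    (∀ t ∈ T, Matrix.GeneralLinearGroup.map (starRingEnd ℂ) t ∈ T) ∧
    ∃ C : Set (GL H.ι ℝ), IsCompact C ∧
      ∀ t ∈ H.pts ℝ, Matrix.GeneralLinearGroup.map Complex.ofRealHom t ∈ T →
        ∃ c ∈ C, ∃ z ∈ H.pts ℝ, (∀ h ∈ H.pts ℝ, h * z = z * h) ∧ t = c * z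

/-- The three types of elliptic endoscopic groups. -/
inductive EllType
  | G2
  | PGL3
  | SO4

/-- The group over `F` of the given type. -/
def EllType.grp (F : Type u) [Field F] : EllType → AlgGrp F
  | .G2 => grpG2 F
  | .PGL3 => grpPGL3 F
  | .SO4 => grpSO4 F

end

/-!
Elliptic endoscopic pairs of `G_2` are classified inside the concrete group `Ĝ = G_2(ℂ)`, the
automorphism group of the split octonions, written as Zorn vector matrices `oct a b v w` with
scalars `a`, `b` and three-dimensional vectors `v`, `w`.

**Tori.** The stabilizer of the idempotent `oct 1 0 0 0` is `SL_3` (`exists_octSL_eq`), all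
idempotents of trace one are conjugate to it by explicit unipotent automorphisms
(`exists_move_idempotent`), and a semisimple automorphism fixes one of them
(`exists_fixed_idempotent`). So a semisimple element is conjugate to one of the diagonal torus,
with coordinates `t₀`, `t₁`, `t₂` of product `1`, of which `(t₀, t₁)` is recorded. The notion
`IsSplitModel` collects what is needed of such a torus. It implies that every parametrized maximal
torus, also of a connected centralizer, is conjugate to the diagonal one up to an integral change
of coordinates (`IsSplitModel.exists_conj_param`), so that root data may be computed on the diagonal
torus. The models are `isSplitModel_oct`, `isSplitModel_mat3` and `isSplitModel_so4`; their roots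
and coroots (`rootPairs_oct`, `rootPairs_mat3`, `rootPairs_so4`) are found by exhibiting
homomorphisms from `SL_2`, and by bounding all others through the reflections they induce on the
finite set of weights.

**Elliptic pairs.** The three coordinates can be rotated by an element of `SL_3`. After such a
rotation either `s = (a, a)` with `a² = 1` or `a³ = 1`, or a nontrivial one-parameter subgroup of
the torus commutes with the whole centralizer of `s` (`canNormalize`). As `ρ` is realized by
elements which centralize `s`, it fixes this one-parameter subgroup, so in the second case the pair
is not elliptic (`IsElliptic.eq_zero_of_central`). In the first case the centralizer of `s` is
connected (`isZConnected_centralizer`); hence it is `Ĥ`, the elements which realize `ρ` lie in `Ĥ`,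
and `ρ` is trivial (`IsElliptic.ρ_eq_one`).

**Types.** The roots of `Ĥ` are the roots of `G_2` which are trivial on `s`
(`mem_rootPairs_idComp_centralizer`). For `s` of order `1`, `2`, `3` there are `12`, `4`, `6` of
them, so that their number determines the order of `s`, and explicit integral matrices match them
with the coroots of `G_2`, `SO_4`, `PGL_3`, respectively (`EllType.roots_eq_image`). The centre of
`Ĥ` consists of the elements `(y, y)` with `y` a root of unity of this order (`exists_eq_of_central`).
Therefore all three pairs are elliptic, two elements `s` of the same order are conjugate, and an
automorphism of the pair sends `s` to `s` or its inverse. In the first case it is inner; the second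
case differs from the first for order `3` only, where an inversion is given by the automorphism
`octSwap`. This gives the groups `Λ`.

**Remaining claims.** The three groups are connected and reductive: a normal unipotent subgroup
fixes a vector by Kolchin's theorem (`exists_fixed_vector_of_unipotent`), and so acts trivially on
an irreducible representation. An elliptic endoscopic group has two linearly independent roots. It
is therefore not a torus, and not `GL_2`, in which the kernel of any root is central
(`not_algIsomorphic_GL2`). Over the real numbers, `G_2` and `SO_4` contain an image of
`SL_2 × SL_2` with the full maximal torus, and the Cayley transform turns the diagonal torus of
`SL_2 × SL_2` into a compact one (`hasRealEllipticMaximalTorus_of_hom`). In `PGL_3`, complex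
conjugation would have to invert an anisotropic torus, which is impossible because `diag(2, 1, 1)`
and `diag(1/2, 1, 1)` are not conjugate up to scalars (`not_hasRealEllipticMaximalTorus_PGL3`).
-/

open scoped Pointwise

set_option linter.unusedSectionVars false
set_option linter.unusedSimpArgs false

/-! ### Closed subgroups, identity components and conjugation -/

section ClosedSubgroups

variable {ι : Type} [Fintype ι] [DecidableEq ι] {K : Type*} [Field K]

/-- The conjugate `g H g⁻¹` of a subgroup. -/
abbrev conjSub {G : Type*} [Group G] (g : G) (H : Subgroup G) : Subgroup G :=
  H.map (MulAut.conj g).toMonoidHom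

lemma mem_conjSub {G : Type*} [Group G] {g x : G} {H : Subgroup G} :
    x ∈ conjSub g H ↔ g⁻¹ * x * g ∈ H := by
  constructor
  · rintro ⟨h, hh, rfl⟩
    simpa [mul_assoc] using hh
  · intro h
    exact ⟨_, h, by simp [mul_assoc]⟩

lemma conjSub_conjSub {G : Type*} [Group G] (g h : G) (H : Subgroup G) :
    conjSub g (conjSub h H) = conjSub (g * h) H := by
  ext x; simp only [mem_conjSub, _root_.mul_inv_rev, mul_assoc]

lemma conjSub_one {G : Type*} [Group G] (H : Subgroup G) : conjSub 1 H = H := by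
  ext x; simp

lemma conjSub_of_mem {G : Type*} [Group G] {g : G} {H : Subgroup G} (hg : g ∈ H) :
    conjSub g H = H := by
  ext x
  rw [mem_conjSub, Subgroup.mul_mem_cancel_right _ hg, Subgroup.mul_mem_cancel_left _ (inv_mem hg)]

lemma conjSub_mono {G : Type*} [Group G] {g : G} {H H' : Subgroup G} (h : H ≤ H') :
    conjSub g H ≤ conjSub g H' := Subgroup.map_mono h

lemma le_conjSub_iff {G : Type*} [Group G] {g : G} {H H' : Subgroup G} :
    H ≤ conjSub g H' ↔ conjSub g⁻¹ H ≤ H' := by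
  constructor
  · intro h
    simpa [conjSub_conjSub, conjSub_one] using conjSub_mono (g := g⁻¹) h
  · intro h
    simpa [conjSub_conjSub, conjSub_one] using conjSub_mono (g := g) h

lemma conjSub_le_iff {G : Type*} [Group G] {g : G} {H H' : Subgroup G} :
    conjSub g H ≤ H' ↔ H ≤ conjSub g⁻¹ H' := by
  rw [le_conjSub_iff, inv_inv]

/-- An element with roots of all orders lies in every subgroup of finite index. -/
lemma mem_of_forall_exists_pow {G : Type*} [Group G] {N H : Subgroup G} (hN : N.relIndex H ≠ 0)
    {x : G} (hx : ∀ k : ℕ, 0 < k → ∃ y ∈ H, y ^ k = x) : x ∈ N := by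
  obtain ⟨y, hy, rfl⟩ := hx (N.relIndex H).factorial (Nat.factorial_pos _)
  exact (Subgroup.pow_mem_of_relIndex_ne_zero_of_dvd hN hy fun m hm hm' =>
    Nat.dvd_factorial hm hm').1

lemma mem_idComp_of_forall_exists_pow {H : Subgroup (GL ι K)} {x : GL ι K}
    (hx : ∀ k : ℕ, 0 < k → ∃ y ∈ H, y ^ k = x) : x ∈ idComp H := by
  rw [idComp, Subgroup.mem_sInf]
  rintro N ⟨_, _, hN⟩
  exact mem_of_forall_exists_pow hN hx

lemma idComp_le {H : Subgroup (GL ι K)} (hH : IsZClosed H) : idComp H ≤ H :=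
  sInf_le ⟨le_rfl, hH, by simp⟩

lemma isZConnected_of_forall {H : Subgroup (GL ι K)} (hH : IsZClosed H)
    (h : ∀ N ≤ H, N.relIndex H ≠ 0 → H ≤ N) : IsZConnected H :=
  le_antisymm (idComp_le hH) (le_sInf fun N hN => h N hN.1 hN.2.2)

lemma IsZClosed.inf {H H' : Subgroup (GL ι K)} (h : IsZClosed H) (h' : IsZClosed H') :
    IsZClosed (H ⊓ H') := by
  obtain ⟨S, hS⟩ := h
  obtain ⟨S', hS'⟩ := h'
  refine ⟨S ∪ S', fun g => ?_⟩
  rw [Subgroup.mem_inf, hS, hS']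
  simp only [Set.mem_union, or_imp, forall_and]

lemma isZClosed_bot : IsZClosed (⊥ : Subgroup (GL ι K)) := by
  refine ⟨{p | ∃ i j, p = MvPolynomial.X (i, j) - MvPolynomial.C ((1 : Matrix ι ι K) i j)},
    fun g => ?_⟩
  rw [Subgroup.mem_bot]
  constructor
  · rintro rfl p ⟨i, j, rfl⟩
    simp
  · intro h
    ext i j
    have := h _ ⟨i, j, rfl⟩
    simpa [sub_eq_zero] using this

/-- The group of invertible diagonal matrices. -/
def diagSub (ι : Type) [Fintype ι] [DecidableEq ι] (K : Type*) [Field K] :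
    Subgroup (GL ι K) where
  carrier := {g | g.1.IsDiag}
  one_mem' := by simp
  mul_mem' := by
    intro g h hg hh
    simp only [Set.mem_ofPred_eq, Units.val_mul] at *
    rw [← hg.diagonal_diag, ← hh.diagonal_diag, diagonal_mul_diagonal]
    exact isDiag_diagonal _
  inv_mem' := by
    intro g hg
    simp only [Set.mem_ofPred_eq] at *
    rw [Matrix.coe_units_inv, ← hg.diagonal_diag, Matrix.inv_diagonal]
    exact isDiag_diagonal _

lemma mem_diagSub {g : GL ι K} : g ∈ diagSub ι K ↔ g.1.IsDiag := Iff.rfl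

lemma isZClosed_diagSub : IsZClosed (diagSub ι K) := by
  refine ⟨{p | ∃ i j, i ≠ j ∧ p = MvPolynomial.X (i, j)}, fun g => ?_⟩
  rw [mem_diagSub]
  constructor
  · rintro h p ⟨i, j, hij, rfl⟩
    simpa using h hij
  · intro h i j hij
    simpa using h _ ⟨i, j, hij, rfl⟩

lemma commute_of_mem_diagSub {g h : GL ι K} (hg : g ∈ diagSub ι K) (hh : h ∈ diagSub ι K) :
    g * h = h * g := by
  ext1
  rw [Units.val_mul, Units.val_mul, ← IsDiag.diagonal_diag hg, ← IsDiag.diagonal_diag hh,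
    diagonal_mul_diagonal, diagonal_mul_diagonal]
  simp only [mul_comm]

lemma mem_centralizer_singleton {G : Type*} [Group G] {s g : G} :
    g ∈ Subgroup.centralizer {s} ↔ s * g = g * s := by
  rw [Subgroup.mem_centralizer_iff]; simp

lemma isZClosed_centralizer (s : GL ι K) : IsZClosed (Subgroup.centralizer {s}) := by
  refine ⟨{p | ∃ i j, p = ∑ k, MvPolynomial.C (s.1 i k) * MvPolynomial.X (k, j)
    - ∑ k, MvPolynomial.X (i, k) * MvPolynomial.C (s.1 k j)}, fun g => ?_⟩
  rw [mem_centralizer_singleton]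
  constructor
  · rintro h p ⟨i, j, rfl⟩
    have := congrArg (fun x : GL ι K => x.1 i j) h
    simpa [Matrix.mul_apply, sub_eq_zero] using this
  · intro h
    ext i j
    have := h _ ⟨i, j, rfl⟩
    simpa [Matrix.mul_apply, sub_eq_zero] using this

lemma IsZClosed.conj {H : Subgroup (GL ι K)} (h : IsZClosed H) (g : GL ι K) :
    IsZClosed (conjSub g H) := by
  obtain ⟨S, hS⟩ := h
  refine ⟨(fun p => MvPolynomial.aeval (fun ij : ι × ι => ∑ k, ∑ l,
    MvPolynomial.C ((g⁻¹).1 ij.1 k) * MvPolynomial.X (k, l) * MvPolynomial.C (g.1 l ij.2)) p) '' S,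
    fun x => ?_⟩
  rw [mem_conjSub, hS, Set.forall_mem_image]
  refine forall₂_congr fun p _ => ?_
  have : MvPolynomial.eval (fun ij : ι × ι => x.1 ij.1 ij.2)
      (MvPolynomial.aeval (fun ij : ι × ι => ∑ k, ∑ l, (MvPolynomial.C ((g⁻¹).1 ij.1 k) *
        MvPolynomial.X (k, l) * MvPolynomial.C (g.1 l ij.2) : MvPolynomial (ι × ι) K)) p) =
      MvPolynomial.eval (fun ij : ι × ι => (g⁻¹ * x * g).1 ij.1 ij.2) p := by
    rw [← MvPolynomial.coe_aeval_eq_eval, ← MvPolynomial.coe_aeval_eq_eval]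
    simp only [RingHom.coe_coe]
    rw [← AlgHom.comp_apply, MvPolynomial.comp_aeval]
    congr 2
    ext ij
    simp only [map_sum, map_mul, MvPolynomial.aeval_X, MvPolynomial.algHom_C, Units.val_mul,
      Matrix.mul_apply, Finset.sum_mul, Algebra.algebraMap_self, RingHom.id_apply]
    exact Finset.sum_comm
  rw [this]

lemma conjSub_relIndex {G : Type*} [Group G] (g : G) (N H : Subgroup G) :
    (conjSub g N).relIndex (conjSub g H) = N.relIndex H :=
  Subgroup.relIndex_map_map_of_injective _ _ (MulAut.conj g).injective

lemma idComp_conjSub_le (g : GL ι K) (H : Subgroup (GL ι K)) :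
    idComp (conjSub g H) ≤ conjSub g (idComp H) := by
  rw [le_conjSub_iff]
  refine le_sInf fun N hN => ?_
  rw [conjSub_le_iff, inv_inv]
  exact sInf_le ⟨conjSub_mono hN.1, hN.2.1.conj g, by rw [conjSub_relIndex]; exact hN.2.2⟩

lemma idComp_conjSub (g : GL ι K) (H : Subgroup (GL ι K)) :
    idComp (conjSub g H) = conjSub g (idComp H) := by
  refine le_antisymm (idComp_conjSub_le g H) ?_
  rw [conjSub_le_iff]
  have := idComp_conjSub_le g⁻¹ (conjSub g H)
  rwa [conjSub_conjSub, inv_mul_cancel, conjSub_one] at this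

lemma IsTorus.conj {T : Subgroup (GL ι K)} (h : IsTorus T) (g : GL ι K) :
    IsTorus (conjSub g T) := by
  obtain ⟨h1, h2, P, hP⟩ := h
  refine ⟨h1.conj g, ?_, P * g⁻¹, ?_⟩
  · rw [IsZConnected, idComp_conjSub, h2]
  · rintro _ ⟨t, ht, rfl⟩
    have := hP t ht
    simpa [mul_assoc] using this

lemma IsMaximalTorus.conj {H T : Subgroup (GL ι K)} (h : IsMaximalTorus H T) (g : GL ι K) :
    IsMaximalTorus (conjSub g H) (conjSub g T) := by
  obtain ⟨h1, h2, h3⟩ := h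
  refine ⟨conjSub_mono h1, h2.conj g, fun T' h4 h5 h6 => ?_⟩
  have := h3 (conjSub g⁻¹ T') (by rwa [conjSub_le_iff, inv_inv]) (h5.conj _)
    (by rwa [le_conjSub_iff, inv_inv])
  rw [← this, conjSub_conjSub, mul_inv_cancel, conjSub_one]

/-- The homomorphism `z ↦ g a(z) g⁻¹`. -/
def conjHom {A G : Type*} [Group A] [Group G] (g : G) (a : A →* G) : A →* G :=
  (MulAut.conj g).toMonoidHom.comp a

@[simp] lemma conjHom_apply {A G : Type*} [Group A] [Group G] (g : G) (a : A →* G) (x : A) :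
    conjHom g a x = g * a x * g⁻¹ := rfl

lemma conjHom_range {A G : Type*} [Group A] [Group G] (g : G) (a : A →* G) :
    (conjHom g a).range = conjSub g a.range := by
  rw [conjHom, MonoidHom.range_comp]

lemma IsAlgTorusHom.conj {r : ℕ} {a : (Fin r → Kˣ) →* GL ι K} (h : IsAlgTorusHom a)
    (g : GL ι K) : IsAlgTorusHom (conjHom g a) := by
  choose p k hp using h
  intro i j
  refine ⟨∑ x, ∑ y, MvPolynomial.C (g.1 i y * (g⁻¹).1 x j) * p y x *
    (∏ l, MvPolynomial.X l) ^ (∑ x, ∑ y, k y x - k y x), ∑ x, ∑ y, k y x, fun z => ?_⟩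
  simp only [conjHom_apply, Units.val_mul, Matrix.mul_apply, map_sum, map_mul,
    MvPolynomial.eval_C, map_pow, map_prod, MvPolynomial.eval_X, Finset.sum_mul, ← hp]
  refine Finset.sum_congr rfl fun x _ => Finset.sum_congr rfl fun y _ => ?_
  have : ∑ x, ∑ y, k y x = k y x + (∑ x, ∑ y, k y x - k y x) := by
    have h1 : k y x ≤ ∑ y, k y x := Finset.single_le_sum (f := fun y => k y x)
      (fun _ _ => Nat.zero_le _) (Finset.mem_univ y)
    have h2 : ∑ y, k y x ≤ ∑ x, ∑ y, k y x := Finset.single_le_sum (f := fun x => ∑ y, k y x)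
      (fun _ _ => Nat.zero_le _) (Finset.mem_univ x)
    omega
  conv_lhs => rw [this, pow_add]
  ring

lemma IsMaxTorusParam.conj {r : ℕ} {H : Subgroup (GL ι K)} {a : (Fin r → Kˣ) →* GL ι K}
    (h : IsMaxTorusParam H a) (g : GL ι K) : IsMaxTorusParam (conjSub g H) (conjHom g a) := by
  obtain ⟨h1, h2, h3⟩ := h
  refine ⟨h1.conj g, fun x y hxy => h2 (by simpa using hxy), ?_⟩
  rw [conjHom_range]
  exact h3.conj g

lemma IsAlgSL2Hom.conj {f : SpecialLinearGroup (Fin 2) K →* GL ι K} (h : IsAlgSL2Hom f)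
    (g : GL ι K) : IsAlgSL2Hom (conjHom g f) := by
  choose p hp using h
  intro i j
  refine ⟨∑ x, ∑ y, MvPolynomial.C (g.1 i y * (g⁻¹).1 x j) * p y x, fun z => ?_⟩
  simp only [conjHom_apply, Units.val_mul, Matrix.mul_apply, map_sum, map_mul,
    MvPolynomial.eval_C, Finset.sum_mul, ← hp]
  exact Finset.sum_congr rfl fun x _ => Finset.sum_congr rfl fun y _ => by ring

lemma rootPairs_conj_le {r : ℕ} (H : Subgroup (GL ι K)) (a : (Fin r → Kˣ) →* GL ι K)
    (g : GL ι K) : rootPairs H a ⊆ rootPairs (conjSub g H) (conjHom g a) := by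
  rintro ⟨m, n⟩ ⟨f, h1, h2, h3, h4, h5, h6⟩
  have key : ∀ x y z : GL ι K, x * y * x⁻¹ = z →
      (g * x * g⁻¹) * (g * y * g⁻¹) * (g * x * g⁻¹)⁻¹ = g * z * g⁻¹ := by
    rintro x y _ rfl; group
  refine ⟨conjHom g f, h1.conj g, fun h => h2 ?_, ?_, fun z x => key _ _ _ (h4 z x),
    fun z x => key _ _ _ (h5 z x), fun c => by simp [h6]⟩
  · ext1 x
    have := DFunLike.congr_fun h x
    simpa [mul_inv_eq_one] using this
  · rw [conjHom_range]; exact conjSub_mono h3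

lemma rootPairs_conj {r : ℕ} (H : Subgroup (GL ι K)) (a : (Fin r → Kˣ) →* GL ι K)
    (g : GL ι K) : rootPairs (conjSub g H) (conjHom g a) = rootPairs H a := by
  refine le_antisymm ?_ (rootPairs_conj_le H a g)
  have := rootPairs_conj_le (conjSub g H) (conjHom g a) g⁻¹
  rw [conjSub_conjSub, inv_mul_cancel, conjSub_one] at this
  have e : conjHom g⁻¹ (conjHom g a) = a := by ext1 z; simp [mul_assoc]
  rwa [e] at this

end ClosedSubgroups

/-! ### Characters and endomorphisms of a split torus -/

section Characters

variable {K : Type*} [Field K] {r s : ℕ}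

lemma zpow_finsetSum {A κ : Type*} [CommGroup A] (c : A) (t : Finset κ) (n : κ → ℤ) :
    c ^ ∑ i ∈ t, n i = ∏ i ∈ t, c ^ n i :=
  map_sum (zpowersHom A c).toAdditiveRight n t

lemma monomialChar_mul (m : Fin r → ℤ) (z z' : Fin r → Kˣ) :
    monomialChar m (z * z') = monomialChar m z * monomialChar m z' := by
  simp [monomialChar, mul_zpow, Finset.prod_mul_distrib]

@[simp] lemma monomialChar_one (m : Fin r → ℤ) : monomialChar m (1 : Fin r → Kˣ) = 1 := by
  simp [monomialChar]

lemma monomialChar_inv (m : Fin r → ℤ) (z : Fin r → Kˣ) :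
    monomialChar m z⁻¹ = (monomialChar m z)⁻¹ := by
  simp [monomialChar]

lemma monomialChar_add (m m' : Fin r → ℤ) (z : Fin r → Kˣ) :
    monomialChar (m + m') z = monomialChar m z * monomialChar m' z := by
  simp [monomialChar, _root_.zpow_add, Finset.prod_mul_distrib]

lemma monomialChar_zero (z : Fin r → Kˣ) : monomialChar 0 z = 1 := by
  simp [monomialChar]

lemma monomialChar_neg (m : Fin r → ℤ) (z : Fin r → Kˣ) :
    monomialChar (-m) z = (monomialChar m z)⁻¹ := by
  simp [monomialChar]

lemma monomialChar_sub (m m' : Fin r → ℤ) (z : Fin r → Kˣ) :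
    monomialChar (m - m') z = monomialChar m z * (monomialChar m' z)⁻¹ := by
  rw [sub_eq_add_neg, monomialChar_add, monomialChar_neg]

lemma monomialChar_smul (k : ℤ) (m : Fin r → ℤ) (z : Fin r → Kˣ) :
    monomialChar (k • m) z = monomialChar m z ^ k := by
  simp only [monomialChar, Pi.smul_apply, smul_eq_mul, ← Finset.prod_zpow]
  exact Finset.prod_congr rfl fun i _ => by rw [mul_comm, _root_.zpow_mul]

lemma monomialChar_single (i : Fin r) (z : Fin r → Kˣ) :
    monomialChar (Pi.single i 1) z = z i := by
  rw [monomialChar, Finset.prod_eq_single i]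
  · simp
  · intro j _ hj; simp [hj]
  · simp

/-- The value of a character on a one-parameter subgroup. -/
lemma monomialChar_cochar (m n : Fin r → ℤ) (c : Kˣ) :
    monomialChar m (fun i => c ^ n i) = c ^ (m ⬝ᵥ n) := by
  simp only [monomialChar, ← _root_.zpow_mul, dotProduct]
  rw [zpow_finsetSum]
  exact Finset.prod_congr rfl fun i _ => by rw [mul_comm]

/-- A character as a homomorphism to the multiplicative monoid of the field. -/
def monomialHom (m : Fin r → ℤ) : (Fin r → Kˣ) →* K where
  toFun z := (monomialChar m z : Kˣ)
  map_one' := by simp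
  map_mul' z z' := by rw [monomialChar_mul]; simp

lemma monomialHom_apply (m : Fin r → ℤ) (z : Fin r → Kˣ) :
    monomialHom m z = ((monomialChar m z : Kˣ) : K) := rfl

lemma exists_unit_not_root_of_unity [Infinite K] (k : ℤ) (hk : k ≠ 0) : ∃ c : Kˣ, c ^ k ≠ 1 := by
  by_contra! h
  have h' : ∀ c : Kˣ, c ^ k.natAbs = 1 := fun c => by
    rcases Int.natAbs_eq k with e | e
    · rw [← zpow_natCast, ← e, h]
    · rw [← _root_.inv_inj, ← zpow_natCast, ← _root_.zpow_neg, ← e, h, inv_one]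
  have hp : (Polynomial.X ^ k.natAbs * Polynomial.X - Polynomial.X : Polynomial K) = 0 := by
    refine Polynomial.eq_zero_of_infinite_isRoot _ (Set.infinite_univ.mono fun c _ => ?_)
    rcases eq_or_ne c 0 with rfl | hc
    · simp
    · have := congrArg Units.val (h' (Units.mk0 c hc))
      simp only [Units.val_pow_eq_pow_val, Units.val_mk0, Units.val_one] at this
      simp [this]
  rw [← pow_succ, sub_eq_zero] at hp
  have := congrArg Polynomial.natDegree hp
  simp at this
  omega

lemma monomialChar_injective [Infinite K] :
    Function.Injective (fun m : Fin r → ℤ => (monomialHom m : (Fin r → Kˣ) →* K)) := by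
  intro m m' h
  ext i
  by_contra hne
  obtain ⟨c, hc⟩ := exists_unit_not_root_of_unity (K := K) (m i - m' i) (sub_ne_zero.2 hne)
  have h1 := DFunLike.congr_fun h (fun j => c ^ (Pi.single i 1 : Fin r → ℤ) j)
  simp only [monomialHom_apply, monomialChar_cochar, dotProduct_single, mul_one] at h1
  exact hc (by rw [_root_.zpow_sub, Units.ext h1, mul_inv_cancel])

/-- Distinct characters are linearly independent. -/
lemma linearIndependent_monomialHom [Infinite K] :
    LinearIndependent K (fun m : Fin r → ℤ =>
      ((monomialHom m : (Fin r → Kˣ) →* K) : (Fin r → Kˣ) → K)) :=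
  (linearIndependent_monoidHom (Fin r → Kˣ) K).comp _ monomialChar_injective

lemma monomialChar_matTorus (C : Matrix (Fin r) (Fin r) ℤ) (m : Fin r → ℤ) (z : Fin r → Kˣ) :
    monomialChar m (matTorus C z) = monomialChar (Cᵀ *ᵥ m) z := by
  simp only [monomialChar, matTorus, mulVec, dotProduct, transpose_apply,
    ← Finset.prod_zpow, ← _root_.zpow_mul, zpow_finsetSum]
  rw [Finset.prod_comm]

lemma matTorus_apply (C : Matrix (Fin r) (Fin r) ℤ) (z : Fin r → Kˣ) (i : Fin r) :
    matTorus C z i = monomialChar (C i) z := rfl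

lemma matTorus_matTorus (C D : Matrix (Fin r) (Fin r) ℤ) (z : Fin r → Kˣ) :
    matTorus C (matTorus D z) = matTorus (C * D) z := by
  ext1 i
  rw [matTorus_apply, monomialChar_matTorus, matTorus_apply]
  congr 1; ext j; simp [mulVec, dotProduct, mul_apply, mul_comm]

lemma matTorus_one (z : Fin r → Kˣ) : matTorus 1 z = z := by
  ext1 i
  rw [matTorus_apply]
  convert monomialChar_single i z using 2
  ext j; simp [Matrix.one_apply, Pi.single_apply, eq_comm]

lemma matTorus_cochar (C : Matrix (Fin r) (Fin r) ℤ) (n : Fin r → ℤ) (c : Kˣ) :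
    matTorus C (fun i => c ^ n i) = fun i => c ^ (C *ᵥ n) i := by
  ext1 i
  rw [matTorus_apply, monomialChar_cochar]; rfl

/-- `matTorus C` as a homomorphism. -/
def matTorusHom (C : Matrix (Fin r) (Fin r) ℤ) : (Fin r → Kˣ) →* (Fin r → Kˣ) where
  toFun := matTorus C
  map_one' := by ext1 i; simp [matTorus_apply]
  map_mul' z z' := by ext1 i; simp [matTorus_apply, monomialChar_mul]

@[simp] lemma matTorusHom_apply (C : Matrix (Fin r) (Fin r) ℤ) (z : Fin r → Kˣ) :
    matTorusHom C z = matTorus C z := rfl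

variable {ι : Type} [Fintype ι] [DecidableEq ι]

/-- The effect on roots and coroots of a change of coordinates of the torus. -/
lemma mem_rootPairs_comp_matTorusHom (H : Subgroup (GL ι K)) (a : (Fin r → Kˣ) →* GL ι K)
    {C C' : Matrix (Fin r) (Fin r) ℤ} (hC : C * C' = 1) (m n : Fin r → ℤ) :
    (m, n) ∈ rootPairs H (a.comp (matTorusHom C)) ↔ (C'ᵀ *ᵥ m, C *ᵥ n) ∈ rootPairs H a := by
  have hC' : C' * C = 1 := mul_eq_one_comm.1 hC
  refine exists_congr fun f => and_congr_right fun _ => and_congr_right fun _ =>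
    and_congr_right fun _ => and_congr ?_ (and_congr ?_ ?_)
  · constructor
    · intro h z x
      have := h (matTorus C' z) x
      simpa [matTorus_matTorus, hC, matTorus_one, monomialChar_matTorus] using this
    · intro h z x
      have := h (matTorus C z) x
      simpa [monomialChar_matTorus, ← transpose_mul, hC', matTorus_one] using this
  · constructor
    · intro h z x
      have := h (matTorus C' z) x
      simpa [matTorus_matTorus, hC, matTorus_one, monomialChar_matTorus] using this
    · intro h z x
      have := h (matTorus C z) x
      simpa [monomialChar_matTorus, ← transpose_mul, hC', matTorus_one] using this
  · simp [matTorus_cochar]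

end Characters

/-! ### Diagonalizable matrices and generic elements of tori -/

section Diagonalizable

variable {ι : Type} [Fintype ι] [DecidableEq ι] {K : Type*} [Field K]

lemma gl_mul_mulVec (g h : GL ι K) (x : ι → K) : (g * h).1 *ᵥ x = g.1 *ᵥ (h.1 *ᵥ x) := by
  rw [Units.val_mul, mulVec_mulVec]

lemma gl_inv_mulVec_mulVec (g : GL ι K) (x : ι → K) : (g⁻¹).1 *ᵥ (g.1 *ᵥ x) = x := by
  rw [← gl_mul_mulVec]; simp

lemma gl_mulVec_inv_mulVec (g : GL ι K) (x : ι → K) : g.1 *ᵥ ((g⁻¹).1 *ᵥ x) = x := by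
  rw [← gl_mul_mulVec]; simp

lemma gl_mulVec_injective (g : GL ι K) : Function.Injective (fun x => g.1 *ᵥ x) :=
  Function.LeftInverse.injective (gl_inv_mulVec_mulVec g)

/-- The matrix `M` is annihilated by a squarefree polynomial; over an algebraically closed field
this means that it is diagonalizable. -/
def SqfreeAnn (M : Matrix ι ι K) : Prop := ∃ p : Polynomial K, Squarefree p ∧ Polynomial.aeval M p = 0

lemma aeval_toLin' (M : Matrix ι ι K) (p : Polynomial K) :
    Polynomial.aeval (Matrix.toLin' M) p = Matrix.toLin' (Polynomial.aeval M p) :=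
  Polynomial.aeval_algHom_apply (Matrix.toLinAlgEquiv' : Matrix ι ι K ≃ₐ[K] _) M p

lemma sqfreeAnn_iff {M : Matrix ι ι K} :
    SqfreeAnn M ↔ Module.End.IsSemisimple (Matrix.toLin' M) := by
  constructor
  · rintro ⟨p, hp, h⟩
    exact Module.End.isSemisimple_of_squarefree_aeval_eq_zero hp (by rw [aeval_toLin', h, map_zero])
  · intro h
    refine ⟨_, h.minpoly_squarefree, ?_⟩
    have := minpoly.aeval K (Matrix.toLin' M)
    rwa [aeval_toLin', LinearEquiv.map_eq_zero_iff] at this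

/-- A matrix which is intertwined injectively with a diagonalizable one is diagonalizable. -/
lemma SqfreeAnn.of_intertwine {κ : Type} [Fintype κ] [DecidableEq κ] {M : Matrix ι ι K}
    {A : Matrix κ κ K} (h : SqfreeAnn M) (j : (κ → K) →ₗ[K] (ι → K)) (hj : Function.Injective j)
    (hA : ∀ x, M *ᵥ j x = j (A *ᵥ x)) : SqfreeAnn A := by
  obtain ⟨p, hp, h⟩ := h
  refine ⟨p, hp, ?_⟩
  have key : ∀ q : Polynomial K, ∀ x, Polynomial.aeval M q *ᵥ j x = j (Polynomial.aeval A q *ᵥ x) := by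
    intro q
    induction q using Polynomial.induction_on' with
    | add a b ha hb => intro x; simp [add_mulVec, ha, hb]
    | monomial n a =>
      intro x
      simp only [Polynomial.aeval_monomial, Algebra.algebraMap_eq_smul_one, smul_mul_assoc, one_mul,
        smul_mulVec, map_smul]
      congr 1
      induction n generalizing x with
      | zero => simp
      | succ n ih => rw [pow_succ, pow_succ, ← mulVec_mulVec, ← mulVec_mulVec, hA, ih]
  apply Matrix.toLin'.injective
  refine LinearMap.ext fun x => hj ?_
  have := key p x
  rw [h] at this
  simpa using this.symm

lemma SqfreeAnn.conj {M : GL ι K} (h : SqfreeAnn M.1) (g : GL ι K) :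
    SqfreeAnn (g * M * g⁻¹).1 := by
  refine h.of_intertwine (Matrix.toLin' (g⁻¹).1) ?_ fun x => ?_
  · intro x y hxy
    have := congrArg (fun v => g.1 *ᵥ v) hxy
    simpa [mulVec_mulVec, ← Units.val_mul] using this
  · simp only [toLin'_apply, mulVec_mulVec, ← Units.val_mul]
    congr 2; group

lemma aeval_diagonal (d : ι → K) (p : Polynomial K) :
    Polynomial.aeval (diagonal d) p = diagonal fun i => p.eval (d i) := by
  induction p using Polynomial.induction_on' with
  | add a b ha hb => simp [ha, hb]
  | monomial n a =>
    simp [diagonal_pow, Algebra.algebraMap_eq_smul_one, ← Matrix.diagonal_smul]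

lemma sqfreeAnn_diagonal (d : ι → K) : SqfreeAnn (diagonal d) := by
  classical
  refine ⟨∏ c ∈ Finset.univ.image d, (Polynomial.X - Polynomial.C c), ?_, ?_⟩
  · exact (Polynomial.separable_prod_X_sub_C_iff'.2 fun x _ y _ h => h).squarefree
  · rw [aeval_diagonal]
    ext i j
    rw [diagonal_apply]
    split_ifs
    · rw [Polynomial.eval_prod]
      exact Finset.prod_eq_zero (Finset.mem_image_of_mem d (Finset.mem_univ i)) (by simp)
    · rfl

lemma sqfreeAnn_of_isDiag {M : Matrix ι ι K} (h : M.IsDiag) : SqfreeAnn M := by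
  rw [← h.diagonal_diag]; exact sqfreeAnn_diagonal _

lemma sqfreeAnn_of_conj_isDiag {M P : GL ι K} (h : (P * M * P⁻¹).1.IsDiag) : SqfreeAnn M.1 := by
  have := (sqfreeAnn_of_isDiag h).conj P⁻¹
  simpa [mul_assoc] using this

/-- A matrix of which all basis vectors are eigenvectors is diagonal. -/
lemma isDiag_of_mulVec_single {M : Matrix ι ι K}
    (h : ∀ i, ∃ c : K, M *ᵥ Pi.single i 1 = c • Pi.single i 1) : M.IsDiag := by
  intro i j hij
  obtain ⟨c, hc⟩ := h j
  have := congrFun hc i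
  simpa [Pi.single_apply, hij] using this

lemma IsDiag.mulVec_single {M : Matrix ι ι K} (h : M.IsDiag) (i : ι) :
    M *ᵥ Pi.single i 1 = M i i • Pi.single i 1 := by
  ext j
  simp only [mulVec_single_one, col_apply, Pi.smul_apply, smul_eq_mul]
  rcases eq_or_ne j i with rfl | hji
  · simp
  · simp [h hji, hji]

/-- If the common eigenvectors of a set of matrices span, these matrices are simultaneously
diagonalizable. -/
lemma exists_conj_isDiag_of_span {S : Set (GL ι K)}
    (h : Submodule.span K {x : ι → K | ∀ t ∈ S, ∃ c : K, t.1 *ᵥ x = c • x} = ⊤) :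
    ∃ P : GL ι K, ∀ t ∈ S, (P * t * P⁻¹).1.IsDiag := by
  obtain ⟨b, hb, hspan, hli⟩ := exists_linearIndependent K
    {x : ι → K | ∀ t ∈ S, ∃ c : K, t.1 *ᵥ x = c • x}
  let B : Module.Basis b K (ι → K) := Module.Basis.mk hli (by
    rw [Subtype.range_coe, hspan, h])
  let e : b ≃ ι := B.indexEquiv (Pi.basisFun K ι)
  let B' := B.reindex e
  have hB' : ∀ i, ∀ t ∈ S, ∃ c : K, t.1 *ᵥ B' i = c • B' i := fun i => by
    have : B' i = (e.symm i : ι → K) := by simp [B', B]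
    rw [this]
    exact hb (e.symm i).2
  let Q : Matrix ι ι K := (Pi.basisFun K ι).toMatrix B'
  have hQ : ∀ i, Q *ᵥ Pi.single i 1 = B' i := fun i => by
    ext j; simp [Q, Module.Basis.toMatrix_apply]
  let P : GL ι K := ⟨B'.toMatrix (Pi.basisFun K ι), Q, by simp [Q], by simp [Q]⟩
  refine ⟨P, fun t ht => isDiag_of_mulVec_single fun i => ?_⟩
  obtain ⟨c, hc⟩ := hB' i t ht
  refine ⟨c, ?_⟩
  have h1 : (P * t * P⁻¹).1 *ᵥ Pi.single i 1 = P.1 *ᵥ (t.1 *ᵥ (Q *ᵥ Pi.single i 1)) := by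
    rw [gl_mul_mulVec, gl_mul_mulVec]; rfl
  have h2 : P.1 *ᵥ (Q *ᵥ Pi.single i 1) = Pi.single i 1 := by
    rw [mulVec_mulVec]
    have : P.1 * Q = 1 := P.mul_inv
    rw [this, one_mulVec]
  rw [h1, hQ, hc, ← hQ, mulVec_smul, h2]

/-- A commuting family of diagonalizable matrices is simultaneously diagonalizable: the space is the
sum of the intersections of their eigenspaces. -/
lemma exists_conj_isDiag [IsAlgClosed K] {S : Set (GL ι K)}
    (hc : ∀ t ∈ S, ∀ t' ∈ S, t * t' = t' * t) (hs : ∀ t ∈ S, SqfreeAnn t.1) :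
    ∃ P : GL ι K, ∀ t ∈ S, (P * t * P⁻¹).1.IsDiag := by
  apply exists_conj_isDiag_of_span
  rw [eq_top_iff]
  have h' : ∀ t : S, ∀ μ, Module.End.maxGenEigenspace (toLin' t.1.1) μ =
      Module.End.eigenspace (toLin' t.1.1) μ :=
    fun t μ => ((sqfreeAnn_iff.1 (hs _ t.2)).isFinitelySemisimple).maxGenEigenspace_eq_eigenspace μ
  have := Module.End.iSup_iInf_maxGenEigenspace_eq_top_of_iSup_maxGenEigenspace_eq_top_of_commute
    (fun t : S => Matrix.toLin' t.1.1) (fun s t _ => by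
      change _ * _ = _ * _
      rw [Module.End.mul_eq_comp, Module.End.mul_eq_comp, ← toLin'_mul, ← toLin'_mul,
        ← Units.val_mul, ← Units.val_mul, hc _ s.2 _ t.2]) (fun t => by
      simp_rw [h']
      exact (sqfreeAnn_iff.1 (hs _ t.2)).iSup_eigenspace_eq_top)
  rw [← this]
  refine iSup_le fun χ x hx => Submodule.subset_span fun t ht => ⟨χ ⟨t, ht⟩, ?_⟩
  have := (Submodule.mem_iInf _).1 hx ⟨t, ht⟩
  rw [h', Module.End.mem_eigenspace_iff] at this
  simpa using this

/-- For a torus `T` and a diagonalizable `s` which commutes with `T`, some element of the coset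
`T s` is generic: its eigenvectors are eigenvectors of all elements of `T` and of `s`. -/
lemma IsTorus.exists_generic [IsAlgClosed K] {T : Subgroup (GL ι K)} (hT : IsTorus T) {s : GL ι K}
    (hs : SqfreeAnn s.1) (hc : ∀ t ∈ T, t * s = s * t) :
    ∃ t ∈ T, SqfreeAnn (t * s).1 ∧ ∀ x : ι → K, (∃ c : K, (t * s).1 *ᵥ x = c • x) →
      (∀ t' ∈ T, ∃ c : K, t'.1 *ᵥ x = c • x) ∧ ∃ c : K, s.1 *ᵥ x = c • x := by
  obtain ⟨hT1, hT2, P₀, hP₀⟩ := hT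
  have hTc : ∀ t ∈ T, ∀ t' ∈ T, t * t' = t' * t := fun t ht t' ht' => by
    have := commute_of_mem_diagSub (hP₀ t ht) (hP₀ t' ht')
    have h2 := congrArg (fun x => P₀⁻¹ * x * P₀) this
    simpa [mul_assoc] using h2
  obtain ⟨P, hP⟩ := exists_conj_isDiag (S := insert s (T : Set (GL ι K))) (by
      rintro t (rfl | ht) t' (rfl | ht')
      · rfl
      · exact (hc _ ht').symm
      · exact hc _ ht
      · exact hTc _ ht _ ht') (by
      rintro t (rfl | ht)
      · exact hs
      · exact sqfreeAnn_of_conj_isDiag (hP₀ t ht))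
  have hPs := hP s (Set.mem_insert _ _)
  replace hP : ∀ t ∈ T, (P * t * P⁻¹).1.IsDiag := fun t ht => hP t (Set.mem_insert_of_mem _ ht)
  let d : GL ι K → ι → K := fun t i => (P * t * P⁻¹).1 i i
  have hPd : ∀ t, (P * t * P⁻¹).1.IsDiag → (P * t * P⁻¹).1 = diagonal (d t) := fun t ht =>
    ht.diagonal_diag.symm
  have hmul : ∀ t t' : GL ι K, (P * t * P⁻¹).1.IsDiag → (P * t' * P⁻¹).1.IsDiag →
      (P * (t * t') * P⁻¹).1 = diagonal fun i => d t i * d t' i := fun t t' h h' => by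
    have : P * (t * t') * P⁻¹ = (P * t * P⁻¹) * (P * t' * P⁻¹) := by group
    rw [this, Units.val_mul, hPd t h, hPd t' h', diagonal_mul_diagonal]
  have hd : ∀ t ∈ T, ∀ i, d t i ≠ 0 := fun t ht i h0 => by
    have h1 := hmul t t⁻¹ (hP t ht) (hP _ (inv_mem ht))
    simp only [mul_inv_cancel, mul_one, Units.val_one] at h1
    have := congrFun (congrFun h1 i) i
    simp [h0] at this
  have hds : ∀ i, d s i ≠ 0 := fun i h0 => by
    have hi : (P * s⁻¹ * P⁻¹).1.IsDiag := by
      have := inv_mem (show P * s * P⁻¹ ∈ diagSub ι K from hPs)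
      have e : (P * s * P⁻¹)⁻¹ = P * s⁻¹ * P⁻¹ := by group
      rwa [e] at this
    have h1 := hmul s s⁻¹ hPs hi
    simp only [mul_inv_cancel, mul_one, Units.val_one] at h1
    have := congrFun (congrFun h1 i) i
    simp [h0] at this
  -- the subgroup of `T` where the `i`-th and the `j`-th eigenvalue agree
  let D : ι × ι → Subgroup T := fun q =>
    { carrier := {t | d t q.1 = d t q.2}
      one_mem' := by simp [d]
      mul_mem' := by
        intro t t' h h'
        have := hmul t t' (hP _ t.2) (hP _ t'.2)
        have e : ∀ i, d (t * t') i = d t i * d t' i := fun i => by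
          simp only [d] at this ⊢
          rw [this, diagonal_apply_eq]
        simp only [Set.mem_ofPred_eq, Subgroup.coe_mul, e] at *
        rw [h, h']
      inv_mem' := by
        intro t h
        have := hmul t t⁻¹ (hP _ t.2) (hP _ (inv_mem t.2))
        simp only [mul_inv_cancel, mul_one, Units.val_one] at this
        have e : ∀ i, d t i * d (t : GL ι K)⁻¹ i = 1 := fun i => by
          have := congrFun (congrFun this i) i
          simpa using this.symm
        simp only [Set.mem_ofPred_eq, Subgroup.coe_inv] at *
        have h1 := e q.1
        rw [h, ← e q.2] at h1
        exact mul_left_cancel₀ (hd _ t.2 _) h1 }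
  -- a closed subgroup of finite index in a torus is the whole torus
  have hD : ∀ q, (D q).FiniteIndex → D q = ⊤ := by
    intro q hq
    let N : Subgroup (GL ι K) := (D q).map T.subtype
    have hNT : N ≤ T := by
      rintro _ ⟨t, _, rfl⟩; exact t.2
    have hN : IsZClosed N := by
      have h1 : IsZClosed (conjSub P⁻¹ (conjSub P N)) := by
        refine IsZClosed.conj ?_ _
        obtain ⟨S, hS⟩ := (hT1.conj P)
        refine ⟨insert (MvPolynomial.X (q.1, q.1) - MvPolynomial.X (q.2, q.2)) S, fun g => ?_⟩
        rw [Set.forall_mem_insert, ← hS]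
        constructor
        · rintro ⟨_, ⟨t, ht, rfl⟩, rfl⟩
          refine ⟨?_, ⟨_, t.2, rfl⟩⟩
          have : d t q.1 = d t q.2 := ht
          simpa [sub_eq_zero, d, mul_assoc] using this
        · rintro ⟨h1, ⟨t, ht, rfl⟩⟩
          refine ⟨t, ⟨⟨t, ht⟩, ?_, rfl⟩, rfl⟩
          change d t q.1 = d t q.2
          simpa [sub_eq_zero, d, mul_assoc] using h1
      rwa [conjSub_conjSub, inv_mul_cancel, conjSub_one] at h1
    have hrel : N.relIndex T ≠ 0 := by
      have : N.subgroupOf T = D q := by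
        ext t; simp [N, Subgroup.mem_subgroupOf]
      rw [Subgroup.relIndex, this]
      exact hq.index_ne_zero
    have hle : T ≤ N := by
      have : idComp T ≤ N := sInf_le ⟨hNT, hN, hrel⟩
      rwa [hT2] at this
    rw [eq_top_iff]
    intro t _
    obtain ⟨t', ht', h⟩ := hle t.2
    rwa [← Subtype.ext (a1 := t') (a2 := t) h]
  -- otherwise `T` is a finite union of cosets of the `D q`, one of which then has finite index
  have key : ∃ t ∈ T, ∀ i j, d t i * d s i = d t j * d s j → D (i, j) = ⊤ ∧ d s i = d s j := by
    by_contra! hbad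
    classical
    let Z : ι × ι → Set T := fun q => {t | d t q.1 * d s q.1 = d t q.2 * d s q.2}
    let I : Finset (ι × ι) := Finset.univ.filter fun q =>
      (D q = ⊤ → d s q.1 ≠ d s q.2) ∧ (Z q).Nonempty
    let g : ι × ι → T := fun q => if h : (Z q).Nonempty then h.some else 1
    have hcov : ⋃ q ∈ I, g q • (D q : Set T) = Set.univ := by
      rw [Set.eq_univ_iff_forall]
      intro t
      obtain ⟨i, j, h1, h2⟩ := hbad t t.2
      have hne : (Z (i, j)).Nonempty := ⟨t, h1⟩
      refine Set.mem_biUnion (x := (i, j)) (Finset.mem_filter.2 ⟨Finset.mem_univ _, h2, hne⟩) ?_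
      have hg : g (i, j) ∈ Z (i, j) := by
        simp only [g, dif_pos hne]; exact hne.some_mem
      rw [mem_leftCoset_iff]
      change d ((g (i, j))⁻¹ * t : T) i = d ((g (i, j))⁻¹ * t : T) j
      have e1 := hmul (g (i, j)) ((g (i, j))⁻¹ * t) (hP _ (g (i, j)).2)
        (hP _ (mul_mem (inv_mem (g (i, j)).2) t.2))
      rw [Subgroup.coe_inv, mul_inv_cancel_left] at e1
      have e : ∀ k, d t k = d (g (i, j)) k * d ((g (i, j))⁻¹ * t : T) k := fun k => by
        simp only [d, Subgroup.coe_mul, Subgroup.coe_inv] at e1 ⊢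
        rw [e1, diagonal_apply_eq]
      have h3 : d (g (i, j)) i * d s i = d (g (i, j)) j * d s j := hg
      have h4 : d t i * d s i = d t j * d s j := h1
      rw [e i, e j, mul_right_comm, mul_right_comm _ _ (d s j), h3] at h4
      exact mul_left_cancel₀ (mul_ne_zero (hd _ (g (i, j)).2 _) (hds j)) h4
    obtain ⟨q, hq, hfi⟩ := Subgroup.exists_finiteIndex_of_leftCoset_cover hcov
    obtain ⟨-, h1, t, ht⟩ := Finset.mem_filter.1 hq
    have htop := hD q hfi
    apply h1 htop
    have h2 : d t q.1 = d t q.2 := by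
      have : t ∈ D q := by rw [htop]; trivial
      exact this
    have h3 : d t q.1 * d s q.1 = d t q.2 * d s q.2 := ht
    rw [h2] at h3
    exact mul_left_cancel₀ (hd _ t.2 _) h3
  obtain ⟨t, ht, hgen⟩ := key
  have hts := hmul t s (hP t ht) hPs
  refine ⟨t, ht, sqfreeAnn_of_conj_isDiag (P := P) (by rw [hts]; exact isDiag_diagonal _), ?_⟩
  rintro x ⟨c, hx⟩
  have hback : ∀ u : GL ι K, ∀ c : K, (P * u * P⁻¹).1 *ᵥ (P.1 *ᵥ x) = c • (P.1 *ᵥ x) ↔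
      u.1 *ᵥ x = c • x := by
    intro u c
    have e : (P * u * P⁻¹).1 *ᵥ (P.1 *ᵥ x) = P.1 *ᵥ (u.1 *ᵥ x) := by
      simp only [mulVec_mulVec, ← Units.val_mul]; congr 2; group
    rw [e, ← mulVec_smul]
    exact (gl_mulVec_injective P).eq_iff
  rw [← hback, hts] at hx
  set y := P.1 *ᵥ x with hy
  by_cases hy0 : y = 0
  · have : ∀ u : GL ι K, ∃ c : K, u.1 *ᵥ x = c • x := fun u => ⟨0, by rw [← hback, hy0]; simp⟩
    exact ⟨fun t' _ => this t', this s⟩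
  obtain ⟨i, hi⟩ := Function.ne_iff.1 hy0
  have hsupp : ∀ j, y j ≠ 0 → D (i, j) = ⊤ ∧ d s i = d s j := by
    intro j hj
    apply hgen
    have h1 := congrFun hx i
    have h2 := congrFun hx j
    simp only [mulVec_diagonal, Pi.smul_apply, smul_eq_mul] at h1 h2
    rw [mul_right_cancel₀ hi h1, mul_right_cancel₀ hj h2]
  constructor
  · intro t' ht'
    refine ⟨d t' i, ?_⟩
    rw [← hback, hPd _ (hP t' ht')]
    ext j
    simp only [mulVec_diagonal, Pi.smul_apply, smul_eq_mul]
    by_cases hj : y j = 0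
    · simp [hj]
    · have : (⟨t', ht'⟩ : T) ∈ D (i, j) := by rw [(hsupp j hj).1]; trivial
      have h5 : d t' i = d t' j := this
      rw [h5]
  · refine ⟨d s i, ?_⟩
    rw [← hback, hPd _ hPs]
    ext j
    simp only [mulVec_diagonal, Pi.smul_apply, smul_eq_mul]
    by_cases hj : y j = 0
    · simp [hj]
    · rw [(hsupp j hj).2]

end Diagonalizable

/-! ### Split maximal tori -/

section SplitTorus

variable {ι : Type} [Fintype ι] [DecidableEq ι] {K : Type*} [Field K] {r : ℕ}

/-- The homomorphism from a split torus to the diagonal matrices with weights `χ`. -/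
def weightTorus (χ : ι → Fin r → ℤ) : (Fin r → Kˣ) →* GL ι K where
  toFun z := ⟨diagonal fun i => (monomialChar (χ i) z : Kˣ),
    diagonal fun i => ((monomialChar (χ i) z)⁻¹ : Kˣ),
    by rw [diagonal_mul_diagonal]; simp, by rw [diagonal_mul_diagonal]; simp⟩
  map_one' := by ext1; simp
  map_mul' z z' := by
    ext1; simp [monomialChar_mul]

lemma weightTorus_val (χ : ι → Fin r → ℤ) (z : Fin r → Kˣ) :
    (weightTorus χ z).1 = diagonal fun i => ((monomialChar (χ i) z : Kˣ) : K) := rfl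

lemma weightTorus_mem_diagSub (χ : ι → Fin r → ℤ) (z : Fin r → Kˣ) :
    weightTorus χ z ∈ diagSub ι K := by
  rw [mem_diagSub, weightTorus_val]; exact isDiag_diagonal _

lemma isAlgTorusHom_weightTorus (χ : ι → Fin r → ℤ) :
    IsAlgTorusHom (weightTorus χ : (Fin r → Kˣ) →* GL ι K) := by
  intro i j
  by_cases hij : i = j
  · subst hij
    refine ⟨∏ l, MvPolynomial.X l ^ (χ i l + (∑ l, (χ i l).natAbs : ℕ) : ℤ).toNat,
      ∑ l, (χ i l).natAbs, fun z => ?_⟩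
    rw [weightTorus_val, diagonal_apply_eq, monomialChar, map_prod, Units.coe_prod,
      ← Finset.prod_pow, ← Finset.prod_mul_distrib]
    refine Finset.prod_congr rfl fun l _ => ?_
    rw [map_pow, MvPolynomial.eval_X, ← Units.val_pow_eq_pow_val, ← Units.val_mul,
      ← Units.val_pow_eq_pow_val]
    congr 1
    rw [← zpow_natCast, ← zpow_natCast, ← _root_.zpow_add]
    congr 1
    have h : (χ i l).natAbs ≤ ∑ l, (χ i l).natAbs :=
      Finset.single_le_sum (f := fun l => (χ i l).natAbs) (fun _ _ => Nat.zero_le _)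
        (Finset.mem_univ l)
    have : (0 : ℤ) ≤ χ i l + (∑ l, (χ i l).natAbs : ℕ) := by omega
    rw [Int.toNat_of_nonneg this]
  · exact ⟨0, 0, fun z => by simp [weightTorus_val, diagonal_apply_ne _ hij]⟩

/-- A homomorphism of algebraic groups from a split torus to the diagonal matrices is given by
weights. -/
lemma exists_eq_weightTorus [Infinite K] {a : (Fin r → Kˣ) →* GL ι K} (ha : IsAlgTorusHom a)
    (hd : ∀ z, a z ∈ diagSub ι K) : ∃ χ : ι → Fin r → ℤ, a = weightTorus χ := by
  have key : ∀ i, ∃ m : Fin r → ℤ, ∀ z, (a z).1 i i = ((monomialChar m z : Kˣ) : K) := by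
    intro i
    obtain ⟨p, k, hp⟩ := ha i i
    -- after multiplication by a monomial, the entry is a polynomial and a multiplicative character,
    -- hence one of its monomials by the linear independence of characters
    let φ : (Fin r → Kˣ) →* K :=
      { toFun := fun z => (a z).1 i i * (∏ l, (z l : K)) ^ k
        map_one' := by simp
        map_mul' := fun z z' => by
          have h : (a (z * z')).1 i i = (a z).1 i i * (a z').1 i i := by
            rw [map_mul, Units.val_mul, ← IsDiag.diagonal_diag (hd z),
              ← IsDiag.diagonal_diag (hd z'), diagonal_mul_diagonal]
            simp
          simp only [h, Pi.mul_apply, Units.val_mul, Finset.prod_mul_distrib, mul_pow]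
          ring }
    have hφ : (φ : (Fin r → Kˣ) → K) ∈ Submodule.span K
        ((fun f : (Fin r → Kˣ) →* K => (f : (Fin r → Kˣ) → K)) ''
          Set.range fun α : Fin r →₀ ℕ => monomialHom fun l => (α l : ℤ)) := by
      have e : (φ : (Fin r → Kˣ) → K) = ∑ α ∈ p.support, p.coeff α •
          ((monomialHom fun l => (α l : ℤ) : (Fin r → Kˣ) →* K) : (Fin r → Kˣ) → K) := by
        ext z
        rw [Finset.sum_apply]
        refine (hp z).trans ?_
        rw [MvPolynomial.eval_eq']
        refine Finset.sum_congr rfl fun α _ => ?_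
        simp [monomialHom_apply, monomialChar]
      rw [e]
      exact Submodule.sum_mem _ fun α _ => Submodule.smul_mem _ _
        (Submodule.subset_span ⟨_, ⟨α, rfl⟩, rfl⟩)
    have hmem : φ ∈ Set.range fun α : Fin r →₀ ℕ => monomialHom (K := K) fun l => (α l : ℤ) := by
      by_contra hno
      exact (linearIndependent_monoidHom (Fin r → Kˣ) K).notMem_span_image hno hφ
    obtain ⟨α, hα⟩ := hmem
    refine ⟨fun l => α l - k, fun z => ?_⟩
    have h1 : ((monomialChar (fun l => (α l : ℤ)) z : Kˣ) : K) =
      (a z).1 i i * (∏ l, (z l : K)) ^ k := DFunLike.congr_fun hα z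
    have h2 : (fun l => (α l : ℤ) - k) = (fun l => (α l : ℤ)) - fun _ => (k : ℤ) := rfl
    have h3 : ((monomialChar (fun _ : Fin r => (k : ℤ)) z : Kˣ) : K) = (∏ l, (z l : K)) ^ k := by
      simp [monomialChar, Finset.prod_pow]
    rw [h2, monomialChar_sub, Units.val_mul, h1, ← h3, mul_assoc, ← Units.val_mul]
    simp
  choose χ hχ using key
  refine ⟨χ, MonoidHom.ext fun z => Units.ext ?_⟩
  rw [weightTorus_val, ← IsDiag.diagonal_diag (hd z)]
  congr 1; ext i; exact hχ i z

variable [IsAlgClosed K] [CharZero K]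

lemma exists_torus_pow (z : Fin r → Kˣ) (k : ℕ) (hk : 0 < k) : ∃ y : Fin r → Kˣ, y ^ k = z := by
  have : ∀ c : Kˣ, ∃ d : Kˣ, d ^ k = c := fun c => by
    obtain ⟨d, hd⟩ := IsAlgClosed.exists_pow_nat_eq (c : K) hk
    have hd0 : d ≠ 0 := by rintro rfl; rw [zero_pow hk.ne'] at hd; exact c.ne_zero hd.symm
    exact ⟨Units.mk0 d hd0, Units.ext (by simpa using hd)⟩
  choose f hf using this
  exact ⟨fun i => f (z i), funext fun i => hf _⟩

/-- A bijective endomorphism of a split torus given by characters is invertible over `ℤ`. -/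
lemma exists_mul_eq_one_of_bijective {s : ℕ} (ψ : Fin s → Fin r → ℤ)
    (hψ : Function.Bijective fun (z : Fin r → Kˣ) (l : Fin s) => monomialChar (ψ l) z) :
    ∃ h : r = s, ∃ C' : Matrix (Fin s) (Fin s) ℤ,
      (Matrix.of fun l j => ψ l (Fin.cast h.symm j)) * C' = 1 := by
  have hmap : ∀ (z : Fin r → Kˣ) (k : ℕ),
      (fun l => monomialChar (ψ l) (z ^ k)) = (fun l => monomialChar (ψ l) z) ^ k := fun z k => by
    ext1 l
    simp only [monomialChar, Pi.pow_apply, ← Finset.prod_pow]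
    refine Finset.prod_congr rfl fun i _ => ?_
    rw [← zpow_natCast, ← zpow_natCast, ← _root_.zpow_mul, ← _root_.zpow_mul, mul_comm]
  have hone : (fun l => monomialChar (ψ l) (1 : Fin r → Kˣ)) = 1 := by ext l; simp
  have hroot : ∀ p : ℕ, 0 < p → ∃ ζ : Kˣ, IsPrimitiveRoot ζ p := fun p hp => by
    have : NeZero p := ⟨hp.ne'⟩
    have : NeZero (p : K) := ⟨Nat.cast_ne_zero.2 hp.ne'⟩
    obtain ⟨ζ, hζ⟩ := HasEnoughRootsOfUnity.exists_primitiveRoot K p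
    exact ⟨(hζ.isUnit hp.ne').unit, IsPrimitiveRoot.coe_units_iff.1 (by simpa using hζ)⟩
  have hrs : r = s := by
    obtain ⟨ζ, hζ⟩ := hroot 2 two_pos
    -- compare the numbers of elements of order dividing `2`
    let e : {z : Fin r → Kˣ // z ^ 2 = 1} ≃ {z : Fin s → Kˣ // z ^ 2 = 1} :=
      Equiv.ofBijective (fun z => ⟨fun l => monomialChar (ψ l) z.1, by
        rw [← hmap, z.2, hone]⟩) ⟨fun z z' h => Subtype.ext (hψ.1 (congrArg Subtype.val h)), by
        rintro ⟨y, hy⟩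
        obtain ⟨z, rfl⟩ := hψ.2 y
        refine ⟨⟨z, hψ.1 ?_⟩, rfl⟩
        simp only
        rw [hone, hmap, hy]⟩
    have hcard : ∀ n, Nat.card {z : Fin n → Kˣ // z ^ 2 = 1} = 2 ^ n := by
      intro n
      let E : {z : Fin n → Kˣ // z ^ 2 = 1} ≃ (Fin n → rootsOfUnity 2 K) :=
        { toFun := fun z i => ⟨z.1 i, by
            rw [mem_rootsOfUnity]; exact congrFun z.2 i⟩
          invFun := fun y => ⟨fun i => y i, funext fun i => (mem_rootsOfUnity _ _).1 (y i).2⟩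
          left_inv := fun z => rfl
          right_inv := fun y => rfl }
      rw [Nat.card_congr E, Nat.card_pi]
      have : Nat.card (rootsOfUnity 2 K) = 2 := by
        exact (IsPrimitiveRoot.coe_units_iff.2 hζ).card_rootsOfUnity
      rw [Finset.prod_congr rfl fun _ _ => this]; simp
    have := Nat.card_congr e
    rw [hcard, hcard] at this
    exact Nat.pow_right_injective le_rfl this
  subst hrs
  refine ⟨rfl, ?_⟩
  set C : Matrix (Fin r) (Fin r) ℤ := Matrix.of fun l j => ψ l (Fin.cast rfl j) with hC
  suffices h : IsUnit C.det by
    exact ⟨C⁻¹, mul_nonsing_inv _ h⟩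
  by_contra hu
  obtain ⟨p, hp, hdvd⟩ := Int.exists_prime_and_dvd (n := C.det) (fun h => hu (Int.isUnit_iff_natAbs_eq.2 h))
  obtain ⟨q, hq⟩ : ∃ q : ℕ, q = p.natAbs := ⟨_, rfl⟩
  have hqp : q.Prime := hq ▸ Int.prime_iff_natAbs_prime.1 hp
  have : Fact q.Prime := ⟨hqp⟩
  have hdet : (C.map (Int.castRingHom (ZMod q))).det = 0 := by
    have := (RingHom.map_det (Int.castRingHom (ZMod q)) C).symm
    rw [RingHom.mapMatrix_apply] at this
    rw [this]
    rw [eq_intCast, ZMod.intCast_zmod_eq_zero_iff_dvd, hq, Int.natCast_natAbs, abs_dvd]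
    exact hdvd
  -- a kernel vector modulo the prime `q` gives a nontrivial torsion point of order `q` in the kernel
  obtain ⟨v, hv0, hv⟩ := Matrix.exists_mulVec_eq_zero_iff.2 hdet
  obtain ⟨ζ, hζ⟩ := hroot q hqp.pos
  let z : Fin r → Kˣ := fun i => ζ ^ ((v i).val : ℤ)
  have hz : z = 1 := by
    apply hψ.1
    simp only
    rw [hone]
    ext1 l
    simp only [Pi.one_apply, z]
    rw [monomialChar_cochar, hζ.zpow_eq_one_iff_dvd, ← ZMod.intCast_zmod_eq_zero_iff_dvd]
    have := congrFun hv l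
    simp only [mulVec, dotProduct, map_apply, hC, Pi.zero_apply, of_apply, Fin.cast_eq_self] at this
    rw [dotProduct, Int.cast_sum, ← this]
    refine Finset.sum_congr rfl fun i _ => ?_
    simp
  apply hv0
  ext i
  have h1 := congrFun hz i
  simp only [z, Pi.one_apply] at h1
  rw [hζ.zpow_eq_one_iff_dvd] at h1
  have : (v i).val = 0 := Nat.eq_zero_of_dvd_of_lt (by exact_mod_cast h1) (ZMod.val_lt _)
  exact (ZMod.val_eq_zero _).1 this

/-- `H` is a closed group whose diagonal elements form the maximal torus with weights `χ`. Moreover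
the coordinates of the torus are the weights at `e`, and all diagonalizable elements of `H` are
conjugate in `H` to diagonal ones. -/
structure IsSplitModel (H : Subgroup (GL ι K)) (χ : ι → Fin 2 → ℤ) (e : Fin 2 → ι) : Prop where
  closed : IsZClosed H
  mem : ∀ z, weightTorus χ z ∈ H
  coord : ∀ l, χ (e l) = Pi.single l 1
  diag : ∀ h ∈ H, h ∈ diagSub ι K → ∃ z, weightTorus χ z = h
  cent : ∀ h ∈ H, (∀ z, h * weightTorus χ z = weightTorus χ z * h) → h ∈ diagSub ι K
  conj : ∀ x ∈ H, SqfreeAnn x.1 → ∃ g ∈ H, g * x * g⁻¹ ∈ diagSub ι K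

namespace IsSplitModel

variable {H : Subgroup (GL ι K)} {χ : ι → Fin 2 → ℤ} {e : Fin 2 → ι}

lemma coord_apply (hH : IsSplitModel H χ e) (z : Fin 2 → Kˣ) (l : Fin 2) :
    (weightTorus χ z).1 (e l) (e l) = z l := by
  rw [weightTorus_val, diagonal_apply_eq, hH.coord, monomialChar_single]

lemma injective (hH : IsSplitModel H χ e) :
    Function.Injective (weightTorus χ : (Fin 2 → Kˣ) →* GL ι K) := fun z z' h => by
  ext l
  rw [← hH.coord_apply z, ← hH.coord_apply z', h]

lemma range_eq (hH : IsSplitModel H χ e) : (weightTorus χ).range = H ⊓ diagSub ι K := by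
  ext h
  constructor
  · rintro ⟨z, rfl⟩
    exact ⟨hH.mem z, weightTorus_mem_diagSub _ _⟩
  · rintro ⟨h1, h2⟩
    exact hH.diag h h1 h2

lemma exists_pow (χ : ι → Fin r → ℤ) {x : GL ι K} (hx : x ∈ (weightTorus χ).range) (k : ℕ)
    (hk : 0 < k) : ∃ y ∈ (weightTorus χ).range, y ^ k = x := by
  obtain ⟨z, rfl⟩ := hx
  obtain ⟨y, rfl⟩ := exists_torus_pow z k hk
  exact ⟨_, ⟨y, rfl⟩, by rw [map_pow]⟩

lemma isTorus (hH : IsSplitModel H χ e) :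
    IsTorus (weightTorus χ : (Fin 2 → Kˣ) →* GL ι K).range := by
  have hcl : IsZClosed (weightTorus χ : (Fin 2 → Kˣ) →* GL ι K).range := by
    rw [hH.range_eq]; exact hH.closed.inf isZClosed_diagSub
  refine ⟨hcl, isZConnected_of_forall hcl fun N _ hN x hx => ?_, 1, ?_⟩
  · exact mem_of_forall_exists_pow hN (exists_pow χ hx)
  · rintro _ ⟨z, rfl⟩
    simpa using mem_diagSub.1 (weightTorus_mem_diagSub χ z)

/-- The diagonal torus is a maximal torus in each subgroup of the model which contains it. -/
lemma isMaxTorusParam (hH : IsSplitModel H χ e) {H' : Subgroup (GL ι K)} (hle : H' ≤ H)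
    (hmem : ∀ z, weightTorus χ z ∈ H') :
    IsMaxTorusParam H' (weightTorus χ : (Fin 2 → Kˣ) →* GL ι K) := by
  refine ⟨isAlgTorusHom_weightTorus χ, hH.injective, ?_, hH.isTorus, fun T' h1 h2 h3 => ?_⟩
  · rintro _ ⟨z, rfl⟩; exact hmem z
  · refine le_antisymm (fun t ht => ?_) h3
    rw [hH.range_eq]
    refine ⟨hle (h1 ht), hH.cent t (hle (h1 ht)) fun z => ?_⟩
    obtain ⟨_, _, P, hP⟩ := h2
    have := commute_of_mem_diagSub (hP t ht) (hP _ (h3 ⟨z, rfl⟩))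
    have h4 := congrArg (fun x => P⁻¹ * x * P) this
    simpa [mul_assoc] using h4

/-- A torus and a diagonalizable element commuting with it can be conjugated together into the
diagonal torus. -/
lemma exists_conj_torus (hH : IsSplitModel H χ e) {T : Subgroup (GL ι K)} (hT : IsTorus T)
    (hle : T ≤ H) {s : GL ι K} (hsH : s ∈ H) (hs : SqfreeAnn s.1) (hc : ∀ t ∈ T, t * s = s * t) :
    ∃ g ∈ H, conjSub g T ≤ diagSub ι K ∧ g * s * g⁻¹ ∈ diagSub ι K := by
  obtain ⟨t, ht, hts, hgen⟩ := hT.exists_generic hs hc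
  obtain ⟨g, hg, hd⟩ := hH.conj (t * s) (mul_mem (hle ht) hsH) hts
  have hev : ∀ i, ∃ c : K, (t * s).1 *ᵥ ((g⁻¹).1 *ᵥ Pi.single i 1) = c • ((g⁻¹).1 *ᵥ Pi.single i 1) := by
    intro i
    have h1 := IsDiag.mulVec_single hd i
    refine ⟨(g * (t * s) * g⁻¹).1 i i, gl_mulVec_injective g ?_⟩
    simp only
    rw [mulVec_smul, gl_mulVec_inv_mulVec, ← h1, gl_mul_mulVec (g * (t * s)), gl_mul_mulVec g]
  have hfin : ∀ u : GL ι K, (∀ i, ∃ c : K, u.1 *ᵥ ((g⁻¹).1 *ᵥ Pi.single i 1) =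
      c • ((g⁻¹).1 *ᵥ Pi.single i 1)) → g * u * g⁻¹ ∈ diagSub ι K := by
    intro u hu
    refine isDiag_of_mulVec_single fun i => ?_
    obtain ⟨c, hc⟩ := hu i
    exact ⟨c, by rw [gl_mul_mulVec, gl_mul_mulVec, hc, mulVec_smul, gl_mulVec_inv_mulVec]⟩
  refine ⟨g, hg, ?_, hfin s fun i => (hgen _ (hev i)).2⟩
  rintro _ ⟨u, hu, rfl⟩
  exact hfin u fun i => (hgen _ (hev i)).1 u hu

/-- Every maximal torus of a subgroup `H'` of the model which contains all tori of the model that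
commute with some `s` is conjugate to the diagonal torus, and its parametrization is unique up to an
integral change of coordinates. -/
lemma exists_conj_param (hH : IsSplitModel H χ e) {H' : Subgroup (GL ι K)} (hle : H' ≤ H)
    {s : GL ι K} (hsH : s ∈ H) (hs : SqfreeAnn s.1) (hc : ∀ t ∈ H', t * s = s * t)
    (hT' : ∀ T : Subgroup (GL ι K), T ≤ H → IsTorus T → (∀ t ∈ T, t * s = s * t) → T ≤ H')
    {a : (Fin r → Kˣ) →* GL ι K} (ha : IsMaxTorusParam H' a) :
    ∃ h : r = 2, ∃ g ∈ H, g * s * g⁻¹ ∈ diagSub ι K ∧ ∃ C C' : Matrix (Fin 2) (Fin 2) ℤ,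
      C * C' = 1 ∧ ∀ z, g * a z * g⁻¹ = weightTorus χ (matTorus C fun i => z (Fin.cast h.symm i)) := by
  obtain ⟨ha1, ha2, haH, haT, hamax⟩ := ha
  obtain ⟨g, hg, hd, hds⟩ := hH.exists_conj_torus haT (haH.trans hle) hsH hs
    fun t ht => hc t (haH ht)
  have hle2 : conjSub g a.range ≤ (weightTorus χ).range := by
    rw [hH.range_eq]
    refine le_inf ?_ hd
    have := conjSub_mono (g := g) (haH.trans hle)
    rwa [conjSub_of_mem hg] at this
  have hrange : conjSub g a.range = (weightTorus χ).range := by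
    have h1 := hamax (conjSub g⁻¹ (weightTorus χ).range) (hT' _ ?_ (hH.isTorus.conj _) ?_)
      (hH.isTorus.conj _) (by rwa [le_conjSub_iff, inv_inv])
    · rw [← h1, conjSub_conjSub, mul_inv_cancel, conjSub_one]
    · rw [conjSub_le_iff, inv_inv, conjSub_of_mem hg]
      rintro _ ⟨z, rfl⟩; exact hH.mem z
    · rintro _ ⟨_, ⟨z, rfl⟩, rfl⟩
      have := commute_of_mem_diagSub (weightTorus_mem_diagSub χ z) hds
      have h4 := congrArg (fun x => g⁻¹ * x * g) this
      simpa [mul_assoc] using h4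
  obtain ⟨ψ, hψ⟩ := exists_eq_weightTorus (ha1.conj g) fun z => hd ⟨a z, ⟨z, rfl⟩, rfl⟩
  have hψ' : ∀ z, g * a z * g⁻¹ = weightTorus ψ z := fun z => by rw [← hψ]; rfl
  have hval : ∀ z, g * a z * g⁻¹ = weightTorus χ fun l => monomialChar (ψ (e l)) z := by
    intro z
    obtain ⟨y, hy⟩ : g * a z * g⁻¹ ∈ (weightTorus χ).range := hle2 ⟨a z, ⟨z, rfl⟩, rfl⟩
    rw [← hy]
    congr 1
    ext l
    rw [← hH.coord_apply y, hy, hψ', weightTorus_val, diagonal_apply_eq]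
  obtain ⟨h, C', hC'⟩ := exists_mul_eq_one_of_bijective (K := K) (fun l => ψ (e l)) (by
    constructor
    · intro z z' hzz
      have h1 := (hval z).trans ((congrArg (weightTorus χ) hzz).trans (hval z').symm)
      exact ha2 (by simpa using h1)
    · intro y
      obtain ⟨_, ⟨z, rfl⟩, hz⟩ : weightTorus χ y ∈ conjSub g a.range := by
        rw [hrange]; exact ⟨y, rfl⟩
      refine ⟨z, hH.injective ?_⟩
      simp only
      rw [← hval, ← hz]; rfl)
  subst h
  exact ⟨rfl, g, hg, hds, _, C', hC', fun z => hval z⟩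

end IsSplitModel

end SplitTorus

/-! ### Unipotent groups have fixed vectors -/

section Kolchin

variable {K : Type*} [Field K]

/-- In characteristic zero an endomorphism is nilpotent if all its powers have trace zero. -/
lemma isNilpotent_of_trace_pow_eq_zero [CharZero K] {V : Type*} [AddCommGroup V] [Module K V]
    [FiniteDimensional K V] (f : Module.End K V)
    (h : ∀ k : ℕ, 0 < k → LinearMap.trace K V (f ^ k) = 0) : IsNilpotent f := by
  obtain ⟨q, hq, hndvd⟩ := (minpoly K f).exists_eq_pow_rootMultiplicity_mul_and_not_dvd
    (minpoly.ne_zero_of_finite K f) 0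
  set a := (minpoly K f).rootMultiplicity 0
  rw [map_zero, sub_zero] at hq hndvd
  obtain ⟨u, v, huv⟩ : IsCoprime (Polynomial.X ^ (a + 1)) q :=
    IsCoprime.pow_left ((Polynomial.irreducible_X.coprime_iff_not_dvd).2 hndvd)
  have hann : f ^ (a + 1) * Polynomial.aeval f q = 0 := by
    have := minpoly.aeval K f
    rw [hq, map_mul, map_pow, Polynomial.aeval_X] at this
    rw [pow_succ', mul_assoc, this, mul_zero]
  -- the projection to the part where `f` is invertible
  set E := Polynomial.aeval f (u * Polynomial.X ^ (a + 1)) with hE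
  have hE1 : E + Polynomial.aeval f (v * q) = 1 := by
    rw [hE, ← map_add, huv, map_one]
  have hE0 : E * Polynomial.aeval f (v * q) = 0 := by
    rw [hE, ← map_mul]
    have : u * Polynomial.X ^ (a + 1) * (v * q) = u * v * (Polynomial.X ^ (a + 1) * q) := by ring
    rw [this, map_mul, map_mul _ (Polynomial.X ^ (a + 1)), map_pow, Polynomial.aeval_X, hann, mul_zero]
  have hidem : IsIdempotentElem E := by
    have := congrArg (fun x => E * x) hE1
    rwa [mul_add, hE0, add_zero, mul_one] at this
  have htr : LinearMap.trace K V E = 0 := by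
    rw [hE, map_mul, map_pow, Polynomial.aeval_X, Polynomial.aeval_eq_sum_range, Finset.sum_mul, map_sum]
    refine Finset.sum_eq_zero fun i _ => ?_
    rw [smul_mul_assoc, map_smul, ← pow_add, h _ (by omega), smul_zero]
  have hz : E = 0 := LinearMap.IsIdempotentElem.eq_zero_of_trace_eq_zero hidem htr
  refine ⟨a + 1, ?_⟩
  rw [hz, zero_add, map_mul] at hE1
  have h1 : f ^ (a + 1) * (Polynomial.aeval f v * Polynomial.aeval f q) = f ^ (a + 1) := by
    rw [hE1, mul_one]
  have h2 : Commute (f ^ (a + 1)) (Polynomial.aeval f v) := by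
    have : f ^ (a + 1) = Polynomial.aeval f (Polynomial.X ^ (a + 1) : Polynomial K) := by simp
    rw [this, Commute, SemiconjBy, ← map_mul, ← map_mul, mul_comm]
  rw [← h1, ← mul_assoc, h2.eq, mul_assoc, hann, mul_zero]

variable {ι : Type} [Fintype ι] [DecidableEq ι]

/-- Kolchin's theorem: a group of unipotent matrices has a nonzero fixed vector in every nonzero
stable subspace. -/
theorem exists_fixed_vector_of_unipotent [CharZero K] {U : Subgroup (GL ι K)}
    (hU : ∀ u ∈ U, IsNilpotent (u.1 - 1)) (V : Submodule K (ι → K)) (hV : V ≠ ⊥)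
    (hst : ∀ u ∈ U, ∀ x ∈ V, u.1 *ᵥ x ∈ V) :
    ∃ x ∈ V, x ≠ 0 ∧ ∀ u ∈ U, u.1 *ᵥ x = x := by
  let S : Set (Module.End K V) :=
    {f | ∃ u ∈ U, ∀ x : V, (f x : ι → K) = u.1 *ᵥ x - x}
  have hS : ∀ u ∈ U, ∃ f ∈ S, ∀ x : V, (f x : ι → K) = u.1 *ᵥ x - x := fun u hu => by
    let f : Module.End K V := (Matrix.toLin' u.1 - 1).restrict (p := V) (q := V) fun x hx => by
      simpa using V.sub_mem (hst u hu x hx) hx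
    exact ⟨f, ⟨u, hu, fun x => by simp [f]⟩, fun x => by simp [f]⟩
  -- the span of the `u - 1` is closed under products and consists of endomorphisms of trace zero;
  -- as a Lie algebra of nilpotent endomorphisms, it kills a vector by Engel's theorem
  let W := Submodule.span K S
  have hmul : ∀ f ∈ W, ∀ g ∈ W, f * g ∈ W := by
    have hbase : ∀ f ∈ S, ∀ g ∈ S, f * g ∈ W := by
      intro f hf g hg
      obtain ⟨u, hu, hfu⟩ := id hf
      obtain ⟨w, hw, hgw⟩ := id hg
      obtain ⟨k, hk, hk'⟩ := hS _ (mul_mem hu hw)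
      have : f * g = k + (-1 : K) • f + (-1 : K) • g := by
        ext1 x
        apply Subtype.ext
        simp only [Module.End.mul_apply, LinearMap.add_apply, LinearMap.smul_apply,
          Submodule.coe_add, Submodule.coe_smul, hfu, hk', hgw, gl_mul_mulVec, mulVec_sub]
        module
      rw [this]
      exact W.add_mem (W.add_mem (Submodule.subset_span hk)
        (W.smul_mem _ (Submodule.subset_span hf))) (W.smul_mem _ (Submodule.subset_span hg))
    intro f hf g hg
    refine Submodule.span_induction₂ (p := fun f g _ _ => f * g ∈ W)
      (fun f g hf hg => hbase f hf g hg)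
      (fun y _ => by rw [zero_mul]; exact W.zero_mem)
      (fun x _ => by rw [mul_zero]; exact W.zero_mem) ?_ ?_ ?_ ?_ hf hg
    · intro x y z _ _ _ h1 h2; rw [add_mul]; exact W.add_mem h1 h2
    · intro x y z _ _ _ h1 h2; rw [mul_add]; exact W.add_mem h1 h2
    · intro r x y _ _ h; rw [smul_mul_assoc]; exact W.smul_mem _ h
    · intro r x y _ _ h; rw [mul_smul_comm]; exact W.smul_mem _ h
  have htr : ∀ f ∈ W, LinearMap.trace K V f = 0 := by
    intro f hf
    refine Submodule.span_induction (p := fun f _ => LinearMap.trace K V f = 0) ?_ (map_zero _) ?_ ?_ hf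
    · rintro f ⟨u, hu, hfu⟩
      refine (LinearMap.isNilpotent_trace_of_isNilpotent ?_).eq_zero
      obtain ⟨k, hk⟩ := hU u hu
      refine ⟨k, LinearMap.ext fun x => Subtype.ext ?_⟩
      have : ∀ j : ℕ, ((f ^ j) x : ι → K) = (u.1 - 1) ^ j *ᵥ (x : ι → K) := by
        intro j
        induction j with
        | zero => simp
        | succ j ih =>
          rw [pow_succ', Module.End.mul_apply, hfu, ih, pow_succ', ← mulVec_mulVec, sub_mulVec,
            one_mulVec]
      rw [this, hk]; simp
    · intro f g _ _ h1 h2; rw [map_add, h1, h2, add_zero]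
    · intro c f _ h; rw [map_smul, h, smul_zero]
  have hnil : ∀ f ∈ W, IsNilpotent f := by
    intro f hf
    refine isNilpotent_of_trace_pow_eq_zero f fun k hk => htr _ ?_
    induction k, hk using Nat.le_induction with
    | base => simpa using hf
    | succ k _ ih => rw [pow_succ]; exact hmul _ ih _ hf
  let _i : LieRing (Module.End K V) := LieRing.ofAssociativeRing
  let _i : LieAlgebra K (Module.End K V) := LieAlgebra.ofAssociativeAlgebra
  let L : LieSubalgebra K (Module.End K V) :=
    { W with
      lie_mem' := by
        intro f g hf hg
        rw [Ring.lie_def]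
        exact W.sub_mem (hmul _ hf _ hg) (hmul _ hg _ hf) }
  have : Nontrivial V := (Submodule.nontrivial_iff_ne_bot).2 hV
  have : LieModule.IsNilpotent L V := by
    rw [LieModule.isNilpotent_iff_forall' (R := K)]
    rintro ⟨f, hf⟩
    exact hnil f hf
  have : Nontrivial (LieModule.maxTrivSubmodule K L V) :=
    LieModule.nontrivial_max_triv_of_isNilpotent K L V
  obtain ⟨⟨x, hx⟩, hx0⟩ := exists_ne (0 : LieModule.maxTrivSubmodule K L V)
  refine ⟨x, x.2, fun h => hx0 (Subtype.ext (Subtype.ext h)), fun u hu => ?_⟩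
  obtain ⟨f, hf, hfu⟩ := hS u hu
  have h1 := hx ⟨f, Submodule.subset_span hf⟩
  have h2 : f x = 0 := h1
  have h3 := hfu x
  rw [h2] at h3
  exact (sub_eq_zero.1 h3.symm)

end Kolchin

/-! ### Roots and coroots with respect to a diagonal torus -/

section RootPairs

variable {K : Type*} [Field K]

@[simp] lemma upperUni_val (x : K) : (upperUni x).1 = !![1, x; 0, 1] := rfl

@[simp] lemma lowerUni_val (x : K) : (lowerUni x).1 = !![1, 0; x, 1] := rfl

@[simp] lemma diagSL2_val (c : Kˣ) : (diagSL2 c).1 = !![(c : K), 0; 0, ((c⁻¹ : Kˣ) : K)] := rfl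

lemma upperUni_mul (x y : K) : upperUni x * upperUni y = upperUni (x + y) := by
  ext i j; fin_cases i <;> fin_cases j <;> simp [add_comm]

lemma lowerUni_mul (x y : K) : lowerUni x * lowerUni y = lowerUni (x + y) := by
  ext i j; fin_cases i <;> fin_cases j <;> simp

lemma upperUni_zero : upperUni (0 : K) = 1 := by
  ext i j; fin_cases i <;> fin_cases j <;> simp

lemma upperUni_pow (x : K) (k : ℕ) : upperUni x ^ k = upperUni (k * x) := by
  induction k with
  | zero => simp [upperUni_zero]
  | succ k ih => rw [pow_succ, ih, upperUni_mul]; congr 1; push_cast; ring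

lemma lowerUni_pow (x : K) (k : ℕ) : lowerUni x ^ k = lowerUni (k * x) := by
  induction k with
  | zero => ext i j; fin_cases i <;> fin_cases j <;> simp
  | succ k ih => rw [pow_succ, ih, lowerUni_mul]; congr 1; push_cast; ring

/-- A representative of the nontrivial Weyl group element of `SL_2`. -/
def weylSL2 (K : Type*) [Field K] : SpecialLinearGroup (Fin 2) K := ⟨!![0, 1; -1, 0], by simp⟩

@[simp] lemma weylSL2_val : (weylSL2 K).1 = !![0, 1; -1, 0] := rfl

lemma weylSL2_eq : weylSL2 K = upperUni 1 * lowerUni (-1) * upperUni 1 := by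
  ext i j; fin_cases i <;> fin_cases j <;> simp

lemma diagSL2_mul_weylSL2 (c : Kˣ) : diagSL2 c * weylSL2 K =
    upperUni (c : K) * lowerUni (-(c⁻¹ : Kˣ) : K) * upperUni (c : K) := by
  ext i j; fin_cases i <;> fin_cases j <;> simp

lemma weylSL2_conj (x : K) : weylSL2 K * upperUni x * (weylSL2 K)⁻¹ = lowerUni (-x) := by
  rw [mul_inv_eq_iff_eq_mul]
  ext i j; fin_cases i <;> fin_cases j <;> simp

lemma weylSL2_conj' (x : K) : weylSL2 K * lowerUni x * (weylSL2 K)⁻¹ = upperUni (-x) := by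
  rw [mul_inv_eq_iff_eq_mul]
  ext i j; fin_cases i <;> fin_cases j <;> simp

lemma weylSL2_conj_diagSL2 (c : Kˣ) : weylSL2 K * diagSL2 c * (weylSL2 K)⁻¹ = diagSL2 c⁻¹ := by
  rw [mul_inv_eq_iff_eq_mul]
  ext i j; fin_cases i <;> fin_cases j <;> simp

lemma diagSL2_conj (c : Kˣ) (x : K) :
    diagSL2 c * upperUni x * (diagSL2 c)⁻¹ = upperUni ((c : K) ^ 2 * x) := by
  rw [mul_inv_eq_iff_eq_mul]
  ext i j; fin_cases i <;> fin_cases j <;> simp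
  field_simp

/-- `SL_2` is generated by its upper and lower unipotent elements. -/
lemma sl2_mem_of_unipotents {N : Subgroup (SpecialLinearGroup (Fin 2) K)}
    (hu : ∀ x, upperUni x ∈ N) (hl : ∀ x, lowerUni x ∈ N) (g : SpecialLinearGroup (Fin 2) K) :
    g ∈ N := by
  have key : ∀ g : SpecialLinearGroup (Fin 2) K, g.1 1 0 ≠ 0 → g ∈ N := by
    intro g hg
    have hdet := g.2
    rw [Matrix.det_fin_two] at hdet
    have : g = upperUni ((g.1 0 0 - 1) / g.1 1 0) * lowerUni (g.1 1 0) *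
        upperUni ((g.1 1 1 - 1) / g.1 1 0) := by
      ext i j; fin_cases i <;> fin_cases j <;> simp <;> field_simp
      · ring
      · linear_combination -hdet
      · ring
    rw [this]
    exact mul_mem (mul_mem (hu _) (hl _)) (hu _)
  by_cases hg : g.1 1 0 = 0
  · have hdet := g.2
    rw [Matrix.det_fin_two, hg, mul_zero, sub_zero] at hdet
    have h1 : (lowerUni 1 * g).1 1 0 ≠ 0 := by
      have : (lowerUni 1 * g).1 1 0 = g.1 0 0 := by
        simp [Matrix.mul_apply, Fin.sum_univ_two, hg]
      rw [this]
      rintro h0; simp [h0] at hdet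
    exact (Subgroup.mul_mem_cancel_left _ (hl 1)).1 (key _ h1)
  · exact key g hg

section

variable {G : Type*} [Group G] [IsAlgClosed K]

/-- A nontrivial homomorphism from `SL_2` is injective on the upper unipotent elements. -/
lemma eq_zero_of_map_upperUni_eq_one {f : SpecialLinearGroup (Fin 2) K →* G} (hf : f ≠ 1) {x : K}
    (hx : f (upperUni x) = 1) : x = 0 := by
  by_contra hx0
  apply hf
  have hu : ∀ y, upperUni y ∈ f.ker := by
    intro y
    rcases eq_or_ne y 0 with rfl | hy
    · rw [upperUni_zero]; exact one_mem _
    obtain ⟨c, hc⟩ := IsAlgClosed.exists_pow_nat_eq (y / x) two_pos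
    have hc0 : c ≠ 0 := by
      rintro rfl
      rw [zero_pow two_ne_zero, eq_comm, div_eq_zero_iff] at hc
      tauto
    have := diagSL2_conj (Units.mk0 c hc0) x
    rw [Units.val_mk0, hc, div_mul_cancel₀ _ hx0] at this
    rw [← this, MonoidHom.mem_ker, map_mul, map_mul, hx, mul_one, ← map_mul, mul_inv_cancel, map_one]
  have hl : ∀ y, lowerUni y ∈ f.ker := by
    intro y
    rw [← neg_neg y, ← weylSL2_conj]
    exact (MonoidHom.normal_ker f).conj_mem _ (hu _) _
  ext1 g
  exact sl2_mem_of_unipotents hu hl g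

lemma map_upperUni_injective {f : SpecialLinearGroup (Fin 2) K →* G} (hf : f ≠ 1) :
    Function.Injective fun x => f (upperUni x) := by
  intro x y h
  have : f (upperUni (x - y)) = 1 := by
    have h1 : upperUni x = upperUni (x - y) * upperUni y := by rw [upperUni_mul, sub_add_cancel]
    have h2 := congrArg f h1
    rw [map_mul] at h2
    simp only at h
    rwa [h, eq_comm, mul_eq_right] at h2
  exact sub_eq_zero.1 (eq_zero_of_map_upperUni_eq_one hf this)

end

variable {ι : Type} [Fintype ι] [DecidableEq ι] {r : ℕ} {H : Subgroup (GL ι K)}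

/-- The negative of a root is a root. -/
lemma neg_mem_rootPairs {a : (Fin r → Kˣ) →* GL ι K} {m n : Fin r → ℤ}
    (h : (m, n) ∈ rootPairs H a) : (-m, -n) ∈ rootPairs H a := by
  obtain ⟨f, ⟨hf, h1, h2, h3, h4, h5⟩⟩ := h
  have hw : ∀ g, conjHom (f (weylSL2 K)) f g = f (weylSL2 K * g * (weylSL2 K)⁻¹) := fun g => by
    simp
  refine ⟨conjHom (f (weylSL2 K)) f, hf.conj _, fun h => h1 ?_, ?_, fun z x => ?_, fun z x => ?_,
    fun c => ?_⟩
  · ext1 x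
    have := DFunLike.congr_fun h x
    simpa [mul_inv_eq_one] using this
  · rintro _ ⟨g, rfl⟩
    rw [hw]; exact h2 ⟨_, rfl⟩
  · rw [hw, hw, weylSL2_conj, weylSL2_conj, h4]
    congr 2; simp only [monomialChar_neg]; ring
  · rw [hw, hw, weylSL2_conj', weylSL2_conj', h3]
    congr 2; simp only [monomialChar_neg, inv_inv]; ring
  · rw [hw, weylSL2_conj_diagSL2, h5]
    congr 1; ext1 i; simp

variable [IsAlgClosed K] [CharZero K]

/-- The pairing of a root with its coroot is `2`: both describe how the diagonal torus of `SL_2` acts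
on the upper unipotent elements, which map injectively. -/
lemma dotProduct_eq_two_of_mem_rootPairs {a : (Fin r → Kˣ) →* GL ι K} {m n : Fin r → ℤ}
    (h : (m, n) ∈ rootPairs H a) : m ⬝ᵥ n = 2 := by
  obtain ⟨f, ⟨-, h1, -, h3, -, h5⟩⟩ := h
  by_contra hne
  obtain ⟨c, hc⟩ := exists_unit_not_root_of_unity (K := K) (m ⬝ᵥ n - 2) (sub_ne_zero.2 hne)
  have e1 := h3 (fun i => c ^ n i) 1
  rw [monomialChar_cochar, ← h5, ← map_mul, ← map_inv, ← map_mul, diagSL2_conj] at e1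
  have e2 := map_upperUni_injective h1 e1
  apply hc
  rw [mul_one, mul_one, ← Units.val_pow_eq_pow_val] at e2
  rw [_root_.zpow_sub, ← Units.ext e2]
  simp [zpow_ofNat]

/-- The image of the Weyl element of a root acts on the torus by the reflection. -/
lemma weyl_mul_torus {a : (Fin r → Kˣ) →* GL ι K} {m n : Fin r → ℤ}
    {f : SpecialLinearGroup (Fin 2) K →* GL ι K}
    (hu : ∀ z x, a z * f (upperUni x) * (a z)⁻¹ = f (upperUni ((monomialChar m z : Kˣ) * x)))
    (hl : ∀ z x, a z * f (lowerUni x) * (a z)⁻¹ = f (lowerUni (((monomialChar m z)⁻¹ : Kˣ) * x)))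
    (hd : ∀ c : Kˣ, f (diagSL2 c) = a fun i => c ^ n i) (z : Fin r → Kˣ) :
    f (weylSL2 K) * a z = a (fun i => z i * (monomialChar m z)⁻¹ ^ n i) * f (weylSL2 K) := by
  have key : ∀ z, a z * f (weylSL2 K) * (a z)⁻¹ =
      a (fun i => monomialChar m z ^ n i) * f (weylSL2 K) := by
    intro z
    rw [← hd, ← map_mul, diagSL2_mul_weylSL2, weylSL2_eq]
    simp only [map_mul]
    have h1 := hu z 1
    have h2 := hl z (-1)
    rw [mul_one] at h1
    rw [mul_neg, mul_one] at h2
    rw [← h1, ← h2]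
    group
  have h1 := key z⁻¹
  rw [map_inv, inv_inv, monomialChar_inv] at h1
  have h2 : (fun i => z i * (monomialChar m z)⁻¹ ^ n i) =
    z * fun i => (monomialChar m z)⁻¹ ^ n i := rfl
  rw [h2, map_mul, mul_assoc, ← h1]
  group

/-- The reflection of a root permutes the weights. -/
lemma exists_reflection_of_mem_rootPairs {χ : ι → Fin r → ℤ} {m n : Fin r → ℤ}
    (h : (m, n) ∈ rootPairs H (weightTorus χ)) (i : ι) : ∃ j, χ j = χ i - (χ i ⬝ᵥ n) • m := by
  obtain ⟨f, ⟨-, -, -, h3, h4, h5⟩⟩ := h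
  have hrow : ∃ j, (f (weylSL2 K)).1 i j ≠ 0 := by
    by_contra! h0
    have : (f (weylSL2 K) * (f (weylSL2 K))⁻¹).1 i i = 0 := by
      rw [Units.val_mul, Matrix.mul_apply]
      exact Finset.sum_eq_zero fun j _ => by rw [h0, zero_mul]
    simp at this
  obtain ⟨j, hj⟩ := hrow
  refine ⟨j, monomialChar_injective (K := K) (MonoidHom.ext fun z => ?_)⟩
  have e := congrArg (fun g : GL ι K => g.1 i j) (weyl_mul_torus h3 h4 h5 z)
  simp only [Units.val_mul, weightTorus_val, mul_diagonal, diagonal_mul] at e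
  rw [mul_comm] at e
  have e' := mul_right_cancel₀ hj e
  rw [monomialHom_apply, monomialHom_apply, e']
  have h6 : (fun i => z i * (monomialChar m z)⁻¹ ^ n i) =
    z * fun i => (monomialChar m z)⁻¹ ^ n i := rfl
  rw [h6, monomialChar_mul, monomialChar_cochar, monomialChar_sub, monomialChar_smul, _root_.inv_zpow]

/-- The root subgroup of `m` shifts the weights by multiples of `m`. -/
lemma exists_unipotent_of_mem_rootPairs {χ : ι → Fin r → ℤ} {m n : Fin r → ℤ}
    (h : (m, n) ∈ rootPairs H (weightTorus χ)) : ∃ M ∈ H, M ≠ 1 ∧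
      (∀ i j, M.1 i j ≠ 0 → ∃ k : ℕ, χ i - χ j = k • m) ∧
      (∀ i j, χ i = χ j → M.1 i j = (1 : Matrix ι ι K) i j) := by
  have hmn := dotProduct_eq_two_of_mem_rootPairs h
  obtain ⟨f, ⟨hf, h1, h2, h3, -, -⟩⟩ := h
  choose p hp using hf
  -- the matrix entries of the image of the upper unipotent elements, as polynomials
  let P : ι → ι → Polynomial K := fun i j => MvPolynomial.aeval (fun kl : Fin 2 × Fin 2 =>
    if kl = (0, 1) then Polynomial.X else Polynomial.C ((1 : Matrix (Fin 2) (Fin 2) K) kl.1 kl.2)) (p i j)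
  have hP : ∀ i j x, (f (upperUni x)).1 i j = (P i j).eval x := by
    intro i j x
    rw [hp, ← Polynomial.coe_evalRingHom]
    simp only [P]
    rw [MvPolynomial.aeval_def, MvPolynomial.hom_eval₂, MvPolynomial.eval]
    simp only [MvPolynomial.coe_eval₂Hom]
    congr 1
    · ext; simp
    · ext ⟨k, l⟩
      fin_cases k <;> fin_cases l <;> simp [upperUni]
  have hent : ∀ i j z, ((monomialChar (χ i - χ j) z : Kˣ) : K) * (f (upperUni 1)).1 i j =
      (P i j).eval ((monomialChar m z : Kˣ) : K) := by
    intro i j z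
    have e := congrArg (fun g : GL ι K => g.1 i j) (h3 z 1)
    simp only [mul_one, hP] at e
    rw [← e, monomialChar_sub]
    have hval : (weightTorus χ z * f (upperUni 1) * (weightTorus χ z)⁻¹).1 =
        diagonal (fun i => ((monomialChar (χ i) z : Kˣ) : K)) * (f (upperUni 1)).1 *
          diagonal fun i => (((monomialChar (χ i) z)⁻¹ : Kˣ) : K) := rfl
    rw [hval, mul_diagonal, diagonal_mul, Units.val_mul]
    ring
  refine ⟨f (upperUni 1), h2 ⟨_, rfl⟩, fun h => one_ne_zero (eq_zero_of_map_upperUni_eq_one h1 h),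
    fun i j hij => ?_, fun i j hij => ?_⟩
  · have hspan : ((monomialHom (χ i - χ j) : (Fin r → Kˣ) →* K) : (Fin r → Kˣ) → K) ∈
        Submodule.span K ((fun m : Fin r → ℤ => ((monomialHom m : (Fin r → Kˣ) →* K) :
          (Fin r → Kˣ) → K)) '' Set.range fun k : ℕ => k • m) := by
      have e : ((monomialHom (χ i - χ j) : (Fin r → Kˣ) →* K) : (Fin r → Kˣ) → K) =
          ((f (upperUni 1)).1 i j)⁻¹ • ∑ k ∈ (P i j).support, (P i j).coeff k •
            ((monomialHom (k • m) : (Fin r → Kˣ) →* K) : (Fin r → Kˣ) → K) := by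
        ext z
        rw [Pi.smul_apply, smul_eq_mul, eq_inv_mul_iff_mul_eq₀ hij, mul_comm, monomialHom_apply, hent,
          Finset.sum_apply, Polynomial.eval_eq_sum, Polynomial.sum]
        refine Finset.sum_congr rfl fun k _ => ?_
        rw [Pi.smul_apply, smul_eq_mul, monomialHom_apply, ← natCast_zsmul, monomialChar_smul]
        simp
      rw [e]
      exact Submodule.smul_mem _ _ (Submodule.sum_mem _ fun k _ => Submodule.smul_mem _ _
        (Submodule.subset_span ⟨_, ⟨k, rfl⟩, rfl⟩))
    by_contra hno
    refine (linearIndependent_monomialHom (K := K) (r := r)).notMem_span_image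
      (s := Set.range fun k : ℕ => k • m) (x := χ i - χ j) ?_ hspan
    rintro ⟨k, hk⟩
    exact hno ⟨k, hk.symm⟩
  · have hconst : P i j = Polynomial.C ((f (upperUni 1)).1 i j) := by
      rw [← sub_eq_zero]
      refine Polynomial.eq_zero_of_infinite_isRoot _ ?_
      refine Set.Infinite.mono (s := {0}ᶜ) (fun c hc => ?_) (Set.Finite.infinite_compl (Set.finite_singleton _))
      obtain ⟨d, hd⟩ := IsAlgClosed.exists_pow_nat_eq c two_pos
      have hd0 : d ≠ 0 := by rintro rfl; exact hc (by rw [← hd]; simp)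
      have e := hent i j (fun l => Units.mk0 d hd0 ^ n l)
      rw [hij, sub_self, monomialChar_zero, monomialChar_cochar, hmn] at e
      simp only [Units.val_one, one_mul, Units.val_zpow_eq_zpow_val, Units.val_mk0] at e
      rw [show ((2 : ℤ)) = ((2 : ℕ) : ℤ) from rfl, zpow_natCast, hd] at e
      simp [e]
    have e0 := hP i j 0
    rw [upperUni_zero, map_one, hconst, Polynomial.eval_C] at e0
    rw [← e0]; rfl

/-- The roots of the connected centralizer of a torus element `s` are the roots of the group which
vanish on `s`. -/
lemma mem_rootPairs_idComp_centralizer {a : (Fin r → Kˣ) →* GL ι K} (hH : IsZClosed H)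
    (z : Fin r → Kˣ) (m n : Fin r → ℤ) :
    (m, n) ∈ rootPairs (idComp (H ⊓ Subgroup.centralizer {a z})) a ↔
      (m, n) ∈ rootPairs H a ∧ monomialChar m z = 1 := by
  have hle : idComp (H ⊓ Subgroup.centralizer {a z}) ≤ H ⊓ Subgroup.centralizer {a z} :=
    idComp_le (hH.inf (isZClosed_centralizer _))
  constructor
  · rintro ⟨f, h1, h2, h3, h4, h5, h6⟩
    refine ⟨⟨f, h1, h2, fun x hx => (hle (h3 hx)).1, h4, h5, h6⟩, ?_⟩
    have h7 : a z * f (upperUni 1) = f (upperUni 1) * a z :=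
      mem_centralizer_singleton.1 (hle (h3 ⟨upperUni 1, rfl⟩)).2
    have h8 := h4 z 1
    rw [h7, mul_inv_cancel_right, mul_one] at h8
    exact Units.ext (map_upperUni_injective h2 h8).symm
  · rintro ⟨⟨f, h1, h2, h3, h4, h5, h6⟩, hz⟩
    refine ⟨f, h1, h2, ?_, h4, h5, h6⟩
    have hcent : ∀ x, f x ∈ H ⊓ Subgroup.centralizer {a z} := by
      intro x
      refine sl2_mem_of_unipotents (N := (H ⊓ Subgroup.centralizer {a z}).comap f) (fun x => ?_)
        (fun x => ?_) x
      · refine ⟨h3 ⟨_, rfl⟩, mem_centralizer_singleton.2 ?_⟩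
        have := h4 z x
        rw [hz, Units.val_one, one_mul, mul_inv_eq_iff_eq_mul] at this
        exact this
      · refine ⟨h3 ⟨_, rfl⟩, mem_centralizer_singleton.2 ?_⟩
        have := h5 z x
        rw [hz, inv_one, Units.val_one, one_mul, mul_inv_eq_iff_eq_mul] at this
        exact this
    rintro _ ⟨x, rfl⟩
    -- unipotent elements have roots of all orders
    refine sl2_mem_of_unipotents (N := (idComp (H ⊓ Subgroup.centralizer {a z})).comap f)
      (fun x => ?_) (fun x => ?_) x
    · refine mem_idComp_of_forall_exists_pow fun k hk => ⟨f (upperUni (x / k)), hcent _, ?_⟩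
      rw [← map_pow, upperUni_pow, mul_div_cancel₀ _ (Nat.cast_ne_zero.2 hk.ne')]
    · refine mem_idComp_of_forall_exists_pow fun k hk => ⟨f (lowerUni (x / k)), hcent _, ?_⟩
      rw [← map_pow, lowerUni_pow, mul_div_cancel₀ _ (Nat.cast_ne_zero.2 hk.ne')]

end RootPairs

/-! ### The split octonions and their automorphisms -/

section Octonions

variable {K : Type*} [Field K]

lemma gl_ext_mulVec {ι : Type} [Fintype ι] [DecidableEq ι] {g h : GL ι K}
    (H : ∀ x, g.1 *ᵥ x = h.1 *ᵥ x) : g = h :=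
  Units.ext (Matrix.toLin'.injective (LinearMap.ext fun x => by simpa using H x))

/-- The invertible matrix of a linear map with a given inverse. -/
def glOfInverse {ι : Type} [Fintype ι] [DecidableEq ι] (f g : (ι → K) →ₗ[K] (ι → K))
    (h : ∀ x, f (g x) = x) (h' : ∀ x, g (f x) = x) : GL ι K where
  val := LinearMap.toMatrix' f
  inv := LinearMap.toMatrix' g
  val_inv := by
    rw [← LinearMap.toMatrix'_comp, show f ∘ₗ g = LinearMap.id from LinearMap.ext h,
      LinearMap.toMatrix'_id]
  inv_val := by
    rw [← LinearMap.toMatrix'_comp, show g ∘ₗ f = LinearMap.id from LinearMap.ext h',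
      LinearMap.toMatrix'_id]

lemma glOfInverse_mulVec {ι : Type} [Fintype ι] [DecidableEq ι] (f g : (ι → K) →ₗ[K] (ι → K))
    (h : ∀ x, f (g x) = x) (h' : ∀ x, g (f x) = x) (x : ι → K) :
    (glOfInverse f g h h').1 *ᵥ x = f x := LinearMap.toMatrix'_mulVec _ _

/-- The octonion with diagonal entries `a`, `b` and off-diagonal vectors `v`, `w`. -/
def oct (a b : K) (v w : Fin 3 → K) : Fin 8 → K := ![a, b, v 0, v 1, v 2, w 0, w 1, w 2]

/-- The upper vector of an octonion. -/
def octV (x : Fin 8 → K) : Fin 3 → K := ![x 2, x 3, x 4]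

/-- The lower vector of an octonion. -/
def octW (x : Fin 8 → K) : Fin 3 → K := ![x 5, x 6, x 7]

lemma oct_eta (x : Fin 8 → K) : oct (x 0) (x 1) (octV x) (octW x) = x := by
  ext i; fin_cases i <;> rfl

@[simp] lemma oct_zero (a b : K) (v w : Fin 3 → K) : oct a b v w 0 = a := rfl
@[simp] lemma oct_one (a b : K) (v w : Fin 3 → K) : oct a b v w 1 = b := rfl
@[simp] lemma octV_oct (a b : K) (v w : Fin 3 → K) : octV (oct a b v w) = v := by
  ext i; fin_cases i <;> rfl
@[simp] lemma octW_oct (a b : K) (v w : Fin 3 → K) : octW (oct a b v w) = w := by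
  ext i; fin_cases i <;> rfl

lemma oct_inj {a b a' b' : K} {v w v' w' : Fin 3 → K} :
    oct a b v w = oct a' b' v' w' ↔ a = a' ∧ b = b' ∧ v = v' ∧ w = w' := by
  constructor
  · intro h
    refine ⟨congrFun h 0, congrFun h 1, ?_, ?_⟩
    · simpa using congrArg octV h
    · simpa using congrArg octW h
  · rintro ⟨rfl, rfl, rfl, rfl⟩; rfl

lemma oct_add (a b a' b' : K) (v w v' w' : Fin 3 → K) :
    oct a b v w + oct a' b' v' w' = oct (a + a') (b + b') (v + v') (w + w') := by
  ext i; fin_cases i <;> rfl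

lemma oct_smul (c a b : K) (v w : Fin 3 → K) :
    c • oct a b v w = oct (c * a) (c * b) (c • v) (c • w) := by
  ext i; fin_cases i <;> rfl

lemma octV_add (x y : Fin 8 → K) : octV (x + y) = octV x + octV y := by
  ext i; fin_cases i <;> rfl
lemma octW_add (x y : Fin 8 → K) : octW (x + y) = octW x + octW y := by
  ext i; fin_cases i <;> rfl
lemma octV_smul (c : K) (x : Fin 8 → K) : octV (c • x) = c • octV x := by
  ext i; fin_cases i <;> rfl
lemma octW_smul (c : K) (x : Fin 8 → K) : octW (c • x) = c • octW x := by
  ext i; fin_cases i <;> rfl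

lemma oct_induction {p : (Fin 8 → K) → Prop} (h : ∀ a b v w, p (oct a b v w)) (x : Fin 8 → K) :
    p x := by
  rw [← oct_eta x]; exact h _ _ _ _

lemma sum_ite_and_mul {ι : Type*} [Fintype ι] [DecidableEq ι] (a b : ι) (x y : ι → K) :
    ∑ i, ∑ j, (if i = a ∧ j = b then (1 : K) else 0) * (x i * y j) = x a * y b := by
  rw [Finset.sum_eq_single a (fun i _ hi => Finset.sum_eq_zero fun j _ => by simp [hi]) (by simp),
    Finset.sum_eq_single b (fun j _ hj => by simp [hj]) (by simp)]
  simp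

/-- The product of octonions. -/
lemma scMul_oct (a b a' b' : K) (v w v' w' : Fin 3 → K) :
    scMul zornConst (oct a b v w) (oct a' b' v' w') =
      oct (a * a' + v ⬝ᵥ w') (b * b' + v' ⬝ᵥ w) (a • v' + b' • v + crossProduct w w')
        (a' • w + b • w' - crossProduct v v') := by
  have h0 : ∀ i j, zornConst i j 0 = (if i = 0 ∧ j = 0 then 1 else 0) + (if i = 2 ∧ j = 5 then 1 else 0) + (if i = 3 ∧ j = 6 then 1 else 0) + (if i = 4 ∧ j = 7 then 1 else 0) := by decide
  have h1 : ∀ i j, zornConst i j 1 = (if i = 1 ∧ j = 1 then 1 else 0) + (if i = 5 ∧ j = 2 then 1 else 0) + (if i = 6 ∧ j = 3 then 1 else 0) + (if i = 7 ∧ j = 4 then 1 else 0) := by decide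
  have h2 : ∀ i j, zornConst i j 2 = (if i = 0 ∧ j = 2 then 1 else 0) + (if i = 2 ∧ j = 1 then 1 else 0) + (if i = 6 ∧ j = 7 then 1 else 0) - (if i = 7 ∧ j = 6 then 1 else 0) := by decide
  have h3 : ∀ i j, zornConst i j 3 = (if i = 0 ∧ j = 3 then 1 else 0) + (if i = 3 ∧ j = 1 then 1 else 0) - (if i = 5 ∧ j = 7 then 1 else 0) + (if i = 7 ∧ j = 5 then 1 else 0) := by decide
  have h4 : ∀ i j, zornConst i j 4 = (if i = 0 ∧ j = 4 then 1 else 0) + (if i = 4 ∧ j = 1 then 1 else 0) + (if i = 5 ∧ j = 6 then 1 else 0) - (if i = 6 ∧ j = 5 then 1 else 0) := by decide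
  have h5 : ∀ i j, zornConst i j 5 = (if i = 1 ∧ j = 5 then 1 else 0) - (if i = 3 ∧ j = 4 then 1 else 0) + (if i = 4 ∧ j = 3 then 1 else 0) + (if i = 5 ∧ j = 0 then 1 else 0) := by decide
  have h6 : ∀ i j, zornConst i j 6 = (if i = 1 ∧ j = 6 then 1 else 0) + (if i = 2 ∧ j = 4 then 1 else 0) - (if i = 4 ∧ j = 2 then 1 else 0) + (if i = 6 ∧ j = 0 then 1 else 0) := by decide
  have h7 : ∀ i j, zornConst i j 7 = (if i = 1 ∧ j = 7 then 1 else 0) - (if i = 2 ∧ j = 3 then 1 else 0) + (if i = 3 ∧ j = 2 then 1 else 0) + (if i = 7 ∧ j = 0 then 1 else 0) := by decide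
  ext k
  fin_cases k <;>
  simp only [scMul, Fin.reduceFinMk, Fin.zero_eta, Fin.mk_one, h0, h1, h2, h3, h4, h5, h6, h7, Int.cast_add, Int.cast_sub,
    Int.cast_ite, Int.cast_one, Int.cast_zero, add_mul, sub_mul, Finset.sum_add_distrib,
    Finset.sum_sub_distrib, sum_ite_and_mul] <;>
  simp [oct, crossProduct, vec3_dotProduct] <;> ring

@[simp] lemma oct_val2 (a b : K) (v w : Fin 3 → K) : oct a b v w 2 = v 0 := rfl
@[simp] lemma oct_val3 (a b : K) (v w : Fin 3 → K) : oct a b v w 3 = v 1 := rfl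
@[simp] lemma oct_val4 (a b : K) (v w : Fin 3 → K) : oct a b v w 4 = v 2 := rfl
@[simp] lemma oct_val5 (a b : K) (v w : Fin 3 → K) : oct a b v w 5 = w 0 := rfl
@[simp] lemma oct_val6 (a b : K) (v w : Fin 3 → K) : oct a b v w 6 = w 1 := rfl
@[simp] lemma oct_val7 (a b : K) (v w : Fin 3 → K) : oct a b v w 7 = w 2 := rfl

@[simp] lemma octV_val0 (x : Fin 8 → K) : octV x 0 = x 2 := rfl
@[simp] lemma octV_val1 (x : Fin 8 → K) : octV x 1 = x 3 := rfl
@[simp] lemma octV_val2 (x : Fin 8 → K) : octV x 2 = x 4 := rfl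
@[simp] lemma octW_val0 (x : Fin 8 → K) : octW x 0 = x 5 := rfl
@[simp] lemma octW_val1 (x : Fin 8 → K) : octW x 1 = x 6 := rfl
@[simp] lemma octW_val2 (x : Fin 8 → K) : octW x 2 = x 7 := rfl

@[simp] lemma cross_val0 (u v : Fin 3 → K) : crossProduct u v 0 = u 1 * v 2 - u 2 * v 1 := by
  simp [cross_apply]
@[simp] lemma cross_val1 (u v : Fin 3 → K) : crossProduct u v 1 = u 2 * v 0 - u 0 * v 2 := by
  simp [cross_apply]
@[simp] lemma cross_val2 (u v : Fin 3 → K) : crossProduct u v 2 = u 0 * v 1 - u 1 * v 0 := by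
  simp [cross_apply]

/-- The norm form of the octonions. -/
def octNorm (x : Fin 8 → K) : K := x 0 * x 1 - octV x ⬝ᵥ octW x

/-- The polar form of the norm form. -/
def octPolar (x y : Fin 8 → K) : K :=
  x 0 * y 1 + x 1 * y 0 - octV x ⬝ᵥ octW y - octV y ⬝ᵥ octW x

lemma octNorm_add (x y : Fin 8 → K) : octNorm (x + y) = octNorm x + octNorm y + octPolar x y := by
  simp [octNorm, octPolar, vec3_dotProduct]; ring

lemma octNorm_smul (c : K) (x : Fin 8 → K) : octNorm (c • x) = c ^ 2 * octNorm x := by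
  simp [octNorm, vec3_dotProduct]; ring

lemma octNorm_mul (x y : Fin 8 → K) :
    octNorm (scMul zornConst x y) = octNorm x * octNorm y := by
  induction x using oct_induction with | h a b v w
  induction y using oct_induction with | h a' b' v' w'
  rw [scMul_oct]
  simp [octNorm, vec3_dotProduct]; ring

lemma scMul_smul_left {ι : Type} [Fintype ι] (c : ι → ι → ι → ℤ) (t : K) (x z : ι → K) :
    scMul c (t • x) z = t • scMul c x z := by
  ext k; simp only [scMul, Pi.smul_apply, smul_eq_mul, Finset.mul_sum]
  refine Finset.sum_congr rfl fun i _ => Finset.sum_congr rfl fun j _ => by ring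

lemma scMul_smul_right {ι : Type} [Fintype ι] (c : ι → ι → ι → ℤ) (t : K) (x z : ι → K) :
    scMul c x (t • z) = t • scMul c x z := by
  ext k; simp only [scMul, Pi.smul_apply, smul_eq_mul, Finset.mul_sum]
  refine Finset.sum_congr rfl fun i _ => Finset.sum_congr rfl fun j _ => by ring

/-- Octonions satisfy a quadratic equation, given by trace and norm. -/
lemma scMul_self (x : Fin 8 → K) :
    scMul zornConst x x = (x 0 + x 1) • x - octNorm x • oct 1 1 0 0 := by
  induction x using oct_induction with | h a b v w
  rw [scMul_oct]
  ext i; fin_cases i <;> simp [octNorm, vec3_dotProduct] <;> ring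

/-- The trace of a product of octonions, in terms of the polar form. -/
lemma octTrace_mul (x y : Fin 8 → K) : scMul zornConst x y 0 + scMul zornConst x y 1 =
    (x 0 + x 1) * (y 0 + y 1) - octPolar x y := by
  induction x using oct_induction with | h a b v w
  induction y using oct_induction with | h a' b' v' w'
  rw [scMul_oct]
  simp [octPolar, vec3_dotProduct]; ring

lemma one_scMul_oct (x : Fin 8 → K) : scMul zornConst (oct 1 1 0 0) x = x := by
  induction x using oct_induction with | h a b v w
  rw [scMul_oct]; simp

lemma scMul_oct_one (x : Fin 8 → K) : scMul zornConst x (oct 1 1 0 0) = x := by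
  induction x using oct_induction with | h a b v w
  rw [scMul_oct]; simp

/-- The polar form is nondegenerate. -/
lemma exists_octPolar_ne_zero {x : Fin 8 → K} (hx : x ≠ 0) : ∃ y, octPolar x y ≠ 0 := by
  by_contra! h
  apply hx
  have h0 := h (Pi.single 0 1)
  have h1 := h (Pi.single 1 1)
  have h2 := h (Pi.single 2 1)
  have h3 := h (Pi.single 3 1)
  have h4 := h (Pi.single 4 1)
  have h5 := h (Pi.single 5 1)
  have h6 := h (Pi.single 6 1)
  have h7 := h (Pi.single 7 1)
  simp [octPolar, vec3_dotProduct] at h0 h1 h2 h3 h4 h5 h6 h7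
  ext i; fin_cases i <;> simp_all

lemma octPolar_smul (c d : K) (x y : Fin 8 → K) : octPolar (c • x) (d • y) = c * d * octPolar x y := by
  simp [octPolar, vec3_dotProduct]; ring

/-- The linear form given by an octonion. -/
def octPolarLin (x : Fin 8 → K) : (Fin 8 → K) →ₗ[K] K where
  toFun := octPolar x
  map_add' y z := by simp [octPolar, vec3_dotProduct]; ring
  map_smul' c y := by simp [octPolar, vec3_dotProduct]; ring

/-! ### Automorphisms of the octonions -/

section Aut

variable {g : GL (Fin 8) K}

lemma map_scMul (hg : g ∈ autPts zornConst K) (x y : Fin 8 → K) :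
    g.1 *ᵥ scMul zornConst x y = scMul zornConst (g.1 *ᵥ x) (g.1 *ᵥ y) := hg x y

lemma map_one_oct (hg : g ∈ autPts zornConst K) : g.1 *ᵥ oct 1 1 0 0 = oct 1 1 0 0 := by
  have h := map_scMul hg (oct 1 1 0 0) ((g⁻¹).1 *ᵥ oct 1 1 0 0)
  rw [one_scMul_oct, gl_mulVec_inv_mulVec, scMul_oct_one] at h
  exact h.symm

lemma trace_norm_map (hg : g ∈ autPts zornConst K) (x : Fin 8 → K) :
    (g.1 *ᵥ x) 0 + (g.1 *ᵥ x) 1 = x 0 + x 1 ∧ octNorm (g.1 *ᵥ x) = octNorm x := by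
  have h := map_scMul hg x x
  rw [scMul_self, scMul_self, mulVec_sub, mulVec_smul, mulVec_smul, map_one_oct hg] at h
  set y := g.1 *ᵥ x with hy
  by_cases hsc : ∃ c : K, y = c • oct 1 1 0 0
  · obtain ⟨c, hc⟩ := hsc
    have hx : x = c • oct 1 1 0 0 := by
      apply gl_mulVec_injective g
      simp only
      rw [← hy, hc, mulVec_smul, map_one_oct hg]
    rw [hc, hx]; exact ⟨rfl, rfl⟩
  · have h1 : (x 0 + x 1 - (y 0 + y 1)) • y = (octNorm x - octNorm y) • oct 1 1 0 0 := by
      rw [sub_smul, sub_smul]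
      linear_combination (exp := 1) h
    have h2 : x 0 + x 1 - (y 0 + y 1) = 0 := by
      by_contra hne
      refine hsc ⟨(x 0 + x 1 - (y 0 + y 1))⁻¹ * (octNorm x - octNorm y), ?_⟩
      rw [mul_smul, ← h1, inv_smul_smul₀ hne]
    rw [h2, zero_smul] at h1
    have h3 := congrFun h1 0
    simp at h3
    exact ⟨(sub_eq_zero.1 h2).symm, (sub_eq_zero.1 h3.symm).symm⟩

lemma octPolar_map (hg : g ∈ autPts zornConst K) (x y : Fin 8 → K) :
    octPolar (g.1 *ᵥ x) (g.1 *ᵥ y) = octPolar x y := by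
  have h := (trace_norm_map hg (x + y)).2
  rw [mulVec_add, octNorm_add, octNorm_add, (trace_norm_map hg x).2, (trace_norm_map hg y).2] at h
  exact add_left_cancel h

lemma glOfInverse_mem_autPts {f f' : (Fin 8 → K) →ₗ[K] (Fin 8 → K)} (h : ∀ x, f (f' x) = x)
    (h' : ∀ x, f' (f x) = x)
    (hf : ∀ x y, f (scMul zornConst x y) = scMul zornConst (f x) (f y)) :
    glOfInverse f f' h h' ∈ autPts zornConst K := fun x y => by
  simp only [glOfInverse_mulVec, hf]

end Aut

/-- The one-parameter subgroups of the automorphism group in the direction of the upper vectors. -/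
def octELin (u : Fin 3 → K) : (Fin 8 → K) →ₗ[K] (Fin 8 → K) where
  toFun x := oct (x 0 - u ⬝ᵥ octW x) (x 1 + u ⬝ᵥ octW x)
    (octV x + (x 0 - x 1 - u ⬝ᵥ octW x) • u) (octW x - crossProduct u (octV x))
  map_add' x y := by
    ext i; fin_cases i <;> simp [vec3_dotProduct] <;> ring
  map_smul' c x := by
    ext i; fin_cases i <;> simp [vec3_dotProduct] <;> ring

lemma octELin_oct (u : Fin 3 → K) (a b : K) (v w : Fin 3 → K) : octELin u (oct a b v w) =
    oct (a - u ⬝ᵥ w) (b + u ⬝ᵥ w) (v + (a - b - u ⬝ᵥ w) • u) (w - crossProduct u v) := by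
  simp [octELin]

lemma octELin_add (s t : K) (u : Fin 3 → K) (x : Fin 8 → K) :
    octELin (s • u) (octELin (t • u) x) = octELin ((s + t) • u) x := by
  induction x using oct_induction with | h a b v w
  simp only [octELin_oct]
  ext i; fin_cases i <;> simp [vec3_dotProduct] <;> ring

lemma octELin_zero (x : Fin 8 → K) : octELin 0 x = x := by
  induction x using oct_induction with | h a b v w
  simp [octELin_oct]

lemma octELin_neg (u : Fin 3 → K) (x : Fin 8 → K) : octELin u (octELin (-u) x) = x := by
  have := octELin_add 1 (-1) u x
  simpa [octELin_zero] using this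

lemma octELin_mul (u : Fin 3 → K) (x y : Fin 8 → K) :
    octELin u (scMul zornConst x y) = scMul zornConst (octELin u x) (octELin u y) := by
  induction x using oct_induction with | h a b v w
  induction y using oct_induction with | h a' b' v' w'
  rw [scMul_oct, octELin_oct, octELin_oct, octELin_oct, scMul_oct]
  ext i; fin_cases i <;> simp [vec3_dotProduct] <;> ring

/-- The unipotent automorphism of the octonions given by an upper vector. -/
def octE (u : Fin 3 → K) : GL (Fin 8) K :=
  glOfInverse (octELin u) (octELin (-u)) (octELin_neg u) fun x => by
    simpa using octELin_neg (-u) x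

lemma octE_mem (u : Fin 3 → K) : octE u ∈ autPts zornConst K :=
  glOfInverse_mem_autPts _ _ (octELin_mul u)

lemma octE_mulVec (u : Fin 3 → K) (a b : K) (v w : Fin 3 → K) : (octE u).1 *ᵥ oct a b v w =
    oct (a - u ⬝ᵥ w) (b + u ⬝ᵥ w) (v + (a - b - u ⬝ᵥ w) • u) (w - crossProduct u v) := by
  rw [octE, glOfInverse_mulVec, octELin_oct]

lemma octE_smul_mul (s t : K) (u : Fin 3 → K) : octE (s • u) * octE (t • u) = octE ((s + t) • u) :=
  gl_ext_mulVec fun x => by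
    rw [gl_mul_mulVec]; simp only [octE, glOfInverse_mulVec, octELin_add]

lemma octE_pow (u : Fin 3 → K) (k : ℕ) : octE u ^ k = octE ((k : K) • u) := by
  induction k with
  | zero => exact gl_ext_mulVec fun x => by simp [octE, glOfInverse_mulVec, octELin_zero]
  | succ k ih =>
    have := octE_smul_mul (k : K) 1 u
    rw [one_smul] at this
    rw [pow_succ, ih, this]; push_cast; rfl

/-- The automorphism which interchanges the two diagonal entries. -/
def octSwap : GL (Fin 8) K :=
  let f : (Fin 8 → K) →ₗ[K] (Fin 8 → K) :=
    { toFun := fun x => oct (x 1) (x 0) (-octW x) (-octV x)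
      map_add' := fun x y => by
        ext i; fin_cases i <;> simp <;> ring
      map_smul' := fun c x => by
        ext i; fin_cases i <;> simp }
  glOfInverse f f (fun x => by simp [f, oct_eta]) (fun x => by simp [f, oct_eta])

lemma octSwap_mulVec (a b : K) (v w : Fin 3 → K) :
    (octSwap : GL (Fin 8) K).1 *ᵥ oct a b v w = oct b a (-w) (-v) := by
  rw [octSwap, glOfInverse_mulVec]; simp

lemma octSwap_mem : (octSwap : GL (Fin 8) K) ∈ autPts zornConst K := fun x y => by
  induction x using oct_induction with | h a b v w
  induction y using oct_induction with | h a' b' v' w'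
  rw [scMul_oct, octSwap_mulVec, octSwap_mulVec, octSwap_mulVec, scMul_oct]
  ext i; fin_cases i <;> simp [vec3_dotProduct] <;> ring

lemma octSwap_mul_self : (octSwap : GL (Fin 8) K) * octSwap = 1 := gl_ext_mulVec fun x => by
  induction x using oct_induction with | h a b v w
  rw [gl_mul_mulVec, octSwap_mulVec, octSwap_mulVec]; simp

lemma octSwap_inv : (octSwap : GL (Fin 8) K)⁻¹ = octSwap := inv_eq_of_mul_eq_one_left octSwap_mul_self

/-- The unipotent automorphism of the octonions given by a lower vector. -/
def octF (u : Fin 3 → K) : GL (Fin 8) K := octSwap * octE u * octSwap⁻¹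

lemma octF_mem (u : Fin 3 → K) : octF u ∈ autPts zornConst K :=
  mul_mem (mul_mem octSwap_mem (octE_mem u)) (inv_mem octSwap_mem)

lemma octF_mulVec (u : Fin 3 → K) (a b : K) (v w : Fin 3 → K) : (octF u).1 *ᵥ oct a b v w =
    oct (a - u ⬝ᵥ v) (b + u ⬝ᵥ v) (v - crossProduct u w) (w + (a - b - u ⬝ᵥ v) • u) := by
  rw [octF, octSwap_inv, gl_mul_mulVec, gl_mul_mulVec, octSwap_mulVec, octE_mulVec, octSwap_mulVec]
  ext i; fin_cases i <;> simp [vec3_dotProduct] <;> ring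

lemma octF_pow (u : Fin 3 → K) (k : ℕ) : octF u ^ k = octF ((k : K) • u) := by
  rw [octF, conj_pow, octE_pow, octF]

/-- Every idempotent of trace one is moved to the standard one by the unipotent automorphisms; the
version with submodules `P` and `Q` yields the same statement for subalgebras. -/
lemma exists_move_idempotent {N : Subgroup (GL (Fin 8) K)} {P Q : Submodule K (Fin 3 → K)}
    (hE : ∀ u ∈ P, octE u ∈ N) (hF : ∀ u ∈ Q, octF u ∈ N) {u₀ w₀ : Fin 3 → K} (hu₀ : u₀ ∈ P)
    (hw₀ : w₀ ∈ Q) (huw : u₀ ⬝ᵥ w₀ = 1) {e : Fin 8 → K} (hv : octV e ∈ P) (hw : octW e ∈ Q)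
    (h1 : e 0 + e 1 = 1) (h2 : octNorm e = 0) : ∃ g ∈ N, g.1 *ᵥ e = oct 1 0 0 0 := by
  induction e using oct_induction with | h a b v w
  simp only [octV_oct, octW_oct, oct_zero, oct_one, octNorm, sub_eq_zero] at h1 h2 hv hw
  have hcross : ∀ v : Fin 3 → K, crossProduct v v = 0 := cross_self
  have hab : b = 1 - a := by linear_combination h1
  have key : ∀ w ∈ Q, ∃ g ∈ N, g.1 *ᵥ oct 1 0 0 w = oct 1 0 0 0 := fun w hw =>
    ⟨octF (-w), hF _ (Q.neg_mem hw), by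
      rw [octF_mulVec]
      simp [hcross]⟩
  by_cases hvw : v ⬝ᵥ w = 0
  · rw [hvw, hab, mul_eq_zero, sub_eq_zero] at h2
    rcases h2 with h2 | h2
    · -- the opposite idempotent is moved by a representative of a Weyl group element
      obtain ⟨g, hg, hge⟩ := key _ (Q.zero_mem)
      refine ⟨octE u₀ * octF w₀ * octE u₀ * (octF w * octE v),
        mul_mem (mul_mem (mul_mem (hE _ hu₀) (hF _ hw₀)) (hE _ hu₀)) (mul_mem (hF _ hw) (hE _ hv)), ?_⟩
      have hb : b = 1 := by rw [hab, h2]; ring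
      have e1 : w₀ ⬝ᵥ u₀ = 1 := by rw [dotProduct_comm, huw]
      simp only [gl_mul_mulVec, octE_mulVec, octF_mulVec, hvw, h2, hb, hcross, sub_zero, zero_sub, add_zero,
        zero_add, dotProduct_zero, dotProduct_neg, neg_smul, one_smul, add_neg_cancel, huw, e1, map_zero,
        map_neg, sub_neg_eq_add, neg_neg, sub_self, zero_smul, neg_add_cancel, neg_zero,
        LinearMap.map_neg, add_sub_cancel_right]
    · obtain ⟨g, hg, hge⟩ := key w hw
      refine ⟨g * octE (-v), mul_mem hg (hE _ (P.neg_mem hv)), ?_⟩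
      rw [gl_mul_mulVec, octE_mulVec, ← hge]
      have hb : b = 0 := by rw [hab, ← h2]; ring
      simp [hvw, ← h2, hb, hcross]
  · have ha : a ≠ 0 := by rintro rfl; rw [zero_mul] at h2; exact hvw h2.symm
    obtain ⟨g, hg, hge⟩ := key w hw
    refine ⟨g * octE ((-a⁻¹) • v), mul_mem hg (hE _ (P.smul_mem _ hv)), ?_⟩
    rw [gl_mul_mulVec, octE_mulVec, ← hge]
    congr 1
    have e1 : ((-a⁻¹) • v) ⬝ᵥ w = -b := by
      rw [smul_dotProduct, ← h2, smul_eq_mul]; field_simp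
    rw [oct_inj, e1]
    refine ⟨by linear_combination h1, by ring, ?_, by simp [hcross]⟩
    rw [smul_smul, show (a - b - -b) * -a⁻¹ = -1 by field_simp; ring]
    simp

end Octonions

/-! ### The stabilizer of an idempotent -/

section SL3

variable {K : Type*} [Field K]

lemma cross_mulVec (A : Matrix (Fin 3) (Fin 3) K) (v v' : Fin 3 → K) :
    crossProduct (A *ᵥ v) (A *ᵥ v') = (adjugate A)ᵀ *ᵥ crossProduct v v' := by
  ext i; fin_cases i <;>
  (simp only [mulVec, dotProduct, Fin.sum_univ_three, transpose_apply, Fin.zero_eta, Fin.mk_one,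
    Fin.reduceFinMk, cross_val0, cross_val1, cross_val2]
   simp [adjugate_fin_three]
   ring)

lemma dotProduct_mulVec_transpose {n : Type*} [Fintype n] [DecidableEq n] {A B : Matrix n n K}
    (h : B * A = 1) (v w : n → K) : (A *ᵥ v) ⬝ᵥ (Bᵀ *ᵥ w) = v ⬝ᵥ w := by
  rw [mulVec_transpose, dotProduct_comm, ← dotProduct_mulVec, mulVec_mulVec, h, one_mulVec,
    dotProduct_comm]

/-- The action of `SL_3` on the octonions, as a linear map. -/
def octSLLin (A : SpecialLinearGroup (Fin 3) K) : (Fin 8 → K) →ₗ[K] (Fin 8 → K) where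
  toFun x := oct (x 0) (x 1) (A.1 *ᵥ octV x) ((A⁻¹).1ᵀ *ᵥ octW x)
  map_add' x y := by rw [octV_add, octW_add, mulVec_add, mulVec_add, oct_add]; rfl
  map_smul' c x := by rw [octV_smul, octW_smul, mulVec_smul, mulVec_smul, RingHom.id_apply, oct_smul]; rfl

/-- The embedding of `SL_3` in the automorphism group of the octonions, as the stabilizer of the
diagonal octonions. -/
def octSL : SpecialLinearGroup (Fin 3) K →* GL (Fin 8) K :=
  MonoidHom.toHomUnits
    { toFun := fun A => LinearMap.toMatrix' (octSLLin A)
      map_one' := by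
        rw [show octSLLin (1 : SpecialLinearGroup (Fin 3) K) = LinearMap.id from
          LinearMap.ext fun x => by simp [octSLLin, oct_eta], LinearMap.toMatrix'_id]
      map_mul' := fun A B => by
        rw [← LinearMap.toMatrix'_comp]
        congr 1
        refine LinearMap.ext fun x => ?_
        simp [octSLLin, mulVec_mulVec, transpose_mul] }

lemma octSL_mulVec (A : SpecialLinearGroup (Fin 3) K) (a b : K) (v w : Fin 3 → K) :
    (octSL A).1 *ᵥ oct a b v w = oct a b (A.1 *ᵥ v) ((A⁻¹).1ᵀ *ᵥ w) := by
  rw [octSL, MonoidHom.coe_toHomUnits]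
  simp only [MonoidHom.coe_mk, OneHom.coe_mk, LinearMap.toMatrix'_mulVec]
  simp [octSLLin]

lemma octSL_mem (A : SpecialLinearGroup (Fin 3) K) : octSL A ∈ autPts zornConst K := fun x y => by
  induction x using oct_induction with | h a b v w
  induction y using oct_induction with | h a' b' v' w'
  have h1 : (A⁻¹).1 * A.1 = 1 := by
    rw [← Matrix.SpecialLinearGroup.coe_mul, inv_mul_cancel]; rfl
  have h2 : (A⁻¹).1ᵀ = (adjugate A.1)ᵀ := by rw [Matrix.SpecialLinearGroup.coe_inv]
  have h3 : (adjugate ((A⁻¹).1ᵀ))ᵀ = A.1 := by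
    rw [← adjugate_transpose, transpose_transpose, ← Matrix.SpecialLinearGroup.coe_inv, inv_inv]
  rw [scMul_oct, octSL_mulVec, octSL_mulVec, octSL_mulVec, scMul_oct, cross_mulVec, cross_mulVec,
    dotProduct_mulVec_transpose h1, dotProduct_mulVec_transpose h1, h3, ← h2]
  simp only [mulVec_add, mulVec_sub, mulVec_smul]

lemma mulVec_one_zero {g : GL (Fin 8) K} (hg : g ∈ autPts zornConst K)
    (h0 : g.1 *ᵥ oct 1 0 0 0 = oct 1 0 0 0) : g.1 *ᵥ oct 0 1 0 0 = oct 0 1 0 0 := by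
  have e : (oct 0 1 0 0 : Fin 8 → K) = oct 1 1 0 0 + (-1 : K) • oct 1 0 0 0 := by
    rw [oct_smul, oct_add]; simp
  rw [e, mulVec_add, mulVec_smul, map_one_oct hg, h0]

lemma oct_zero_zero : (oct 0 0 0 0 : Fin 8 → K) = 0 := by ext i; fin_cases i <;> rfl

/-- The upper vectors, as a linear map into the octonions. -/
def octVLin : (Fin 3 → K) →ₗ[K] (Fin 8 → K) where
  toFun v := oct 0 0 v 0
  map_add' v v' := by rw [oct_add]; simp
  map_smul' c v := by rw [oct_smul]; simp

/-- The lower vectors, as a linear map into the octonions. -/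
def octWLin : (Fin 3 → K) →ₗ[K] (Fin 8 → K) where
  toFun w := oct 0 0 0 w
  map_add' v v' := by rw [oct_add]; simp
  map_smul' c v := by rw [oct_smul]; simp

/-- The projection to the upper vectors. -/
def octVProj : (Fin 8 → K) →ₗ[K] (Fin 3 → K) where
  toFun := octV
  map_add' := octV_add
  map_smul' := octV_smul

/-- The projection to the lower vectors. -/
def octWProj : (Fin 8 → K) →ₗ[K] (Fin 3 → K) where
  toFun := octW
  map_add' := octW_add
  map_smul' := octW_smul

/-- The stabilizer of the standard idempotent is `SL_3`. -/
lemma exists_octSL_eq {g : GL (Fin 8) K} (hg : g ∈ autPts zornConst K)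
    (h0 : g.1 *ᵥ oct 1 0 0 0 = oct 1 0 0 0) : ∃ A, octSL A = g := by
  have h1 := mulVec_one_zero hg h0
  let A : Matrix (Fin 3) (Fin 3) K := LinearMap.toMatrix' (octVProj ∘ₗ Matrix.toLin' g.1 ∘ₗ octVLin)
  let B : Matrix (Fin 3) (Fin 3) K := LinearMap.toMatrix' (octWProj ∘ₗ Matrix.toLin' g.1 ∘ₗ octWLin)
  -- the upper and the lower vectors are the Peirce components of the idempotent
  have hV : ∀ v, g.1 *ᵥ oct 0 0 v 0 = oct 0 0 (A *ᵥ v) 0 := by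
    intro v
    have e1 := map_scMul hg (oct 1 0 0 0) (oct 0 0 v 0)
    have e2 := map_scMul hg (oct 0 0 v 0) (oct 1 0 0 0)
    rw [h0] at e1 e2
    have hA : A *ᵥ v = octV (g.1 *ᵥ oct 0 0 v 0) := by
      simp only [A, LinearMap.toMatrix'_mulVec]; rfl
    rw [hA]
    induction hx : g.1 *ᵥ oct 0 0 v 0 using oct_induction with | h a b p q
    rw [hx] at e1 e2
    rw [scMul_oct, scMul_oct] at e1 e2
    simp [oct_inj, hx, oct_zero_zero] at e1 e2
    have e3 := congrFun e2 0
    simp only [Pi.zero_apply, oct_zero] at e3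
    rw [octV_oct, e1.1, e1.2, ← e3]
  have hW : ∀ w, g.1 *ᵥ oct 0 0 0 w = oct 0 0 0 (B *ᵥ w) := by
    intro w
    have e1 := map_scMul hg (oct 1 0 0 0) (oct 0 0 0 w)
    have e2 := map_scMul hg (oct 0 0 0 w) (oct 1 0 0 0)
    rw [h0] at e1 e2
    have hB : B *ᵥ w = octW (g.1 *ᵥ oct 0 0 0 w) := by
      simp only [B, LinearMap.toMatrix'_mulVec]; rfl
    rw [hB]
    induction hx : g.1 *ᵥ oct 0 0 0 w using oct_induction with | h a b p q
    rw [hx] at e1 e2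
    rw [scMul_oct, scMul_oct] at e1 e2
    simp [oct_inj, hx, oct_zero_zero] at e1 e2
    have e3 := congrFun e1 0
    have e4 := congrArg octV e1
    simp only [Pi.zero_apply, oct_zero] at e3
    rw [octV_oct] at e4
    rw [octW_oct, e2.1, e2.2, ← e3]
  have hAB : ∀ v w, (A *ᵥ v) ⬝ᵥ (B *ᵥ w) = v ⬝ᵥ w := by
    intro v w
    have := octPolar_map hg (oct 0 0 v 0) (oct 0 0 0 w)
    rw [hV, hW] at this
    simpa [octPolar] using this
  have hcr : ∀ v v', crossProduct (A *ᵥ v) (A *ᵥ v') = B *ᵥ crossProduct v v' := by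
    intro v v'
    have := map_scMul hg (oct 0 0 v' 0) (oct 0 0 v 0)
    rw [hV, hV, scMul_oct, scMul_oct] at this
    simp [hW, oct_inj, mulVec_neg] at this
    exact this.symm
  -- the triple product of the upper vectors is invariant
  have hdet : A.det = 1 := by
    have e := hAB ![1, 0, 0] (crossProduct ![0, 1, 0] ![0, 0, 1])
    rw [← hcr] at e
    rw [det_fin_three]
    simp [cross_apply, mulVec, dotProduct, Fin.sum_univ_three] at e
    linear_combination e
  have hBA : Aᵀ * B = 1 := by
    ext i j
    have := hAB (Pi.single i 1) (Pi.single j 1)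
    simp [Pi.single_apply, dotProduct] at this
    rw [Matrix.mul_apply, Matrix.one_apply]
    simpa [eq_comm] using this
  obtain ⟨S, hS⟩ : ∃ S : SpecialLinearGroup (Fin 3) K, S.1 = A := ⟨⟨A, hdet⟩, rfl⟩
  have hB : (S⁻¹).1ᵀ = B := by
    have e : (S⁻¹).1ᵀ * Aᵀ = 1 := by
      rw [← transpose_mul, ← hS, ← Matrix.SpecialLinearGroup.coe_mul, mul_inv_cancel]; simp
    rw [← mul_one (S⁻¹).1ᵀ, ← hBA, ← Matrix.mul_assoc, e, Matrix.one_mul]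
  refine ⟨S, gl_ext_mulVec fun x => ?_⟩
  induction x using oct_induction with | h a b v w
  have e : (oct a b v w : Fin 8 → K) = a • oct 1 0 0 0 + b • oct 0 1 0 0 + oct 0 0 v 0 + oct 0 0 0 w := by
    simp [oct_smul, oct_add]
  rw [octSL_mulVec, e, mulVec_add, mulVec_add, mulVec_add, mulVec_smul, mulVec_smul, h0, h1, hV, hW,
    hB, hS]
  simp [oct_smul, oct_add]

/-- The weights of the diagonal torus on the octonions. -/
def octWeight : Fin 8 → Fin 2 → ℤ :=
  ![0, 0, ![1, 0], ![0, 1], ![-1, -1], ![-1, 0], ![0, -1], ![1, 1]]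

lemma monomialChar_two (m : Fin 2 → ℤ) (z : Fin 2 → Kˣ) :
    monomialChar m z = z 0 ^ m 0 * z 1 ^ m 1 := by
  simp [monomialChar, Fin.prod_univ_two]

lemma weightTorus_mulVec {ι : Type} [Fintype ι] [DecidableEq ι] {r : ℕ} (χ : ι → Fin r → ℤ)
    (z : Fin r → Kˣ) (x : ι → K) (i : ι) :
    ((weightTorus χ z).1 *ᵥ x) i = (monomialChar (χ i) z : Kˣ) * x i := by
  rw [weightTorus_val, mulVec_diagonal]

lemma octWeight_mulVec (z : Fin 2 → Kˣ) (a b : K) (v w : Fin 3 → K) :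
    (weightTorus octWeight z).1 *ᵥ oct a b v w =
      oct a b ![z 0 * v 0, z 1 * v 1, ((z 0 * z 1)⁻¹ : Kˣ) * v 2]
        ![((z 0)⁻¹ : Kˣ) * w 0, ((z 1)⁻¹ : Kˣ) * w 1, z 0 * z 1 * w 2] := by
  ext i
  rw [weightTorus_mulVec, monomialChar_two]
  fin_cases i <;> simp [octWeight, mul_comm]

/-- The diagonal torus of `SL_3`. -/
def diagSL3 (z : Fin 2 → Kˣ) : SpecialLinearGroup (Fin 3) K :=
  ⟨diagonal ![(z 0 : K), (z 1 : K), (((z 0 * z 1)⁻¹ : Kˣ) : K)], by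
    rw [det_diagonal, Fin.prod_univ_three]
    simp only [cons_val_zero, cons_val_one, cons_val]
    rw [← Units.val_mul, ← Units.val_mul, mul_inv_cancel, Units.val_one]⟩

lemma diagSL3_val (z : Fin 2 → Kˣ) :
    (diagSL3 z).1 = diagonal ![(z 0 : K), (z 1 : K), (((z 0 * z 1)⁻¹ : Kˣ) : K)] := rfl

lemma diagSL3_inv (z : Fin 2 → Kˣ) : (diagSL3 z)⁻¹ = diagSL3 z⁻¹ := by
  rw [inv_eq_iff_mul_eq_one]
  apply Subtype.ext
  rw [Matrix.SpecialLinearGroup.coe_mul, diagSL3_val, diagSL3_val, diagonal_mul_diagonal,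
    Matrix.SpecialLinearGroup.coe_one, ← diagonal_one]
  congr 1
  ext i; fin_cases i <;> simp
  field_simp

lemma octSL_diagSL3 (z : Fin 2 → Kˣ) : octSL (diagSL3 z) = weightTorus octWeight z :=
  gl_ext_mulVec fun x => by
    induction x using oct_induction with | h a b v w
    rw [octSL_mulVec, octWeight_mulVec, diagSL3_inv]
    simp only [diagSL3_val, diagonal_transpose]
    ext i
    fin_cases i <;> simp [mulVec_diagonal, mul_comm]

lemma exists_diagSL3_eq {D : SpecialLinearGroup (Fin 3) K} (hD : D.1.IsDiag) :
    ∃ z, diagSL3 z = D := by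
  have hdet := D.2
  rw [← hD.diagonal_diag, det_diagonal, Fin.prod_univ_three] at hdet
  simp only [diag_apply] at hdet
  have h0 : D.1 0 0 ≠ 0 := fun h => by simp [h] at hdet
  have h1 : D.1 1 1 ≠ 0 := fun h => by simp [h] at hdet
  refine ⟨![Units.mk0 _ h0, Units.mk0 _ h1], Subtype.ext ?_⟩
  rw [diagSL3_val]
  refine Eq.trans ?_ hD.diagonal_diag
  congr 1
  ext i; fin_cases i <;> simp
  rw [← mul_inv, mul_comm]
  exact (eq_inv_of_mul_eq_one_right hdet).symm

/-! ### Semisimple automorphisms of the octonions -/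

section Semisimple

variable [IsAlgClosed K]

/-- A vector is detected by the polar form against eigenvectors of a diagonalizable matrix. -/
lemma exists_eigenvector_octPolar_ne_zero {s : GL (Fin 8) K} (hs : SqfreeAnn s.1) {x : Fin 8 → K}
    (hx : x ≠ 0) : ∃ (y : Fin 8 → K) (μ : K), s.1 *ᵥ y = μ • y ∧ octPolar x y ≠ 0 := by
  obtain ⟨P, hP⟩ := exists_conj_isDiag (S := {s}) (by simp) (by simpa using hs)
  have hD := hP s rfl
  obtain ⟨y, hy⟩ := exists_octPolar_ne_zero hx
  by_contra! h
  apply hy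
  have key : ∀ z, octPolarLin x ((P⁻¹).1 *ᵥ z) = 0 := by
    have : (octPolarLin x) ∘ₗ Matrix.toLin' (P⁻¹).1 = 0 := by
      apply LinearMap.pi_ext'
      intro i
      ext1
      refine h ((P⁻¹).1 *ᵥ Pi.single i 1) ((P * s * P⁻¹).1 i i) ?_
      have e1 := IsDiag.mulVec_single hD i
      rw [gl_mul_mulVec, gl_mul_mulVec] at e1
      have e2 := congrArg (fun v => (P⁻¹).1 *ᵥ v) e1
      simpa [gl_inv_mulVec_mulVec, mulVec_smul] using e2
    intro z
    have h2 := LinearMap.congr_fun this z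
    simpa using h2
  have := key (P.1 *ᵥ y)
  rwa [gl_inv_mulVec_mulVec] at this

/-- A diagonalizable automorphism with a singular eigenvector of trace zero fixes an idempotent. -/
lemma exists_idempotent_of_eigenvector {s : GL (Fin 8) K} (hs : SqfreeAnn s.1)
    (hsG : s ∈ autPts zornConst K) {x : Fin 8 → K} {c : K} (hx : x ≠ 0) (hsx : s.1 *ᵥ x = c • x)
    (h1 : x 0 + x 1 = 0) (h2 : octNorm x = 0) :
    ∃ e, s.1 *ᵥ e = e ∧ e 0 + e 1 = 1 ∧ octNorm e = 0 := by
  -- a multiple of the product `x y`, for a dual eigenvector `y`, is the required idempotent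
  obtain ⟨y, μ, hy, hxy⟩ := exists_eigenvector_octPolar_ne_zero hs hx
  have hμ : c * μ = 1 := by
    have := octPolar_map hsG x y
    rw [hsx, hy, octPolar_smul] at this
    exact mul_right_cancel₀ hxy (by rw [this, one_mul])
  have htr := octTrace_mul x y
  rw [h1, zero_mul, zero_sub] at htr
  refine ⟨(-octPolar x y)⁻¹ • scMul zornConst x y, ?_, ?_, ?_⟩
  · rw [mulVec_smul, map_scMul hsG, hsx, hy, scMul_smul_left, scMul_smul_right, smul_smul _ _ (scMul _ _ _),
      hμ, one_smul]
  · rw [Pi.smul_apply, Pi.smul_apply, ← smul_add, htr, smul_eq_mul,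
      inv_mul_cancel₀ (neg_ne_zero.2 hxy)]
  · rw [octNorm_smul, octNorm_mul, h2]; ring

/-- A diagonalizable automorphism of the octonions fixes an idempotent of trace one. -/
lemma exists_fixed_idempotent [CharZero K] {s : GL (Fin 8) K} (hs : SqfreeAnn s.1)
    (hsG : s ∈ autPts zornConst K) : ∃ e, s.1 *ᵥ e = e ∧ e 0 + e 1 = 1 ∧ octNorm e = 0 := by
  by_cases hev : ∃ (x : Fin 8 → K) (c : K), x ≠ 0 ∧ s.1 *ᵥ x = c • x ∧ c ^ 2 ≠ 1
  · obtain ⟨x, c, hx, hsx, hc⟩ := hev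
    have hc1 : c ≠ 1 := by rintro rfl; simp at hc
    obtain ⟨h1, h2⟩ := trace_norm_map hsG x
    rw [hsx] at h1 h2
    rw [octNorm_smul] at h2
    simp only [Pi.smul_apply, smul_eq_mul] at h1
    refine exists_idempotent_of_eigenvector hs hsG hx hsx ?_ ?_
    · have : (c - 1) * (x 0 + x 1) = 0 := by linear_combination h1
      exact (mul_eq_zero.1 this).resolve_left (sub_ne_zero.2 hc1)
    · have : (c ^ 2 - 1) * octNorm x = 0 := by linear_combination h2
      exact (mul_eq_zero.1 this).resolve_left (sub_ne_zero.2 hc)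
  push Not at hev
  -- now `s` is an involution, and is not `-1` on the octonions of trace zero
  obtain ⟨P, hP⟩ := exists_conj_isDiag (S := {s}) (by simp) (by simpa using hs)
  have hD := hP s rfl
  have hss : ∀ z, s.1 *ᵥ (s.1 *ᵥ z) = z := by
    have hlin : Matrix.toLin' (s * s).1 ∘ₗ Matrix.toLin' (P⁻¹).1 = Matrix.toLin' (P⁻¹).1 := by
      apply LinearMap.pi_ext'
      intro i
      ext1
      have e1 := IsDiag.mulVec_single hD i
      have e2 := congrArg (fun v => (P⁻¹).1 *ᵥ v) e1
      simp only [gl_mul_mulVec, gl_inv_mulVec_mulVec, mulVec_smul] at e2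
      have e3 := hev _ _ (fun h0 => by
        have := congrArg (fun v => P.1 *ᵥ v) h0
        simp only [gl_mulVec_inv_mulVec, mulVec_zero] at this
        simpa using congrFun this i) e2
      simp only [LinearMap.comp_apply, LinearMap.coe_single, toLin'_apply, gl_mul_mulVec] at e2 ⊢
      rw [e2, mulVec_smul, e2, smul_smul, ← sq, e3, one_smul]
    intro z
    have := LinearMap.congr_fun hlin (P.1 *ᵥ z)
    simpa only [LinearMap.comp_apply, toLin'_apply, gl_mul_mulVec, gl_inv_mulVec_mulVec] using this
  obtain ⟨z, hz, hz1⟩ : ∃ z : Fin 8 → K, z 0 + z 1 = 0 ∧ z + s.1 *ᵥ z ≠ 0 := by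
    by_contra! h
    have e2 : ∀ z : Fin 8 → K, z 0 + z 1 = 0 → s.1 *ᵥ z = -z := fun z hz =>
      (neg_eq_of_add_eq_zero_right (h z hz)).symm
    have e3 := map_scMul hsG (oct 0 0 ![1, 0, 0] 0) (oct 0 0 ![0, 1, 0] 0)
    rw [e2 (oct 0 0 ![1, 0, 0] 0) (by simp), e2 (oct 0 0 ![0, 1, 0] 0) (by simp), e2] at e3
    · have e4 : ∀ x : Fin 8 → K, -x = (-1 : K) • x := fun x => by simp
      rw [e4 (oct 0 0 ![1, 0, 0] 0), e4 (oct 0 0 ![0, 1, 0] 0), scMul_smul_left, scMul_smul_right] at e3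
      have e5 := congrFun e3 7
      rw [scMul_oct] at e5
      simp at e5
      norm_num [eq_neg_iff_add_eq_zero] at e5
    · rw [scMul_oct]; simp
  set y := z + s.1 *ᵥ z with hy
  have hsy : s.1 *ᵥ y = y := by rw [hy, mulVec_add, hss, add_comm]
  have hty : y 0 + y 1 = 0 := by
    have := (trace_norm_map hsG z).1
    rw [hz] at this
    rw [hy, Pi.add_apply, Pi.add_apply]; linear_combination this + hz
  -- if `y` is not singular, `(1 + y / c) / 2` is an idempotent for `c² = -N(y)`
  by_cases hN : octNorm y = 0
  · exact exists_idempotent_of_eigenvector (c := 1) hs hsG hz1 (by rw [hsy, one_smul]) hty hN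
  · obtain ⟨c, hc⟩ := IsAlgClosed.exists_pow_nat_eq (-octNorm y) two_pos
    have hc0 : c ≠ 0 := by
      rintro rfl; apply hN; rw [zero_pow two_ne_zero] at hc; exact neg_eq_zero.1 hc.symm
    refine ⟨(2 : K)⁻¹ • (oct 1 1 0 0 + c⁻¹ • y), ?_, ?_, ?_⟩
    · rw [mulVec_smul, mulVec_add, map_one_oct hsG, mulVec_smul, hsy]
    · simp only [Pi.smul_apply, Pi.add_apply, oct_zero, oct_one, smul_eq_mul]
      have h3 : (2 : K) ≠ 0 := two_ne_zero
      field_simp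
      linear_combination hty
    · rw [octNorm_smul, octNorm_add, octNorm_smul]
      have h3 : octPolar (oct 1 1 0 0) (c⁻¹ • y) = 0 := by
        simp [octPolar]
        linear_combination c⁻¹ * hty
      have h4 : octNorm (oct 1 1 0 0 : Fin 8 → K) = 1 := by simp [octNorm]
      rw [h3, h4]
      have h5 : (1 : K) + c⁻¹ ^ 2 * octNorm y + 0 = 0 := by
        field_simp
        linear_combination hc
      rw [h5, mul_zero]

/-- The automorphism group of the octonions acts transitively on the idempotents of trace one. -/
lemma exists_mulVec_idempotent {e : Fin 8 → K} (h1 : e 0 + e 1 = 1) (h2 : octNorm e = 0) :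
    ∃ g ∈ autPts zornConst K, g.1 *ᵥ e = oct 1 0 0 0 :=
  exists_move_idempotent (P := ⊤) (Q := ⊤) (fun u _ => octE_mem u) (fun u _ => octF_mem u)
    (u₀ := ![1, 0, 0]) (w₀ := ![1, 0, 0]) trivial trivial (by simp) trivial trivial h1 h2

/-- A diagonalizable matrix is diagonalized by a matrix of determinant one. -/
lemma exists_SL_conj_isDiag {n : ℕ} [NeZero n] {A : GL (Fin n) K} (hA : SqfreeAnn A.1) :
    ∃ P : SpecialLinearGroup (Fin n) K, (P.1 * A.1 * (P⁻¹).1).IsDiag := by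
  obtain ⟨P, hP⟩ := exists_conj_isDiag (S := {A}) (by simp) (by simpa using hA)
  have hD := hP A rfl
  have hdet : P.1.det ≠ 0 := (Matrix.isUnits_det_units P).ne_zero
  obtain ⟨c, hc⟩ := IsAlgClosed.exists_pow_nat_eq P.1.det (Nat.pos_of_neZero n)
  have hc0 : c ≠ 0 := by rintro rfl; rw [zero_pow (NeZero.ne n)] at hc; exact hdet hc.symm
  obtain ⟨Q, hQ⟩ : ∃ Q : SpecialLinearGroup (Fin n) K, Q.1 = c⁻¹ • P.1 :=
    ⟨⟨c⁻¹ • P.1, by rw [det_smul, Fintype.card_fin, ← hc, inv_pow, inv_mul_cancel₀ (pow_ne_zero _ hc0)]⟩, rfl⟩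
  have hQ' : (Q⁻¹).1 = c • (P⁻¹).1 := by
    have e1 : Q.1 * (c • (P⁻¹).1) = 1 := by
      rw [hQ, smul_mul_smul_comm, inv_mul_cancel₀ hc0, one_smul, ← Units.val_mul, mul_inv_cancel]; rfl
    have e2 : (Q⁻¹).1 * Q.1 = 1 := by rw [← Matrix.SpecialLinearGroup.coe_mul, inv_mul_cancel]; simp
    rw [← one_mul (c • (P⁻¹).1), ← e2, Matrix.mul_assoc, e1, mul_one]
  refine ⟨Q, ?_⟩
  rw [hQ, hQ', smul_mul_assoc, smul_mul_assoc, mul_smul_comm, smul_smul, inv_mul_cancel₀ hc0, one_smul]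
  exact hD

/-- Every diagonalizable automorphism of the octonions is conjugate to a diagonal one. -/
lemma exists_conj_diag_oct [CharZero K] {s : GL (Fin 8) K} (hsG : s ∈ autPts zornConst K)
    (hs : SqfreeAnn s.1) : ∃ g ∈ autPts zornConst K, g * s * g⁻¹ ∈ diagSub (Fin 8) K := by
  obtain ⟨e, he, h1, h2⟩ := exists_fixed_idempotent hs hsG
  obtain ⟨g, hg, hge⟩ := exists_mulVec_idempotent h1 h2
  have h3 : (g * s * g⁻¹).1 *ᵥ oct 1 0 0 0 = oct 1 0 0 0 := by
    rw [gl_mul_mulVec, gl_mul_mulVec, ← hge, gl_inv_mulVec_mulVec, he]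
  obtain ⟨A, hA⟩ := exists_octSL_eq (mul_mem (mul_mem hg hsG) (inv_mem hg)) h3
  have hAs : SqfreeAnn A.1 := (hs.conj g).of_intertwine octVLin
    (fun v v' h => (oct_inj.1 h).2.2.1) fun v => by
      rw [← hA]; change (octSL A).1 *ᵥ oct 0 0 v 0 = oct 0 0 (A.1 *ᵥ v) 0
      rw [octSL_mulVec, mulVec_zero]
  obtain ⟨P, hP⟩ := exists_SL_conj_isDiag (A := (A : GL (Fin 3) K)) hAs
  refine ⟨octSL P * g, mul_mem (octSL_mem P) hg, ?_⟩
  have e : octSL P * g * s * (octSL P * g)⁻¹ = octSL (P * A * P⁻¹) := by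
    rw [map_mul, map_mul, hA, map_inv]; group
  obtain ⟨z, hz⟩ := exists_diagSL3_eq (D := P * A * P⁻¹) hP
  rw [e, ← hz, octSL_diagSL3]
  exact weightTorus_mem_diagSub _ _

end Semisimple

/-! ### The automorphism group of the octonions as a split group of rank two -/

lemma isZClosed_autPts {ι : Type} [Fintype ι] [DecidableEq ι] (c : ι → ι → ι → ℤ) :
    IsZClosed (autPts c K) := by
  refine ⟨(autGrp c K).eqs, fun g => ?_⟩
  simp only [← MvPolynomial.coe_aeval_eq_eval]
  exact (autGrp c K).mem_pts K g

/-- A matrix which commutes with a diagonal torus preserves the weight spaces. -/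
lemma apply_eq_zero_of_commute_weightTorus [Infinite K] {ι : Type} [Fintype ι] [DecidableEq ι] {r : ℕ}
    {χ : ι → Fin r → ℤ} {h : GL ι K} (hh : ∀ z, h * weightTorus χ z = weightTorus χ z * h) {i j : ι}
    (hij : χ i ≠ χ j) : h.1 i j = 0 := by
  by_contra h0
  apply hij
  refine monomialChar_injective (K := K) (MonoidHom.ext fun z => ?_)
  have e := congrArg (fun g : GL ι K => g.1 i j) (hh z)
  simp only [Units.val_mul, weightTorus_val, mul_diagonal, diagonal_mul] at e
  rw [mul_comm] at e
  exact (mul_right_cancel₀ h0 e).symm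

lemma weightTorus_octWeight_mem (z : Fin 2 → Kˣ) : weightTorus octWeight z ∈ autPts zornConst K := by
  rw [← octSL_diagSL3]; exact octSL_mem _

lemma exists_weightTorus_of_octSL_isDiag {A : SpecialLinearGroup (Fin 3) K}
    (hA : octSL A ∈ diagSub (Fin 8) K) : ∃ z, weightTorus octWeight z = octSL A := by
  have : A.1.IsDiag := by
    refine isDiag_of_mulVec_single fun i => ?_
    have key : ∀ i : Fin 8, ∃ c : K, (octSL A).1 *ᵥ Pi.single i 1 = c • Pi.single i 1 := fun i =>
      ⟨_, IsDiag.mulVec_single hA i⟩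
    obtain ⟨c, hc⟩ : ∃ c : K, (octSL A).1 *ᵥ oct 0 0 (Pi.single i 1) 0 = c • oct 0 0 (Pi.single i 1) 0 := by
      have h2 := key 2
      have h3 := key 3
      have h4 := key 4
      have e2 : (Pi.single 2 1 : Fin 8 → K) = oct 0 0 (Pi.single 0 1) 0 := by
        ext i; fin_cases i <;> simp
      have e3 : (Pi.single 3 1 : Fin 8 → K) = oct 0 0 (Pi.single 1 1) 0 := by
        ext i; fin_cases i <;> simp
      have e4 : (Pi.single 4 1 : Fin 8 → K) = oct 0 0 (Pi.single 2 1) 0 := by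
        ext i; fin_cases i <;> simp
      rw [e2] at h2; rw [e3] at h3; rw [e4] at h4
      fin_cases i
      exacts [h2, h3, h4]
    rw [octSL_mulVec, oct_smul, oct_inj] at hc
    exact ⟨c, hc.2.2.1⟩
  obtain ⟨z, rfl⟩ := exists_diagSL3_eq this
  exact ⟨z, (octSL_diagSL3 z).symm⟩

lemma oct_idempotent_mulVec {g : GL (Fin 8) K} (hg : g ∈ autPts zornConst K) :
    (g.1 *ᵥ oct 1 0 0 0) 0 + (g.1 *ᵥ oct 1 0 0 0) 1 = 1 ∧ octNorm (g.1 *ᵥ oct 1 0 0 0) = 0 := by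
  obtain ⟨h1, h2⟩ := trace_norm_map hg (oct 1 0 0 0)
  exact ⟨by rw [h1]; simp, by rw [h2]; simp [octNorm]⟩

lemma oct_single_zero : (Pi.single 0 1 : Fin 8 → K) = oct 1 0 0 0 := by
  ext i; fin_cases i <;> simp

/-- The diagonal automorphisms of the octonions form a maximal torus. An automorphism which is diagonal
or commutes with this torus fixes the idempotent `oct 1 0 0 0`, hence belongs to `SL_3`. -/
theorem isSplitModel_oct [IsAlgClosed K] [CharZero K] :
    IsSplitModel (autPts zornConst K) octWeight ![2, 3] where
  closed := isZClosed_autPts _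
  mem := weightTorus_octWeight_mem
  coord l := by fin_cases l <;> · ext i; fin_cases i <;> simp [octWeight]
  diag h hh hd := by
    have h0 : h.1 *ᵥ oct 1 0 0 0 = oct 1 0 0 0 := by
      have e1 := IsDiag.mulVec_single hd 0
      rw [oct_single_zero] at e1
      have e2 := (oct_idempotent_mulVec hh).1
      rw [e1] at e2
      simp at e2
      rw [e1, e2, one_smul]
    obtain ⟨A, rfl⟩ := exists_octSL_eq hh h0
    exact exists_weightTorus_of_octSL_isDiag hd
  cent h hh hc := by
    have h0 : h.1 *ᵥ oct 1 0 0 0 = oct 1 0 0 0 := by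
      have e1 : ∀ i, octWeight i ≠ 0 → (h.1 *ᵥ oct 1 0 0 0) i = 0 := by
        intro i hi
        rw [← oct_single_zero, mulVec_single_one]
        exact apply_eq_zero_of_commute_weightTorus hc hi
      have e2 : ∀ i, octWeight i ≠ octWeight 2 → (h.1 *ᵥ oct 0 0 ![1, 0, 0] 0) i = 0 := by
        intro i hi
        have e : (oct 0 0 ![1, 0, 0] 0 : Fin 8 → K) = Pi.single 2 1 := by
          ext i; fin_cases i <;> simp
        rw [e, mulVec_single_one]
        exact apply_eq_zero_of_commute_weightTorus hc hi
      obtain ⟨a, b, hab⟩ : ∃ a b, h.1 *ᵥ oct 1 0 0 0 = oct a b 0 0 := by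
        refine ⟨_, _, (oct_eta _).symm.trans (oct_inj.2 ⟨rfl, rfl, ?_, ?_⟩)⟩ <;> ext i <;> fin_cases i
        exacts [e1 2 (by decide), e1 3 (by decide), e1 4 (by decide), e1 5 (by decide),
          e1 6 (by decide), e1 7 (by decide)]
      obtain ⟨c, hc⟩ : ∃ c, h.1 *ᵥ oct 0 0 ![1, 0, 0] 0 = oct 0 0 ![c, 0, 0] 0 := by
        refine ⟨(h.1 *ᵥ oct 0 0 ![1, 0, 0] 0) 2, (oct_eta _).symm.trans (oct_inj.2 ⟨e2 0 (by decide), e2 1 (by decide), ?_, ?_⟩)⟩ <;>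
          ext i <;> fin_cases i
        exacts [rfl, e2 3 (by decide), e2 4 (by decide), e2 5 (by decide), e2 6 (by decide),
          e2 7 (by decide)]
      have e3 := map_scMul hh (oct 1 0 0 0) (oct 0 0 ![1, 0, 0] 0)
      rw [hab, hc, scMul_oct, scMul_oct] at e3
      simp [hc, oct_inj] at e3
      have hc0 : c ≠ 0 := by
        rintro rfl
        have e4 : h.1 *ᵥ oct 0 0 ![1, 0, 0] 0 = h.1 *ᵥ 0 := by
          rw [hc, mulVec_zero]; ext i; fin_cases i <;> simp
        have e5 := congrFun (gl_mulVec_injective h e4) 2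
        simp at e5
      have ha : a = 1 := mul_right_cancel₀ hc0 (by rw [← e3, one_mul])
      have hb := (oct_idempotent_mulVec hh).1
      rw [hab] at hb
      simp [ha] at hb
      rw [hab, ha, hb]
    obtain ⟨A, rfl⟩ := exists_octSL_eq hh h0
    refine mem_diagSub.2 fun i j hij => ?_
    by_cases hw : octWeight i = octWeight j
    · have : (i = 0 ∧ j = 1) ∨ (i = 1 ∧ j = 0) := by
        revert i j; decide
      rcases this with ⟨rfl, rfl⟩ | ⟨rfl, rfl⟩
      · have := congrFun (mulVec_one_zero hh h0) 0
        have e : (oct 0 1 0 0 : Fin 8 → K) = Pi.single 1 1 := by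
          ext i; fin_cases i <;> simp
        rw [e, mulVec_single_one] at this
        simpa using this
      · have := congrFun h0 1
        rw [← oct_single_zero, mulVec_single_one] at this
        simpa using this
    · exact apply_eq_zero_of_commute_weightTorus hc hw
  conj x hx hs := exists_conj_diag_oct hx hs

end SL3

/-! ### Root subgroups of the automorphism group of the octonions -/

section OctRoots

variable {K : Type*} [Field K]

/-- The functions on `SL_2` which are polynomials in the entries. -/
noncomputable def polySL2 (K : Type*) [Field K] : Subalgebra K (SpecialLinearGroup (Fin 2) K → K) :=
  (MvPolynomial.aeval fun (kl : Fin 2 × Fin 2) (g : SpecialLinearGroup (Fin 2) K) =>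
    g.1 kl.1 kl.2).range

lemma mem_polySL2 {φ : SpecialLinearGroup (Fin 2) K → K} : φ ∈ polySL2 K ↔
    ∃ p : MvPolynomial (Fin 2 × Fin 2) K, ∀ g, φ g = MvPolynomial.eval (fun kl => g.1 kl.1 kl.2) p := by
  have key : ∀ (p : MvPolynomial (Fin 2 × Fin 2) K) (g : SpecialLinearGroup (Fin 2) K),
      (MvPolynomial.aeval (fun (kl : Fin 2 × Fin 2) (g : SpecialLinearGroup (Fin 2) K) =>
        g.1 kl.1 kl.2) p) g = MvPolynomial.eval (fun kl => g.1 kl.1 kl.2) p := by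
    intro p g
    induction p using MvPolynomial.induction_on with
    | C a => simp
    | add p q hp hq => simp [hp, hq]
    | mul_X p i hp => simp [hp]
  constructor
  · rintro ⟨p, rfl⟩
    exact ⟨p, key p⟩
  · rintro ⟨p, hp⟩
    exact ⟨p, funext fun g => (key p g).trans (hp g).symm⟩

lemma entry_mem_polySL2 (k l : Fin 2) : (fun g => g.1 k l) ∈ polySL2 K :=
  ⟨MvPolynomial.X (k, l), by funext g; simp⟩

lemma const_mem_polySL2 (c : K) : (fun _ => c) ∈ polySL2 K := (polySL2 K).algebraMap_mem c

/-- A homomorphism from `SL_2` is algebraic if polynomial functions depend polynomially on the group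
element after applying it. -/
lemma isAlgSL2Hom_of_mulVec {ι : Type} [Fintype ι] [DecidableEq ι]
    {f : SpecialLinearGroup (Fin 2) K →* GL ι K}
    (h : ∀ (x : ι → K) i, (fun g => ((f g).1 *ᵥ x) i) ∈ polySL2 K) : IsAlgSL2Hom f := by
  intro i j
  obtain ⟨p, hp⟩ := mem_polySL2.1 (h (Pi.single j 1) i)
  refine ⟨p, fun g => ?_⟩
  rw [← hp g, mulVec_single_one]; rfl

/-- The homomorphism from `SL_2` given by a short root: the octonions are the sum of two copies of the
standard representation and of the matrix algebra with the conjugation action. -/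
def octShortLin (A : SpecialLinearGroup (Fin 2) K) : (Fin 8 → K) →ₗ[K] (Fin 8 → K) where
  toFun x :=
    let α := A.1 0 0; let β := A.1 0 1; let γ := A.1 1 0; let δ := A.1 1 1
    oct (δ * (α * x 0 - β * x 5) + γ * (α * x 2 - β * x 1))
      (β * (-γ * x 0 + δ * x 5) + α * (-γ * x 2 + δ * x 1))
      ![β * (α * x 0 - β * x 5) + α * (α * x 2 - β * x 1), -γ * x 7 + δ * x 3, γ * x 6 + δ * x 4]
      ![δ * (-γ * x 0 + δ * x 5) + γ * (-γ * x 2 + δ * x 1), α * x 6 + β * x 4, α * x 7 - β * x 3]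
  map_add' x y := by ext i; fin_cases i <;> simp <;> ring
  map_smul' c x := by ext i; fin_cases i <;> simp <;> ring

lemma octShortLin_apply (A : SpecialLinearGroup (Fin 2) K) (x : Fin 8 → K) : octShortLin A x =
    oct (A.1 1 1 * (A.1 0 0 * x 0 - A.1 0 1 * x 5) + A.1 1 0 * (A.1 0 0 * x 2 - A.1 0 1 * x 1))
      (A.1 0 1 * (-A.1 1 0 * x 0 + A.1 1 1 * x 5) + A.1 0 0 * (-A.1 1 0 * x 2 + A.1 1 1 * x 1))
      ![A.1 0 1 * (A.1 0 0 * x 0 - A.1 0 1 * x 5) + A.1 0 0 * (A.1 0 0 * x 2 - A.1 0 1 * x 1),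
        -A.1 1 0 * x 7 + A.1 1 1 * x 3, A.1 1 0 * x 6 + A.1 1 1 * x 4]
      ![A.1 1 1 * (-A.1 1 0 * x 0 + A.1 1 1 * x 5) + A.1 1 0 * (-A.1 1 0 * x 2 + A.1 1 1 * x 1),
        A.1 0 0 * x 6 + A.1 0 1 * x 4, A.1 0 0 * x 7 - A.1 0 1 * x 3] := rfl

/-- The homomorphism from `SL_2` given by a short root. -/
def octShort : SpecialLinearGroup (Fin 2) K →* GL (Fin 8) K :=
  MonoidHom.toHomUnits
    { toFun := fun A => LinearMap.toMatrix' (octShortLin A)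
      map_one' := by
        rw [show octShortLin (1 : SpecialLinearGroup (Fin 2) K) = LinearMap.id from
          LinearMap.ext fun x => by
            rw [octShortLin_apply]; ext i; fin_cases i <;> simp, LinearMap.toMatrix'_id]
      map_mul' := fun A B => by
        rw [← LinearMap.toMatrix'_comp]
        congr 1
        refine LinearMap.ext fun x => ?_
        rw [LinearMap.comp_apply, octShortLin_apply, octShortLin_apply, octShortLin_apply]
        ext i; fin_cases i <;> simp [Matrix.mul_apply, Fin.sum_univ_two] <;> ring }

lemma octShort_mulVec (A : SpecialLinearGroup (Fin 2) K) (x : Fin 8 → K) :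
    (octShort A).1 *ᵥ x = octShortLin A x := by
  rw [octShort, MonoidHom.coe_toHomUnits]
  simp only [MonoidHom.coe_mk, OneHom.coe_mk, LinearMap.toMatrix'_mulVec]

lemma octShort_upperUni (x : K) : octShort (upperUni x) = octE ![x, 0, 0] :=
  gl_ext_mulVec fun y => by
    induction y using oct_induction with | h a b v w
    rw [octShort_mulVec, octE_mulVec, octShortLin_apply]
    ext i; fin_cases i <;> simp [vec3_dotProduct, -sub_cons, -cons_sub, -add_cons, -cons_add, -cons_dotProduct, -dotProduct_cons] <;> ring

lemma octShort_lowerUni (x : K) : octShort (lowerUni x) = octF ![-x, 0, 0] :=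
  gl_ext_mulVec fun y => by
    induction y using oct_induction with | h a b v w
    rw [octShort_mulVec, octF_mulVec, octShortLin_apply]
    ext i; fin_cases i <;> simp [vec3_dotProduct, -sub_cons, -cons_sub, -add_cons, -cons_add, -cons_dotProduct, -dotProduct_cons] <;> ring

lemma octShort_diagSL2 (c : Kˣ) : octShort (diagSL2 c) =
    weightTorus octWeight fun i => c ^ (![2, -1] : Fin 2 → ℤ) i :=
  gl_ext_mulVec fun y => by
    induction y using oct_induction with | h a b v w
    rw [octShort_mulVec, octWeight_mulVec, octShortLin_apply]
    ext i; fin_cases i <;> simp [zpow_ofNat] <;> field_simp <;> simp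

lemma octShort_mem (A : SpecialLinearGroup (Fin 2) K) : octShort A ∈ autPts zornConst K :=
  sl2_mem_of_unipotents (N := (autPts zornConst K).comap octShort)
    (fun x => by rw [Subgroup.mem_comap, octShort_upperUni]; exact octE_mem _)
    (fun x => by rw [Subgroup.mem_comap, octShort_lowerUni]; exact octF_mem _) A

lemma weightTorus_conj_octE (z : Fin 2 → Kˣ) (u : Fin 3 → K) :
    weightTorus octWeight z * octE u * (weightTorus octWeight z)⁻¹ =
      octE ![z 0 * u 0, z 1 * u 1, ((z 0 * z 1)⁻¹ : Kˣ) * u 2] := by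
  rw [mul_inv_eq_iff_eq_mul]
  refine gl_ext_mulVec fun y => ?_
  induction y using oct_induction with | h a b v w
  rw [gl_mul_mulVec, gl_mul_mulVec, octWeight_mulVec, octE_mulVec, octE_mulVec, octWeight_mulVec]
  ext i; fin_cases i <;> simp [vec3_dotProduct, -sub_cons, -cons_sub, -add_cons, -cons_add, -cons_dotProduct, -dotProduct_cons] <;> field_simp

lemma weightTorus_conj_octF (z : Fin 2 → Kˣ) (u : Fin 3 → K) :
    weightTorus octWeight z * octF u * (weightTorus octWeight z)⁻¹ =
      octF ![((z 0)⁻¹ : Kˣ) * u 0, ((z 1)⁻¹ : Kˣ) * u 1, z 0 * z 1 * u 2] := by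
  rw [mul_inv_eq_iff_eq_mul]
  refine gl_ext_mulVec fun y => ?_
  induction y using oct_induction with | h a b v w
  rw [gl_mul_mulVec, gl_mul_mulVec, octWeight_mulVec, octF_mulVec, octF_mulVec, octWeight_mulVec]
  ext i; fin_cases i <;> simp [vec3_dotProduct, -sub_cons, -cons_sub, -add_cons, -cons_add, -cons_dotProduct, -dotProduct_cons] <;> field_simp

lemma isAlgSL2Hom_octShort : IsAlgSL2Hom (octShort : SpecialLinearGroup (Fin 2) K →* GL (Fin 8) K) := by
  refine isAlgSL2Hom_of_mulVec fun x i => ?_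
  have e := entry_mem_polySL2 (K := K)
  have c := const_mem_polySL2 (K := K)
  have m : ∀ {f g : SpecialLinearGroup (Fin 2) K → K}, f ∈ polySL2 K → g ∈ polySL2 K →
    (fun A => f A * g A) ∈ polySL2 K := fun hf hg => mul_mem hf hg
  have a : ∀ {f g : SpecialLinearGroup (Fin 2) K → K}, f ∈ polySL2 K → g ∈ polySL2 K →
    (fun A => f A + g A) ∈ polySL2 K := fun hf hg => add_mem hf hg
  have s : ∀ {f g : SpecialLinearGroup (Fin 2) K → K}, f ∈ polySL2 K → g ∈ polySL2 K →
    (fun A => f A - g A) ∈ polySL2 K := fun hf hg => sub_mem hf hg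
  have n : ∀ {f : SpecialLinearGroup (Fin 2) K → K}, f ∈ polySL2 K →
    (fun A => - f A) ∈ polySL2 K := fun hf => neg_mem hf
  simp only [octShort_mulVec, octShortLin_apply]
  fin_cases i
  · exact a (m (e 1 1) (s (m (e 0 0) (c _)) (m (e 0 1) (c _))))
      (m (e 1 0) (s (m (e 0 0) (c _)) (m (e 0 1) (c _))))
  · exact a (m (e 0 1) (a (m (n (e 1 0)) (c _)) (m (e 1 1) (c _))))
      (m (e 0 0) (a (m (n (e 1 0)) (c _)) (m (e 1 1) (c _))))
  · exact a (m (e 0 1) (s (m (e 0 0) (c _)) (m (e 0 1) (c _))))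
      (m (e 0 0) (s (m (e 0 0) (c _)) (m (e 0 1) (c _))))
  · exact a (m (n (e 1 0)) (c _)) (m (e 1 1) (c _))
  · exact a (m (e 1 0) (c _)) (m (e 1 1) (c _))
  · exact a (m (e 1 1) (a (m (n (e 1 0)) (c _)) (m (e 1 1) (c _))))
      (m (e 1 0) (a (m (n (e 1 0)) (c _)) (m (e 1 1) (c _))))
  · exact a (m (e 0 0) (c _)) (m (e 0 1) (c _))
  · exact s (m (e 0 0) (c _)) (m (e 0 1) (c _))

lemma octE_injective : Function.Injective (octE : (Fin 3 → K) → GL (Fin 8) K) := fun u u' h => by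
  have e := congrArg (fun g : GL (Fin 8) K => g.1 *ᵥ oct 1 0 0 0) h
  simp only [octE_mulVec, oct_inj] at e
  simpa using e.2.2.1

/-- A short root of `G_2` with its coroot. -/
lemma octShort_mem_rootPairs : ((![1, 0], ![2, -1]) : (Fin 2 → ℤ) × (Fin 2 → ℤ)) ∈
    rootPairs (autPts zornConst K) (weightTorus octWeight) := by
  refine ⟨octShort, isAlgSL2Hom_octShort, fun h => ?_, ?_, fun z x => ?_, fun z x => ?_,
    octShort_diagSL2⟩
  · have e : octE ![1, 0, 0] = octE (0 : Fin 3 → K) := by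
      have e1 := octShort_upperUni (1 : K)
      have e2 := octShort_upperUni (0 : K)
      rw [h] at e1 e2
      rw [← e1, MonoidHom.one_apply, ← MonoidHom.one_apply (upperUni (0 : K)), e2]
      congr 1; ext i; fin_cases i <;> rfl
    simpa using congrFun (octE_injective e) 0
  · rintro _ ⟨A, rfl⟩; exact octShort_mem A
  · rw [octShort_upperUni, octShort_upperUni, weightTorus_conj_octE]
    simp [monomialChar_two]
  · rw [octShort_lowerUni, octShort_lowerUni, weightTorus_conj_octF]
    simp [monomialChar_two]

/-- The block embedding of `SL_2` in `SL_3`. -/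
def blockSL3 : SpecialLinearGroup (Fin 2) K →* SpecialLinearGroup (Fin 3) K where
  toFun A := ⟨!![A.1 0 0, A.1 0 1, 0; A.1 1 0, A.1 1 1, 0; 0, 0, 1], by
    have := A.2
    rw [det_fin_two] at this
    rw [det_fin_three]; simp; linear_combination this⟩
  map_one' := by
    apply Subtype.ext
    change !![(1 : Matrix (Fin 2) (Fin 2) K) 0 0, (1 : Matrix (Fin 2) (Fin 2) K) 0 1, 0;
      (1 : Matrix (Fin 2) (Fin 2) K) 1 0, (1 : Matrix (Fin 2) (Fin 2) K) 1 1, 0; 0, 0, 1] = 1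
    ext i j; fin_cases i <;> fin_cases j <;> simp
  map_mul' A B := by
    apply Subtype.ext
    change !![(A.1 * B.1) 0 0, (A.1 * B.1) 0 1, 0; (A.1 * B.1) 1 0, (A.1 * B.1) 1 1, 0; 0, 0, 1] =
      !![A.1 0 0, A.1 0 1, 0; A.1 1 0, A.1 1 1, 0; 0, 0, 1] * !![B.1 0 0, B.1 0 1, 0; B.1 1 0, B.1 1 1, 0; 0, 0, 1]
    ext i j; fin_cases i <;> fin_cases j <;> simp [Matrix.mul_apply, Fin.sum_univ_two, Fin.sum_univ_three]

lemma blockSL3_val (A : SpecialLinearGroup (Fin 2) K) :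
    (blockSL3 A).1 = !![A.1 0 0, A.1 0 1, 0; A.1 1 0, A.1 1 1, 0; 0, 0, 1] := rfl

lemma blockSL3_inv_val (A : SpecialLinearGroup (Fin 2) K) :
    ((blockSL3 A)⁻¹).1 = !![A.1 1 1, -A.1 0 1, 0; -A.1 1 0, A.1 0 0, 0; 0, 0, 1] := by
  rw [← map_inv, blockSL3_val, Matrix.SpecialLinearGroup.coe_inv, adjugate_fin_two]; simp

/-- The homomorphism from `SL_2` given by a long root. -/
def octLong : SpecialLinearGroup (Fin 2) K →* GL (Fin 8) K := octSL.comp blockSL3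

lemma octLong_mulVec (A : SpecialLinearGroup (Fin 2) K) (a b : K) (v w : Fin 3 → K) :
    (octLong A).1 *ᵥ oct a b v w =
      oct a b ![A.1 0 0 * v 0 + A.1 0 1 * v 1, A.1 1 0 * v 0 + A.1 1 1 * v 1, v 2]
        ![A.1 1 1 * w 0 - A.1 1 0 * w 1, -A.1 0 1 * w 0 + A.1 0 0 * w 1, w 2] := by
  rw [octLong, MonoidHom.comp_apply, octSL_mulVec, blockSL3_inv_val, blockSL3_val]
  ext i; fin_cases i <;> simp [mulVec, dotProduct, Fin.sum_univ_three] <;> ring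

lemma isAlgSL2Hom_octLong : IsAlgSL2Hom (octLong : SpecialLinearGroup (Fin 2) K →* GL (Fin 8) K) := by
  refine isAlgSL2Hom_of_mulVec fun x i => ?_
  have e := entry_mem_polySL2 (K := K)
  have c := const_mem_polySL2 (K := K)
  have m : ∀ {f g : SpecialLinearGroup (Fin 2) K → K}, f ∈ polySL2 K → g ∈ polySL2 K →
    (fun A => f A * g A) ∈ polySL2 K := fun hf hg => mul_mem hf hg
  have a : ∀ {f g : SpecialLinearGroup (Fin 2) K → K}, f ∈ polySL2 K → g ∈ polySL2 K →
    (fun A => f A + g A) ∈ polySL2 K := fun hf hg => add_mem hf hg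
  have s : ∀ {f g : SpecialLinearGroup (Fin 2) K → K}, f ∈ polySL2 K → g ∈ polySL2 K →
    (fun A => f A - g A) ∈ polySL2 K := fun hf hg => sub_mem hf hg
  have n : ∀ {f : SpecialLinearGroup (Fin 2) K → K}, f ∈ polySL2 K →
    (fun A => - f A) ∈ polySL2 K := fun hf => neg_mem hf
  induction x using oct_induction with | h p q v w
  simp only [octLong_mulVec]
  fin_cases i
  exacts [c _, c _, a (m (e 0 0) (c _)) (m (e 0 1) (c _)), a (m (e 1 0) (c _)) (m (e 1 1) (c _)), c _,
    s (m (e 1 1) (c _)) (m (e 1 0) (c _)), a (m (n (e 0 1)) (c _)) (m (e 0 0) (c _)), c _]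

/-- A long root of `G_2` with its coroot. -/
lemma octLong_mem_rootPairs : ((![1, -1], ![1, -1]) : (Fin 2 → ℤ) × (Fin 2 → ℤ)) ∈
    rootPairs (autPts zornConst K) (weightTorus octWeight) := by
  refine ⟨octLong, isAlgSL2Hom_octLong, fun h => ?_, ?_, fun z x => ?_, fun z x => ?_, fun c => ?_⟩
  · have e := octLong_mulVec (upperUni (1 : K)) 0 0 ![0, 1, 0] 0
    rw [h] at e
    simpa using congrFun e 2
  · rintro _ ⟨A, rfl⟩; exact octSL_mem _
  · rw [mul_inv_eq_iff_eq_mul]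
    refine gl_ext_mulVec fun y => ?_
    induction y using oct_induction with | h a b v w
    rw [gl_mul_mulVec, gl_mul_mulVec, octWeight_mulVec, octLong_mulVec, octLong_mulVec, octWeight_mulVec,
      monomialChar_two]
    ext i; fin_cases i <;> simp [vec3_dotProduct, -sub_cons, -cons_sub, -add_cons, -cons_add, -cons_dotProduct, -dotProduct_cons] <;> field_simp
  · rw [mul_inv_eq_iff_eq_mul]
    refine gl_ext_mulVec fun y => ?_
    induction y using oct_induction with | h a b v w
    rw [gl_mul_mulVec, gl_mul_mulVec, octWeight_mulVec, octLong_mulVec, octLong_mulVec, octWeight_mulVec,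
      monomialChar_two]
    ext i; fin_cases i <;> simp [vec3_dotProduct, -sub_cons, -cons_sub, -add_cons, -cons_add, -cons_dotProduct, -dotProduct_cons] <;> field_simp
  · refine gl_ext_mulVec fun y => ?_
    induction y using oct_induction with | h a b v w
    rw [octWeight_mulVec, octLong_mulVec]
    ext i; fin_cases i <;> simp

end OctRoots

/-! ### The root datum of the automorphism group of the octonions -/

section OctRootSystem

/-- The roots and coroots of the automorphism group of the octonions. -/
def octRoots : Finset ((Fin 2 → ℤ) × (Fin 2 → ℤ)) :=
  {(![1, 0], ![2, -1]), (![0, 1], ![-1, 2]), (![-1, -1], ![-1, -1]),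
    (![-1, 0], ![-2, 1]), (![0, -1], ![1, -2]), (![1, 1], ![1, 1]),
    (![1, -1], ![1, -1]), (![1, 2], ![0, 1]), (![-2, -1], ![-1, 0]),
    (![-1, 1], ![-1, 1]), (![-1, -2], ![0, -1]), (![2, 1], ![1, 0])}

/-- If all weights have coordinates at most one, the reflections in the roots bound the roots and
the coroots. -/
lemma bound_of_reflection {ι : Type} {χ : ι → Fin 2 → ℤ} {e : Fin 2 → ι}
    (he : ∀ l, χ (e l) = Pi.single l 1) (hχ : ∀ i l, |χ i l| ≤ 1) {m n : Fin 2 → ℤ}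
    (hmn : m ⬝ᵥ n = 2) (hr : ∀ i, ∃ j, χ j = χ i - (χ i ⬝ᵥ n) • m) :
    ∀ l, (-2 ≤ m l ∧ m l ≤ 2) ∧ (-2 ≤ n l ∧ n l ≤ 2) := by
  have key : ∀ k l, |n k * m l| ≤ 2 := by
    intro k l
    obtain ⟨j, hj⟩ := hr (e k)
    rw [he, single_one_dotProduct] at hj
    have h1 := congrFun hj l
    rw [Pi.sub_apply, Pi.smul_apply, smul_eq_mul, ← he k] at h1
    have h2 := hχ j l
    have h3 := hχ (e k) l
    rw [abs_le] at *
    constructor <;> linarith [h2.1, h2.2, h3.1, h3.2]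
  have small : ∀ a b : ℤ, a ≠ 0 → |a * b| ≤ 2 → -2 ≤ b ∧ b ≤ 2 := by
    intro a b ha hab
    rw [abs_mul] at hab
    have h1 : 1 ≤ |a| := Int.one_le_abs ha
    rw [← abs_le]
    nlinarith [abs_nonneg b]
  have hn : ∃ k, n k ≠ 0 := by
    by_contra! h
    rw [show n = 0 from funext h, dotProduct_zero] at hmn
    norm_num at hmn
  have hm : ∃ k, m k ≠ 0 := by
    by_contra! h
    rw [show m = 0 from funext h, zero_dotProduct] at hmn
    norm_num at hmn
  obtain ⟨k, hk⟩ := hn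
  obtain ⟨k', hk'⟩ := hm
  exact fun l => ⟨small _ _ hk (key k l), small _ _ hk' (by rw [mul_comm]; exact key l k')⟩

set_option synthInstance.maxHeartbeats 200000 in
set_option synthInstance.maxSize 2000 in
/-- Among all pairs with coordinates of absolute value at most `2`, only the roots and coroots of `G_2`
have pairing `2` and define a reflection which preserves the weights of the octonions. -/
lemma mem_octRoots_of_reflection : ∀ m0 ∈ Finset.Icc (-2 : ℤ) 2, ∀ m1 ∈ Finset.Icc (-2 : ℤ) 2,
    ∀ n0 ∈ Finset.Icc (-2 : ℤ) 2, ∀ n1 ∈ Finset.Icc (-2 : ℤ) 2, m0 * n0 + m1 * n1 = 2 →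
      (∀ i, ∃ j, octWeight j 0 = octWeight i 0 - (octWeight i 0 * n0 + octWeight i 1 * n1) * m0 ∧
        octWeight j 1 = octWeight i 1 - (octWeight i 0 * n0 + octWeight i 1 * n1) * m1) →
      (![m0, m1], ![n0, n1]) ∈ octRoots := by
  decide +kernel

variable {K : Type*} [Field K]

/-- An element of the group which normalizes the torus permutes the roots. -/
lemma mem_rootPairs_of_normalizer {ι : Type} [Fintype ι] [DecidableEq ι] {r : ℕ}
    {H : Subgroup (GL ι K)} {a : (Fin r → Kˣ) →* GL ι K} {g : GL ι K} (hg : g ∈ H)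
    {C C' : Matrix (Fin r) (Fin r) ℤ} (hC : C * C' = 1)
    (h : ∀ z, g * a z * g⁻¹ = a (matTorus C z)) {m n : Fin r → ℤ} :
    (m, n) ∈ rootPairs H a ↔ (C'ᵀ *ᵥ m, C *ᵥ n) ∈ rootPairs H a := by
  have h1 : conjHom g a = a.comp (matTorusHom C) := by ext1 z; exact h z
  rw [← mem_rootPairs_comp_matTorusHom H a hC, ← h1]
  conv_rhs => rw [← conjSub_of_mem hg]
  rw [rootPairs_conj]

/-- The cyclic permutation of the coordinates, in `SL_3`. -/
def cycleSL3 (K : Type*) [Field K] : SpecialLinearGroup (Fin 3) K :=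
  ⟨!![0, 0, 1; 1, 0, 0; 0, 1, 0], by rw [det_fin_three]; simp⟩

lemma cycleSL3_val : (cycleSL3 K).1 = !![0, 0, 1; 1, 0, 0; 0, 1, 0] := rfl

lemma cycleSL3_inv_val : ((cycleSL3 K)⁻¹).1 = !![0, 1, 0; 0, 0, 1; 1, 0, 0] := by
  rw [Matrix.SpecialLinearGroup.coe_inv, cycleSL3_val, adjugate_fin_three]
  ext i j; fin_cases i <;> fin_cases j <;> simp

lemma octCycle_mulVec (a b : K) (v w : Fin 3 → K) : (octSL (cycleSL3 K)).1 *ᵥ oct a b v w =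
    oct a b ![v 2, v 0, v 1] ![w 2, w 0, w 1] := by
  rw [octSL_mulVec, cycleSL3_inv_val, cycleSL3_val]
  ext i; fin_cases i <;> simp [mulVec, dotProduct, Fin.sum_univ_three]

lemma octCycle_conj (z : Fin 2 → Kˣ) :
    octSL (cycleSL3 K) * weightTorus octWeight z * (octSL (cycleSL3 K))⁻¹ =
      weightTorus octWeight (matTorus !![-1, -1; 1, 0] z) := by
  rw [mul_inv_eq_iff_eq_mul]
  refine gl_ext_mulVec fun x => ?_
  induction x using oct_induction with | h a b v w
  rw [gl_mul_mulVec, gl_mul_mulVec, octWeight_mulVec, octCycle_mulVec, octCycle_mulVec, octWeight_mulVec]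
  ext i; fin_cases i <;>
    simp [matTorus, Fin.prod_univ_two, -mul_eq_mul_right_iff, -mul_eq_mul_left_iff] <;> field_simp

variable [IsAlgClosed K] [CharZero K]

/-- The root datum of `G_2`. The reflections in the roots permute the weights of the octonions, which
leaves only the twelve listed pairs; these arise from a short and a long root by negation and by
the cyclic permutation in `SL_3`. -/
theorem rootPairs_oct : rootPairs (autPts zornConst K) (weightTorus octWeight) = octRoots := by
  ext ⟨m, n⟩
  constructor
  · intro h
    have hmn := dotProduct_eq_two_of_mem_rootPairs h
    have hr := exists_reflection_of_mem_rootPairs h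
    have hb := bound_of_reflection (isSplitModel_oct (K := K)).coord (by decide) hmn hr
    have e : ∀ x : Fin 2 → ℤ, x = ![x 0, x 1] := fun x => by ext i; fin_cases i <;> rfl
    rw [Finset.mem_coe, e m, e n]
    refine mem_octRoots_of_reflection _ (Finset.mem_Icc.2 (hb 0).1) _ (Finset.mem_Icc.2 (hb 1).1) _
      (Finset.mem_Icc.2 (hb 0).2) _ (Finset.mem_Icc.2 (hb 1).2) ?_ fun i => ?_
    · simpa only [dotProduct, Fin.sum_univ_two] using hmn
    · obtain ⟨j, hj⟩ := hr i
      exact ⟨j, by simpa [dotProduct, Fin.sum_univ_two] using congrFun hj 0,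
        by simpa [dotProduct, Fin.sum_univ_two] using congrFun hj 1⟩
  · have hcyc : ∀ {m n : Fin 2 → ℤ} (m' n' : Fin 2 → ℤ),
        (m, n) ∈ rootPairs (autPts zornConst K) (weightTorus octWeight) →
        (!![0, 1; -1, -1])ᵀ *ᵥ m = m' → !![-1, -1; 1, 0] *ᵥ n = n' →
        (m', n') ∈ rootPairs (autPts zornConst K) (weightTorus octWeight) := by
      rintro m n _ _ h rfl rfl
      exact (mem_rootPairs_of_normalizer (octSL_mem (cycleSL3 K)) (C' := !![0, 1; -1, -1])
        (by decide) octCycle_conj).1 h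
    have hneg : ∀ {m n : Fin 2 → ℤ} (m' n' : Fin 2 → ℤ),
        (m, n) ∈ rootPairs (autPts zornConst K) (weightTorus octWeight) → -m = m' → -n = n' →
        (m', n') ∈ rootPairs (autPts zornConst K) (weightTorus octWeight) := by
      rintro m n _ _ h rfl rfl
      exact neg_mem_rootPairs h
    have s1 := octShort_mem_rootPairs (K := K)
    have s2 := hcyc ![0, 1] ![-1, 2] s1 (by decide) (by decide)
    have s3 := hcyc ![-1, -1] ![-1, -1] s2 (by decide) (by decide)
    have l1 := octLong_mem_rootPairs (K := K)
    have l2 := hcyc ![1, 2] ![0, 1] l1 (by decide) (by decide)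
    have l3 := hcyc ![-2, -1] ![-1, 0] l2 (by decide) (by decide)
    intro h
    simp only [octRoots, Finset.coe_insert, Finset.coe_singleton, Set.mem_insert_iff,
      Set.mem_singleton_iff] at h
    rcases h with h | h | h | h | h | h | h | h | h | h | h | h <;> rw [h]
    exacts [s1, s2, s3, hneg _ _ s1 (by decide) (by decide), hneg _ _ s2 (by decide) (by decide),
      hneg _ _ s3 (by decide) (by decide), l1, l2, l3, hneg _ _ l1 (by decide) (by decide),
      hneg _ _ l2 (by decide) (by decide), hneg _ _ l3 (by decide) (by decide)]

end OctRootSystem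

/-! ### Connectedness and reductivity of the automorphism group of the octonions -/

section Connected

variable {K : Type*} [Field K] [IsAlgClosed K] [CharZero K]

/-- The special linear group over an algebraically closed field of characteristic zero has no proper
subgroups of finite index. -/
lemma range_le_of_relIndex_ne_zero {n : ℕ} [Nontrivial (Fin n)] {G : Type*} [Group G]
    {f : SpecialLinearGroup (Fin n) K →* G} {H N : Subgroup G} (hf : f.range ≤ H)
    (hN : N.relIndex H ≠ 0) : f.range ≤ N := by
  rintro _ ⟨A, rfl⟩
  refine Matrix.SpecialLinearGroup.diagonal_transvection_induction' (fun A => f A ∈ N) A ?_ ?_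
    (fun A B hA hB => by simp only [map_mul]; exact mul_mem hA hB)
  · intro i j hij c hc
    refine mem_of_forall_exists_pow hN fun k hk => ?_
    obtain ⟨d, hd⟩ := IsAlgClosed.exists_pow_nat_eq c hk
    have hd0 : d ≠ 0 := by rintro rfl; rw [zero_pow hk.ne'] at hd; exact hc hd.symm
    refine ⟨_, hf ⟨Matrix.SpecialLinearGroup.diag2n hij d hd0, rfl⟩, ?_⟩
    rw [← map_pow]
    congr 1
    apply Subtype.ext
    rw [Matrix.SpecialLinearGroup.coe_pow, Matrix.SpecialLinearGroup.diag2n_coe,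
      Matrix.SpecialLinearGroup.diag2n_coe, diagonal_pow]
    congr 1
    ext l
    simp only [Pi.pow_apply]
    split_ifs <;> simp [hd]
  · intro i j hij c
    refine mem_of_forall_exists_pow hN fun k hk => ?_
    refine ⟨_, hf ⟨Matrix.SpecialLinearGroup.transvection hij (c / k), rfl⟩, ?_⟩
    rw [← map_pow]
    congr 1
    have hpow : ∀ (b : K) (l : ℕ), Matrix.SpecialLinearGroup.transvection hij b ^ l =
        Matrix.SpecialLinearGroup.transvection hij (l * b) := by
      intro b l
      induction l with
      | zero => simp
      | succ l ih =>
        rw [pow_succ, ih, ← Matrix.SpecialLinearGroup.transvection_add]; congr 1; push_cast; ring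
    rw [hpow, mul_div_cancel₀ _ (Nat.cast_ne_zero.2 hk.ne')]

lemma octE_mem_of_relIndex_ne_zero {H N : Subgroup (GL (Fin 8) K)} (hN : N.relIndex H ≠ 0)
    {u : Fin 3 → K} (h : ∀ c : K, octE (c • u) ∈ H) : octE u ∈ N :=
  mem_of_forall_exists_pow hN fun k hk => ⟨octE ((k : K)⁻¹ • u), h _, by
    rw [octE_pow, smul_smul, mul_inv_cancel₀ (Nat.cast_ne_zero.2 hk.ne'), one_smul]⟩

lemma octF_mem_of_relIndex_ne_zero {H N : Subgroup (GL (Fin 8) K)} (hN : N.relIndex H ≠ 0)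
    {u : Fin 3 → K} (h : ∀ c : K, octF (c • u) ∈ H) : octF u ∈ N :=
  mem_of_forall_exists_pow hN fun k hk => ⟨octF ((k : K)⁻¹ • u), h _, by
    rw [octF_pow, smul_smul, mul_inv_cancel₀ (Nat.cast_ne_zero.2 hk.ne'), one_smul]⟩

/-- The automorphism group of the octonions is generated by unipotent elements and `SL_3`, which all lie
in each closed subgroup of finite index. -/
theorem isZConnected_oct : IsZConnected (autPts zornConst K) := by
  refine isZConnected_of_forall (isZClosed_autPts _) fun N hle hN g hg => ?_
  obtain ⟨h1, h2⟩ := oct_idempotent_mulVec hg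
  obtain ⟨x, hx, hxg⟩ := exists_move_idempotent (N := N) (P := ⊤) (Q := ⊤)
    (fun u _ => octE_mem_of_relIndex_ne_zero hN fun c => octE_mem _)
    (fun u _ => octF_mem_of_relIndex_ne_zero hN fun c => octF_mem _)
    (u₀ := ![1, 0, 0]) (w₀ := ![1, 0, 0]) trivial trivial (by simp) trivial trivial h1 h2
  obtain ⟨A, hA⟩ := exists_octSL_eq (mul_mem (hle hx) hg) (by rw [gl_mul_mulVec, hxg])
  have : octSL A ∈ N := range_le_of_relIndex_ne_zero (f := octSL)
    (by rintro _ ⟨B, rfl⟩; exact octSL_mem B) hN ⟨A, rfl⟩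
  rw [hA] at this
  exact (Subgroup.mul_mem_cancel_left _ hx).1 this

/-- The fixed vectors of a normal unipotent subgroup in a stable subspace form a nonzero stable
subspace. -/
lemma exists_stable_fixed {ι : Type} [Fintype ι] [DecidableEq ι] {H U : Subgroup (GL ι K)}
    (hUH : U ≤ H) (hn : ∀ h ∈ H, ∀ n ∈ U, h * n * h⁻¹ ∈ U) (hu : ∀ n ∈ U, IsNilpotent (n.1 - 1))
    {V : Submodule K (ι → K)} (hV : V ≠ ⊥) (hst : ∀ h ∈ H, ∀ x ∈ V, h.1 *ᵥ x ∈ V) :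
    ∃ Y : Submodule K (ι → K), Y ≠ ⊥ ∧ Y ≤ V ∧ (∀ h ∈ H, ∀ x ∈ Y, h.1 *ᵥ x ∈ Y) ∧
      ∀ n ∈ U, ∀ x ∈ Y, n.1 *ᵥ x = x := by
  obtain ⟨x, hxV, hx0, hx⟩ := exists_fixed_vector_of_unipotent hu V hV fun u hu => hst u (hUH hu)
  refine ⟨{ carrier := {y | y ∈ V ∧ ∀ n ∈ U, n.1 *ᵥ y = y}, add_mem' := ?_, zero_mem' := ?_, smul_mem' := ?_ },
    ?_, fun y hy => hy.1, fun h hh y hy => ⟨hst h hh y hy.1, fun n hnU => ?_⟩, fun n hnU y hy => hy.2 n hnU⟩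
  · rintro y z ⟨h1, h2⟩ ⟨h3, h4⟩
    exact ⟨V.add_mem h1 h3, fun n hn => by rw [mulVec_add, h2 n hn, h4 n hn]⟩
  · exact ⟨V.zero_mem, fun n _ => mulVec_zero _⟩
  · rintro c y ⟨h1, h2⟩
    exact ⟨V.smul_mem c h1, fun n hn => by rw [mulVec_smul, h2 n hn]⟩
  · rw [Submodule.ne_bot_iff]; exact ⟨x, ⟨hxV, hx⟩, hx0⟩
  · have h1 := hy.2 _ (hn h⁻¹ (inv_mem hh) n hnU)
    have h2 := congrArg (fun v => h.1 *ᵥ v) h1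
    simpa only [inv_inv, gl_mul_mulVec, gl_mulVec_inv_mulVec] using h2

/-- The octonions of trace zero form an irreducible representation. -/
lemma oct_irreducible {Y : Submodule K (Fin 8 → K)} (hY : Y ≠ ⊥) (h0 : ∀ x ∈ Y, x 0 + x 1 = 0)
    (hE : ∀ u, ∀ x ∈ Y, (octE u).1 *ᵥ x ∈ Y) (hF : ∀ u, ∀ x ∈ Y, (octF u).1 *ᵥ x ∈ Y) :
    ∀ x : Fin 8 → K, x 0 + x 1 = 0 → x ∈ Y := by
  have hz : ∀ {a b : K} {v w : Fin 3 → K}, oct a b v w ∈ Y → b = -a := fun h => by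
    have := h0 _ h
    simp at this
    linear_combination this
  -- the second difference along an upper unipotent extracts a component
  have hsecE : ∀ {a b : K} {v w : Fin 3 → K} (u : Fin 3 → K), oct a b v w ∈ Y → u ⬝ᵥ w ≠ 0 →
      oct 0 0 u 0 ∈ Y := by
    intro a b v w u h huw
    have h1 := Y.sub_mem (Y.add_mem (hE u _ h) (hE (-u) _ h)) (Y.add_mem h h)
    have h2 : (octE u).1 *ᵥ oct a b v w + (octE (-u)).1 *ᵥ oct a b v w - (oct a b v w + oct a b v w)
        = (-2 * (u ⬝ᵥ w)) • oct 0 0 u 0 := by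
      rw [octE_mulVec, octE_mulVec]
      ext i; fin_cases i <;> simp [vec3_dotProduct] <;> ring
    rw [h2] at h1
    exact (Y.smul_mem_iff (mul_ne_zero (neg_ne_zero.2 two_ne_zero) huw)).1 h1
  have hsecF : ∀ {a b : K} {v w : Fin 3 → K} (u : Fin 3 → K), oct a b v w ∈ Y → u ⬝ᵥ v ≠ 0 →
      oct 0 0 0 u ∈ Y := by
    intro a b v w u h huv
    have h1 := Y.sub_mem (Y.add_mem (hF u _ h) (hF (-u) _ h)) (Y.add_mem h h)
    have h2 : (octF u).1 *ᵥ oct a b v w + (octF (-u)).1 *ᵥ oct a b v w - (oct a b v w + oct a b v w)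
        = (-2 * (u ⬝ᵥ v)) • oct 0 0 0 u := by
      rw [octF_mulVec, octF_mulVec]
      ext i; fin_cases i <;> simp [vec3_dotProduct] <;> ring
    rw [h2] at h1
    exact (Y.smul_mem_iff (mul_ne_zero (neg_ne_zero.2 two_ne_zero) huv)).1 h1
  have hdual : ∀ {w : Fin 3 → K}, w ≠ 0 → ∃ u : Fin 3 → K, u ⬝ᵥ w ≠ 0 := fun {w} hw => by
    by_contra! h
    exact hw (dotProduct_eq_zero_iff.1 fun u => by rw [dotProduct_comm]; exact h u)
  have hV : ∀ {a b : K} {v w : Fin 3 → K}, oct a b v w ∈ Y → w ≠ 0 → ∀ u, oct 0 0 u 0 ∈ Y := by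
    intro a b v w h hw u
    by_cases huw : u ⬝ᵥ w = 0
    · obtain ⟨u', hu'⟩ := hdual hw
      have h1 := Y.sub_mem (hsecE (u + u') h (by rwa [add_dotProduct, huw, zero_add])) (hsecE u' h hu')
      convert h1 using 1
      ext i; fin_cases i <;> simp
    · exact hsecE u h huw
  have hW : ∀ {a b : K} {v w : Fin 3 → K}, oct a b v w ∈ Y → v ≠ 0 → ∀ u, oct 0 0 0 u ∈ Y := by
    intro a b v w h hv u
    by_cases huv : u ⬝ᵥ v = 0
    · obtain ⟨u', hu'⟩ := hdual hv
      have h1 := Y.sub_mem (hsecF (u + u') h (by rwa [add_dotProduct, huv, zero_add])) (hsecF u' h hu')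
      convert h1 using 1
      ext i; fin_cases i <;> simp
    · exact hsecF u h huv
  have hone : (![1, 0, 0] : Fin 3 → K) ≠ 0 := fun h => by simpa using congrFun h 0
  -- some vector of `Y` has a nonzero lower part
  obtain ⟨a, b, v, w, h1, hw⟩ : ∃ (a b : K) (v w : Fin 3 → K), oct a b v w ∈ Y ∧ w ≠ 0 := by
    obtain ⟨x, hx, hx0⟩ := (Submodule.ne_bot_iff _).1 hY
    induction x using oct_induction with | h a b v w
    by_cases hw : w = 0
    · by_cases hv : v = 0
      · subst hw hv
        have hb := hz hx
        have ha : a ≠ 0 := by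
          rintro rfl
          exact hx0 (by rw [hb, neg_zero, oct_zero_zero])
        have h1 := hF ![1, 0, 0] _ hx
        rw [octF_mulVec] at h1
        refine ⟨_, _, _, _, h1, fun h => ?_⟩
        have := congrFun h 0
        rw [hb] at this
        simp at this
        exact ha (by simpa using this)
      · exact ⟨_, _, _, _, hW hx hv ![1, 0, 0], hone⟩
    · exact ⟨_, _, _, _, hx, hw⟩
  have h2 := hV h1 hw
  have h3 := hW (h2 ![1, 0, 0]) hone
  have h4 : oct 1 (-1) 0 0 ∈ Y := by
    have h5 := Y.sub_mem (Y.sub_mem (h3 ![1, 0, 0]) (hE ![1, 0, 0] _ (h3 ![1, 0, 0])))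
      (h2 ![1, 0, 0])
    convert h5 using 1
    rw [octE_mulVec]
    ext i; fin_cases i <;> simp
  intro x hx
  induction x using oct_induction with | h a b v w
  simp only [oct_zero, oct_one] at hx
  have h5 := Y.add_mem (Y.add_mem (Y.smul_mem a h4) (h2 v)) (h3 w)
  convert h5 using 1
  rw [oct_smul, oct_add, oct_add, oct_inj]
  refine ⟨by ring, by linear_combination hx, by simp, by simp⟩

/-- A normal unipotent subgroup fixes all octonions of trace zero, by irreducibility, and fixes `1`. -/
theorem isConnectedReductive_oct : IsConnectedReductive (autPts zornConst K) := by
  refine ⟨isZClosed_autPts _, isZConnected_oct, fun U hUH _ _ hn hu => ?_⟩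
  let V : Submodule K (Fin 8 → K) :=
    { carrier := {x | x 0 + x 1 = 0}
      add_mem' := fun {x y} hx hy => by
        simp only [Set.mem_ofPred_eq, Pi.add_apply] at *; linear_combination hx + hy
      zero_mem' := by simp
      smul_mem' := fun c x hx => by
        simp only [Set.mem_ofPred_eq, Pi.smul_apply, smul_eq_mul] at *; linear_combination c * hx }
  have hV : V ≠ ⊥ := by
    rw [Submodule.ne_bot_iff]
    refine ⟨oct 0 0 ![1, 0, 0] 0, by simp [V], fun h => ?_⟩
    simpa using congrFun h 2
  obtain ⟨Y, hY, hYV, hst, hfix⟩ := exists_stable_fixed hUH hn hu hV fun h hh x hx =>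
    (trace_norm_map hh x).1.trans hx
  have hall := oct_irreducible hY (fun x hx => hYV hx) (fun u => hst _ (octE_mem u))
    fun u => hst _ (octF_mem u)
  rw [Subgroup.eq_bot_iff_forall]
  intro n hnU
  refine gl_ext_mulVec fun x => ?_
  have e : x = (2⁻¹ * (x 0 + x 1)) • oct 1 1 0 0 + (x - (2⁻¹ * (x 0 + x 1)) • oct 1 1 0 0) := by abel
  have h1 := hfix n hnU (x - (2⁻¹ * (x 0 + x 1)) • oct 1 1 0 0) (hall _ (by
    simp only [Pi.sub_apply, Pi.smul_apply, oct_zero, oct_one, smul_eq_mul]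
    field_simp; ring))
  rw [e, mulVec_add, mulVec_smul, map_one_oct (hUH hnU), h1, Units.val_one, one_mulVec]

end Connected

/-! ### Two-sided multiplication on matrices -/

section Kron

variable {K : Type*} [Field K] {m n : Type} [Fintype m] [DecidableEq m] [Fintype n] [DecidableEq n]

/-- The entries of a matrix as a vector. -/
def matVec : Matrix m n K ≃ₗ[K] (m × n → K) where
  toFun X p := X p.1 p.2
  map_add' _ _ := rfl
  map_smul' _ _ := rfl
  invFun x := Matrix.of fun i j => x (i, j)
  left_inv _ := rfl
  right_inv _ := rfl

lemma matVec_apply (X : Matrix m n K) (p : m × n) : matVec X p = X p.1 p.2 := rfl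

lemma matVec_symm_apply (x : m × n → K) (i : m) (j : n) : matVec.symm x i j = x (i, j) := rfl

lemma matVec_single (i : m) (j : n) : matVec (Matrix.single i j (1 : K)) = Pi.single (i, j) 1 := by
  ext ⟨k, l⟩
  simp [matVec_apply, Matrix.single_apply, Pi.single_apply, Prod.ext_iff, eq_comm]

lemma kron_mulVec (A : Matrix m m K) (B : Matrix n n K) (X : Matrix m n K) :
    kroneckerMap (· * ·) A B *ᵥ matVec X = matVec (A * X * Bᵀ) := by
  ext ⟨i, j⟩
  simp only [mulVec, dotProduct, kroneckerMap_apply, matVec_apply, Matrix.mul_apply, transpose_apply,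
    Fintype.sum_prod_type, Finset.sum_mul]
  rw [Finset.sum_comm]
  exact Finset.sum_congr rfl fun k _ => Finset.sum_congr rfl fun l _ => by ring

/-- Two-sided multiplication `X ↦ g X h⁻¹` on matrices. -/
def kronHom : GL m K × GL n K →* GL (m × n) K :=
  MonoidHom.toHomUnits
    { toFun := fun p => kroneckerMap (· * ·) p.1.1 ((p.2⁻¹).1)ᵀ
      map_one' := by
        simp only [Prod.fst_one, Prod.snd_one, inv_one, Units.val_one, transpose_one]
        exact one_kronecker_one
      map_mul' := fun p q => by
        simp only [Prod.fst_mul, Prod.snd_mul, _root_.mul_inv_rev, Units.val_mul, transpose_mul]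
        exact mul_kronecker_mul _ _ _ _ }

lemma kronHom_val (g : GL m K) (h : GL n K) :
    (kronHom (g, h)).1 = kroneckerMap (· * ·) g.1 ((h⁻¹).1)ᵀ := rfl

lemma kronHom_mulVec (g : GL m K) (h : GL n K) (X : Matrix m n K) :
    (kronHom (g, h)).1 *ᵥ matVec X = matVec (g.1 * X * (h⁻¹).1) := by
  rw [kronHom_val, kron_mulVec, transpose_transpose]

lemma gl_ext_matVec {g h : GL (m × n) K} (H : ∀ X : Matrix m n K, g.1 *ᵥ matVec X = h.1 *ᵥ matVec X) :
    g = h := gl_ext_mulVec fun x => by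
  obtain ⟨X, rfl⟩ := matVec.surjective x; exact H X

lemma gl_mul_inv_val (g : GL m K) : g.1 * (g⁻¹).1 = 1 := by rw [← Units.val_mul, mul_inv_cancel]; rfl
lemma gl_inv_mul_val (g : GL m K) : (g⁻¹).1 * g.1 = 1 := by rw [← Units.val_mul, inv_mul_cancel]; rfl

end Kron

/-! ### Automorphisms of the algebra of `3 × 3` matrices -/

section PGL3

variable {K : Type*} [Field K]

lemma scMul_mat3 (X Y : Matrix (Fin 3) (Fin 3) K) :
    scMul mat3Const (matVec X) (matVec Y) = matVec (X * Y) := by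
  ext ⟨a, b⟩
  have hc : ∀ i j : Fin 3 × Fin 3, (mat3Const i j (a, b) : K) =
      if i.1 = a ∧ j.2 = b ∧ i.2 = j.1 then 1 else 0 := by
    intro i j
    rw [mat3Const]
    by_cases h : i.2 = j.1
    · rw [← h, Matrix.single_mul_single_same]
      simp [Matrix.single_apply, h]
    · rw [Matrix.single_mul_single_of_ne _ _ _ _ h]
      simp [h]
  simp only [scMul, hc, matVec_apply, Matrix.mul_apply, Fintype.sum_prod_type]
  rw [Finset.sum_eq_single a, Finset.sum_congr rfl]
  · intro k _
    rw [Finset.sum_eq_single k, Finset.sum_eq_single b]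
    · simp
    · intro l _ hl; simp [hl]
    · simp
    · intro l _ hl; exact Finset.sum_eq_zero fun x _ => by simp [Ne.symm hl]
    · simp
  · intro k _ hk
    exact Finset.sum_eq_zero fun _ _ => Finset.sum_eq_zero fun _ _ => Finset.sum_eq_zero fun _ _ => by
      simp [hk]
  · simp

/-- Conjugation of matrices. -/
def adHom : GL (Fin 3) K →* GL (Fin 3 × Fin 3) K :=
  kronHom.comp ((MonoidHom.id _).prod (MonoidHom.id _))

lemma adHom_val (g : GL (Fin 3) K) : (adHom g).1 = kroneckerMap (· * ·) g.1 ((g⁻¹).1)ᵀ := rfl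

lemma adHom_mulVec (g : GL (Fin 3) K) (X : Matrix (Fin 3) (Fin 3) K) :
    (adHom g).1 *ᵥ matVec X = matVec (g.1 * X * (g⁻¹).1) := kronHom_mulVec g g X

lemma adHom_mem (g : GL (Fin 3) K) : adHom g ∈ autPts mat3Const K := fun x y => by
  obtain ⟨X, rfl⟩ := matVec.surjective x
  obtain ⟨Y, rfl⟩ := matVec.surjective y
  rw [scMul_mat3, adHom_mulVec, adHom_mulVec, adHom_mulVec, scMul_mat3]
  congr 1
  calc g.1 * (X * Y) * (g⁻¹).1 = g.1 * X * 1 * Y * (g⁻¹).1 := by simp only [Matrix.mul_assoc, Matrix.one_mul]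
    _ = _ := by rw [← gl_inv_mul_val g]; simp only [Matrix.mul_assoc]

/-- All automorphisms of a matrix algebra are inner. -/
theorem mem_autPts_mat3 {M : GL (Fin 3 × Fin 3) K} :
    M ∈ autPts mat3Const K ↔ ∃ g, adHom g = M := by
  constructor
  swap
  · rintro ⟨g, rfl⟩; exact adHom_mem g
  intro hM
  let f : Matrix (Fin 3) (Fin 3) K →ₗ[K] Matrix (Fin 3) (Fin 3) K :=
    matVec.symm.toLinearMap ∘ₗ (Matrix.toLin' M.1) ∘ₗ matVec.toLinearMap
  have hf : ∀ X, matVec (f X) = M.1 *ᵥ matVec X := fun X => by simp [f]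
  have hmul : ∀ X Y, f (X * Y) = f X * f Y := fun X Y => matVec.injective <| by
    rw [hf, ← scMul_mat3, hM, ← scMul_mat3, hf, hf]
  have hinj : ∀ X, f X = 0 → X = 0 := fun X hX => by
    have := hf X
    rw [hX, map_zero] at this
    refine matVec.injective (gl_mulVec_injective M ?_)
    change M.1 *ᵥ matVec X = M.1 *ᵥ matVec 0
    rw [← this, map_zero, mulVec_zero]
  -- `f` intertwines the column space with itself through evaluation at a vector `w`
  -- which the image of a rank one idempotent does not kill
  obtain ⟨w, hw⟩ : ∃ w, f (vecMulVec (Pi.single 0 1) (Pi.single 0 1)) *ᵥ w ≠ 0 := by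
    by_contra! h
    have h0 := hinj _ (Matrix.ext_of_mulVec_single fun i => by rw [h, zero_mulVec])
    simpa [vecMulVec_apply] using congrFun (congrFun h0 0) 0
  let γ : (Fin 3 → K) →ₗ[K] (Fin 3 → K) :=
    { toFun := fun x => f (vecMulVec x (Pi.single 0 1)) *ᵥ w
      map_add' := fun x y => by rw [add_vecMulVec, map_add, add_mulVec]
      map_smul' := fun c x => by rw [smul_vecMulVec, map_smul, smul_mulVec, RingHom.id_apply] }
  have hγ : ∀ X x, γ (X *ᵥ x) = f X *ᵥ γ x := fun X x => by
    change f (vecMulVec (X *ᵥ x) _) *ᵥ w = f X *ᵥ (f (vecMulVec x _) *ᵥ w)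
    rw [mulVec_mulVec, ← hmul, mul_vecMulVec]
  have hγi : Function.Injective γ := by
    rw [injective_iff_map_eq_zero]
    intro x hx
    by_contra hx0
    obtain ⟨i, hi⟩ := Function.ne_iff.1 hx0
    refine hw ?_
    have h1 : (vecMulVec (Pi.single 0 (x i)⁻¹) (Pi.single i 1) : Matrix (Fin 3) (Fin 3) K) *ᵥ x =
        Pi.single 0 1 := by
      rw [vecMulVec_mulVec, single_one_dotProduct]
      ext k
      have : x i ≠ 0 := hi
      fin_cases k <;> simp [this]
    have h2 := hγ (vecMulVec (Pi.single 0 (x i)⁻¹) (Pi.single i 1)) x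
    rw [hx, mulVec_zero, h1] at h2
    exact h2
  have hdet : (LinearMap.toMatrix' γ).det ≠ 0 := by
    rw [LinearMap.det_toMatrix']
    exact (LinearMap.isUnit_det _ ((Module.End.isUnit_iff _).2
      ⟨hγi, LinearMap.injective_iff_surjective.1 hγi⟩)).ne_zero
  let g : GL (Fin 3) K := Matrix.GeneralLinearGroup.mkOfDetNeZero _ hdet
  have hg : ∀ x, g.1 *ᵥ x = γ x := fun x => LinearMap.toMatrix'_mulVec γ x
  refine ⟨g, gl_ext_matVec fun X => ?_⟩
  rw [adHom_mulVec, ← hf]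
  congr 1
  have h1 : g.1 * X = f X * g.1 := Matrix.ext_of_mulVec_single fun i => by
    rw [← mulVec_mulVec, ← mulVec_mulVec, hg, hg, hγ]
  rw [h1, Matrix.mul_assoc, gl_mul_inv_val, Matrix.mul_one]

lemma adHom_eq_one {g : GL (Fin 3) K} : adHom g = 1 ↔ ∃ c : K, g.1 = c • 1 := by
  constructor
  · intro h
    have hc : ∀ X : Matrix (Fin 3) (Fin 3) K, g.1 * X = X * g.1 := by
      intro X
      have h1 := adHom_mulVec g X
      rw [h, Units.val_one, one_mulVec] at h1
      have h2 := matVec.injective h1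
      conv_rhs => rw [h2]
      rw [Matrix.mul_assoc, gl_inv_mul_val, Matrix.mul_one]
    have := Matrix.mem_range_scalar_of_commute_single (M := g.1) fun i j _ => (hc _).symm
    obtain ⟨c, hc⟩ := this
    exact ⟨c, by rw [← hc]; simp [smul_one_eq_diagonal]⟩
  · rintro ⟨c, hc⟩
    refine gl_ext_matVec fun X => ?_
    rw [adHom_mulVec, Units.val_one, one_mulVec, hc]
    congr 1
    have h2 := gl_mul_inv_val g
    rw [hc] at h2
    rw [smul_mul_assoc, one_mul, smul_mul_assoc, ← mul_smul_comm]
    rw [smul_mul_assoc, one_mul] at h2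
    rw [h2, mul_one]

end PGL3

/-! ### Algebraicity and diagonalization of two-sided multiplications -/

section KronAlg

variable {K : Type*} [Field K] {m n : Type} [Fintype m] [DecidableEq m] [Fintype n] [DecidableEq n]

lemma comp_inv_mem_polySL2 {φ : SpecialLinearGroup (Fin 2) K → K} (hφ : φ ∈ polySL2 K) :
    (fun g => φ g⁻¹) ∈ polySL2 K := by
  obtain ⟨p, hp⟩ := mem_polySL2.1 hφ
  simp only [hp]
  induction p using MvPolynomial.induction_on generalizing φ with
  | C a => simpa using const_mem_polySL2 a
  | add p q ihp ihq =>
    simp only [map_add]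
    exact add_mem (ihp (mem_polySL2.2 ⟨p, fun _ => rfl⟩) fun _ => rfl)
      (ihq (mem_polySL2.2 ⟨q, fun _ => rfl⟩) fun _ => rfl)
  | mul_X p kl ih =>
    simp only [map_mul, MvPolynomial.eval_X]
    refine mul_mem (ih (mem_polySL2.2 ⟨p, fun _ => rfl⟩) fun _ => rfl) ?_
    obtain ⟨k, l⟩ := kl
    have e := entry_mem_polySL2 (K := K)
    simp only [Matrix.SpecialLinearGroup.coe_inv, adjugate_fin_two]
    fin_cases k <;> fin_cases l
    exacts [e 1 1, neg_mem (e 0 1), neg_mem (e 1 0), e 0 0]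

lemma isAlgSL2Hom_kronHom {f : SpecialLinearGroup (Fin 2) K →* GL m K}
    {g : SpecialLinearGroup (Fin 2) K →* GL n K} (hf : IsAlgSL2Hom f) (hg : IsAlgSL2Hom g) :
    IsAlgSL2Hom (kronHom.comp (f.prod g)) := by
  intro i j
  refine mem_polySL2.1 ?_
  have h : (fun A => ((kronHom.comp (f.prod g)) A).1 i j) =
      (fun A => (f A).1 i.1 j.1) * fun A => (g A⁻¹).1 j.2 i.2 := by
    funext A
    rw [Pi.mul_apply, map_inv]
    rfl
  rw [h]
  exact mul_mem (mem_polySL2.2 (hf _ _)) (comp_inv_mem_polySL2 (mem_polySL2.2 (hg j.2 i.2)))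

/-- If a two-sided multiplication is diagonalizable, then so are its two factors. -/
lemma exists_conj_diag_left [IsAlgClosed K] {m n : ℕ} [NeZero m] [NeZero n] {g : GL (Fin m) K}
    {h : GL (Fin n) K} (hg : SqfreeAnn (kronHom (g, h)).1) :
    ∃ P : SpecialLinearGroup (Fin m) K, (P.1 * g.1 * (P⁻¹).1).IsDiag := by
  -- the matrices `x vᵀ`, for an eigenvector `v` of the contragredient of `h`
  obtain ⟨l, hl⟩ := Module.End.exists_eigenvalue (Matrix.toLin' ((h⁻¹).1)ᵀ)
  obtain ⟨v, hv⟩ := hl.exists_hasEigenvector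
  have hv1 : v ᵥ* (h⁻¹).1 = l • v := by
    rw [← mulVec_transpose]; exact hv.apply_eq_smul
  have hl0 : l ≠ 0 := by
    rintro rfl
    rw [zero_smul] at hv1
    apply hv.2
    have := congrArg (fun v => v ᵥ* h.1) hv1
    simpa [vecMul_vecMul, gl_inv_mul_val] using this
  let j : (Fin m → K) →ₗ[K] (Fin m × Fin n → K) :=
    { toFun := fun x => matVec (vecMulVec x v)
      map_add' := fun x y => by rw [add_vecMulVec, map_add]
      map_smul' := fun c x => by rw [smul_vecMulVec, map_smul, RingHom.id_apply] }
  have hj : Function.Injective j := by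
    rw [injective_iff_map_eq_zero]
    intro x hx
    obtain ⟨i, hi⟩ := Function.ne_iff.1 hv.2
    ext k
    have h1 : vecMulVec x v = 0 := matVec.injective (hx.trans (map_zero _).symm)
    have h2 := congrFun (congrFun h1 k) i
    rw [vecMulVec_apply] at h2
    exact (mul_eq_zero.1 h2).resolve_right hi
  let g' : GL (Fin m) K := ⟨l • g.1, l⁻¹ • (g⁻¹).1, by
      rw [smul_mul_smul_comm, mul_inv_cancel₀ hl0, one_smul, gl_mul_inv_val], by
      rw [smul_mul_smul_comm, inv_mul_cancel₀ hl0, one_smul, gl_inv_mul_val]⟩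
  have hg' : SqfreeAnn g'.1 := hg.of_intertwine j hj fun x => by
    change (kronHom (g, h)).1 *ᵥ matVec (vecMulVec x v) = matVec (vecMulVec ((l • g.1) *ᵥ x) v)
    rw [kronHom_mulVec, mul_vecMulVec, vecMulVec_mul, hv1, smul_mulVec, vecMulVec_smul, smul_vecMulVec]
  obtain ⟨P, hP⟩ := exists_SL_conj_isDiag hg'
  refine ⟨P, fun a b hab => ?_⟩
  have h1 := hP hab
  change (P.1 * (l • g.1) * (P⁻¹).1) a b = 0 at h1
  rw [mul_smul_comm, smul_mul_assoc, Matrix.smul_apply, smul_eq_mul] at h1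
  exact (mul_eq_zero.1 h1).resolve_left hl0

/-- If a two-sided multiplication is diagonalizable, so is its right factor. -/
lemma exists_conj_diag_right [IsAlgClosed K] {m n : ℕ} [NeZero m] [NeZero n] {g : GL (Fin m) K}
    {h : GL (Fin n) K} (hg : SqfreeAnn (kronHom (g, h)).1) :
    ∃ P : SpecialLinearGroup (Fin n) K, (P.1 * h.1 * (P⁻¹).1).IsDiag := by
  -- the matrices `u yᵀ`, for an eigenvector `u` of `g`
  obtain ⟨l, hl⟩ := Module.End.exists_eigenvalue (Matrix.toLin' g.1)
  obtain ⟨u, hu⟩ := hl.exists_hasEigenvector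
  have hu1 : g.1 *ᵥ u = l • u := hu.apply_eq_smul
  have hl0 : l ≠ 0 := by
    rintro rfl
    rw [zero_smul] at hu1
    exact hu.2 (gl_mulVec_injective g (hu1.trans (mulVec_zero _).symm))
  let j : (Fin n → K) →ₗ[K] (Fin m × Fin n → K) :=
    { toFun := fun y => matVec (vecMulVec u y)
      map_add' := fun x y => by rw [vecMulVec_add, map_add]
      map_smul' := fun c x => by rw [vecMulVec_smul, map_smul, RingHom.id_apply] }
  have hj : Function.Injective j := by
    rw [injective_iff_map_eq_zero]
    intro y hy
    obtain ⟨i, hi⟩ := Function.ne_iff.1 hu.2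
    ext k
    have h1 : vecMulVec u y = 0 := matVec.injective (hy.trans (map_zero _).symm)
    have h2 := congrFun (congrFun h1 i) k
    rw [vecMulVec_apply] at h2
    exact (mul_eq_zero.1 h2).resolve_left hi
  let h' : GL (Fin n) K := ⟨l • ((h⁻¹).1)ᵀ, l⁻¹ • (h.1)ᵀ, by
      rw [smul_mul_smul_comm, mul_inv_cancel₀ hl0, one_smul, ← transpose_mul, gl_mul_inv_val,
        transpose_one], by
      rw [smul_mul_smul_comm, inv_mul_cancel₀ hl0, one_smul, ← transpose_mul, gl_inv_mul_val,
        transpose_one]⟩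
  have hh' : SqfreeAnn h'.1 := hg.of_intertwine j hj fun y => by
    change (kronHom (g, h)).1 *ᵥ matVec (vecMulVec u y) =
      matVec (vecMulVec u ((l • ((h⁻¹).1)ᵀ) *ᵥ y))
    rw [kronHom_mulVec, mul_vecMulVec, vecMulVec_mul, hu1, smul_mulVec, vecMulVec_smul, smul_vecMulVec,
      mulVec_transpose]
  obtain ⟨P, hP⟩ := exists_SL_conj_isDiag hh'
  have hD : ((P : GL (Fin n) K) * h' * (P : GL (Fin n) K)⁻¹)⁻¹ ∈ diagSub (Fin n) K :=
    inv_mem (mem_diagSub.2 hP)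
  have e : ((P : GL (Fin n) K) * h' * (P : GL (Fin n) K)⁻¹)⁻¹.1 = P.1 * (l⁻¹ • (h.1)ᵀ) * (P⁻¹).1 := by
    rw [_root_.mul_inv_rev, _root_.mul_inv_rev, inv_inv, ← mul_assoc]
    rfl
  rw [mem_diagSub, e] at hD
  refine ⟨(P⁻¹).transpose, fun a b hab => ?_⟩
  have e1 : ((P⁻¹).transpose⁻¹).1 = (P.1)ᵀ := by
    rw [show (P⁻¹).transpose⁻¹ = P.transpose from inv_eq_of_mul_eq_one_left (by
      apply Subtype.ext
      rw [Matrix.SpecialLinearGroup.coe_mul, Matrix.SpecialLinearGroup.coe_transpose,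
        Matrix.SpecialLinearGroup.coe_transpose, ← transpose_mul, ← Matrix.SpecialLinearGroup.coe_mul,
        inv_mul_cancel, Matrix.SpecialLinearGroup.coe_one, transpose_one])]
    rfl
  have h1 := hD hab.symm
  rw [mul_smul_comm, smul_mul_assoc, Matrix.smul_apply, smul_eq_mul] at h1
  have h2 := (mul_eq_zero.1 h1).resolve_left (inv_ne_zero hl0)
  rw [e1, Matrix.SpecialLinearGroup.coe_transpose]
  have e2 : ((P⁻¹).1)ᵀ * h.1 * (P.1)ᵀ = (P.1 * (h.1)ᵀ * (P⁻¹).1)ᵀ := by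
    rw [transpose_mul, transpose_mul, transpose_transpose, Matrix.mul_assoc]
  rw [e2]
  exact h2

end KronAlg

/-! ### The projective linear group as a split group of rank two -/

section PGL3

variable {K : Type*} [Field K]

/-- The weights of the standard representation for the torus of the matrices `diag (z₁, z₂, 1)`. -/
def stdWeight : Fin 3 → Fin 2 → ℤ := ![![1, 0], ![0, 1], ![0, 0]]

/-- The weights of the torus of `PGL_3` on the matrix units. -/
def projWeight (p : Fin 3 × Fin 3) : Fin 2 → ℤ := stdWeight p.1 - stdWeight p.2

lemma weightTorus_mulVec_matVec {r : ℕ} {m n : Type} [Fintype m] [DecidableEq m] [Fintype n]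
    [DecidableEq n] (χ : m × n → Fin r → ℤ) (z : Fin r → Kˣ) (X : Matrix m n K) :
    (weightTorus χ z).1 *ᵥ matVec X =
      matVec (Matrix.of fun i j => ((monomialChar (χ (i, j)) z : Kˣ) : K) * X i j) := by
  rw [weightTorus_val]
  ext p
  rw [mulVec_diagonal]
  rfl

lemma adHom_weightTorus (z : Fin 2 → Kˣ) :
    adHom (weightTorus stdWeight z) = weightTorus projWeight z := by
  refine gl_ext_matVec fun X => ?_
  rw [adHom_mulVec, weightTorus_mulVec_matVec, ← map_inv, weightTorus_val, weightTorus_val]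
  congr 1
  ext i j
  rw [mul_diagonal, diagonal_mul, of_apply, projWeight, monomialChar_sub, monomialChar_inv]
  push_cast
  ring

lemma exists_adHom_weightTorus_eq {g : GL (Fin 3) K} (hg : g.1.IsDiag) :
    ∃ z, weightTorus projWeight z = adHom g := by
  have h0 : ∀ i, g.1 i i ≠ 0 := fun i hi => by
    have h1 := IsDiag.mulVec_single hg i
    rw [hi, zero_smul] at h1
    have h2 := gl_mulVec_injective g (h1.trans (mulVec_zero g.1).symm)
    simpa using congrFun h2 i
  let u : Fin 3 → Kˣ := fun i => Units.mk0 _ (h0 i)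
  refine ⟨![u 0 / u 2, u 1 / u 2], ?_⟩
  rw [← adHom_weightTorus, ← mul_inv_eq_one, ← map_inv, ← map_mul, adHom_eq_one]
  refine ⟨((u 2)⁻¹ : Kˣ), ?_⟩
  have h1 : (weightTorus stdWeight ![u 0 / u 2, u 1 / u 2]).1 = (((u 2)⁻¹ : Kˣ) : K) • g.1 := by
    have hu : g.1 = diagonal fun i => (u i : K) := (hg.diagonal_diag).symm
    rw [weightTorus_val, hu, ← diagonal_smul]
    congr 1
    ext i
    fin_cases i <;> simp [stdWeight, monomialChar, Fin.prod_univ_two, div_eq_inv_mul]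
  rw [Units.val_mul, h1, smul_mul_assoc, gl_mul_inv_val]

/-- Diagonal automorphisms of the matrix algebra come from diagonal matrices. -/
lemma isDiag_of_adHom {g : GL (Fin 3) K}
    (h : ∀ i, ∃ c : K, (adHom g).1 *ᵥ matVec (Matrix.single i i 1) = c • matVec (Matrix.single i i 1)) :
    g.1.IsDiag := by
  intro k i hki
  obtain ⟨c, hc⟩ := h i
  rw [adHom_mulVec, ← map_smul] at hc
  have h1 := congrArg (· * g.1) (matVec.injective hc)
  simp only [Matrix.mul_assoc, gl_inv_mul_val, Matrix.mul_one] at h1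
  simpa [Matrix.single_mul_apply_of_ne, hki] using congrFun (congrFun h1 k) i

variable [IsAlgClosed K] [CharZero K]

/-- The diagonal matrices modulo scalars form a maximal torus of `PGL_3`. What commutes with this torus
preserves the lines of the off-diagonal matrix units, hence of the diagonal ones, which are products
of these. -/
theorem isSplitModel_mat3 :
    IsSplitModel (autPts mat3Const K) projWeight ![(0, 2), (1, 2)] where
  closed := isZClosed_autPts _
  mem z := by rw [← adHom_weightTorus]; exact adHom_mem _
  coord l := by fin_cases l <;> · ext i; fin_cases i <;> simp [projWeight, stdWeight]
  diag h hh hd := by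
    obtain ⟨g, rfl⟩ := mem_autPts_mat3.1 hh
    refine exists_adHom_weightTorus_eq (isDiag_of_adHom fun i => ?_)
    rw [matVec_single]
    exact ⟨_, IsDiag.mulVec_single hd (i, i)⟩
  cent h hh hc := by
    obtain ⟨g, rfl⟩ := mem_autPts_mat3.1 hh
    have h1 : ∀ i j, i ≠ j → ∃ c : K, (adHom g).1 *ᵥ matVec (Matrix.single i j 1) =
        c • matVec (Matrix.single i j 1) := by
      intro i j hij
      refine ⟨(adHom g).1 (i, j) (i, j), ?_⟩
      rw [matVec_single, mulVec_single_one]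
      ext p
      by_cases hp : p = (i, j)
      · subst hp; simp
      · rw [Pi.smul_apply, Pi.single_eq_of_ne hp, smul_zero]
        exact apply_eq_zero_of_commute_weightTorus hc (by revert i j p; decide)
    have h2 : ∀ i, ∃ c : K, (adHom g).1 *ᵥ matVec (Matrix.single i i 1) =
        c • matVec (Matrix.single i i 1) := by
      intro i
      obtain ⟨j, hj⟩ := exists_ne i
      obtain ⟨c, hc⟩ := h1 i j hj.symm
      obtain ⟨c', hc'⟩ := h1 j i hj
      refine ⟨c * c', ?_⟩
      have h3 := adHom_mem g (matVec (Matrix.single i j 1)) (matVec (Matrix.single j i 1))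
      rw [hc, hc', ← map_smul, ← map_smul, scMul_mat3, scMul_mat3, smul_mul_smul_comm,
        Matrix.single_mul_single_same, mul_one, map_smul] at h3
      exact h3
    obtain ⟨z, hz⟩ := exists_adHom_weightTorus_eq (isDiag_of_adHom h2)
    rw [← hz]
    exact weightTorus_mem_diagSub _ _
  conj x hx hs := by
    obtain ⟨g, rfl⟩ := mem_autPts_mat3.1 hx
    obtain ⟨P, hP⟩ := exists_conj_diag_left hs
    refine ⟨adHom P, adHom_mem _, ?_⟩
    rw [← map_inv, ← map_mul, ← map_mul]
    obtain ⟨z, hz⟩ := exists_adHom_weightTorus_eq (g := (P : GL (Fin 3) K) * g * (P : GL (Fin 3) K)⁻¹) hP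
    rw [← hz]
    exact weightTorus_mem_diagSub _ _

end PGL3

/-! ### Roots, connectedness and reductivity of the projective linear group -/

section PGL3Roots

/-- The roots and coroots of `PGL_3`. -/
def mat3Roots : Finset ((Fin 2 → ℤ) × (Fin 2 → ℤ)) :=
  {(![1, -1], ![1, -1]), (![0, 1], ![1, 2]), (![-1, 0], ![-2, -1]),
    (![-1, 1], ![-1, 1]), (![0, -1], ![-1, -2]), (![1, 0], ![2, 1])}

lemma eq_of_eq_nsmul {d m : Fin 2 → ℤ} {k : ℕ} (h : d = k • m) (hd : d ≠ 0) (h1 : ∀ l, |d l| ≤ 1) :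
    m = d := by
  obtain ⟨l, hl⟩ := Function.ne_iff.1 hd
  have h5 : |d l| = 1 := le_antisymm (h1 l) (Int.one_le_abs hl)
  rw [h, Pi.smul_apply, nsmul_eq_mul, abs_mul, Nat.abs_cast] at h5
  have h6 : (k : ℤ) = 1 := Int.eq_one_of_mul_eq_one_right (Int.natCast_nonneg _) h5
  rw [h, show k = 1 by exact_mod_cast h6, one_smul]

set_option synthInstance.maxHeartbeats 200000 in
set_option synthInstance.maxSize 2000 in
/-- The coroots of `PGL_3` are determined by the reflections on the weights. -/
lemma mem_mat3Roots_of_reflection : ∀ p, projWeight p ≠ 0 →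
    ∀ n0 ∈ Finset.Icc (-2 : ℤ) 2, ∀ n1 ∈ Finset.Icc (-2 : ℤ) 2,
      projWeight p 0 * n0 + projWeight p 1 * n1 = 2 →
      (∀ i, ∃ j, projWeight j 0 =
          projWeight i 0 - (projWeight i 0 * n0 + projWeight i 1 * n1) * projWeight p 0 ∧
        projWeight j 1 =
          projWeight i 1 - (projWeight i 0 * n0 + projWeight i 1 * n1) * projWeight p 1) →
      (projWeight p, ![n0, n1]) ∈ mat3Roots := by
  decide +kernel

variable {K : Type*} [Field K]

lemma adHom_SL_mulVec (A : SpecialLinearGroup (Fin 3) K) (X : Matrix (Fin 3) (Fin 3) K) :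
    (adHom (A : GL (Fin 3) K)).1 *ᵥ matVec X = matVec (A.1 * X * (A⁻¹).1) := adHom_mulVec _ X

lemma adHom_cycle_conj (z : Fin 2 → Kˣ) :
    adHom (cycleSL3 K : GL (Fin 3) K) * weightTorus projWeight z * (adHom (cycleSL3 K : GL (Fin 3) K))⁻¹ =
      weightTorus projWeight (matTorus !![0, -1; 1, -1] z) := by
  rw [mul_inv_eq_iff_eq_mul]
  refine gl_ext_matVec fun X => ?_
  rw [gl_mul_mulVec, gl_mul_mulVec, weightTorus_mulVec_matVec, adHom_SL_mulVec, adHom_SL_mulVec,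
    weightTorus_mulVec_matVec, cycleSL3_val, cycleSL3_inv_val]
  congr 1
  ext i j
  simp only [Matrix.mul_apply, Fin.sum_univ_three, of_apply]
  fin_cases i <;> fin_cases j <;>
    simp [projWeight, stdWeight, monomialChar, matTorus,
      Fin.prod_univ_two, -mul_eq_mul_right_iff, -mul_eq_mul_left_iff]
  all_goals field_simp

variable [IsAlgClosed K] [CharZero K]

/-- A root of `PGL_3` is a weight of the adjoint representation: otherwise the root subgroup would
fix the diagonal matrices, and would hence consist of diagonal elements. -/
lemma exists_projWeight_eq {m n : Fin 2 → ℤ}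
    (h : (m, n) ∈ rootPairs (autPts mat3Const K) (weightTorus projWeight)) :
    ∃ p, projWeight p ≠ 0 ∧ projWeight p = m := by
  obtain ⟨M, hM, hM1, h1, h2⟩ := exists_unipotent_of_mem_rootPairs h
  obtain ⟨p, k, hp0, hpk⟩ : ∃ p, ∃ k : ℕ, projWeight p ≠ 0 ∧ projWeight p = k • m := by
    by_contra! hno
    obtain ⟨g, rfl⟩ := mem_autPts_mat3.1 hM
    have hfix : ∀ i, (adHom g).1 *ᵥ matVec (Matrix.single i i 1) = matVec (Matrix.single i i 1) := by
      intro i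
      have hi : projWeight (i, i) = 0 := sub_self _
      rw [matVec_single, mulVec_single_one]
      ext q
      by_cases hq : projWeight q = 0
      · rw [col_apply, h2 q (i, i) (hq.trans hi.symm), Matrix.one_apply, Pi.single_apply]
      · by_cases h0 : (adHom g).1 q (i, i) = 0
        · rw [col_apply, h0, Pi.single_eq_of_ne]
          rintro rfl
          exact hq hi
        · obtain ⟨k, hk⟩ := h1 _ _ h0
          rw [hi, sub_zero] at hk
          exact absurd hk (hno q k hq)
    obtain ⟨z, hz⟩ := exists_adHom_weightTorus_eq (g := g)
      (isDiag_of_adHom fun i => ⟨1, by rw [hfix, one_smul]⟩)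
    apply hM1
    refine Units.ext (Matrix.ext fun i j => ?_)
    by_cases hij : i = j
    · subst hij; exact h2 i i rfl
    · rw [← hz, weightTorus_val, diagonal_apply_ne _ hij, Units.val_one, Matrix.one_apply_ne hij]
  refine ⟨p, hp0, ?_⟩
  exact (eq_of_eq_nsmul hpk hp0 ((by decide : ∀ p l, |projWeight p l| ≤ 1) p)).symm

lemma adHom_block_mem_rootPairs : ((![1, -1], ![1, -1]) : (Fin 2 → ℤ) × (Fin 2 → ℤ)) ∈
    rootPairs (autPts mat3Const K) (weightTorus projWeight) := by
  obtain ⟨φ, hφ⟩ : ∃ φ : SpecialLinearGroup (Fin 2) K →* GL (Fin 3) K,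
      ∀ A, (φ A).1 = !![A.1 0 0, A.1 0 1, 0; A.1 1 0, A.1 1 1, 0; 0, 0, 1] :=
    ⟨Matrix.SpecialLinearGroup.toGL.comp blockSL3, blockSL3_val⟩
  have hφa : IsAlgSL2Hom φ := by
    intro i j
    refine mem_polySL2.1 ?_
    have e := entry_mem_polySL2 (K := K)
    have c := const_mem_polySL2 (K := K)
    simp only [hφ]
    fin_cases i <;> fin_cases j
    exacts [e 0 0, e 0 1, c 0, e 1 0, e 1 1, c 0, c 0, c 0, c 1]
  refine ⟨adHom.comp φ, isAlgSL2Hom_kronHom hφa hφa, fun h => ?_, ?_, fun z x => ?_, fun z x => ?_,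
    fun c => ?_⟩
  · have h1 : adHom (φ (upperUni 1)) = 1 := DFunLike.congr_fun h (upperUni 1)
    obtain ⟨c, hc⟩ := adHom_eq_one.1 h1
    have h2 := congrFun (congrFun hc 0) 1
    rw [hφ] at h2
    simp [upperUni_val] at h2
  · rintro _ ⟨A, rfl⟩; exact adHom_mem _
  · rw [← adHom_weightTorus, MonoidHom.comp_apply, MonoidHom.comp_apply, ← map_inv, ← map_mul, ← map_mul]
    refine congrArg adHom ?_
    rw [mul_inv_eq_iff_eq_mul]
    refine Units.ext ?_
    rw [Units.val_mul, Units.val_mul, hφ, hφ, weightTorus_val, monomialChar_two]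
    ext i j
    fin_cases i <;> fin_cases j <;> simp [stdWeight, monomialChar_two, upperUni_val]
    field_simp
  · rw [← adHom_weightTorus, MonoidHom.comp_apply, MonoidHom.comp_apply, ← map_inv, ← map_mul, ← map_mul]
    refine congrArg adHom ?_
    rw [mul_inv_eq_iff_eq_mul]
    refine Units.ext ?_
    rw [Units.val_mul, Units.val_mul, hφ, hφ, weightTorus_val, monomialChar_two]
    ext i j
    fin_cases i <;> fin_cases j <;> simp [stdWeight, monomialChar_two, lowerUni_val]
    field_simp
  · rw [← adHom_weightTorus, MonoidHom.comp_apply]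
    congr 1
    refine Units.ext ?_
    rw [hφ, weightTorus_val]
    ext i j
    fin_cases i <;> fin_cases j <;> simp [stdWeight, monomialChar_two, diagSL2_val]

/-- The root datum of `PGL_3`. Unlike for `G_2`, the reflections alone do not suffice; that a root is one
of the weights is used as well. -/
theorem rootPairs_mat3 : rootPairs (autPts mat3Const K) (weightTorus projWeight) = mat3Roots := by
  ext ⟨m, n⟩
  constructor
  · intro h
    have hmn := dotProduct_eq_two_of_mem_rootPairs h
    have hr := exists_reflection_of_mem_rootPairs h
    have hb := bound_of_reflection (isSplitModel_mat3 (K := K)).coord (by decide) hmn hr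
    obtain ⟨p, hp, rfl⟩ := exists_projWeight_eq h
    have e : n = ![n 0, n 1] := by ext i; fin_cases i <;> rfl
    rw [Finset.mem_coe, e]
    refine mem_mat3Roots_of_reflection p hp _ (Finset.mem_Icc.2 (hb 0).2) _
      (Finset.mem_Icc.2 (hb 1).2) ?_ fun i => ?_
    · simpa only [dotProduct, Fin.sum_univ_two] using hmn
    · obtain ⟨j, hj⟩ := hr i
      exact ⟨j, by simpa [dotProduct, Fin.sum_univ_two] using congrFun hj 0,
        by simpa [dotProduct, Fin.sum_univ_two] using congrFun hj 1⟩
  · have hcyc : ∀ {m n : Fin 2 → ℤ} (m' n' : Fin 2 → ℤ),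
        (m, n) ∈ rootPairs (autPts mat3Const K) (weightTorus projWeight) →
        (!![-1, 1; -1, 0])ᵀ *ᵥ m = m' → !![0, -1; 1, -1] *ᵥ n = n' →
        (m', n') ∈ rootPairs (autPts mat3Const K) (weightTorus projWeight) := by
      rintro m n _ _ h rfl rfl
      exact (mem_rootPairs_of_normalizer (adHom_mem _) (C' := !![-1, 1; -1, 0])
        (by decide) adHom_cycle_conj).1 h
    have hneg : ∀ {m n : Fin 2 → ℤ} (m' n' : Fin 2 → ℤ),
        (m, n) ∈ rootPairs (autPts mat3Const K) (weightTorus projWeight) → -m = m' → -n = n' →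
        (m', n') ∈ rootPairs (autPts mat3Const K) (weightTorus projWeight) := by
      rintro m n _ _ h rfl rfl
      exact neg_mem_rootPairs h
    have s1 := adHom_block_mem_rootPairs (K := K)
    have s2 := hcyc ![0, 1] ![1, 2] s1 (by decide) (by decide)
    have s3 := hcyc ![-1, 0] ![-2, -1] s2 (by decide) (by decide)
    intro h
    simp only [mat3Roots, Finset.coe_insert, Finset.coe_singleton, Set.mem_insert_iff,
      Set.mem_singleton_iff] at h
    rcases h with h | h | h | h | h | h <;> rw [h]
    exacts [s1, s2, s3, hneg _ _ s1 (by decide) (by decide), hneg _ _ s2 (by decide) (by decide),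
      hneg _ _ s3 (by decide) (by decide)]

/-- Modulo scalars, a matrix has determinant one. -/
lemma exists_SL_adHom_eq (g : GL (Fin 3) K) : ∃ A : SpecialLinearGroup (Fin 3) K, adHom (A : GL (Fin 3) K) = adHom g := by
  have hdet : g.1.det ≠ 0 := (Matrix.isUnits_det_units g).ne_zero
  obtain ⟨c, hc⟩ := IsAlgClosed.exists_pow_nat_eq g.1.det (n := 3) (by norm_num)
  have hc0 : c ≠ 0 := by rintro rfl; rw [zero_pow (by norm_num)] at hc; exact hdet hc.symm
  obtain ⟨A, hA⟩ : ∃ A : SpecialLinearGroup (Fin 3) K, A.1 = c⁻¹ • g.1 :=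
    ⟨⟨c⁻¹ • g.1, by
      rw [det_smul, Fintype.card_fin, ← hc, inv_pow, inv_mul_cancel₀ (pow_ne_zero _ hc0)]⟩, rfl⟩
  refine ⟨A, ?_⟩
  rw [← mul_inv_eq_one, ← map_inv, ← map_mul, adHom_eq_one]
  refine ⟨c⁻¹, ?_⟩
  rw [Units.val_mul]
  change A.1 * _ = _
  rw [hA, smul_mul_assoc, gl_mul_inv_val]

theorem isZConnected_mat3 : IsZConnected (autPts mat3Const K) := by
  refine isZConnected_of_forall (isZClosed_autPts _) fun N hle hN h hh => ?_
  obtain ⟨g, rfl⟩ := mem_autPts_mat3.1 hh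
  obtain ⟨A, hA⟩ := exists_SL_adHom_eq g
  rw [← hA]
  exact range_le_of_relIndex_ne_zero (f := adHom.comp Matrix.SpecialLinearGroup.toGL)
    (by rintro _ ⟨B, rfl⟩; exact adHom_mem _) hN ⟨A, rfl⟩

lemma adHom_transvection_mulVec {i j : Fin 3} (hij : i ≠ j) (c : K) (X : Matrix (Fin 3) (Fin 3) K) :
    (adHom (Matrix.SpecialLinearGroup.transvection hij c : GL (Fin 3) K)).1 *ᵥ matVec X =
      matVec (X + c • (Matrix.single i j 1 * X - X * Matrix.single i j 1)
        - (c ^ 2 * X j i) • Matrix.single i j 1) := by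
  rw [adHom_SL_mulVec, Matrix.SpecialLinearGroup.transvection_inv,
    Matrix.SpecialLinearGroup.transvection_coe, Matrix.SpecialLinearGroup.transvection_coe]
  congr 1
  have h : Matrix.single i j (1 : K) * X * Matrix.single i j 1 = X j i • Matrix.single i j 1 := by
    rw [Matrix.single_mul_mul_single, Matrix.smul_single]; simp
  have e : ∀ c : K, Matrix.single i j c = c • Matrix.single i j (1 : K) := fun c => by
    rw [Matrix.smul_single]; simp
  rw [mul_smul, ← h, e c, e (-c)]
  simp only [Matrix.add_mul, Matrix.mul_add, Matrix.one_mul, Matrix.mul_one, smul_mul_assoc,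
    mul_smul_comm, smul_sub, neg_smul, pow_two, mul_smul, Matrix.mul_neg, smul_neg, smul_add, Matrix.mul_assoc]
  abel

/-- The matrices of trace zero form an irreducible representation: a nonzero stable subspace contains
all off-diagonal matrix units. -/
lemma mat3_irreducible {Y : Submodule K (Fin 3 × Fin 3 → K)} (hY : Y ≠ ⊥)
    (h0 : ∀ X, matVec X ∈ Y → X.trace = 0) (hst : ∀ g : GL (Fin 3) K, ∀ x ∈ Y, (adHom g).1 *ᵥ x ∈ Y)
    {k l : Fin 3} (hkl : k ≠ l) : matVec (Matrix.single k l (1 : K)) ∈ Y := by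
  -- the second difference along a root subgroup extracts a matrix unit
  have hsec : ∀ {X i j}, i ≠ j → X j i ≠ 0 → matVec X ∈ Y → matVec (Matrix.single i j (1 : K)) ∈ Y := by
    intro X i j hij hX h
    have h1 := Y.sub_mem (Y.add_mem (hst (Matrix.SpecialLinearGroup.transvection hij (1 : K) : GL (Fin 3) K) _ h)
      (hst (Matrix.SpecialLinearGroup.transvection hij (-1 : K) : GL (Fin 3) K) _ h)) (Y.add_mem h h)
    rw [adHom_transvection_mulVec, adHom_transvection_mulVec, ← map_add, ← map_add, ← map_sub] at h1
    have e : (X + (1 : K) • (Matrix.single i j 1 * X - X * Matrix.single i j 1)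
        - (1 ^ 2 * X j i) • Matrix.single i j 1) + (X + (-1 : K) • (Matrix.single i j 1 * X -
        X * Matrix.single i j 1) - ((-1) ^ 2 * X j i) • Matrix.single i j 1) - (X + X) =
        (-2 * X j i) • Matrix.single i j (1 : K) := by
      module
    rw [e, map_smul] at h1
    exact (Y.smul_mem_iff (mul_ne_zero (neg_ne_zero.2 two_ne_zero) hX)).1 h1
  -- left and right multiplication by matrix units
  have hleft : ∀ {i j k : Fin 3}, i ≠ j → k ≠ i → k ≠ j → matVec (Matrix.single i j (1 : K)) ∈ Y →
      matVec (Matrix.single k j (1 : K)) ∈ Y := by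
    intro i j k hij hki hkj h
    have h1 := Y.sub_mem (hst (Matrix.SpecialLinearGroup.transvection hki (1 : K) : GL (Fin 3) K) _ h) h
    rw [adHom_transvection_mulVec, ← map_sub] at h1
    convert h1 using 2
    rw [Matrix.single_mul_single_same, Matrix.single_mul_single_of_ne _ _ _ _ hkj.symm,
      show Matrix.single i j (1 : K) i k = 0 by simp [Matrix.single_apply, hkj.symm]]
    simp
  have hright : ∀ {i j k : Fin 3}, i ≠ j → k ≠ i → k ≠ j → matVec (Matrix.single i j (1 : K)) ∈ Y →
      matVec (Matrix.single i k (1 : K)) ∈ Y := by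
    intro i j k hij hki hkj h
    have h1 := Y.sub_mem h (hst (Matrix.SpecialLinearGroup.transvection hkj.symm (1 : K) : GL (Fin 3) K) _ h)
    rw [adHom_transvection_mulVec, ← map_sub] at h1
    convert h1 using 2
    rw [Matrix.single_mul_single_same, Matrix.single_mul_single_of_ne _ _ _ _ hki,
      show Matrix.single i j (1 : K) k j = 0 by simp [Matrix.single_apply, hki.symm]]
    simp
  obtain ⟨i, j, hij, h⟩ : ∃ i j : Fin 3, i ≠ j ∧ matVec (Matrix.single i j (1 : K)) ∈ Y := by
    obtain ⟨x, hx, hx0⟩ := (Submodule.ne_bot_iff _).1 hY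
    obtain ⟨X, rfl⟩ := matVec.surjective x
    by_cases hd : ∃ i j, i ≠ j ∧ X j i ≠ 0
    · obtain ⟨i, j, hij, hX⟩ := hd
      exact ⟨i, j, hij, hsec hij hX hx⟩
    · push Not at hd
      obtain ⟨i, j, hij⟩ : ∃ i j, X i i ≠ X j j := by
        by_contra! heq
        have ht := h0 X hx
        rw [Matrix.trace_fin_three, heq 1 0, heq 2 0] at ht
        have h00 : X 0 0 = 0 := by
          have : (3 : K) * X 0 0 = 0 := by linear_combination ht
          exact (mul_eq_zero.1 this).resolve_left three_ne_zero
        apply hx0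
        rw [show X = 0 from ?_, map_zero]
        ext k l
        by_cases hkl : k = l
        · subst hkl; rw [heq k 0, h00]; rfl
        · exact hd l k (Ne.symm hkl)
      have hne : i ≠ j := fun h => hij (by rw [h])
      refine ⟨i, j, hne, ?_⟩
      have h1 := Y.sub_mem (hst (Matrix.SpecialLinearGroup.transvection hne (1 : K) : GL (Fin 3) K) _ hx) hx
      rw [adHom_transvection_mulVec, ← map_sub, hd i j hne] at h1
      have e : X + (1 : K) • (Matrix.single i j 1 * X - X * Matrix.single i j 1)
          - (1 ^ 2 * 0 : K) • Matrix.single i j 1 - X = (X j j - X i i) • Matrix.single i j (1 : K) := by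
        have hX : X = diagonal fun i => X i i := by
          ext k l
          by_cases hkl : k = l
          · subst hkl; simp
          · rw [hd l k (Ne.symm hkl), diagonal_apply_ne _ hkl]
        have e1 : ∀ d : Fin 3 → K, Matrix.single i j 1 * diagonal d = d j • Matrix.single i j (1 : K) :=
          fun d => by
            ext k l
            rw [mul_diagonal, Matrix.smul_apply, Matrix.single_apply, smul_eq_mul, mul_comm]
            split_ifs with h
            · rw [h.2]
            · simp
        have e2 : ∀ d : Fin 3 → K, diagonal d * Matrix.single i j 1 = d i • Matrix.single i j (1 : K) :=
          fun d => by
            ext k l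
            rw [diagonal_mul, Matrix.smul_apply, Matrix.single_apply, smul_eq_mul]
            split_ifs with h
            · rw [h.1]
            · simp
        rw [hX, e1, e2]
        simp only [diagonal_apply_eq]
        module
      rw [e, map_smul] at h1
      exact (Y.smul_mem_iff (sub_ne_zero.2 hij.symm)).1 h1
  obtain ⟨m, hmi, hmj⟩ : ∃ m : Fin 3, m ≠ i ∧ m ≠ j :=
    (by decide : ∀ i j : Fin 3, ∃ m, m ≠ i ∧ m ≠ j) i j
  have h1 := hleft hij hmi hmj h
  have h2 := hright hij hmi hmj h
  have h3 := hright hmj hmi.symm hij h1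
  have h4 := hleft hmi.symm hij.symm hmj.symm h2
  have h5 := hleft hmi hmj.symm hij.symm h3
  have key : ∀ k : Fin 3, k = i ∨ k = j ∨ k = m := fun k =>
    (by decide : ∀ i j m k : Fin 3, i ≠ j → m ≠ i → m ≠ j → k = i ∨ k = j ∨ k = m) i j m k hij hmi hmj
  rcases key k with rfl | rfl | rfl <;> rcases key l with rfl | rfl | rfl <;>
    first | exact absurd rfl hkl | assumption

/-- A normal unipotent subgroup of `PGL_3` fixes all off-diagonal matrix units, by irreducibility of the
matrices of trace zero; a matrix which commutes with these is scalar. -/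
theorem isConnectedReductive_mat3 : IsConnectedReductive (autPts mat3Const K) := by
  refine ⟨isZClosed_autPts _, isZConnected_mat3, fun U hUH _ _ hn hu => ?_⟩
  let V : Submodule K (Fin 3 × Fin 3 → K) :=
    (LinearMap.ker (Matrix.traceLinearMap (Fin 3) K K)).map matVec.toLinearMap
  have hVmem : ∀ X, matVec X ∈ V ↔ X.trace = 0 := by
    intro X
    refine (Submodule.mem_map_equiv (e := matVec) _).trans ?_
    rw [LinearEquiv.symm_apply_apply]
    rfl
  have hV : V ≠ ⊥ := by
    rw [Submodule.ne_bot_iff]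
    refine ⟨matVec (Matrix.single 0 1 1), (hVmem _).2 (by simp), fun h => ?_⟩
    simpa [matVec_apply] using congrFun h (0, 1)
  obtain ⟨Y, hY, hYV, hst, hfix⟩ := exists_stable_fixed hUH hn hu hV fun h hh x hx => by
    obtain ⟨g, rfl⟩ := mem_autPts_mat3.1 hh
    obtain ⟨X, rfl⟩ := matVec.surjective x
    rw [adHom_mulVec, hVmem, Matrix.trace_mul_comm, ← Matrix.mul_assoc, gl_inv_mul_val, Matrix.one_mul]
    exact (hVmem _).1 hx
  rw [Subgroup.eq_bot_iff_forall]
  intro n hnU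
  obtain ⟨g, rfl⟩ := mem_autPts_mat3.1 (hUH hnU)
  rw [adHom_eq_one]
  obtain ⟨c, hc⟩ := Matrix.mem_range_scalar_of_commute_single (M := g.1) fun i j hij => by
    have h1 := hfix _ hnU _ (mat3_irreducible hY (fun X hX => (hVmem X).1 (hYV hX))
      (fun g => hst _ (adHom_mem g)) hij)
    rw [adHom_mulVec] at h1
    have h2 := congrArg (· * g.1) (matVec.injective h1)
    simp only [Matrix.mul_assoc, gl_inv_mul_val, Matrix.mul_one] at h2
    exact h2.symm
  exact ⟨c, by rw [← hc]; simp [smul_one_eq_diagonal]⟩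

end PGL3Roots

/-! ### The special orthogonal group of the determinant form -/

section SO4

variable {K : Type*} [Field K]

/-- The polar form of the determinant of `2 × 2` matrices. -/
def detPolar (X Y : Matrix (Fin 2) (Fin 2) K) : K :=
  X 0 0 * Y 1 1 + X 1 1 * Y 0 0 - X 0 1 * Y 1 0 - X 1 0 * Y 0 1

lemma detForm_dotProduct (X Y : Matrix (Fin 2) (Fin 2) K) :
    matVec X ⬝ᵥ (detForm.map (Int.cast : ℤ → K) *ᵥ matVec Y) = detPolar X Y := by
  simp [dotProduct, mulVec, Fintype.sum_prod_type, Fin.sum_univ_two, matVec_apply, detForm, detPolar]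
  ring

lemma ext_of_matVec {M N : Matrix (Fin 2 × Fin 2) (Fin 2 × Fin 2) K}
    (h : ∀ X Y, matVec X ⬝ᵥ (M *ᵥ matVec Y) = matVec X ⬝ᵥ (N *ᵥ matVec Y)) : M = N := by
  ext p q
  obtain ⟨i, j⟩ := p
  obtain ⟨k, l⟩ := q
  have := h (Matrix.single i j 1) (Matrix.single k l 1)
  rw [matVec_single, matVec_single, mulVec_single_one, mulVec_single_one, single_one_dotProduct,
    single_one_dotProduct] at this
  exact this

lemma mem_so4Pts_iff {g : GL (Fin 2 × Fin 2) K} : g ∈ so4Pts K ↔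
    (∀ X Y, detPolar (matVec.symm (g.1 *ᵥ matVec X)) (matVec.symm (g.1 *ᵥ matVec Y)) = detPolar X Y) ∧
      g.1.det = 1 := by
  have key : ∀ X Y, detPolar (matVec.symm (g.1 *ᵥ matVec X)) (matVec.symm (g.1 *ᵥ matVec Y)) =
      matVec X ⬝ᵥ (((g.1)ᵀ * detForm.map (Int.cast : ℤ → K) * g.1) *ᵥ matVec Y) := by
    intro X Y
    rw [← detForm_dotProduct, LinearEquiv.apply_symm_apply, LinearEquiv.apply_symm_apply,
      ← mulVec_mulVec, ← mulVec_mulVec, dotProduct_mulVec _ (g.1)ᵀ, vecMul_transpose]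
  refine and_congr_left fun _ => ⟨fun h X Y => ?_, fun h => ext_of_matVec fun X Y => ?_⟩
  · rw [key, h, detForm_dotProduct]
  · rw [← key, h, detForm_dotProduct]

lemma detPolar_self (X : Matrix (Fin 2) (Fin 2) K) : detPolar X X = 2 * X.det := by
  rw [detPolar, det_fin_two]; ring

lemma detPolar_eq (X Y : Matrix (Fin 2) (Fin 2) K) : detPolar X Y = (X + Y).det - X.det - Y.det := by
  rw [detPolar, det_fin_two, det_fin_two, det_fin_two]; simp only [Matrix.add_apply]; ring

/-- Two-sided multiplication by matrices of determinant one. -/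
def soHom : SpecialLinearGroup (Fin 2) K × SpecialLinearGroup (Fin 2) K →* GL (Fin 2 × Fin 2) K :=
  kronHom.comp (Matrix.SpecialLinearGroup.toGL.prodMap Matrix.SpecialLinearGroup.toGL)

lemma soHom_val (g h : SpecialLinearGroup (Fin 2) K) :
    (soHom (g, h)).1 = kroneckerMap (· * ·) g.1 ((h⁻¹).1)ᵀ := rfl

lemma soHom_mulVec (g h : SpecialLinearGroup (Fin 2) K) (X : Matrix (Fin 2) (Fin 2) K) :
    (soHom (g, h)).1 *ᵥ matVec X = matVec (g.1 * X * (h⁻¹).1) := kronHom_mulVec _ _ X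

lemma soHom_mem (g h : SpecialLinearGroup (Fin 2) K) : soHom (g, h) ∈ so4Pts K := by
  refine mem_so4Pts_iff.2 ⟨fun X Y => ?_, ?_⟩
  · rw [soHom_mulVec, soHom_mulVec, LinearEquiv.symm_apply_apply, LinearEquiv.symm_apply_apply,
      detPolar_eq, detPolar_eq, ← Matrix.add_mul, ← Matrix.mul_add]
    have hd : ∀ Z, (g.1 * Z * (h⁻¹).1).det = Z.det := fun Z => by
      rw [det_mul, det_mul, g.2, (h⁻¹).2, one_mul, mul_one]
    rw [hd, hd, hd]
  · rw [soHom_val]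
    refine (det_kronecker _ _).trans ?_
    rw [g.2, det_transpose, (h⁻¹).2, one_pow, mul_one]

/-- The kernel of the action of `SL_2 × SL_2`: the pairs of equal scalars `1` or `-1`. -/
lemma soHom_eq_one {g h : SpecialLinearGroup (Fin 2) K} :
    soHom (g, h) = 1 ↔ (g.1 = 1 ∧ h.1 = 1) ∨ (g.1 = -1 ∧ h.1 = -1) := by
  constructor
  · intro H
    have h1 : ∀ X : Matrix (Fin 2) (Fin 2) K, g.1 * X = X * h.1 := fun X => by
      have h2 := soHom_mulVec g h X
      rw [H, Units.val_one, one_mulVec] at h2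
      conv_rhs => rw [matVec.injective h2]
      rw [Matrix.mul_assoc, ← Matrix.SpecialLinearGroup.coe_mul, inv_mul_cancel,
        Matrix.SpecialLinearGroup.coe_one, Matrix.mul_one]
    have h2 : g.1 = h.1 := by simpa using h1 1
    obtain ⟨c, hc⟩ := Matrix.mem_range_scalar_of_commute_single (M := g.1) fun i j _ => by
      have := h1 (Matrix.single i j 1)
      rw [← h2] at this
      exact this.symm
    have hc' : g.1 = c • 1 := by rw [← hc]; simp [smul_one_eq_diagonal]
    have h3 := g.2
    rw [hc', det_smul, det_one, Fintype.card_fin, mul_one, sq_eq_one_iff] at h3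
    rcases h3 with rfl | rfl
    · exact Or.inl ⟨by rw [hc', one_smul], by rw [← h2, hc', one_smul]⟩
    · exact Or.inr ⟨by rw [hc', neg_smul, one_smul], by rw [← h2, hc', neg_smul, one_smul]⟩
  · intro H
    refine gl_ext_matVec fun X => ?_
    rw [soHom_mulVec, Units.val_one, one_mulVec]
    have hh : h.1 * (h⁻¹).1 = 1 := by
      rw [← Matrix.SpecialLinearGroup.coe_mul, mul_inv_cancel, Matrix.SpecialLinearGroup.coe_one]
    rcases H with ⟨h1, h2⟩ | ⟨h1, h2⟩ <;> rw [h2] at hh <;> rw [h1]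
    · rw [Matrix.one_mul] at hh; rw [hh]; simp
    · rw [Matrix.neg_mul, Matrix.one_mul] at hh
      rw [neg_eq_iff_eq_neg.1 hh]; simp

/-- An isometry of determinant one which fixes the identity matrix and the two off-diagonal matrix
units is trivial. -/
lemma so4_eq_one [CharZero K] {g : GL (Fin 2 × Fin 2) K} (hg : g ∈ so4Pts K)
    (h1 : g.1 *ᵥ matVec 1 = matVec 1)
    (h2 : g.1 *ᵥ matVec (Matrix.single 0 1 1) = matVec (Matrix.single 0 1 1))
    (h3 : g.1 *ᵥ matVec (Matrix.single 1 0 1) = matVec (Matrix.single 1 0 1)) : g = 1 := by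
  obtain ⟨hp, hdet⟩ := mem_so4Pts_iff.1 hg
  obtain ⟨X, hX⟩ := matVec.surjective (g.1 *ᵥ matVec (Matrix.single 0 0 1))
  have e1 := hp (Matrix.single 0 0 1) 1
  have e2 := hp (Matrix.single 0 0 1) (Matrix.single 0 1 1)
  have e3 := hp (Matrix.single 0 0 1) (Matrix.single 1 0 1)
  have e4 := hp (Matrix.single 0 0 1) (Matrix.single 0 0 1)
  rw [h1, ← hX] at e1
  rw [h2, ← hX] at e2
  rw [h3, ← hX] at e3
  rw [← hX] at e4
  simp [detPolar] at e1 e2 e3 e4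
  -- the image `X` of the first diagonal matrix unit is that matrix unit or the other one, and the
  -- exchange of these two has determinant `-1`
  have e5 : X 0 0 = 0 ∨ X 1 1 = 0 := by
    have : (2 : K) * (X 0 0 * X 1 1) = 0 := by rw [e2, e3] at e4; linear_combination e4
    exact mul_eq_zero.1 ((mul_eq_zero.1 this).resolve_left two_ne_zero)
  have hsum : (1 : Matrix (Fin 2) (Fin 2) K) = Matrix.single 0 0 1 + Matrix.single 1 1 1 := by
    ext i j; fin_cases i <;> fin_cases j <;> simp
  have h4 : g.1 *ᵥ matVec (Matrix.single 1 1 1) = matVec (1 - X) := by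
    rw [map_sub, ← h1, hX, hsum, map_add, mulVec_add, add_sub_cancel_left]
  rcases e5 with h | h
  · exfalso
    have hX' : X = Matrix.single 1 1 1 := by
      ext i j; fin_cases i <;> fin_cases j
      exacts [by simpa using h, by simpa using e3, by simpa using e2, by simpa [h] using e1]
    have hg' : g.1 = (Equiv.swap ((0, 0) : Fin 2 × Fin 2) (1, 1)).permMatrix K := by
      have hX11 : g.1 *ᵥ matVec (Matrix.single 1 1 1) = matVec (Matrix.single 0 0 1) := by
        rw [h4, hX', hsum, add_sub_cancel_right]
      rw [hX'] at hX
      rw [matVec_single, matVec_single] at hX hX11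
      rw [matVec_single] at h2 h3
      refine Matrix.ext_of_mulVec_single fun p => ?_
      have hp : g.1 *ᵥ Pi.single p 1 = Pi.single (Equiv.swap ((0, 0) : Fin 2 × Fin 2) (1, 1) p) 1 := by
        obtain ⟨i, j⟩ := p
        fin_cases i <;> fin_cases j
        exacts [hX.symm, h2, h3, hX11]
      rw [hp, Matrix.permMatrix_mulVec]
      ext q
      simp only [Pi.single_apply, Function.comp_apply, Equiv.swap_apply_eq_iff]
    rw [hg', det_permutation] at hdet
    rw [Equiv.Perm.sign_swap (by decide)] at hdet
    norm_num at hdet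
  · have hX' : X = Matrix.single 0 0 1 := by
      ext i j; fin_cases i <;> fin_cases j
      exacts [by simpa [h] using e1, by simpa using e3, by simpa using e2, by simpa using h]
    refine Units.ext (Matrix.ext_of_mulVec_single fun p => ?_)
    obtain ⟨i, j⟩ := p
    rw [← matVec_single, Units.val_one, one_mulVec]
    fin_cases i <;> fin_cases j
    · exact hX.symm.trans (by rw [hX']; rfl)
    · exact h2
    · exact h3
    · refine h4.trans ?_
      rw [hX', hsum, add_sub_cancel_left]; rfl

/-! ### The special orthogonal group as an image of `SL_2 × SL_2` -/

section Split

variable [IsAlgClosed K] [CharZero K]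

/-- Two square-zero matrices with the anticommutator `1` are simultaneously conjugate to the off-diagonal
matrix units. -/
lemma conj_of_anticommute {N N' : Matrix (Fin 2) (Fin 2) K} (h1 : N * N = 0) (h2 : N' * N' = 0)
    (h3 : N * N' + N' * N = 1) : ∃ g : SpecialLinearGroup (Fin 2) K,
      N * g.1 = g.1 * Matrix.single 0 1 1 ∧ N' * g.1 = g.1 * Matrix.single 1 0 1 := by
  have hN' : ∃ w, N' *ᵥ w ≠ 0 := by
    by_contra! h
    have : N' = 0 := Matrix.ext_of_mulVec_single fun i => by rw [h, zero_mulVec]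
    rw [this, Matrix.mul_zero, Matrix.zero_mul, add_zero] at h3
    exact zero_ne_one h3
  obtain ⟨w, hw⟩ := hN'
  -- the columns of `g` are `N v` and `v`, for a vector `v` in the kernel of `N'`
  obtain ⟨v, hv0, hv⟩ : ∃ v, v ≠ 0 ∧ N' *ᵥ v = 0 := ⟨_, hw, by rw [mulVec_mulVec, h2, zero_mulVec]⟩
  have hv' : N' *ᵥ (N *ᵥ v) = v := by
    have := congrArg (fun M => M *ᵥ v) h3
    simpa [add_mulVec, ← mulVec_mulVec, hv] using this
  have hu : N *ᵥ (N *ᵥ v) = 0 := by rw [mulVec_mulVec, h1, zero_mulVec]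
  let A : Matrix (Fin 2) (Fin 2) K := Matrix.of fun i j => ![(N *ᵥ v) i, v i] j
  have hA0 : A *ᵥ Pi.single 0 1 = N *ᵥ v := by rw [mulVec_single_one]; rfl
  have hA1 : A *ᵥ Pi.single 1 1 = v := by rw [mulVec_single_one]; rfl
  have e1 : N * A = A * Matrix.single 0 1 1 := Matrix.ext_of_mulVec_single fun i => by
    rw [← mulVec_mulVec, ← mulVec_mulVec]
    fin_cases i
    · change N *ᵥ (A *ᵥ Pi.single 0 1) = A *ᵥ (Matrix.single 0 1 1 *ᵥ Pi.single 0 1)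
      rw [hA0, hu]
      ext k; fin_cases k <;> simp
    · change N *ᵥ (A *ᵥ Pi.single 1 1) = A *ᵥ (Matrix.single 0 1 1 *ᵥ Pi.single 1 1)
      rw [hA1, ← hA0]
      ext k; fin_cases k <;> simp
  have e2 : N' * A = A * Matrix.single 1 0 1 := Matrix.ext_of_mulVec_single fun i => by
    rw [← mulVec_mulVec, ← mulVec_mulVec]
    fin_cases i
    · change N' *ᵥ (A *ᵥ Pi.single 0 1) = A *ᵥ (Matrix.single 1 0 1 *ᵥ Pi.single 0 1)
      rw [hA0, hv']
      conv_lhs => rw [← hA1]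
      ext k; fin_cases k <;> simp
    · change N' *ᵥ (A *ᵥ Pi.single 1 1) = A *ᵥ (Matrix.single 1 0 1 *ᵥ Pi.single 1 1)
      rw [hA1, hv]
      ext k; fin_cases k <;> simp
  have hdet : A.det ≠ 0 := by
    intro hd
    obtain ⟨x, hx0, hx⟩ := Matrix.exists_mulVec_eq_zero_iff.2 hd
    have hx' : x 0 • (N *ᵥ v) + x 1 • v = 0 := by
      rw [← hx]
      ext i
      fin_cases i <;> simp [A, mulVec, dotProduct, Fin.sum_univ_two] <;> ring
    have hx2 := congrArg (fun y => N' *ᵥ y) hx'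
    simp only [mulVec_add, mulVec_smul, hv, hv', smul_zero, add_zero, mulVec_zero] at hx2
    have h0 : x 0 = 0 := (smul_eq_zero.1 hx2).resolve_right hv0
    rw [h0, zero_smul, zero_add] at hx'
    have h1 : x 1 = 0 := (smul_eq_zero.1 hx').resolve_right hv0
    exact hx0 (by ext i; fin_cases i <;> assumption)
  obtain ⟨c, hc⟩ := IsAlgClosed.exists_pow_nat_eq A.det (n := 2) two_pos
  have hc0 : c ≠ 0 := by rintro rfl; rw [zero_pow two_ne_zero] at hc; exact hdet hc.symm
  obtain ⟨g, hg⟩ : ∃ g : SpecialLinearGroup (Fin 2) K, g.1 = c⁻¹ • A :=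
    ⟨⟨c⁻¹ • A, by
      rw [det_smul, Fintype.card_fin, ← hc, inv_pow, inv_mul_cancel₀ (pow_ne_zero _ hc0)]⟩, rfl⟩
  exact ⟨g, by rw [hg, mul_smul_comm, smul_mul_assoc, e1], by rw [hg, mul_smul_comm, smul_mul_assoc, e2]⟩

/-- The special orthogonal group is the image of `SL_2 × SL_2`. -/
theorem mem_so4Pts {M : GL (Fin 2 × Fin 2) K} : M ∈ so4Pts K ↔ ∃ g h, soHom (g, h) = M := by
  constructor
  swap
  · rintro ⟨g, h, rfl⟩; exact soHom_mem g h
  intro hM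
  -- after a left multiplication, the identity matrix is fixed
  obtain ⟨X, hX⟩ := matVec.surjective (M.1 *ᵥ matVec 1)
  have hXdet : X.det = 1 := by
    have h1 := (mem_so4Pts_iff.1 hM).1 1 1
    rw [← hX, LinearEquiv.symm_apply_apply, detPolar_self, detPolar_self, det_one] at h1
    exact mul_left_cancel₀ two_ne_zero h1
  obtain ⟨A, hA⟩ : ∃ A : SpecialLinearGroup (Fin 2) K, A.1 = X := ⟨⟨X, hXdet⟩, rfl⟩
  have hM' : soHom (A⁻¹, 1) * M ∈ so4Pts K := mul_mem (soHom_mem _ _) hM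
  have h1 : (soHom (A⁻¹, 1) * M).1 *ᵥ matVec 1 = matVec 1 := by
    rw [gl_mul_mulVec, ← hX, soHom_mulVec, ← hA, ← Matrix.SpecialLinearGroup.coe_mul, inv_mul_cancel]
    simp
  obtain ⟨M', hM'e⟩ : ∃ M', soHom (A⁻¹, 1) * M = M' := ⟨_, rfl⟩
  rw [hM'e] at h1 hM'
  -- then the images of the off-diagonal matrix units are conjugate to these matrix units
  obtain ⟨N, hN⟩ := matVec.surjective (M'.1 *ᵥ matVec (Matrix.single 0 1 1))
  obtain ⟨N', hN'⟩ := matVec.surjective (M'.1 *ᵥ matVec (Matrix.single 1 0 1))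
  have hp := (mem_so4Pts_iff.1 hM').1
  have p1 := hp 1 (Matrix.single 0 1 1)
  have p2 := hp 1 (Matrix.single 1 0 1)
  have p3 := hp (Matrix.single 0 1 1) (Matrix.single 0 1 1)
  have p4 := hp (Matrix.single 1 0 1) (Matrix.single 1 0 1)
  have p5 := hp (Matrix.single 0 1 1) (Matrix.single 1 0 1)
  rw [h1, ← hN] at p1
  rw [h1, ← hN'] at p2
  rw [← hN] at p3
  rw [← hN'] at p4
  rw [← hN, ← hN'] at p5
  simp [detPolar] at p1 p2 p3 p4 p5
  have d3 : N 0 0 * N 1 1 - N 0 1 * N 1 0 = 0 := mul_left_cancel₀ (two_ne_zero (α := K)) (by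
    linear_combination p3)
  have d4 : N' 0 0 * N' 1 1 - N' 0 1 * N' 1 0 = 0 := mul_left_cancel₀ (two_ne_zero (α := K)) (by
    linear_combination p4)
  have e1 : N * N = 0 := by
    simp only [← Matrix.ext_iff, Fin.forall_fin_two, Matrix.mul_apply, Fin.sum_univ_two, Matrix.zero_apply]
    exact ⟨⟨by linear_combination N 0 0 * p1 - d3, by linear_combination N 0 1 * p1⟩,
      by linear_combination N 1 0 * p1, by linear_combination N 1 1 * p1 - d3⟩
  have e2 : N' * N' = 0 := by
    simp only [← Matrix.ext_iff, Fin.forall_fin_two, Matrix.mul_apply, Fin.sum_univ_two, Matrix.zero_apply]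
    exact ⟨⟨by linear_combination N' 0 0 * p2 - d4, by linear_combination N' 0 1 * p2⟩,
      by linear_combination N' 1 0 * p2, by linear_combination N' 1 1 * p2 - d4⟩
  have e3 : N * N' + N' * N = 1 := by
    simp only [← Matrix.ext_iff, Fin.forall_fin_two, Matrix.mul_apply, Fin.sum_univ_two, Matrix.add_apply]
    refine ⟨⟨show _ = (1 : K) from ?_, show _ = (0 : K) from ?_⟩, show _ = (0 : K) from ?_,
      show _ = (1 : K) from ?_⟩
    · linear_combination N 0 0 * p2 + N' 0 0 * p1 - p5
    · linear_combination N' 0 1 * p1 + N 0 1 * p2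
    · linear_combination N' 1 0 * p1 + N 1 0 * p2
    · linear_combination N' 1 1 * p1 + N 1 1 * p2 - p5
  obtain ⟨g, hg1, hg2⟩ := conj_of_anticommute e1 e2 e3
  have hgg : g.1 * (g⁻¹).1 = 1 := by
    rw [← Matrix.SpecialLinearGroup.coe_mul, mul_inv_cancel, Matrix.SpecialLinearGroup.coe_one]
  have hgg' : (g⁻¹).1 * g.1 = 1 := by
    rw [← Matrix.SpecialLinearGroup.coe_mul, inv_mul_cancel, Matrix.SpecialLinearGroup.coe_one]
  have hfin : soHom (g⁻¹, g⁻¹) * M' = 1 := by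
    refine so4_eq_one (mul_mem (soHom_mem _ _) hM') ?_ ?_ ?_
    · rw [gl_mul_mulVec, h1, soHom_mulVec, inv_inv, Matrix.mul_one, hgg']
    · rw [gl_mul_mulVec, ← hN, soHom_mulVec, inv_inv, Matrix.mul_assoc, hg1, ← Matrix.mul_assoc, hgg',
        Matrix.one_mul]
    · rw [gl_mul_mulVec, ← hN', soHom_mulVec, inv_inv, Matrix.mul_assoc, hg2, ← Matrix.mul_assoc, hgg',
        Matrix.one_mul]
  refine ⟨A * g, g, ?_⟩
  have e4 : soHom (A * g, g) = (soHom (A⁻¹, 1))⁻¹ * (soHom (g⁻¹, g⁻¹))⁻¹ := by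
    rw [← map_inv, ← map_inv, ← map_mul]
    simp
  rw [e4, ← mul_one ((soHom (A⁻¹, 1))⁻¹ * _), ← hfin, ← hM'e]
  group

end Split

end SO4

/-! ### The special orthogonal group as a split group of rank two -/

section SO4Split

variable {K : Type*} [Field K]

/-- The weights of a maximal torus of `SO_4` on the matrix units. -/
def soWeight (p : Fin 2 × Fin 2) : Fin 2 → ℤ :=
  !![![1, 0], ![0, 1]; ![0, -1], ![-1, 0]] p.1 p.2

/-- The roots and coroots of `SO_4`. -/
def soRoots : Finset ((Fin 2 → ℤ) × (Fin 2 → ℤ)) :=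
  {(![1, 1], ![1, 1]), (![-1, -1], ![-1, -1]), (![-1, 1], ![-1, 1]), (![1, -1], ![1, -1])}

lemma soWeight_mulVec (z : Fin 2 → Kˣ) (X : Matrix (Fin 2) (Fin 2) K) :
    (weightTorus soWeight z).1 *ᵥ matVec X =
      matVec !![z 0 * X 0 0, z 1 * X 0 1; ((z 1)⁻¹ : Kˣ) * X 1 0, ((z 0)⁻¹ : Kˣ) * X 1 1] := by
  rw [weightTorus_mulVec_matVec]
  congr 1
  ext i j
  fin_cases i <;> fin_cases j <;> simp [soWeight, monomialChar_two]

lemma weightTorus_soWeight_mem (z : Fin 2 → Kˣ) : weightTorus soWeight z ∈ so4Pts K := by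
  refine mem_so4Pts_iff.2 ⟨fun X Y => ?_, ?_⟩
  · rw [soWeight_mulVec, soWeight_mulVec, LinearEquiv.symm_apply_apply, LinearEquiv.symm_apply_apply]
    simp [detPolar]
    field_simp
  · rw [weightTorus_val, det_diagonal, Fintype.prod_prod_type, Fin.prod_univ_two, Fin.prod_univ_two,
      Fin.prod_univ_two]
    simp [soWeight, monomialChar_two]
    field_simp

lemma isZClosed_so4Pts : IsZClosed (so4Pts K) := by
  refine ⟨(grpSO4 K).eqs, fun g => ?_⟩
  simp only [← MvPolynomial.coe_aeval_eq_eval]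
  exact (grpSO4 K).mem_pts K g

lemma exists_soWeight_eq {h : GL (Fin 2 × Fin 2) K} (hh : h ∈ so4Pts K)
    (hd : h ∈ diagSub (Fin 2 × Fin 2) K) : ∃ z, weightTorus soWeight z = h := by
  have h1 : ∀ i j, h.1 *ᵥ matVec (Matrix.single i j 1) =
      matVec (h.1 (i, j) (i, j) • Matrix.single i j (1 : K)) := fun i j => by
    rw [map_smul, matVec_single]
    exact IsDiag.mulVec_single hd (i, j)
  have hp := (mem_so4Pts_iff.1 hh).1
  have e1 := hp (Matrix.single 0 0 1) (Matrix.single 1 1 1)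
  have e2 := hp (Matrix.single 0 1 1) (Matrix.single 1 0 1)
  rw [h1, h1, LinearEquiv.symm_apply_apply, LinearEquiv.symm_apply_apply] at e1 e2
  simp [detPolar] at e1 e2
  have hD : ∀ x, h.1 *ᵥ x = fun p => h.1 p p * x p := fun x => by
    rw [mem_diagSub] at hd
    conv_lhs => rw [← hd.diagonal_diag]
    ext p
    rw [mulVec_diagonal]
    rfl
  refine ⟨![⟨_, _, e1, (mul_comm _ _).trans e1⟩, ⟨_, _, e2, (mul_comm _ _).trans e2⟩], ?_⟩
  refine gl_ext_mulVec fun x => ?_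
  obtain ⟨X, rfl⟩ := matVec.surjective x
  rw [soWeight_mulVec, hD]
  ext ⟨i, j⟩
  fin_cases i <;> fin_cases j <;> rfl

lemma kronHom_mem_diagSub {m n : Type} [Fintype m] [DecidableEq m] [Fintype n] [DecidableEq n]
    {g : GL m K} {h : GL n K} (hg : g ∈ diagSub m K) (hh : h ∈ diagSub n K) :
    kronHom (g, h) ∈ diagSub (m × n) K := by
  have h1 : ((h⁻¹).1)ᵀ.IsDiag := (mem_diagSub.1 (inv_mem hh)).transpose
  rw [mem_diagSub] at hg
  rw [mem_diagSub, kronHom_val, ← hg.diagonal_diag, ← h1.diagonal_diag]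
  have := diagonal_kronecker_diagonal g.1.diag ((h⁻¹).1)ᵀ.diag
  exact this ▸ isDiag_diagonal _

variable [IsAlgClosed K] [CharZero K]

/-- The diagonal isometries form a maximal torus of `SO_4`. Diagonalizability passes from an element of
`SO_4` to its two factors in `SL_2`. -/
theorem isSplitModel_so4 : IsSplitModel (so4Pts K) soWeight ![(0, 0), (0, 1)] where
  closed := isZClosed_so4Pts
  mem := weightTorus_soWeight_mem
  coord l := by fin_cases l <;> · ext i; fin_cases i <;> simp [soWeight]
  diag h hh hd := exists_soWeight_eq hh hd
  cent h hh hc := mem_diagSub.2 fun i j hij =>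
    apply_eq_zero_of_commute_weightTorus hc
      ((by decide : ∀ i j, i ≠ j → soWeight i ≠ soWeight j) i j hij)
  conj x hx hs := by
    obtain ⟨g, h, rfl⟩ := mem_so4Pts.1 hx
    obtain ⟨P, hP⟩ := exists_conj_diag_left (g := (g : GL (Fin 2) K)) (h := (h : GL (Fin 2) K)) hs
    obtain ⟨Q, hQ⟩ := exists_conj_diag_right (g := (g : GL (Fin 2) K)) (h := (h : GL (Fin 2) K)) hs
    refine ⟨soHom (P, Q), soHom_mem _ _, ?_⟩
    rw [← map_inv, ← map_mul, ← map_mul]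
    exact kronHom_mem_diagSub (g := ((P * g * P⁻¹ : SpecialLinearGroup (Fin 2) K) : GL (Fin 2) K))
      (h := ((Q * h * Q⁻¹ : SpecialLinearGroup (Fin 2) K) : GL (Fin 2) K)) hP hQ

/-- A root of `SO_4` is a difference of weights of the standard representation which are neither
equal nor opposite: otherwise each of the weight vectors would be fixed by the root subgroup. -/
lemma exists_soWeight_sub_eq {m n : Fin 2 → ℤ} (h : (m, n) ∈ rootPairs (so4Pts K) (weightTorus soWeight)) :
    ∃ p q, soWeight q ≠ soWeight p ∧ soWeight q ≠ -soWeight p ∧ soWeight q - soWeight p = m := by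
  obtain ⟨M, hM, hM1, h1, h2⟩ := exists_unipotent_of_mem_rootPairs h
  obtain ⟨p, q, k, hqp, hqp', hk⟩ : ∃ p q, ∃ k : ℕ, soWeight q ≠ soWeight p ∧ soWeight q ≠ -soWeight p ∧
      soWeight q - soWeight p = k • m := by
    by_contra! hno
    have h0 : ∀ q p, soWeight q ≠ soWeight p → soWeight q ≠ -soWeight p → M.1 q p = 0 := by
      intro q p hqp hqp'
      by_contra h0
      obtain ⟨k, hk⟩ := h1 _ _ h0
      exact hno p q k hqp hqp' hk
    have hd : ∀ p, M.1 p p = 1 := fun p => by rw [h2 p p rfl, Matrix.one_apply_eq]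
    have hp := (mem_so4Pts_iff.1 hM).1
    have hcol : ∀ i j, (matVec.symm (M.1 *ᵥ matVec (Matrix.single i j 1))) =
        Matrix.of fun k l => M.1 (k, l) (i, j) := fun i j => by
      rw [matVec_single, mulVec_single_one]; rfl
    have key : ∀ i j, M.1 (i + 1, j + 1) (i, j) = 0 := by
      intro i j
      have e := hp (Matrix.single i j 1) (Matrix.single i j 1)
      rw [hcol] at e
      fin_cases i <;> fin_cases j <;>
        simpa [detPolar, hd, h0 (0, 0) (0, 1) (by decide) (by decide), h0 (0, 0) (1, 0) (by decide) (by decide),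
          h0 (1, 1) (0, 1) (by decide) (by decide), h0 (1, 1) (1, 0) (by decide) (by decide),
          h0 (0, 1) (0, 0) (by decide) (by decide), h0 (0, 1) (1, 1) (by decide) (by decide),
          h0 (1, 0) (0, 0) (by decide) (by decide), h0 (1, 0) (1, 1) (by decide) (by decide),
          neg_eq_zero, ← two_mul, ← neg_add', sub_eq_add_neg] using e
    apply hM1
    refine Units.ext (Matrix.ext fun q p => ?_)
    by_cases hqp : soWeight q = soWeight p
    · exact h2 q p hqp
    have hne : q ≠ p := fun h => hqp (by rw [h])
    rw [Units.val_one, Matrix.one_apply_ne hne]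
    by_cases hqp' : soWeight q = -soWeight p
    · rw [(by decide : ∀ q p, soWeight q = -soWeight p → q = (p.1 + 1, p.2 + 1)) q p hqp']
      exact key p.1 p.2
    · exact h0 q p hqp hqp'
  exact ⟨p, q, hqp, hqp', (eq_of_eq_nsmul hk (sub_ne_zero.2 hqp) ((by decide : ∀ p q,
    soWeight q ≠ soWeight p → soWeight q ≠ -soWeight p → ∀ l, |(soWeight q - soWeight p) l| ≤ 1)
      p q hqp hqp')).symm⟩

set_option synthInstance.maxHeartbeats 200000 in
set_option synthInstance.maxSize 2000 in
/-- The coroots of `SO_4` are determined by the reflections on the weights. -/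
lemma mem_soRoots_of_reflection : ∀ p q, soWeight q ≠ soWeight p → soWeight q ≠ -soWeight p →
    ∀ n0 ∈ Finset.Icc (-2 : ℤ) 2, ∀ n1 ∈ Finset.Icc (-2 : ℤ) 2,
      (soWeight q 0 - soWeight p 0) * n0 + (soWeight q 1 - soWeight p 1) * n1 = 2 →
      (∀ i, ∃ j, soWeight j 0 = soWeight i 0 -
          (soWeight i 0 * n0 + soWeight i 1 * n1) * (soWeight q 0 - soWeight p 0) ∧
        soWeight j 1 = soWeight i 1 -
          (soWeight i 0 * n0 + soWeight i 1 * n1) * (soWeight q 1 - soWeight p 1)) →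
      (soWeight q - soWeight p, ![n0, n1]) ∈ soRoots := by
  decide +kernel

/-- Left multiplication by matrices of determinant one. -/
def soLeft : SpecialLinearGroup (Fin 2) K →* GL (Fin 2 × Fin 2) K :=
  soHom.comp (MonoidHom.inl _ _)

/-- Right multiplication by inverses of matrices of determinant one. -/
def soRight : SpecialLinearGroup (Fin 2) K →* GL (Fin 2 × Fin 2) K :=
  soHom.comp (MonoidHom.inr _ _)

lemma soLeft_mulVec (g : SpecialLinearGroup (Fin 2) K) (X : Matrix (Fin 2) (Fin 2) K) :
    (soLeft g).1 *ᵥ matVec X = matVec (g.1 * X) := by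
  refine (soHom_mulVec g 1 X).trans ?_
  rw [inv_one, Matrix.SpecialLinearGroup.coe_one, Matrix.mul_one]

lemma soRight_mulVec (g : SpecialLinearGroup (Fin 2) K) (X : Matrix (Fin 2) (Fin 2) K) :
    (soRight g).1 *ᵥ matVec X = matVec (X * (g⁻¹).1) := by
  refine (soHom_mulVec 1 g X).trans ?_
  rw [Matrix.SpecialLinearGroup.coe_one, Matrix.one_mul]

lemma isAlgSL2Hom_soLeft :
    IsAlgSL2Hom (soLeft : SpecialLinearGroup (Fin 2) K →* GL (Fin 2 × Fin 2) K) := by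
  refine isAlgSL2Hom_of_mulVec fun x p => ?_
  obtain ⟨X, rfl⟩ := matVec.surjective x
  simp only [soLeft_mulVec, matVec_apply, Matrix.mul_apply, Fin.sum_univ_two]
  exact add_mem (mul_mem (entry_mem_polySL2 _ _) (const_mem_polySL2 _))
    (mul_mem (entry_mem_polySL2 _ _) (const_mem_polySL2 _))

lemma isAlgSL2Hom_soRight :
    IsAlgSL2Hom (soRight : SpecialLinearGroup (Fin 2) K →* GL (Fin 2 × Fin 2) K) := by
  refine isAlgSL2Hom_of_mulVec fun x p => ?_
  obtain ⟨X, rfl⟩ := matVec.surjective x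
  simp only [soRight_mulVec, matVec_apply, Matrix.mul_apply, Fin.sum_univ_two]
  exact add_mem (mul_mem (const_mem_polySL2 _) (comp_inv_mem_polySL2 (entry_mem_polySL2 _ _)))
    (mul_mem (const_mem_polySL2 _) (comp_inv_mem_polySL2 (entry_mem_polySL2 _ _)))

/-- The root of the left factor of `SO_4`. -/
lemma soLeft_mem_rootPairs : ((![1, 1], ![1, 1]) : (Fin 2 → ℤ) × (Fin 2 → ℤ)) ∈
    rootPairs (so4Pts K) (weightTorus soWeight) := by
  refine ⟨soLeft, isAlgSL2Hom_soLeft, fun h => ?_, ?_, fun z x => ?_, fun z x => ?_, fun c => ?_⟩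
  · have e := soLeft_mulVec (upperUni (1 : K)) (Matrix.single 1 0 1)
    rw [h] at e
    simpa [matVec_apply, upperUni_val, Matrix.mul_apply, -cons_mul] using congrFun e (0, 0)
  · rintro _ ⟨A, rfl⟩; exact soHom_mem _ _
  · rw [mul_inv_eq_iff_eq_mul]
    refine gl_ext_matVec fun X => ?_
    rw [gl_mul_mulVec, gl_mul_mulVec, soWeight_mulVec, soLeft_mulVec, soLeft_mulVec, soWeight_mulVec,
      monomialChar_two, upperUni_val, upperUni_val]
    congr 1
    ext i j
    fin_cases i <;> fin_cases j <;> simp [Matrix.mul_apply, Fin.sum_univ_two] <;> field_simp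
  · rw [mul_inv_eq_iff_eq_mul]
    refine gl_ext_matVec fun X => ?_
    rw [gl_mul_mulVec, gl_mul_mulVec, soWeight_mulVec, soLeft_mulVec, soLeft_mulVec, soWeight_mulVec,
      monomialChar_two, lowerUni_val, lowerUni_val]
    congr 1
    ext i j
    fin_cases i <;> fin_cases j <;> simp [Matrix.mul_apply, Fin.sum_univ_two] <;> field_simp
  · refine gl_ext_matVec fun X => ?_
    rw [soWeight_mulVec, soLeft_mulVec, diagSL2_val]
    congr 1
    ext i j
    fin_cases i <;> fin_cases j <;> simp [Matrix.mul_apply, Fin.sum_univ_two]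

lemma sl2_inv_val (g : SpecialLinearGroup (Fin 2) K) :
    (g⁻¹).1 = !![g.1 1 1, -g.1 0 1; -g.1 1 0, g.1 0 0] := by
  rw [Matrix.SpecialLinearGroup.coe_inv, adjugate_fin_two]

/-- The root of the right factor of `SO_4`. -/
lemma soRight_mem_rootPairs : ((![-1, 1], ![-1, 1]) : (Fin 2 → ℤ) × (Fin 2 → ℤ)) ∈
    rootPairs (so4Pts K) (weightTorus soWeight) := by
  refine ⟨soRight, isAlgSL2Hom_soRight, fun h => ?_, ?_, fun z x => ?_, fun z x => ?_, fun c => ?_⟩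
  · have e := soRight_mulVec (upperUni (1 : K)) (Matrix.single 0 0 1)
    rw [h, sl2_inv_val] at e
    simpa [matVec_apply, upperUni_val] using congrFun e (0, 1)
  · rintro _ ⟨A, rfl⟩; exact soHom_mem _ _
  · rw [mul_inv_eq_iff_eq_mul]
    refine gl_ext_matVec fun X => ?_
    rw [gl_mul_mulVec, gl_mul_mulVec, soWeight_mulVec, soRight_mulVec, soRight_mulVec, soWeight_mulVec,
      monomialChar_two, sl2_inv_val, sl2_inv_val, upperUni_val, upperUni_val]
    congr 1
    ext i j
    fin_cases i <;> fin_cases j <;> simp [Matrix.mul_apply, Fin.sum_univ_two] <;> field_simp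
  · rw [mul_inv_eq_iff_eq_mul]
    refine gl_ext_matVec fun X => ?_
    rw [gl_mul_mulVec, gl_mul_mulVec, soWeight_mulVec, soRight_mulVec, soRight_mulVec, soWeight_mulVec,
      monomialChar_two, sl2_inv_val, sl2_inv_val, lowerUni_val, lowerUni_val]
    congr 1
    ext i j
    fin_cases i <;> fin_cases j <;> simp [Matrix.mul_apply, Fin.sum_univ_two] <;> field_simp
  · refine gl_ext_matVec fun X => ?_
    rw [soWeight_mulVec, soRight_mulVec, sl2_inv_val, diagSL2_val]
    congr 1
    ext i j
    fin_cases i <;> fin_cases j <;> simp [Matrix.mul_apply, Fin.sum_univ_two] <;> ring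

/-- The root datum of `SO_4`, of type `A_1 × A_1`. -/
theorem rootPairs_so4 : rootPairs (so4Pts K) (weightTorus soWeight) = soRoots := by
  ext ⟨m, n⟩
  constructor
  · intro h
    have hmn := dotProduct_eq_two_of_mem_rootPairs h
    have hr := exists_reflection_of_mem_rootPairs h
    have hb := bound_of_reflection (isSplitModel_so4 (K := K)).coord (by decide) hmn hr
    obtain ⟨p, q, h1, h2, rfl⟩ := exists_soWeight_sub_eq h
    have e : n = ![n 0, n 1] := by ext i; fin_cases i <;> rfl
    rw [Finset.mem_coe, e]
    refine mem_soRoots_of_reflection p q h1 h2 _ (Finset.mem_Icc.2 (hb 0).2) _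
      (Finset.mem_Icc.2 (hb 1).2) ?_ fun i => ?_
    · simpa only [dotProduct, Fin.sum_univ_two, Pi.sub_apply] using hmn
    · obtain ⟨j, hj⟩ := hr i
      exact ⟨j, by simpa [dotProduct, Fin.sum_univ_two] using congrFun hj 0,
        by simpa [dotProduct, Fin.sum_univ_two] using congrFun hj 1⟩
  · have hneg : ∀ {m n : Fin 2 → ℤ} (m' n' : Fin 2 → ℤ),
        (m, n) ∈ rootPairs (so4Pts K) (weightTorus soWeight) → -m = m' → -n = n' →
        (m', n') ∈ rootPairs (so4Pts K) (weightTorus soWeight) := by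
      rintro m n _ _ h rfl rfl
      exact neg_mem_rootPairs h
    have s1 := soLeft_mem_rootPairs (K := K)
    have s2 := soRight_mem_rootPairs (K := K)
    intro h
    simp only [soRoots, Finset.coe_insert, Finset.coe_singleton, Set.mem_insert_iff,
      Set.mem_singleton_iff] at h
    rcases h with h | h | h | h <;> rw [h]
    exacts [s1, hneg _ _ s1 (by decide) (by decide), s2, hneg _ _ s2 (by decide) (by decide)]

lemma soHom_eq_mul (g h : SpecialLinearGroup (Fin 2) K) : soHom (g, h) = soLeft g * soRight h := by
  refine (congrArg soHom ?_).trans (map_mul soHom (g, 1) (1, h))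
  simp

theorem isZConnected_so4 : IsZConnected (so4Pts K) := by
  refine isZConnected_of_forall isZClosed_so4Pts fun N hle hN M hM => ?_
  obtain ⟨g, h, rfl⟩ := mem_so4Pts.1 hM
  rw [soHom_eq_mul]
  exact mul_mem (range_le_of_relIndex_ne_zero (f := soLeft)
    (by rintro _ ⟨B, rfl⟩; exact soHom_mem _ _) hN ⟨g, rfl⟩)
    (range_le_of_relIndex_ne_zero (f := soRight) (by rintro _ ⟨B, rfl⟩; exact soHom_mem _ _) hN ⟨h, rfl⟩)

/-- The standard representation of `SO_4` is irreducible. -/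
lemma so4_irreducible {Y : Submodule K (Fin 2 × Fin 2 → K)} (hY : Y ≠ ⊥)
    (hst : ∀ g ∈ so4Pts K, ∀ x ∈ Y, g.1 *ᵥ x ∈ Y) : Y = ⊤ := by
  have hl : ∀ {k l : Fin 2} {X : Matrix (Fin 2) (Fin 2) K}, k ≠ l → matVec X ∈ Y →
      matVec (Matrix.single k l 1 * X) ∈ Y := by
    intro k l X hkl h
    have h1 := Y.sub_mem (hst (soLeft (Matrix.SpecialLinearGroup.transvection hkl 1)) (soHom_mem _ _) _ h) h
    rw [soLeft_mulVec, ← map_sub, Matrix.SpecialLinearGroup.transvection_coe, Matrix.add_mul,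
      Matrix.one_mul, add_sub_cancel_left] at h1
    exact h1
  have hr : ∀ {k l : Fin 2} {X : Matrix (Fin 2) (Fin 2) K}, k ≠ l → matVec X ∈ Y →
      matVec (X * Matrix.single k l 1) ∈ Y := by
    intro k l X hkl h
    have h1 := Y.sub_mem h (hst (soRight (Matrix.SpecialLinearGroup.transvection hkl 1)) (soHom_mem _ _) _ h)
    rw [soRight_mulVec, ← map_sub, Matrix.SpecialLinearGroup.transvection_inv,
      Matrix.SpecialLinearGroup.transvection_coe, Matrix.mul_add, Matrix.mul_one, sub_add_cancel_left,
      ← Matrix.mul_neg] at h1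
    rwa [← Matrix.single_neg, neg_neg] at h1
  have hl' : ∀ {X : Matrix (Fin 2) (Fin 2) K} (k l : Fin 2), matVec X ∈ Y →
      matVec (Matrix.single k l 1 * X) ∈ Y := by
    intro X k l h
    by_cases hkl : k = l
    · subst hkl
      obtain ⟨l, hl0⟩ := exists_ne k
      have := hl hl0.symm (hl hl0 h)
      rwa [← Matrix.mul_assoc, Matrix.single_mul_single_same, mul_one] at this
    · exact hl hkl h
  have hr' : ∀ {X : Matrix (Fin 2) (Fin 2) K} (k l : Fin 2), matVec X ∈ Y →
      matVec (X * Matrix.single k l 1) ∈ Y := by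
    intro X k l h
    by_cases hkl : k = l
    · subst hkl
      obtain ⟨l, hl0⟩ := exists_ne k
      have := hr hl0 (hr hl0.symm h)
      rwa [Matrix.mul_assoc, Matrix.single_mul_single_same, mul_one] at this
    · exact hr hkl h
  obtain ⟨x, hx, hx0⟩ := (Submodule.ne_bot_iff _).1 hY
  obtain ⟨⟨i, j⟩, hij⟩ := Function.ne_iff.1 hx0
  obtain ⟨X, rfl⟩ := matVec.surjective x
  have hall : ∀ k l, matVec (Matrix.single k l 1) ∈ Y := by
    intro k l
    have h1 := hr' j l (hl' k i hx)
    rw [Matrix.single_mul_mul_single, one_mul, mul_one, ← mul_one (X i j), ← smul_eq_mul,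
      ← Matrix.smul_single, map_smul] at h1
    exact (Y.smul_mem_iff hij).1 h1
  rw [eq_top_iff]
  intro y _
  obtain ⟨Z, rfl⟩ := matVec.surjective y
  rw [Matrix.matrix_eq_sum_single Z, map_sum]
  refine Y.sum_mem fun k _ => ?_
  rw [map_sum]
  refine Y.sum_mem fun l _ => ?_
  rw [← mul_one (Z k l), ← smul_eq_mul, ← Matrix.smul_single, map_smul]
  exact Y.smul_mem _ (hall k l)

theorem isConnectedReductive_so4 : IsConnectedReductive (so4Pts K) := by
  refine ⟨isZClosed_so4Pts, isZConnected_so4, fun U hUH _ _ hn hu => ?_⟩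
  obtain ⟨Y, hY, -, hst, hfix⟩ := exists_stable_fixed hUH hn hu (top_ne_bot) fun _ _ _ _ => trivial
  have htop := so4_irreducible hY hst
  rw [Subgroup.eq_bot_iff_forall]
  intro n hnU
  refine gl_ext_mulVec fun x => ?_
  rw [hfix n hnU x (htop ▸ trivial), Units.val_one, one_mulVec]

end SO4Split

/-! ### Centralizers of semisimple elements of the automorphism group of the octonions -/

section Centralizers

variable {K : Type*} [Field K]

/-- A connected closed subgroup lies in the identity component. -/
lemma le_idComp_of_isZConnected {ι : Type} [Fintype ι] [DecidableEq ι] {T H : Subgroup (GL ι K)}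
    (hT : IsZConnected T) (hcl : IsZClosed T) (hle : T ≤ H) : T ≤ idComp H := by
  refine le_sInf fun N hN => ?_
  have h1 : idComp T ≤ N ⊓ T := sInf_le ⟨inf_le_right, hN.2.1.inf hcl, by
    rw [Subgroup.inf_relIndex_right]
    exact fun h0 => hN.2.2 (Subgroup.relIndex_eq_zero_of_le_right hle h0)⟩
  rw [hT] at h1
  exact h1.trans inf_le_left

/-- A matrix which commutes with one element of a diagonal torus preserves the eigenspaces of this
element. -/
lemma apply_eq_zero_of_commute_diag {r : ℕ} {ι : Type} [Fintype ι] [DecidableEq ι] {χ : ι → Fin r → ℤ}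
    {h : GL ι K} {z : Fin r → Kˣ} (hh : weightTorus χ z * h = h * weightTorus χ z) {i j : ι}
    (hij : monomialChar (χ i - χ j) z ≠ 1) : h.1 i j = 0 := by
  by_contra h0
  apply hij
  have e := congrArg (fun g : GL ι K => g.1 i j) hh
  simp only [Units.val_mul, weightTorus_val, mul_diagonal, diagonal_mul] at e
  rw [mul_comm] at e
  have e2 := Units.ext (mul_left_cancel₀ h0 e)
  rw [monomialChar_sub, e2, mul_inv_cancel]

lemma commute_weightTorus_of_apply_eq_zero {r : ℕ} {ι : Type} [Fintype ι] [DecidableEq ι]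
    {χ : ι → Fin r → ℤ} {h : GL ι K} {z : Fin r → Kˣ}
    (hh : ∀ i j, monomialChar (χ i) z ≠ monomialChar (χ j) z → h.1 i j = 0) :
    weightTorus χ z * h = h * weightTorus χ z := by
  refine Units.ext (Matrix.ext fun i j => ?_)
  simp only [Units.val_mul, weightTorus_val, mul_diagonal, diagonal_mul]
  by_cases hij : monomialChar (χ i) z = monomialChar (χ j) z
  · rw [hij, mul_comm]
  · rw [hh i j hij, mul_zero, zero_mul]

/-- An element of the diagonal torus in general position with respect to a one-parameter subgroup:
its centralizer commutes with this one-parameter subgroup. -/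
lemma commute_of_generic {z : Fin 2 → Kˣ}
    (hz : ∀ d ∈ [![0, 1], ![1, 1], ![-1, 1], ![2, 1], ![1, 2], ![0, 2], ![2, 2]],
      monomialChar (d : Fin 2 → ℤ) z ≠ 1) {h : GL (Fin 8) K}
    (hh : weightTorus octWeight z * h = h * weightTorus octWeight z) (c : Kˣ) :
    weightTorus octWeight ![1, c] * h = h * weightTorus octWeight ![1, c] := by
  refine commute_weightTorus_of_apply_eq_zero fun i j hij => apply_eq_zero_of_commute_diag hh ?_
  have h1 : octWeight i 1 ≠ octWeight j 1 := fun h1 => hij (by simp [monomialChar_two, h1])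
  have h2 : ∀ i j, octWeight i 1 ≠ octWeight j 1 →
      octWeight i - octWeight j ∈ ([![0, 1], ![1, 1], ![-1, 1], ![2, 1], ![1, 2], ![0, 2], ![2, 2]] :
        List (Fin 2 → ℤ)) ∨
      -(octWeight i - octWeight j) ∈ ([![0, 1], ![1, 1], ![-1, 1], ![2, 1], ![1, 2], ![0, 2], ![2, 2]] :
        List (Fin 2 → ℤ)) := by decide
  rcases h2 i j h1 with h3 | h3
  · exact hz _ h3
  · intro h4
    exact hz _ h3 (by rw [monomialChar_neg, h4, inv_one])

/-- The same for an element with two equal coordinates: its centralizer is isomorphic to `GL_2`. -/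
lemma commute_of_eq {a : Kˣ} (h2 : a ^ 2 ≠ 1) (h3 : a ^ 3 ≠ 1) {h : GL (Fin 8) K}
    (hG : h ∈ autPts zornConst K)
    (hh : weightTorus octWeight ![a, a] * h = h * weightTorus octWeight ![a, a]) (c : Kˣ) :
    weightTorus octWeight ![c, c] * h = h * weightTorus octWeight ![c, c] := by
  have hchar : ∀ (m : Fin 2 → ℤ) (c : Kˣ), monomialChar m ![c, c] = c ^ (m 0 + m 1) := fun m c => by
    simp [monomialChar_two, _root_.zpow_add]
  have h1 : a ≠ 1 := fun h => h2 (by rw [h, one_pow])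
  have h0 : ∀ i j, octWeight i 0 + octWeight i 1 ≠ octWeight j 0 + octWeight j 1 →
      (i, j) ≠ (4, 7) → (i, j) ≠ (7, 4) → h.1 i j = 0 := by
    intro i j hij hne hne'
    refine apply_eq_zero_of_commute_diag hh ?_
    rw [hchar]
    have key : ∀ i j, octWeight i 0 + octWeight i 1 ≠ octWeight j 0 + octWeight j 1 →
        (i, j) ≠ (4, 7) → (i, j) ≠ (7, 4) →
        (octWeight i - octWeight j) 0 + (octWeight i - octWeight j) 1 ∈ ([1, 2, 3, -1, -2, -3] : List ℤ) := by
      decide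
    have := key i j hij hne hne'
    simp only [List.mem_cons, List.not_mem_nil, or_false] at this
    rcases this with h | h | h | h | h | h <;> rw [h]
    · simpa using h1
    · exact_mod_cast h2
    · exact_mod_cast h3
    · simpa using h1
    · rw [_root_.zpow_neg, ne_eq, inv_eq_one]; exact_mod_cast h2
    · rw [_root_.zpow_neg, ne_eq, inv_eq_one]; exact_mod_cast h3
  have hcol : ∀ j, h.1 *ᵥ Pi.single j 1 = fun i => h.1 i j := fun j => by rw [mulVec_single_one]; rfl
  have e2 : (Pi.single 2 1 : Fin 8 → K) = oct 0 0 ![1, 0, 0] 0 := by ext i; fin_cases i <;> simp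
  have e3 : (Pi.single 3 1 : Fin 8 → K) = oct 0 0 ![0, 1, 0] 0 := by ext i; fin_cases i <;> simp
  have e4 : (Pi.single 4 1 : Fin 8 → K) = oct 0 0 ![0, 0, 1] 0 := by ext i; fin_cases i <;> simp
  have e5 : (Pi.single 5 1 : Fin 8 → K) = oct 0 0 0 ![1, 0, 0] := by ext i; fin_cases i <;> simp
  have e6 : (Pi.single 6 1 : Fin 8 → K) = oct 0 0 0 ![0, 1, 0] := by ext i; fin_cases i <;> simp
  have e7 : (Pi.single 7 1 : Fin 8 → K) = oct 0 0 0 ![0, 0, 1] := by ext i; fin_cases i <;> simp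
  -- the third upper and lower coordinate vectors are products of two vectors of smaller weight
  have h47 : h.1 4 7 = 0 := by
    have e := hG (Pi.single 2 1) (Pi.single 3 1)
    have f2 : h.1 *ᵥ Pi.single 2 1 = oct 0 0 ![h.1 2 2, h.1 3 2, 0] 0 := by
      rw [hcol]; ext i; fin_cases i <;> simp <;> exact h0 _ _ (by decide) (by decide) (by decide)
    have f3 : h.1 *ᵥ Pi.single 3 1 = oct 0 0 ![h.1 2 3, h.1 3 3, 0] 0 := by
      rw [hcol]; ext i; fin_cases i <;> simp <;> exact h0 _ _ (by decide) (by decide) (by decide)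
    rw [f2, f3, e2, e3, scMul_oct, scMul_oct] at e
    have f : oct (0 * 0 + ![1, 0, 0] ⬝ᵥ (0 : Fin 3 → K)) (0 * 0 + ![0, 1, 0] ⬝ᵥ (0 : Fin 3 → K))
        ((0 : K) • ![0, 1, 0] + (0 : K) • ![1, 0, 0] + crossProduct 0 0)
        ((0 : K) • 0 + (0 : K) • 0 - crossProduct ![1, 0, 0] ![0, 1, 0]) = -Pi.single 7 1 := by
      rw [e7]; ext i; fin_cases i <;> simp
    rw [f, mulVec_neg, hcol] at e
    have := congrFun e 4
    simpa using this
  have h74 : h.1 7 4 = 0 := by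
    have e := hG (Pi.single 5 1) (Pi.single 6 1)
    have f2 : h.1 *ᵥ Pi.single 5 1 = oct 0 0 0 ![h.1 5 5, h.1 6 5, 0] := by
      rw [hcol]; ext i; fin_cases i <;> simp <;> exact h0 _ _ (by decide) (by decide) (by decide)
    have f3 : h.1 *ᵥ Pi.single 6 1 = oct 0 0 0 ![h.1 5 6, h.1 6 6, 0] := by
      rw [hcol]; ext i; fin_cases i <;> simp <;> exact h0 _ _ (by decide) (by decide) (by decide)
    rw [f2, f3, e5, e6, scMul_oct, scMul_oct] at e
    have f : oct (0 * 0 + (0 : Fin 3 → K) ⬝ᵥ ![0, 1, 0]) (0 * 0 + (0 : Fin 3 → K) ⬝ᵥ ![1, 0, 0])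
        ((0 : K) • 0 + (0 : K) • 0 + crossProduct ![1, 0, 0] ![0, 1, 0])
        ((0 : K) • ![1, 0, 0] + (0 : K) • ![0, 1, 0] - crossProduct 0 0) = Pi.single 4 1 := by
      rw [e4]; ext i; fin_cases i <;> simp
    rw [f, hcol] at e
    have := congrFun e 7
    simpa using this
  refine commute_weightTorus_of_apply_eq_zero fun i j hij => ?_
  rw [hchar, hchar] at hij
  by_cases h5 : (i, j) = (4, 7)
  · obtain ⟨rfl, rfl⟩ := Prod.mk.inj h5; exact h47
  by_cases h6 : (i, j) = (7, 4)
  · obtain ⟨rfl, rfl⟩ := Prod.mk.inj h6; exact h74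
  exact h0 i j (fun h => hij (by rw [h])) h5 h6

end Centralizers

/-! ### Normal form of torus elements -/

section Rotation

variable {K : Type*} [Field K]

/-- The property that some one-parameter subgroup of the diagonal torus centralizes the centralizer
of `weightTorus octWeight z`, or else `z = (a, a)` with `a` of order at most `3`. -/
def IsSpecialOrDegenerate (z : Fin 2 → Kˣ) : Prop :=
  (∃ a : Kˣ, z = ![a, a] ∧ (a ^ 2 = 1 ∨ a ^ 3 = 1)) ∨
    ∃ n : Fin 2 → ℤ, n ≠ 0 ∧ ∀ h ∈ autPts zornConst K,
      weightTorus octWeight z * h = h * weightTorus octWeight z → ∀ c : Kˣ,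
        weightTorus octWeight (fun i => c ^ n i) * h = h * weightTorus octWeight fun i => c ^ n i

/-- The elements of the diagonal torus which can be conjugated, by an element normalizing this
torus, into one satisfying the previous property. -/
def CanNormalize (z : Fin 2 → Kˣ) : Prop :=
  ∃ g ∈ autPts zornConst K, ∃ M M' : Matrix (Fin 2) (Fin 2) ℤ, M * M' = 1 ∧
    (∀ y, g * weightTorus octWeight y * g⁻¹ = weightTorus octWeight (matTorus M y)) ∧
    IsSpecialOrDegenerate (matTorus M z)

lemma matTorus_cycle (x y : Kˣ) : matTorus !![-1, -1; 1, 0] ![x, y] = ![(x * y)⁻¹, x] := by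
  ext i
  fin_cases i <;> simp [matTorus, mul_comm]

lemma CanNormalize.of_special {z : Fin 2 → Kˣ} (h : IsSpecialOrDegenerate z) : CanNormalize z :=
  ⟨1, one_mem _, 1, 1, one_mul 1, by simp [matTorus_one], by rwa [matTorus_one]⟩

/-- The three coordinates `x`, `y`, `(x y)⁻¹` may be rotated. -/
lemma CanNormalize.of_cycle {x y : Kˣ} (h : CanNormalize ![(x * y)⁻¹, x]) :
    CanNormalize ![x, y] := by
  obtain ⟨g, hg, M, M', hM, hc, hs⟩ := h
  refine ⟨g * octSL (cycleSL3 K), mul_mem hg (octSL_mem _), M * !![-1, -1; 1, 0],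
    !![0, 1; -1, -1] * M', ?_, fun y => ?_, ?_⟩
  · rw [Matrix.mul_assoc, ← Matrix.mul_assoc !![-1, -1; 1, 0],
      show (!![-1, -1; 1, 0] * !![0, 1; -1, -1] : Matrix (Fin 2) (Fin 2) ℤ) = 1 by decide,
      Matrix.one_mul, hM]
  · rw [← matTorus_matTorus, ← hc, ← octCycle_conj]; group
  · rwa [← matTorus_matTorus, matTorus_cycle]

/-- If `x`, `y` and `(x y)⁻¹` are distinct and only `x` may be `±1`, the one-parameter subgroup
`c ↦ (1, c)` commutes with the centralizer of `(x, y)`. -/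
lemma canNormalize_of_distinct {x y : Kˣ} (hxy : x ≠ y) (hx : x ^ 2 * y ≠ 1) (hy : x * y ^ 2 ≠ 1)
    (h1 : y ^ 2 ≠ 1) (h2 : (x * y) ^ 2 ≠ 1) : CanNormalize ![x, y] := by
  refine CanNormalize.of_special (Or.inr ⟨![0, 1], by simp, fun h _ hh c => ?_⟩)
  have e : (fun i => c ^ (![0, 1] : Fin 2 → ℤ) i) = ![1, c] := by
    ext i; fin_cases i <;> simp
  rw [e]
  refine commute_of_generic (fun d hd => ?_) hh c
  simp only [List.mem_cons, List.not_mem_nil, or_false] at hd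
  rcases hd with rfl | rfl | rfl | rfl | rfl | rfl | rfl <;>
    simp only [monomialChar_two, cons_val_zero, cons_val_one, zpow_one, zpow_zero, one_mul,
      _root_.zpow_neg, Matrix.cons_val_fin_one] <;> norm_cast
  · rintro rfl; exact h1 (one_pow 2)
  · intro h; exact h2 (by rw [h, one_pow])
  · intro h; exact hxy (inv_mul_eq_one.1 h)
  · rwa [← mul_pow]

/-- If two coordinates are equal to `x`, and `x² ≠ 1`, `x³ ≠ 1`, the one-parameter subgroup `c ↦ (c, c)`
commutes with the centralizer of `(x, x)`. -/
lemma canNormalize_of_eq (x : Kˣ) : CanNormalize ![x, x] := by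
  refine CanNormalize.of_special ?_
  by_cases h2 : x ^ 2 = 1
  · exact Or.inl ⟨x, rfl, Or.inl h2⟩
  by_cases h3 : x ^ 3 = 1
  · exact Or.inl ⟨x, rfl, Or.inr h3⟩
  refine Or.inr ⟨![1, 1], by simp, fun h hG hh c => ?_⟩
  have e : (fun i => c ^ (![1, 1] : Fin 2 → ℤ) i) = ![c, c] := by
    ext i; fin_cases i <;> simp
  rw [e]
  exact commute_of_eq h2 h3 hG hh c

/-- The coordinates of `z` and the inverse of their product can be rotated. If two of the three
numbers are equal, rotate them to the front; otherwise at most one of them is `±1`, and it is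
rotated to the front. -/
lemma canNormalize (z : Fin 2 → Kˣ) : CanNormalize z := by
  obtain ⟨x, y, rfl⟩ : ∃ x y, z = ![x, y] := ⟨z 0, z 1, by ext i; fin_cases i <;> rfl⟩
  have e1 : ∀ x y : Kˣ, ((x * y)⁻¹ * x)⁻¹ = y := fun x y => by
    rw [_root_.mul_inv_rev, inv_inv, inv_mul_cancel_left]
  have two : ∀ {x y : Kˣ}, CanNormalize ![y, (x * y)⁻¹] → CanNormalize ![x, y] := fun {x y} h => by
    refine .of_cycle (.of_cycle ?_)
    rwa [e1]
  by_cases hxy : x = y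
  · subst hxy; exact canNormalize_of_eq x
  by_cases hx : x ^ 2 * y = 1
  · refine .of_cycle ?_
    have : (x * y)⁻¹ = x := by
      rw [inv_eq_iff_eq_inv, eq_inv_iff_mul_eq_one, mul_right_comm, ← sq, hx]
    rw [this]; exact canNormalize_of_eq x
  by_cases hy : x * y ^ 2 = 1
  · refine two ?_
    have : (x * y)⁻¹ = y := by
      rw [inv_eq_iff_eq_inv, eq_inv_iff_mul_eq_one, mul_assoc, ← sq, hy]
    rw [this]; exact canNormalize_of_eq y
  have sq1 : ∀ {x : Kˣ}, x ^ 2 = 1 → x = 1 ∨ x = -1 := fun {x} h => by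
    have h' : (x : K) ^ 2 = 1 := by rw [← Units.val_pow_eq_pow_val, h, Units.val_one]
    rcases sq_eq_sq_iff_eq_or_eq_neg.1 (h'.trans (one_pow 2).symm) with h | h
    · left; ext; simpa using h
    · right; ext; simpa using h
  obtain ⟨t, ht⟩ : ∃ t, t = (x * y)⁻¹ := ⟨_, rfl⟩
  have htK : (x * y * t : K) = 1 := by
    rw [← Units.val_mul, ← Units.val_mul, ht, mul_inv_cancel, Units.val_one]
  have val : ∀ {u v : Kˣ}, u = v → (u : K) = v := fun h => congrArg Units.val h
  have hxt : x ≠ t := fun h => hx (Units.ext (by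
    have := val h; push_cast; linear_combination (x * y : K) * this + htK))
  have hyt : y ≠ t := fun h => hy (Units.ext (by
    have := val h; push_cast; linear_combination (x * y : K) * this + htK))
  -- at most one of three distinct numbers with product `1` is `±1`
  have key : ∀ {u v w : Kˣ}, (u * v * w : K) = 1 → u ≠ v → u ≠ w → v ≠ w → u ^ 2 = 1 →
      v ^ 2 ≠ 1 := by
    intro u v w huvw huv huw hvw hu hv
    have hw : w = u * v := Units.ext (by
      have h1 := val hu
      have h2 := val hv
      push_cast at h1 h2 ⊢
      linear_combination (u * v : K) * huvw - w * h1 * v ^ 2 - w * h2)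
    subst hw
    rcases sq1 hu with rfl | rfl <;> rcases sq1 hv with rfl | rfl <;> simp_all
  by_cases h1 : y ^ 2 = 1
  · refine two (ht ▸ canNormalize_of_distinct hyt ?_ ?_ ?_ ?_)
    · exact fun h => hxy (Units.ext (by
        have := val h; push_cast at this; linear_combination -(x : K) * this + y * htK))
    · exact fun h => hx (Units.ext (by
        have := val h; push_cast at this ⊢
        linear_combination -(x ^ 2 * y : K) * this + (x * y * t + 1) * htK))
    · exact key (by linear_combination htK) hyt (Ne.symm hxy) (Ne.symm hxt) h1
    · rw [ht, show y * (x * y)⁻¹ = x⁻¹ by rw [_root_.mul_inv_rev, mul_inv_cancel_left],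
        _root_.inv_pow, ne_eq, inv_eq_one]
      exact key (by linear_combination htK) (Ne.symm hxy) hyt hxt h1
  by_cases h2 : t ^ 2 = 1
  · refine .of_cycle (ht ▸ canNormalize_of_distinct (Ne.symm hxt) ?_ ?_ ?_ ?_)
    · exact fun h => hy (Units.ext (by
        have := val h; push_cast at this ⊢
        linear_combination -(x * y ^ 2 : K) * this + (x * y * t + 1) * htK))
    · exact fun h => hxy (Units.ext (by
        have := val h; push_cast at this; linear_combination (y : K) * this - x * htK))
    · exact key (by linear_combination htK) (Ne.symm hxt) (Ne.symm hyt) hxy h2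
    · rw [ht, show (x * y)⁻¹ * x = y⁻¹ by rw [_root_.mul_inv_rev, inv_mul_cancel_right],
        _root_.inv_pow, ne_eq, inv_eq_one]
      exact h1
  · refine canNormalize_of_distinct hxy hx hy h1 ?_
    rw [ht, _root_.inv_pow, inv_eq_one] at h2
    exact h2

end Rotation

/-! ### Connected centralizers -/

section Connected

variable {K : Type*} [Field K] [IsAlgClosed K] [CharZero K]

lemma range_octSL_le_centralizer {a : Kˣ} (ha : a ^ 3 = 1) :
    (octSL (K := K)).range ≤ autPts zornConst K ⊓
      Subgroup.centralizer {weightTorus octWeight ![a, a]} := by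
  rintro _ ⟨A, rfl⟩
  refine ⟨octSL_mem A, mem_centralizer_singleton.2 ?_⟩
  rw [← octSL_diagSL3, ← map_mul, ← map_mul]
  refine congrArg octSL (Subtype.ext (show (diagSL3 ![a, a]).1 * A.1 = A.1 * (diagSL3 ![a, a]).1 from ?_))
  have e : (diagSL3 ![a, a]).1 = (a : K) • 1 := by
    have : ((a * a)⁻¹ : Kˣ) = a := by rw [inv_eq_iff_mul_eq_one, ← ha, pow_succ, sq]
    rw [diagSL3]
    simp only [cons_val_zero, cons_val_one, this, Matrix.cons_val_fin_one]
    rw [smul_one_eq_diagonal]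
    congr 1
    ext i; fin_cases i <;> rfl
  rw [e]
  simp

/-- The centralizer of an element of order `3` of the centre of `SL_3` is `SL_3`: it cannot exchange
the two idempotents, since these act differently on the eigenspaces of the element. -/
lemma isZConnected_centralizer_order_three {a : Kˣ} (ha : a ^ 3 = 1) (h1 : a ≠ 1) :
    IsZConnected (autPts zornConst K ⊓ Subgroup.centralizer {weightTorus octWeight ![a, a]}) := by
  refine isZConnected_of_forall ((isZClosed_autPts _).inf (isZClosed_centralizer _))
    fun N hN hi => le_trans ?_ (range_le_of_relIndex_ne_zero (range_octSL_le_centralizer ha) hi)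
  rintro h ⟨hG, hc⟩
  replace hc := mem_centralizer_singleton.1 hc
  have hcv : ∀ x : Fin 8 → K, (weightTorus octWeight ![a, a]).1 *ᵥ (h.1 *ᵥ x) =
      h.1 *ᵥ ((weightTorus octWeight ![a, a]).1 *ᵥ x) := fun x => by
    rw [← gl_mul_mulVec, ← gl_mul_mulVec, hc]
  have ha2 : ((a * a)⁻¹ : Kˣ) = a := by rw [inv_eq_iff_mul_eq_one, ← ha, pow_succ, sq]
  have ha' : (a : K) ≠ 1 := fun h => h1 (Units.ext h)
  have hai : ((a⁻¹ : Kˣ) : K) ≠ 1 := fun h => h1 (inv_eq_one.1 (Units.ext h))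
  have haa : ((a⁻¹ : Kˣ) : K) ≠ a := fun h => h1 (by
    have h : a⁻¹ = a := Units.ext h
    rw [inv_eq_iff_mul_eq_one] at h
    rw [← ha, pow_succ, sq, h, one_mul])
  have hW : ∀ (α β : K) (v w : Fin 3 → K),
      (weightTorus octWeight ![a, a]).1 *ᵥ oct α β v w =
        oct α β ((a : K) • v) (((a⁻¹ : Kˣ) : K) • w) := fun α β v w => by
    have ha3 : (a : K) * a = ((a⁻¹ : Kˣ) : K) := by
      rw [← Units.val_mul]; exact congrArg Units.val (inv_injective (by rw [ha2, inv_inv]))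
    rw [octWeight_mulVec]
    simp only [cons_val_zero, cons_val_one, ha2, ha3, Matrix.cons_val_fin_one]
    congr 1 <;> (ext i; fin_cases i <;> rfl)
  have hmul : ∀ {c d : K} {v : Fin 3 → K}, c ≠ d → c • v = d • v → v = 0 := fun {c d v} hcd h => by
    rw [← sub_eq_zero, ← sub_smul] at h
    exact (smul_eq_zero.1 h).resolve_left (sub_ne_zero.2 hcd)
  obtain ⟨hsum, hnorm⟩ := oct_idempotent_mulVec hG
  obtain ⟨e, he⟩ : ∃ e, e = h.1 *ᵥ oct 1 0 0 0 := ⟨_, rfl⟩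
  rw [← he] at hsum hnorm
  have hfix := hcv (oct 1 0 0 0)
  rw [hW, smul_zero, smul_zero, ← he] at hfix
  obtain ⟨v, hv⟩ : ∃ v, v = octV e := ⟨_, rfl⟩
  obtain ⟨w, hw⟩ : ∃ w, w = octW e := ⟨_, rfl⟩
  have ee : e = oct (e 0) (e 1) v w := by rw [hv, hw, oct_eta]
  rw [ee, hW] at hfix
  obtain ⟨-, -, hv0, hw0⟩ := oct_inj.1 hfix
  have hv0 : v = 0 := hmul ha' (by rw [hv0, one_smul])
  have hw0 : w = 0 := hmul hai (by rw [hw0, one_smul])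
  subst hv0 hw0
  have hn : e 0 * e 1 = 0 := by
    rw [octNorm, ← hv, zero_dotProduct, sub_zero] at hnorm
    exact hnorm
  rcases mul_eq_zero.1 hn with h0 | h0
  · -- the two idempotents would be exchanged
    exfalso
    rw [h0, zero_add] at hsum
    rw [h0, hsum] at ee
    obtain ⟨u, hu⟩ : ∃ u : Fin 3 → K, u 0 = 1 := ⟨![1, 0, 0], rfl⟩
    have hx := hcv (oct 0 0 u 0)
    rw [hW, smul_zero, show oct 0 0 ((a : K) • u) 0 = (a : K) • oct 0 0 u 0 by
      rw [oct_smul]; simp, mulVec_smul] at hx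
    obtain ⟨y, hy⟩ : ∃ y, y = h.1 *ᵥ oct 0 0 u 0 := ⟨_, rfl⟩
    rw [← hy, ← oct_eta y, hW, oct_smul, oct_inj] at hx
    have hz : ∀ {x : K}, x = a * x → x = 0 := fun {x} h => by
      by_contra hx
      exact ha' (mul_right_cancel₀ hx (by rw [← h, one_mul]))
    have hy' : y = oct 0 0 (octV y) 0 := by
      conv_lhs => rw [← oct_eta y, hz hx.1, hz hx.2.1, hmul haa hx.2.2.2]
    have h2 := map_scMul hG (oct 1 0 0 0) (oct 0 0 u 0)
    rw [← he, ee, ← hy, hy', scMul_oct, scMul_oct] at h2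
    simp only [mul_zero, zero_mul, dotProduct_zero, zero_dotProduct, add_zero, one_smul, zero_smul,
      smul_zero, map_zero, LinearMap.zero_apply, sub_zero] at h2
    have := gl_mulVec_injective h ((h2.trans (by simp [oct] : _ = (0 : Fin 8 → K))).trans
      (mulVec_zero _).symm)
    simpa [hu] using congrFun this 2
  · rw [h0, add_zero] at hsum
    rw [h0, hsum, he] at ee
    obtain ⟨A, hA⟩ := exists_octSL_eq hG ee
    exact ⟨A, hA⟩

/-- The centralizer of an involution is generated by its identity component: the stabilizer of the
idempotent in it is `GL_2`, and the unipotents in the direction of the fixed vector move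
all the idempotents which are fixed by the involution. -/
lemma isZConnected_centralizer_neg_one :
    IsZConnected (autPts zornConst K ⊓ Subgroup.centralizer {weightTorus octWeight ![-1, -1]}) := by
  refine isZConnected_of_forall ((isZClosed_autPts _).inf (isZClosed_centralizer _))
    fun N hN hi => ?_
  have hWN : ∀ z, weightTorus octWeight z ∈ N := fun z => mem_of_forall_exists_pow hi fun k hk => by
    obtain ⟨y, hy⟩ := exists_torus_pow z k hk
    refine ⟨weightTorus octWeight y, ⟨weightTorus_octWeight_mem y,
      mem_centralizer_singleton.2 ?_⟩, by rw [← map_pow, hy]⟩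
    rw [← map_mul, ← map_mul, mul_comm]
  have hlong : (octLong (K := K)).range ≤ N := by
    refine range_le_of_relIndex_ne_zero ?_ hi
    rintro _ ⟨A, rfl⟩
    refine ⟨octSL_mem _, mem_centralizer_singleton.2 ?_⟩
    rw [← octSL_diagSL3, octLong, MonoidHom.comp_apply, ← map_mul, ← map_mul]
    refine congrArg octSL (Subtype.ext (show (diagSL3 ![-1, -1]).1 * (blockSL3 A).1 =
      (blockSL3 A).1 * (diagSL3 ![-1, -1]).1 from ?_))
    rw [blockSL3_val, diagSL3]
    ext i j
    fin_cases i <;> fin_cases j <;> simp [Matrix.mul_apply, Fin.sum_univ_three]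
  have hE : ∀ u ∈ Submodule.span K {(![0, 0, 1] : Fin 3 → K)}, octE u ∈ N := by
    intro u hu
    obtain ⟨c, rfl⟩ := Submodule.mem_span_singleton.1 hu
    refine octE_mem_of_relIndex_ne_zero hi fun c' => ⟨octE_mem _, mem_centralizer_singleton.2 ?_⟩
    rw [← mul_inv_eq_iff_eq_mul, weightTorus_conj_octE]
    congr 1
    ext i; fin_cases i <;> simp
  have hF : ∀ u ∈ Submodule.span K {(![0, 0, 1] : Fin 3 → K)}, octF u ∈ N := by
    intro u hu
    obtain ⟨c, rfl⟩ := Submodule.mem_span_singleton.1 hu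
    refine octF_mem_of_relIndex_ne_zero hi fun c' => ⟨octF_mem _, mem_centralizer_singleton.2 ?_⟩
    rw [← mul_inv_eq_iff_eq_mul, weightTorus_conj_octF]
    congr 1
    ext i; fin_cases i <;> simp
  have hW : ∀ x : Fin 8 → K, (weightTorus octWeight ![-1, -1]).1 *ᵥ x =
      oct (x 0) (x 1) ![-x 2, -x 3, x 4] ![-x 5, -x 6, x 7] := fun x => by
    conv_lhs => rw [← oct_eta x]
    rw [octWeight_mulVec]
    simp [octV, octW]
  have hcv : ∀ {h : GL (Fin 8) K}, h ∈ Subgroup.centralizer {weightTorus octWeight ![-1, -1]} →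
      ∀ x : Fin 8 → K, (weightTorus octWeight ![-1, -1]).1 *ᵥ (h.1 *ᵥ x) =
        h.1 *ᵥ ((weightTorus octWeight ![-1, -1]).1 *ᵥ x) := fun {h} hh x => by
    rw [← gl_mul_mulVec, ← gl_mul_mulVec, mem_centralizer_singleton.1 hh]
  have hneg : ∀ {x : K}, -x = x → x = 0 := fun {x} h => self_eq_neg.1 h.symm
  intro h hh
  obtain ⟨hG, hc⟩ := Subgroup.mem_inf.1 hh
  obtain ⟨hsum, hnorm⟩ := oct_idempotent_mulVec hG
  have hfix := hcv hc (oct 1 0 0 0)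
  obtain ⟨e, he⟩ : ∃ e, e = h.1 *ᵥ oct 1 0 0 0 := ⟨_, rfl⟩
  have hfix0 : (weightTorus octWeight ![-1, -1]).1 *ᵥ oct 1 0 0 0 = oct (1 : K) 0 0 0 := by
    rw [octWeight_mulVec]; ext i; fin_cases i <;> simp
  rw [hfix0, ← he, hW] at hfix
  rw [← he] at hsum hnorm
  have hx : ∀ i ∈ ([2, 3, 5, 6] : List (Fin 8)), e i = 0 := by
    intro i hi
    have := congrFun hfix i
    fin_cases hi <;> exact hneg (by simpa [oct] using this)
  obtain ⟨n, hn, hne⟩ := exists_move_idempotent hE hF (u₀ := ![0, 0, 1]) (w₀ := ![0, 0, 1])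
    (Submodule.mem_span_singleton_self _) (Submodule.mem_span_singleton_self _)
    (by simp) (e := e)
    (Submodule.mem_span_singleton.2 ⟨e 4, by
      ext i; fin_cases i <;> simp [octV, hx 2, hx 3]⟩)
    (Submodule.mem_span_singleton.2 ⟨e 7, by
      ext i; fin_cases i <;> simp [octW, hx 5, hx 6]⟩) hsum hnorm
  have hnh : n * h ∈ autPts zornConst K ⊓
      Subgroup.centralizer {weightTorus octWeight ![-1, -1]} := mul_mem (hN hn) hh
  obtain ⟨A, hA⟩ := exists_octSL_eq hnh.1 (by rw [gl_mul_mulVec, ← he, hne])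
  suffices hAN : octSL A ∈ N by
    rw [hA] at hAN
    exact (N.mul_mem_cancel_left hn).1 hAN
  have hcA : octSL A ∈ Subgroup.centralizer {weightTorus octWeight ![-1, -1]} := hA ▸ hnh.2
  have h2 : ∀ j, (octSL A).1 *ᵥ oct 0 0 (Pi.single j 1) 0 = oct 0 0 (fun i => A.1 i j) 0 :=
    fun j => by rw [octSL_mulVec, mulVec_single_one, mulVec_zero]; rfl
  have hr : A.1 2 0 = 0 ∧ A.1 2 1 = 0 ∧ A.1 0 2 = 0 ∧ A.1 1 2 = 0 := by
    have k0 := hcv hcA (oct 0 0 (Pi.single 0 1) 0)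
    have k1 := hcv hcA (oct 0 0 (Pi.single 1 1) 0)
    have k2 := hcv hcA (oct 0 0 (Pi.single 2 1) 0)
    have f0 : (weightTorus octWeight ![-1, -1]).1 *ᵥ oct 0 0 (Pi.single 0 1) 0 =
        -oct (0 : K) 0 (Pi.single 0 1) 0 := by rw [hW]; ext i; fin_cases i <;> simp [oct]
    have f1 : (weightTorus octWeight ![-1, -1]).1 *ᵥ oct 0 0 (Pi.single 1 1) 0 =
        -oct (0 : K) 0 (Pi.single 1 1) 0 := by rw [hW]; ext i; fin_cases i <;> simp [oct]
    have f2 : (weightTorus octWeight ![-1, -1]).1 *ᵥ oct 0 0 (Pi.single 2 1) 0 =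
        oct (0 : K) 0 (Pi.single 2 1) 0 := by rw [hW]; ext i; fin_cases i <;> simp [oct]
    rw [f0, mulVec_neg, h2, hW] at k0
    rw [f1, mulVec_neg, h2, hW] at k1
    rw [f2, h2, hW] at k2
    refine ⟨hneg ?_, hneg ?_, hneg ?_, hneg ?_⟩
    · simpa [oct] using (congrFun k0 4).symm
    · simpa [oct] using (congrFun k1 4).symm
    · simpa [oct] using congrFun k2 2
    · simpa [oct] using congrFun k2 3
  obtain ⟨r1, r2, r3, r4⟩ := hr
  have hdet := A.2
  rw [det_fin_three] at hdet
  simp only [r1, r2, r3, r4, mul_zero, zero_mul, sub_zero, add_zero] at hdet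
  have ht : A.1 2 2 ≠ 0 := fun h0 => by simp [h0] at hdet
  obtain ⟨t, htt⟩ : ∃ t : Kˣ, (t : K) = A.1 2 2 := ⟨Units.mk0 _ ht, rfl⟩
  rw [← htt] at hdet
  obtain ⟨B, hB⟩ : ∃ B : SpecialLinearGroup (Fin 2) K,
      B.1 = !![(t : K) * A.1 0 0, t * A.1 0 1; A.1 1 0, A.1 1 1] :=
    ⟨⟨_, by rw [det_fin_two_of]; linear_combination hdet⟩, rfl⟩
  have hAB : A = diagSL3 ![t⁻¹, 1] * blockSL3 B := by
    refine Subtype.ext (show A.1 = (diagSL3 ![t⁻¹, 1]).1 * (blockSL3 B).1 from ?_)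
    rw [blockSL3_val, hB, diagSL3]
    ext i j
    fin_cases i <;> fin_cases j <;>
      simp [Matrix.mul_apply, Fin.sum_univ_three, r1, r2, r3, r4, htt,
        inv_mul_cancel_left₀ ht]
  rw [hAB, map_mul, octSL_diagSL3]
  exact mul_mem (hWN _) (hlong ⟨B, rfl⟩)

/-- The centralizer in `G_2` of `(a, a)` is connected when `a` has order at most `3`. It is `G_2`, `SO_4`,
`SL_3` for order `1`, `2`, `3`, respectively. -/
lemma isZConnected_centralizer {a : Kˣ} (ha : a ^ 2 = 1 ∨ a ^ 3 = 1) :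
    IsZConnected (autPts zornConst K ⊓ Subgroup.centralizer {weightTorus octWeight ![a, a]}) := by
  by_cases h1 : a = 1
  · have : (![a, a] : Fin 2 → Kˣ) = 1 := by rw [h1]; ext i; fin_cases i <;> rfl
    rw [this, map_one, show Subgroup.centralizer {(1 : GL (Fin 8) K)} = ⊤ from
      eq_top_iff.2 fun g _ => mem_centralizer_singleton.2 (by rw [one_mul, mul_one]), inf_top_eq]
    exact isZConnected_oct
  · rcases ha with ha | ha
    · have : a = -1 := by
        have h' : (a : K) ^ 2 = 1 := by rw [← Units.val_pow_eq_pow_val, ha, Units.val_one]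
        rcases sq_eq_sq_iff_eq_or_eq_neg.1 (h'.trans (one_pow 2).symm) with h | h
        · exact absurd (Units.ext h) h1
        · ext; simpa using h
      rw [this]
      exact isZConnected_centralizer_neg_one
    · exact isZConnected_centralizer_order_three ha h1

end Connected

/-! ### Outer automorphisms realized in an ambient group -/

section Outer

variable {G : Type*} [Group G] {H : Subgroup G} {g g' : G} {x y : OutAut H}

lemma InducesOut.unique (h : InducesOut H g x) (h' : InducesOut H g y) : x = y := by
  obtain ⟨f, hf, rfl⟩ := h
  obtain ⟨f', hf', rfl⟩ := h'
  congr 1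
  ext k
  rw [hf, hf']

lemma inducesOut_of_mem (hg : g ∈ H) : InducesOut H g 1 :=
  ⟨MulAut.conj ⟨g, hg⟩, fun _ => rfl, (QuotientGroup.eq_one_iff _).2 ⟨_, rfl⟩⟩

lemma exists_inducesOut (h : ∀ k ∈ H, g * k * g⁻¹ ∈ H) (h' : ∀ k ∈ H, g⁻¹ * k * g ∈ H) :
    ∃ x, InducesOut H g x :=
  ⟨_, { toFun := fun k => ⟨g * k * g⁻¹, h k k.2⟩
        invFun := fun k => ⟨g⁻¹ * k * g, h' k k.2⟩
        left_inv := fun k => Subtype.ext (by group)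
        right_inv := fun k => Subtype.ext (by group)
        map_mul' := fun k l => Subtype.ext (by simp) }, fun _ => rfl, rfl⟩

/-- Elements which induce the same outer automorphism act in the same way on the centre. -/
lemma InducesOut.conj_eq_of_central (h : InducesOut H g x) (h' : InducesOut H g' x) {z : G}
    (hz : z ∈ H) (hc : ∀ k ∈ H, k * z = z * k) : g * z * g⁻¹ = g' * z * g'⁻¹ := by
  obtain ⟨f, hf, rfl⟩ := h
  obtain ⟨f', hf', hff⟩ := h'
  obtain ⟨k, hk⟩ := QuotientGroup.eq.1 hff
  have h1 : f' ((MulAut.conj k) ⟨z, hz⟩) = f ⟨z, hz⟩ := by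
    rw [hk, ← MulAut.mul_apply, mul_inv_cancel_left]
  have h2 : (MulAut.conj k) ⟨z, hz⟩ = ⟨z, hz⟩ := Subtype.ext (by
    simp only [MulAut.conj_apply, Subgroup.coe_mul, InvMemClass.coe_inv]
    rw [hc k k.2, mul_inv_cancel_right])
  rw [h2] at h1
  have := congrArg Subtype.val h1
  rwa [hf, hf', eq_comm] at this

end Outer

/-! ### Normal form of elliptic pairs -/

section Ncard

variable {K : Type*} [Field K] {ι : Type} [Fintype ι] [DecidableEq ι]

lemma ncard_rootPairs_comp {r : ℕ} (H : Subgroup (GL ι K)) (a : (Fin r → Kˣ) →* GL ι K)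
    {C C' : Matrix (Fin r) (Fin r) ℤ} (hC : C * C' = 1) :
    (rootPairs H (a.comp (matTorusHom C))).ncard = (rootPairs H a).ncard := by
  have hC' : C' * C = 1 := mul_eq_one_comm.1 hC
  have h1 : Cᵀ * C'ᵀ = 1 := by rw [← transpose_mul, hC', transpose_one]
  have h2 : C'ᵀ * Cᵀ = 1 := by rw [← transpose_mul, hC, transpose_one]
  refine Set.ncard_congr (fun p _ => (C'ᵀ *ᵥ p.1, C *ᵥ p.2)) (fun p hp => ?_) ?_ fun p hp => ?_
  · exact (mem_rootPairs_comp_matTorusHom H a hC p.1 p.2).1 hp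
  · rintro ⟨m, n⟩ ⟨m', n'⟩ - - h
    obtain ⟨e1, e2⟩ := Prod.mk.inj h
    have e1 := congrArg (Cᵀ *ᵥ ·) e1
    have e2 := congrArg (C' *ᵥ ·) e2
    simp only [mulVec_mulVec, h1, hC', one_mulVec] at e1 e2
    rw [e1, e2]
  · refine ⟨(Cᵀ *ᵥ p.1, C' *ᵥ p.2), ?_, ?_⟩
    · refine (mem_rootPairs_comp_matTorusHom H a hC _ _).2 ?_
      simpa only [mulVec_mulVec, h2, hC, one_mulVec] using hp
    · simp only [mulVec_mulVec, h2, hC, one_mulVec]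

/-- The number of roots does not depend on the parametrization of the maximal torus. -/
lemma IsSplitModel.ncard_rootPairs [IsAlgClosed K] [CharZero K] {H : Subgroup (GL ι K)}
    {χ : ι → Fin 2 → ℤ} {e : Fin 2 → ι} (hH : IsSplitModel H χ e) {r : ℕ}
    {a : (Fin r → Kˣ) →* GL ι K} (ha : IsMaxTorusParam H a) :
    (rootPairs H a).ncard = (rootPairs H (weightTorus χ)).ncard := by
  obtain ⟨rfl, g, hg, -, C, C', hC, h⟩ := hH.exists_conj_param le_rfl (one_mem H)
    ⟨Polynomial.X - 1, (Polynomial.irreducible_X_sub_C 1).squarefree, by simp⟩ (by simp)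
    (fun T hT _ _ => hT) ha
  have e1 : conjHom g a = (weightTorus χ).comp (matTorusHom C) := MonoidHom.ext fun z => by
    rw [conjHom_apply, h]; rfl
  rw [← rootPairs_conj H a g, conjSub_of_mem hg, e1, ncard_rootPairs_comp H _ hC]

end Ncard

/-- The roots of `G_2` which are trivial on an element `(a, a)` with `a` of order `k`. -/
def dualRoots (k : ℕ) : Finset ((Fin 2 → ℤ) × (Fin 2 → ℤ)) :=
  octRoots.filter fun p => (k : ℤ) ∣ p.1 0 + p.1 1

lemma monomialChar_pair {K : Type*} [Field K] (m : Fin 2 → ℤ) (a : Kˣ) :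
    monomialChar m ![a, a] = 1 ↔ (orderOf a : ℤ) ∣ m 0 + m 1 := by
  rw [orderOf_dvd_iff_zpow_eq_one, _root_.zpow_add, monomialChar_two]
  rfl

lemma isSplitModel_G2Dual : IsSplitModel G2Dual octWeight ![2, 3] := isSplitModel_oct

lemma isZClosed_G2Dual_inf (s : GL (Fin 8) ℂ) :
    IsZClosed (G2Dual ⊓ Subgroup.centralizer {s}) :=
  (isZClosed_autPts _).inf (isZClosed_centralizer _)

lemma connCentralizer_le (s : GL (Fin 8) ℂ) :
    connCentralizer s ≤ G2Dual ⊓ Subgroup.centralizer {s} :=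
  idComp_le (isZClosed_G2Dual_inf s)

lemma conjSub_inf_centralizer {g s : GL (Fin 8) ℂ} (hg : g ∈ G2Dual) :
    conjSub g (G2Dual ⊓ Subgroup.centralizer {s}) =
      G2Dual ⊓ Subgroup.centralizer {g * s * g⁻¹} := by
  ext x
  rw [mem_conjSub, Subgroup.mem_inf, Subgroup.mem_inf, mem_centralizer_singleton,
    mem_centralizer_singleton]
  refine and_congr ?_ ?_
  · rw [← mem_conjSub, conjSub_of_mem hg]
  · constructor <;> intro h
    · calc g * s * g⁻¹ * x = g * (s * (g⁻¹ * x * g)) * g⁻¹ := by group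
        _ = _ := by rw [h]; group
    · calc s * (g⁻¹ * x * g) = g⁻¹ * (g * s * g⁻¹ * x) * g := by group
        _ = _ := by rw [h]; group

lemma conjSub_connCentralizer {g s : GL (Fin 8) ℂ} (hg : g ∈ G2Dual) :
    conjSub g (connCentralizer s) = connCentralizer (g * s * g⁻¹) := by
  rw [connCentralizer, ← idComp_conjSub, conjSub_inf_centralizer hg, connCentralizer]

/-- The centre of `G_2` contains no nontrivial element of the torus. -/
lemma eq_one_of_central {z : Fin 2 → ℂˣ}
    (h : ∀ g ∈ G2Dual, g * weightTorus octWeight z = weightTorus octWeight z * g) : z = 1 := by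
  have h1 := weightTorus_conj_octE z ![1, 1, 0]
  rw [← h _ (octE_mem _), mul_inv_cancel_right] at h1
  have h2 := octE_injective h1
  ext i
  fin_cases i
  · simpa using (congrFun h2 0).symm
  · simpa using (congrFun h2 1).symm

namespace EndoPair

variable {F : Type u} [Field F] {d : EndoPair F}

/-- Elements with roots of all orders in the centralizer of `s` lie in its identity component. -/
lemma mem_dual_of_divisible {x : GL (Fin 8) ℂ} {s : GL (Fin 8) ℂ}
    (h : ∀ k : ℕ, 0 < k → ∃ y ∈ G2Dual, y * s = s * y ∧ y ^ k = x) : x ∈ connCentralizer s :=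
  mem_idComp_of_forall_exists_pow fun k hk => by
    obtain ⟨y, hy, hc, hk⟩ := h k hk
    exact ⟨y, ⟨hy, mem_centralizer_singleton.2 hc.symm⟩, hk⟩

/-- A one-parameter subgroup which centralizes the centralizer of `s` is fixed by `ρ`, as `ρ` is
realized in the centralizer of `s`; hence it is trivial for an elliptic pair. -/
lemma IsElliptic.eq_zero_of_central (hd : d.IsElliptic) {g : GL (Fin 8) ℂ} (hg : g ∈ G2Dual)
    {z : Fin 2 → ℂˣ} (hz : g * d.s * g⁻¹ = weightTorus octWeight z) {n : Fin 2 → ℤ}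
    (hn : ∀ h ∈ G2Dual, weightTorus octWeight z * h = h * weightTorus octWeight z → ∀ c : ℂˣ,
      weightTorus octWeight (fun i => c ^ n i) * h = h * weightTorus octWeight fun i => c ^ n i) :
    n = 0 := by
  have hs : d.s = g⁻¹ * weightTorus octWeight z * g := by rw [← hz]; group
  obtain ⟨l, hl⟩ : ∃ l : ℂˣ → GL (Fin 8) ℂ,
      ∀ c, l c = g⁻¹ * weightTorus octWeight (fun i => c ^ n i) * g := ⟨_, fun _ => rfl⟩
  have hlG : ∀ c, l c ∈ G2Dual := fun c => by
    rw [hl]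
    exact mul_mem (mul_mem (inv_mem hg) (weightTorus_octWeight_mem _)) hg
  have hcomm : ∀ h ∈ G2Dual, h * d.s = d.s * h → ∀ c, h * l c = l c * h := by
    intro h hh hc c
    have := hn (g * h * g⁻¹) (mul_mem (mul_mem hg hh) (inv_mem hg)) (by
      rw [← hz]
      calc g * d.s * g⁻¹ * (g * h * g⁻¹) = g * (d.s * h) * g⁻¹ := by group
        _ = _ := by rw [← hc]; group) c
    rw [hl]
    calc h * (g⁻¹ * weightTorus octWeight (fun i => c ^ n i) * g)
        = g⁻¹ * (g * h * g⁻¹ * weightTorus octWeight (fun i => c ^ n i)) * g := by group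
      _ = _ := by rw [← this]; group
  have hpow : ∀ c k, 0 < k → ∃ c', l c' ^ k = l c := fun c k hk => by
    obtain ⟨y, hy⟩ := exists_torus_pow (fun _ : Fin 1 => c) k hk
    refine ⟨y 0, ?_⟩
    have hy0 : y 0 ^ k = c := congrFun hy 0
    have e : (fun i => c ^ n i) = (fun i => y 0 ^ n i) ^ k := by
      ext i
      rw [Pi.pow_apply, ← hy0, ← zpow_natCast, ← zpow_natCast, zpow_comm]
    rw [hl, hl, e, map_pow]
    simpa using conj_pow (a := g⁻¹) (b := weightTorus octWeight fun i => y 0 ^ n i) (i := k)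
  have hls : ∀ c, l c * d.s = d.s * l c := fun c => (hcomm d.s d.s_mem rfl c).symm
  have hdual : ∀ c, l c ∈ d.dual := fun c => mem_dual_of_divisible fun k hk => by
    obtain ⟨c', hc'⟩ := hpow c k hk
    exact ⟨l c', hlG c', hls c', hc'⟩
  have hcen : ∀ c, ∀ h ∈ d.dual, h * l c = l c * h := fun c h hh => by
    obtain ⟨h1, h2⟩ := Subgroup.mem_inf.1 (connCentralizer_le _ hh)
    exact hcomm h h1 (mem_centralizer_singleton.1 h2).symm c
  -- `ρ` is realized by elements which commute with `s`, hence with the one-parameter subgroup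
  have hfix : ∀ c, l c ∈ d.fixedCenter := fun c => ⟨hdual c, hcen c, fun σ g' hg' => by
    obtain ⟨g₀, hg₀, hi, hgs⟩ := d.ρ_realized σ
    rw [hg'.conj_eq_of_central hi (hdual c) (hcen c), hcomm g₀ hg₀ (mul_inv_eq_iff_eq_mul.1 hgs) c,
      mul_inv_cancel_right]⟩
  have hid : ∀ c, l c ∈ idComp d.fixedCenter := fun c =>
    mem_idComp_of_forall_exists_pow fun k hk => by
      obtain ⟨c', hc'⟩ := hpow c k hk
      exact ⟨l c', hfix c', hc'⟩
  have hone : ∀ c : ℂˣ, (fun i => c ^ n i) = 1 := fun c => eq_one_of_central fun h hh => by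
    have h1 := (hd _ (hid c)).2 (g⁻¹ * h * g) (mul_mem (mul_mem (inv_mem hg) hh) hg)
    rw [hl] at h1
    calc h * weightTorus octWeight (fun i => c ^ n i)
        = g * (g⁻¹ * h * g * (g⁻¹ * weightTorus octWeight (fun i => c ^ n i) * g)) * g⁻¹ := by
          group
      _ = _ := by rw [h1]; group
  ext i
  by_contra h0
  obtain ⟨c, hc⟩ := exists_unit_not_root_of_unity (K := ℂ) _ h0
  exact hc (congrFun (hone c) i)

/-- For an elliptic pair, `s` is conjugate to `(a, a)` with `a` of order at most `3`. -/
lemma IsElliptic.exists_normal (hd : d.IsElliptic) {g : GL (Fin 8) ℂ} (hg : g ∈ G2Dual)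
    {z : Fin 2 → ℂˣ} (hz : g * d.s * g⁻¹ = weightTorus octWeight z) :
    ∃ g' ∈ G2Dual, ∃ M M' : Matrix (Fin 2) (Fin 2) ℤ, M * M' = 1 ∧
      (∀ y, g' * weightTorus octWeight y * g'⁻¹ = weightTorus octWeight (matTorus M y)) ∧
      ∃ a : ℂˣ, matTorus M z = ![a, a] ∧ (a ^ 2 = 1 ∨ a ^ 3 = 1) := by
  obtain ⟨g', hg', M, M', hM, hc, hs⟩ := canNormalize z
  refine ⟨g', hg', M, M', hM, hc, ?_⟩
  rcases hs with hs | ⟨n, hn0, hn⟩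
  · exact hs
  · refine absurd (hd.eq_zero_of_central (mul_mem hg' hg) ?_ hn) hn0
    rw [← hc, ← hz]
    group

lemma exists_conj_weightTorus (d : EndoPair F) :
    ∃ g ∈ G2Dual, ∃ z, g * d.s * g⁻¹ = weightTorus octWeight z := by
  obtain ⟨g, hg, h⟩ := isSplitModel_G2Dual.conj d.s d.s_mem (sqfreeAnn_iff.2 d.s_semisimple)
  obtain ⟨z, hz⟩ := isSplitModel_G2Dual.diag _ (mul_mem (mul_mem hg d.s_mem) (inv_mem hg)) h
  exact ⟨g, hg, z, hz.symm⟩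

lemma IsElliptic.exists_conj (hd : d.IsElliptic) : ∃ g ∈ G2Dual, ∃ a : ℂˣ,
    g * d.s * g⁻¹ = weightTorus octWeight ![a, a] ∧ (a ^ 2 = 1 ∨ a ^ 3 = 1) := by
  obtain ⟨g, hg, z, hz⟩ := d.exists_conj_weightTorus
  obtain ⟨g', hg', M, M', -, hc, a, hza, ha⟩ := hd.exists_normal hg hz
  refine ⟨g' * g, mul_mem hg' hg, a, ?_, ha⟩
  rw [← hza, ← hc, ← hz]
  group

/-- For an elliptic pair the full centralizer of `s` is connected. -/
lemma IsElliptic.dual_eq (hd : d.IsElliptic) : d.dual = G2Dual ⊓ Subgroup.centralizer {d.s} := by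
  obtain ⟨g, hg, a, hga, ha⟩ := hd.exists_conj
  have h1 : conjSub g d.dual = conjSub g (G2Dual ⊓ Subgroup.centralizer {d.s}) := by
    rw [conjSub_connCentralizer hg, conjSub_inf_centralizer hg, hga]
    exact isZConnected_centralizer ha
  have := congrArg (conjSub g⁻¹) h1
  rwa [conjSub_conjSub, conjSub_conjSub, inv_mul_cancel, conjSub_one, conjSub_one] at this

lemma IsElliptic.mem_dual (hd : d.IsElliptic) {h : GL (Fin 8) ℂ} :
    h ∈ d.dual ↔ h ∈ G2Dual ∧ d.s * h = h * d.s := by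
  rw [hd.dual_eq, Subgroup.mem_inf, mem_centralizer_singleton]

/-- The elements which realize `ρ` centralize `s`, hence lie in `Ĥ` and induce inner automorphisms. -/
lemma IsElliptic.ρ_eq_one (hd : d.IsElliptic) (σ) : d.ρ σ = 1 := by
  obtain ⟨g, hg, hi, hgs⟩ := d.ρ_realized σ
  exact hi.unique (inducesOut_of_mem
    (hd.mem_dual.2 ⟨hg, (mul_inv_eq_iff_eq_mul.1 hgs).symm⟩))

lemma orderOf_conj_pair {g s : GL (Fin 8) ℂ} {a : ℂˣ}
    (h : g * s * g⁻¹ = weightTorus octWeight ![a, a]) : orderOf a = orderOf s := by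
  have h1 : orderOf s = orderOf (g * s * g⁻¹) := by
    have := orderOf_injective (MulAut.conj g).toMonoidHom (MulAut.conj g).injective s
    exact this.symm
  rw [h1, h, orderOf_injective _ isSplitModel_G2Dual.injective]
  have := orderOf_injective (G := ℂˣ) (H := Fin 2 → ℂˣ)
    { toFun := fun a => ![a, a], map_one' := by ext i; fin_cases i <;> rfl,
      map_mul' := fun a b => by ext i; fin_cases i <;> simp } (fun a b h => congrFun h 0) a
  exact this.symm

lemma IsElliptic.orderOf_mem (hd : d.IsElliptic) :
    orderOf d.s = 1 ∨ orderOf d.s = 2 ∨ orderOf d.s = 3 := by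
  obtain ⟨g, hg, a, hga, ha⟩ := hd.exists_conj
  rw [← orderOf_conj_pair hga]
  rcases ha with ha | ha
  · rcases (Nat.dvd_prime Nat.prime_two).1 (orderOf_dvd_of_pow_eq_one ha) with h | h <;> simp [h]
  · rcases (Nat.dvd_prime Nat.prime_three).1 (orderOf_dvd_of_pow_eq_one ha) with h | h <;> simp [h]

/-- The root datum of `Ĥ`: the torus is conjugate to the diagonal torus, with `s` becoming
`(a, a)`. -/
lemma IsElliptic.exists_conj_param (hd : d.IsElliptic) {r : ℕ} {b : (Fin r → ℂˣ) →* GL (Fin 8) ℂ}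
    (hb : IsMaxTorusParam d.dual b) : ∃ h : r = 2, ∃ g ∈ G2Dual, ∃ a : ℂˣ,
      g * d.s * g⁻¹ = weightTorus octWeight ![a, a] ∧
      ∃ C C' : Matrix (Fin 2) (Fin 2) ℤ, C * C' = 1 ∧
        ∀ z, g * b z * g⁻¹ = weightTorus octWeight (matTorus C fun i => z (Fin.cast h.symm i)) := by
  obtain ⟨h, g, hg, hdiag, C, C', hC, hbC⟩ := isSplitModel_G2Dual.exists_conj_param
    ((connCentralizer_le d.s).trans inf_le_left) d.s_mem (sqfreeAnn_iff.2 d.s_semisimple)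
    (fun t ht => (mem_centralizer_singleton.1 (connCentralizer_le d.s ht).2).symm)
    (fun T hT hT' hc => le_idComp_of_isZConnected hT'.2.1 hT'.1 (le_inf hT fun t ht =>
      mem_centralizer_singleton.2 (hc t ht).symm)) hb
  obtain ⟨z, hz⟩ := isSplitModel_G2Dual.diag _ (mul_mem (mul_mem hg d.s_mem) (inv_mem hg)) hdiag
  obtain ⟨g', hg', M, M', hM, hc, a, hza, -⟩ := hd.exists_normal hg hz.symm
  refine ⟨h, g' * g, mul_mem hg' hg, a, ?_, M * C, C' * M', ?_, fun y => ?_⟩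
  · rw [← hza, ← hc, hz]
    group
  · rw [Matrix.mul_assoc, ← Matrix.mul_assoc C, hC, Matrix.one_mul, hM]
  · rw [← matTorus_matTorus, ← hc, ← hbC]
    group

lemma ncard_rootPairs_pair (a : ℂˣ) :
    (rootPairs (connCentralizer (weightTorus octWeight ![a, a])) (weightTorus octWeight)).ncard =
      (dualRoots (orderOf a)).card := by
  rw [← Set.ncard_coe_finset]
  congr 1
  ext ⟨m, n⟩
  refine (mem_rootPairs_idComp_centralizer isSplitModel_G2Dual.closed ![a, a] m n).trans ?_
  rw [monomialChar_pair, G2Dual, rootPairs_oct, dualRoots, Finset.mem_coe, Finset.mem_coe,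
    Finset.mem_filter]

/-- The number of roots of `Ĥ` depends only on the order of `s`. -/
lemma IsElliptic.ncard_rootPairs (hd : d.IsElliptic) {r : ℕ}
    {b : (Fin r → ℂˣ) →* GL (Fin 8) ℂ} (hb : IsMaxTorusParam d.dual b) :
    (rootPairs d.dual b).ncard = (dualRoots (orderOf d.s)).card := by
  obtain ⟨rfl, g, hg, a, hga, C, C', hC, h⟩ := hd.exists_conj_param hb
  have e1 : conjHom g b = (weightTorus octWeight).comp (matTorusHom C) := MonoidHom.ext fun z => by
    rw [conjHom_apply, h]; rfl
  rw [← rootPairs_conj _ b g, conjSub_connCentralizer hg, e1, hga, ncard_rootPairs_comp _ _ hC,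
    ncard_rootPairs_pair, orderOf_conj_pair hga]

end EndoPair

/-! ### The three elliptic types -/

section Types

variable {F : Type u} [Field F] [CharZero F]

namespace EllType

/-- The order of `s` in an elliptic pair of the given type. -/
def ord : EllType → ℕ
  | G2 => 1
  | PGL3 => 3
  | SO4 => 2

/-- The roots of the group of the given type, in suitable coordinates. -/
def roots : EllType → Finset ((Fin 2 → ℤ) × (Fin 2 → ℤ))
  | G2 => octRoots
  | PGL3 => mat3Roots
  | SO4 => soRoots

/-- The change of coordinates on the diagonal torus of the dual group which matches the roots of
the group with the coroots of its dual; for `G_2` it exchanges the short and the long roots. -/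
def toDual : EllType → Matrix (Fin 2) (Fin 2) ℤ
  | G2 => !![0, 1; 1, -1]
  | PGL3 => 1
  | SO4 => 1

/-- The inverse of `EllType.toDual`. -/
def ofDual : EllType → Matrix (Fin 2) (Fin 2) ℤ
  | G2 => !![1, 1; 1, 0]
  | PGL3 => 1
  | SO4 => 1

/-- The simple roots. -/
def simple : EllType → (Fin 2 → ℤ) × (Fin 2 → ℤ)
  | G2 => (![0, 1], ![1, -1])
  | PGL3 => (![0, 1], ![1, -1])
  | SO4 => (![1, 1], ![-1, 1])

lemma ord_injective : Function.Injective ord := by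
  intro s t h
  cases s <;> cases t <;> simp_all [ord]

lemma toDual_mul_ofDual (t : EllType) : t.toDual * t.ofDual = 1 := by
  cases t <;> decide

/-- The roots and coroots of each group are the coroots and roots of its dual, after the change of
coordinates. -/
lemma roots_eq_image (t : EllType) : t.roots =
    (dualRoots t.ord).image fun p => (t.ofDual *ᵥ p.2, t.toDualᵀ *ᵥ p.1) := by
  cases t <;> decide

lemma mem_roots_iff (t : EllType) (m n : Fin 2 → ℤ) :
    (m, n) ∈ t.roots ↔ (t.ofDualᵀ *ᵥ n, t.toDual *ᵥ m) ∈ dualRoots t.ord := by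
  have h1 : t.ofDual * t.toDual = 1 := mul_eq_one_comm.1 t.toDual_mul_ofDual
  have h2 : t.toDualᵀ * t.ofDualᵀ = 1 := by rw [← transpose_mul, h1, transpose_one]
  have h3 : t.ofDualᵀ * t.toDualᵀ = 1 := by
    rw [← transpose_mul, t.toDual_mul_ofDual, transpose_one]
  rw [roots_eq_image, Finset.mem_image]
  constructor
  · rintro ⟨p, hp, h⟩
    obtain ⟨rfl, rfl⟩ := Prod.mk.inj h
    simpa only [mulVec_mulVec, h3, t.toDual_mul_ofDual, one_mulVec] using hp
  · exact fun h => ⟨_, h, by simp only [mulVec_mulVec, h1, h2, one_mulVec]⟩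

/-- The dual groups have `12`, `4` and `6` roots. -/
lemma card_dualRoots_injOn {k l : ℕ} (hk : k = 1 ∨ k = 2 ∨ k = 3) (hl : l = 1 ∨ l = 2 ∨ l = 3)
    (h : (dualRoots k).card = (dualRoots l).card) : k = l := by
  have h1 : (dualRoots 1).card = 12 := by decide
  have h2 : (dualRoots 2).card = 4 := by decide
  have h3 : (dualRoots 3).card = 6 := by decide
  rcases hk with rfl | rfl | rfl <;> rcases hl with rfl | rfl | rfl <;> simp_all

lemma card_roots (t : EllType) : t.roots.card = (dualRoots t.ord).card := by
  cases t <;> decide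

lemma ord_mem (t : EllType) : t.ord = 1 ∨ t.ord = 2 ∨ t.ord = 3 := by
  cases t <;> simp [ord]

lemma exists_ord_eq {k : ℕ} (hk : k = 1 ∨ k = 2 ∨ k = 3) : ∃ t : EllType, t.ord = k := by
  rcases hk with rfl | rfl | rfl
  exacts [⟨G2, rfl⟩, ⟨SO4, rfl⟩, ⟨PGL3, rfl⟩]

lemma isRootBase_simple (t : EllType) :
    IsRootBase (Prod.fst '' (t.roots : Set ((Fin 2 → ℤ) × (Fin 2 → ℤ))))
      {t.simple.1, t.simple.2} := by
  refine ⟨?_, ?_, ?_⟩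
  · have h : t.simple.1 ∈ t.roots.image Prod.fst ∧ t.simple.2 ∈ t.roots.image Prod.fst := by
      cases t <;> decide
    rw [← Finset.coe_image]
    rintro x (rfl | rfl)
    exacts [h.1, h.2]
  · have h : LinearIndependent ℤ ![t.simple.1, t.simple.2] := by
      rw [LinearIndependent.pair_iff]
      intro x y h
      have h0 := congrFun h 0
      have h1 := congrFun h 1
      cases t <;> simp [simple] at h0 h1 <;> omega
    have h' := h.linearIndepOn_id
    rw [show Set.range ![t.simple.1, t.simple.2] = {t.simple.1, t.simple.2} by
      rw [Matrix.range_cons, Matrix.range_cons, Matrix.range_empty, Set.union_empty]; rfl] at h'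
    exact h'
  · have h : ∀ m ∈ t.roots.image Prod.fst, ∃ i ∈ Finset.range 4, ∃ j ∈ Finset.range 4,
        m = i • t.simple.1 + j • t.simple.2 ∨ -m = i • t.simple.1 + j • t.simple.2 := by
      cases t <;> decide
    intro m hm
    rw [← Finset.coe_image] at hm
    obtain ⟨i, -, j, -, hij⟩ := h m hm
    obtain ⟨u, hu⟩ : ∃ u, u = t.simple.1 := ⟨_, rfl⟩
    obtain ⟨v, hv⟩ : ∃ v, v = t.simple.2 := ⟨_, rfl⟩
    rw [← hu, ← hv] at hij ⊢
    have hu' : u ∈ AddSubmonoid.closure {u, v} :=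
      AddSubmonoid.subset_closure (Set.mem_insert _ _)
    have hv' : v ∈ AddSubmonoid.closure {u, v} :=
      AddSubmonoid.subset_closure (Set.mem_insert_of_mem _ rfl)
    have key := add_mem (AddSubmonoid.nsmul_mem _ hu' i) (AddSubmonoid.nsmul_mem _ hv' j)
    rcases hij with h | h
    · left; rw [h]; exact key
    · right; rw [h]; exact key

/-- The three groups have split models with the listed roots. -/
lemma exists_model (t : EllType) (K : Type u) [Field K] [Algebra F K] [IsAlgClosed K]
    [CharZero K] : ∃ χ e, IsSplitModel ((t.grp F).pts K) χ e ∧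
      rootPairs ((t.grp F).pts K) (weightTorus χ) = t.roots := by
  cases t
  · exact ⟨_, _, isSplitModel_oct, rootPairs_oct⟩
  · exact ⟨_, _, isSplitModel_mat3, rootPairs_mat3⟩
  · exact ⟨_, _, isSplitModel_so4, rootPairs_so4⟩

lemma isConnectedReductive (t : EllType) (K : Type u) [Field K] [Algebra F K] [IsAlgClosed K]
    [CharZero K] : IsConnectedReductive ((t.grp F).pts K) := by
  cases t
  · exact isConnectedReductive_oct
  · exact isConnectedReductive_mat3
  · exact isConnectedReductive_so4

end EllType

lemma ncard_eq_of_swap {α β : Type*} {A : Set (α × β)} {B : Set (β × α)}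
    (h : ∀ m n, (m, n) ∈ A ↔ (n, m) ∈ B) : A.ncard = B.ncard := by
  have : A = Prod.swap '' B := by
    ext ⟨m, n⟩
    rw [h]
    exact ⟨fun hm => ⟨_, hm, rfl⟩, by rintro ⟨⟨n', m'⟩, h', e⟩; cases e; exact h'⟩
  rw [this, Set.ncard_image_of_injective _ Prod.swap_injective]

namespace EndoPair

variable {d d' : EndoPair F}

instance : CharZero (AlgebraicClosure F) := charZero_of_injective_algebraMap
  (algebraMap F (AlgebraicClosure F)).injective

/-- The type of an elliptic pair can be read off from the number of roots. -/
lemma IsElliptic.ord_eq (hd : d.IsElliptic) {t : EllType}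
    (h : IsEndoscopicGroup (t.grp F) d) : t.ord = orderOf d.s := by
  obtain ⟨-, r, a, b, Δ, ha, hb, hab, -, -⟩ := h
  obtain ⟨χ, e, hχ, hroots⟩ := t.exists_model (F := F) (AlgebraicClosure F)
  have h1 := ncard_eq_of_swap hab
  rw [hχ.ncard_rootPairs ha, hd.ncard_rootPairs hb, hroots, Set.ncard_coe_finset,
    EllType.card_roots] at h1
  exact EllType.card_dualRoots_injOn t.ord_mem hd.orderOf_mem h1

lemma weightTorus_mem_connCentralizer (y z : Fin 2 → ℂˣ) :
    weightTorus octWeight z ∈ connCentralizer (weightTorus octWeight y) :=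
  mem_dual_of_divisible fun k hk => by
    obtain ⟨z', hz⟩ := exists_torus_pow z k hk
    refine ⟨weightTorus octWeight z', weightTorus_octWeight_mem _, ?_, by rw [← map_pow, hz]⟩
    rw [← map_mul, ← map_mul, mul_comm]

lemma isMaxTorusParam_matTorus (y : Fin 2 → ℂˣ) {C C' : Matrix (Fin 2) (Fin 2) ℤ}
    (hC : C * C' = 1) : IsMaxTorusParam (connCentralizer (weightTorus octWeight y))
      ((weightTorus octWeight).comp (matTorusHom C)) := by
  have h := isSplitModel_G2Dual.isMaxTorusParam
    ((connCentralizer_le (weightTorus octWeight y)).trans inf_le_left)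
    (weightTorus_mem_connCentralizer y)
  have e : (weightTorus octWeight).comp (matTorusHom C) =
      (weightTorus (K := ℂ) fun i => Cᵀ *ᵥ octWeight i) := by
    refine MonoidHom.ext fun z => Units.ext ?_
    rw [weightTorus_val, MonoidHom.comp_apply, weightTorus_val]
    simp only [← monomialChar_matTorus]
    rfl
  have hC' : C' * C = 1 := mul_eq_one_comm.1 hC
  refine ⟨e ▸ isAlgTorusHom_weightTorus _, fun z z' hz => ?_, ?_⟩
  · have h1 : matTorus C z = matTorus C z' := h.2.1 hz
    have := congrArg (matTorus C') h1
    rwa [matTorus_matTorus, matTorus_matTorus, hC', matTorus_one, matTorus_one] at this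
  · have hr : ((weightTorus octWeight).comp (matTorusHom C)).range =
        (weightTorus (K := ℂ) octWeight).range := by
      refine le_antisymm ?_ ?_
      · rintro _ ⟨z, rfl⟩
        exact ⟨_, rfl⟩
      · rintro _ ⟨z, rfl⟩
        refine ⟨matTorus C' z, ?_⟩
        show weightTorus octWeight (matTorus C (matTorus C' z)) = _
        rw [matTorus_matTorus, hC, matTorus_one]
    rw [hr]
    exact h.2.2

/-- The endoscopic group is determined by the order of `s`. -/
lemma isEndoscopicGroup_of_conj (hd : d.IsElliptic) {t : EllType} (ht : t.ord = orderOf d.s) :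
    IsEndoscopicGroup (t.grp F) d := by
  obtain ⟨g, hg, a, hga, -⟩ := hd.exists_conj
  obtain ⟨χ, e, hχ, hroots⟩ := t.exists_model (F := F) (AlgebraicClosure F)
  have hs : g⁻¹ * weightTorus octWeight ![a, a] * g = d.s := by rw [← hga]; group
  have hdual : conjSub g⁻¹ (connCentralizer (weightTorus octWeight ![a, a])) = d.dual := by
    rw [conjSub_connCentralizer (inv_mem hg), inv_inv, hs]
  refine ⟨t.isConnectedReductive _, 2, weightTorus χ,
    conjHom g⁻¹ ((weightTorus octWeight).comp (matTorusHom t.toDual)),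
    {t.simple.1, t.simple.2}, hχ.isMaxTorusParam le_rfl hχ.mem, ?_, fun m n => ?_, ?_, fun σ => ?_⟩
  · rw [← hdual]
    exact (isMaxTorusParam_matTorus _ t.toDual_mul_ofDual).conj _
  · rw [hroots, ← hdual, rootPairs_conj, mem_rootPairs_comp_matTorusHom _ _ t.toDual_mul_ofDual,
      Finset.mem_coe, t.mem_roots_iff, ht, ← orderOf_conj_pair hga]
    rw [connCentralizer]
    refine Iff.trans ?_
      (mem_rootPairs_idComp_centralizer isSplitModel_G2Dual.closed ![a, a] _ _).symm
    rw [monomialChar_pair, G2Dual, rootPairs_oct, dualRoots, Finset.mem_coe, Finset.mem_filter]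
  · rw [hroots]
    exact t.isRootBase_simple
  · refine ⟨1, ?_, fun z => ?_, 1, one_mem _, ?_, fun z => ?_⟩
    · simp
    · rw [transpose_one, matTorus_one]
      refine Units.ext (Matrix.ext fun i j => ?_)
      rw [Matrix.GeneralLinearGroup.map_apply, weightTorus_val, weightTorus_val, diagonal_apply,
        diagonal_apply]
      split_ifs
      · simp [monomialChar]
      · simp
    · rw [hd.ρ_eq_one]
      exact InducesOut.one _
    · rw [matTorus_one, one_mul, inv_one, mul_one]

/-- The centre of the centralizer of `(a, a)` is generated by this element. -/
lemma exists_eq_of_central {a : ℂˣ} (ha : orderOf a = 1 ∨ orderOf a = 2 ∨ orderOf a = 3)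
    {h : GL (Fin 8) ℂ} (hh : h ∈ connCentralizer (weightTorus octWeight ![a, a]))
    (hc : ∀ k ∈ connCentralizer (weightTorus octWeight ![a, a]), k * h = h * k) :
    ∃ y : ℂˣ, h = weightTorus octWeight ![y, y] ∧ y ^ orderOf a = 1 := by
  have hG := (connCentralizer_le _ hh).1
  obtain ⟨w, rfl⟩ := isSplitModel_G2Dual.diag h hG (isSplitModel_G2Dual.cent h hG fun z =>
    (hc _ (weightTorus_mem_connCentralizer _ z)).symm)
  have hm : ∀ p ∈ dualRoots (orderOf a), monomialChar p.1 w = 1 := by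
    rintro ⟨m, n⟩ hp
    rw [dualRoots, Finset.mem_filter, ← monomialChar_pair, ← Finset.mem_coe,
      ← rootPairs_oct (K := ℂ)] at hp
    obtain ⟨f, -, hf, hr, h1, -, -⟩ :=
      (mem_rootPairs_idComp_centralizer isSplitModel_G2Dual.closed ![a, a] m n).2 hp
    have h2 := h1 w 1
    rw [← hc _ (hr ⟨_, rfl⟩), mul_inv_cancel_right] at h2
    have := map_upperUni_injective hf h2
    rw [mul_one] at this
    exact Units.ext this.symm
  -- the root `(1, -1)` is trivial on each `(a, a)`; it makes the two coordinates equal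
  have h1 := hm (![1, -1], ![1, -1]) (Finset.mem_filter.2 ⟨by decide, by simp⟩)
  have h01 : w 1 = w 0 := by
    simp only [monomialChar_two, cons_val_zero, cons_val_one, zpow_one, _root_.zpow_neg,
      Matrix.cons_val_fin_one] at h1
    exact (mul_inv_eq_one.1 h1).symm
  have hw : w = ![w 0, w 0] := by
    ext i; fin_cases i
    · rfl
    · simp [h01]
  refine ⟨w 0, by rw [← hw], ?_⟩
  have key : ∃ p ∈ dualRoots (orderOf a), p.1 0 + p.1 1 = orderOf a := by
    rcases ha with h | h | h <;> rw [h] <;> decide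
  obtain ⟨p, hp, hpa⟩ := key
  have := hm p hp
  rw [hw, monomialChar_two] at this
  rw [← zpow_natCast, ← hpa, _root_.zpow_add]
  exact this

/-- The pair with `s = (a, a)` and trivial `ρ`. -/
noncomputable def ofUnit (F : Type u) [Field F] (a : ℂˣ) (ha : 0 < orderOf a) : EndoPair F where
  s := weightTorus octWeight ![a, a]
  s_mem := weightTorus_octWeight_mem _
  s_semisimple := by
    refine sqfreeAnn_iff.1 ⟨Polynomial.X ^ orderOf a - Polynomial.C 1,
      (Polynomial.separable_X_pow_sub_C (1 : ℂ) (Nat.cast_ne_zero.2 ha.ne') one_ne_zero).squarefree, ?_⟩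
    have e : (![a, a] : Fin 2 → ℂˣ) ^ orderOf a = 1 := by
      ext i; fin_cases i <;> simp [← Units.val_pow_eq_pow_val, pow_orderOf_eq_one]
    rw [map_sub, map_pow, Polynomial.aeval_X, Polynomial.aeval_C, ← Units.val_pow_eq_pow_val,
      ← map_pow, e, map_one, map_one, Units.val_one, sub_self]
  ρ := 1
  ρ_continuous := by
    rw [MonoidHom.ker_one]
    exact isOpen_univ
  ρ_realized := fun _ => ⟨1, one_mem _, InducesOut.one _, by group⟩

/-- The pair is elliptic because the centre of `Ĥ` is finite. -/
lemma isElliptic_ofUnit {a : ℂˣ} (ha : orderOf a = 1 ∨ orderOf a = 2 ∨ orderOf a = 3)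
    (ha' : 0 < orderOf a) : (ofUnit F a ha').IsElliptic := by
  have hfin : Finite (ofUnit F a ha').fixedCenter := by
    have : NeZero (orderOf a) := ⟨ha'.ne'⟩
    have hs : ((fun y : rootsOfUnity (orderOf a) ℂ => weightTorus octWeight ![y.1, y.1]) ''
        Set.univ).Finite := Set.toFinite _
    refine (hs.subset fun z hz => ?_).to_subtype
    obtain ⟨y, rfl, hy⟩ := exists_eq_of_central ha hz.1 hz.2.1
    exact ⟨⟨y, hy⟩, trivial, rfl⟩
  intro z hz
  have hbot : idComp (ofUnit F a ha').fixedCenter ≤ ⊥ := sInf_le ⟨bot_le, isZClosed_bot, by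
    rw [Subgroup.relIndex_bot_left]
    exact Nat.card_pos.ne'⟩
  rw [Subgroup.mem_bot.1 (hbot hz)]
  exact ⟨one_mem _, fun g _ => by rw [mul_one, one_mul]⟩

/-- Each type occurs, for `s = (a, a)` with `a` a primitive root of unity of the order of the type. -/
lemma exists_isElliptic (t : EllType) :
    ∃ d : EndoPair F, d.IsElliptic ∧ IsEndoscopicGroup (t.grp F) d := by
  have ht : t.ord ≠ 0 := by cases t <;> simp [EllType.ord]
  have hp := Complex.isPrimitiveRoot_exp t.ord ht
  obtain ⟨a, ha⟩ := hp.isUnit ht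
  rw [← ha, IsPrimitiveRoot.coe_units_iff] at hp
  have ho := hp.eq_orderOf
  have hm := t.ord_mem
  rw [ho] at hm
  have ha' : 0 < orderOf a := by omega
  refine ⟨ofUnit F a ha', isElliptic_ofUnit hm ha', isEndoscopicGroup_of_conj
    (isElliptic_ofUnit hm ha') ?_⟩
  rw [ho]
  exact orderOf_conj_pair (g := 1) (by rw [one_mul, inv_one, mul_one]; rfl)

end EndoPair

end Types

/-! ### Isomorphism classes of elliptic pairs and their outer automorphisms -/

/-- The exchange of the two idempotents inverts the diagonal torus. -/
lemma octSwap_conj (z : Fin 2 → ℂˣ) :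
    octSwap * weightTorus octWeight z * octSwap⁻¹ = weightTorus octWeight z⁻¹ := by
  rw [mul_inv_eq_iff_eq_mul]
  refine gl_ext_mulVec fun x => ?_
  induction x using oct_induction with | h a b v w
  rw [gl_mul_mulVec, gl_mul_mulVec, octWeight_mulVec, octSwap_mulVec, octSwap_mulVec,
    octWeight_mulVec, oct_inj]
  refine ⟨rfl, rfl, ?_, ?_⟩ <;> (ext i; fin_cases i <;> simp [mul_comm])

namespace EndoPair

variable {F : Type u} [Field F] {d d' : EndoPair F}

lemma pair_inv {G : Type*} [Group G] (a : G) : (![a, a] : Fin 2 → G)⁻¹ = ![a⁻¹, a⁻¹] := by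
  ext i; fin_cases i <;> rfl

/-- Up to its inverse, an element of order at most `3` is determined by its order. -/
lemma eq_or_eq_inv_of_orderOf {a b : ℂˣ} (ha : orderOf a = 1 ∨ orderOf a = 2 ∨ orderOf a = 3)
    (hb : b ^ orderOf a = 1) (hab : orderOf a = orderOf b) : b = a ∨ b = a⁻¹ := by
  have ha' := pow_orderOf_eq_one a
  have ne : ∀ {c : ℂˣ}, orderOf c ≠ 1 → (c : ℂ) - 1 ≠ 0 := fun {c} hc h => by
    rw [Ne, orderOf_eq_one_iff] at hc
    exact hc (Units.ext (sub_eq_zero.1 h))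
  have val : ∀ {c : ℂˣ} {k : ℕ}, c ^ k = 1 → (c : ℂ) ^ k = 1 := fun h => by
    rw [← Units.val_pow_eq_pow_val, h, Units.val_one]
  rcases ha with h | h | h <;> rw [h] at ha' hb hab
  · left
    rw [pow_one] at ha' hb
    rw [ha', hb]
  · have h2 : ∀ {c : ℂˣ}, orderOf c ≠ 1 → (c : ℂ) ^ 2 = 1 → (c : ℂ) = -1 := fun {c} hc h =>
      mul_left_cancel₀ (ne hc) (by linear_combination h)
    left
    ext
    rw [h2 (by omega) (val hb), h2 (by omega) (val ha')]
  · have h3 : ∀ {c : ℂˣ}, orderOf c ≠ 1 → (c : ℂ) ^ 3 = 1 → (c : ℂ) ^ 2 + c + 1 = 0 :=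
      fun {c} hc h => mul_left_cancel₀ (ne hc) (by linear_combination h)
    have ea := h3 (c := a) (by omega) (val ha')
    have eb := h3 (c := b) (by omega) (val hb)
    have : ((b : ℂ) - a) * (a + b + 1) = 0 := by linear_combination eb - ea
    rcases mul_eq_zero.1 this with h | h
    · left; exact Units.ext (sub_eq_zero.1 h)
    · right
      rw [eq_inv_iff_mul_eq_one]
      ext
      push_cast
      linear_combination (a : ℂ) * h - ea

/-- Elliptic pairs with the same order of `s` are conjugate. -/
lemma IsElliptic.exists_conj_eq (hd : d.IsElliptic) (hd' : d'.IsElliptic)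
    (h : orderOf d.s = orderOf d'.s) : ∃ g ∈ G2Dual, g * d.s * g⁻¹ = d'.s := by
  obtain ⟨g, hg, a, hga, -⟩ := hd.exists_conj
  obtain ⟨g', hg', a', hga', -⟩ := hd'.exists_conj
  have ho : orderOf a = orderOf a' := by rw [orderOf_conj_pair hga, orderOf_conj_pair hga', h]
  have hs' : d'.s = g'⁻¹ * weightTorus octWeight ![a', a'] * g' := by rw [← hga']; group
  have hm := hd.orderOf_mem
  rw [← orderOf_conj_pair hga] at hm
  rcases eq_or_eq_inv_of_orderOf hm (ho ▸ pow_orderOf_eq_one a') ho with rfl | rfl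
  · refine ⟨g'⁻¹ * g, mul_mem (inv_mem hg') hg, ?_⟩
    rw [hs', ← hga]
    group
  · refine ⟨g'⁻¹ * octSwap * g, mul_mem (mul_mem (inv_mem hg') octSwap_mem) hg, ?_⟩
    rw [hs', ← pair_inv, ← octSwap_conj, ← hga]
    group

lemma map_conj_dual {g : GL (Fin 8) ℂ} (hg : g ∈ G2Dual) (h : g * d.s * g⁻¹ = d'.s) :
    d.dual.map (MulAut.conj g).toMonoidHom = d'.dual := by
  rw [dual, dual, ← h, ← conjSub_connCentralizer hg]

/-- An element which conjugates `s` to `s'` is an isomorphism of elliptic pairs, as `ρ` is trivial. -/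
lemma IsElliptic.isIso (hd : d.IsElliptic) (hd' : d'.IsElliptic) {g : GL (Fin 8) ℂ}
    (hg : g ∈ G2Dual) (h : g * d.s * g⁻¹ = d'.s) : IsIso d d' g := by
  refine ⟨hg, map_conj_dual hg h, fun σ => ⟨1, one_mem _, ?_, ?_⟩⟩
  · rw [hd.ρ_eq_one]
    exact InducesOut.one _
  · rw [hd'.ρ_eq_one, mul_one, mul_inv_cancel]
    exact InducesOut.one _

/-- The order of `s` is an isomorphism invariant, as it is determined by the number of roots of `Ĥ`. -/
lemma IsIso.orderOf_eq (hd : d.IsElliptic) (hd' : d'.IsElliptic) {g : GL (Fin 8) ℂ}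
    (h : IsIso d d' g) : orderOf d.s = orderOf d'.s := by
  obtain ⟨g₀, hg₀, a, hga, -⟩ := hd.exists_conj
  have hb := (isMaxTorusParam_matTorus ![a, a] (one_mul (1 : Matrix (Fin 2) (Fin 2) ℤ))).conj g₀⁻¹
  rw [conjSub_connCentralizer (inv_mem hg₀), ← hga, inv_inv,
    show g₀⁻¹ * (g₀ * d.s * g₀⁻¹) * g₀ = d.s by group] at hb
  have hb' := hb.conj g
  have hdual : conjSub g (connCentralizer d.s) = d'.dual := h.2.1
  rw [hdual] at hb'
  have h1 := hd.ncard_rootPairs hb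
  have h2 := hd'.ncard_rootPairs hb'
  rw [← hdual, rootPairs_conj] at h2
  exact EllType.card_dualRoots_injOn hd.orderOf_mem hd'.orderOf_mem (h1.symm.trans h2)

/-- An element which normalizes `Ĥ` sends `s` to a central element of the same order, hence
to `s` or its inverse. -/
lemma IsElliptic.conj_eq_or_eq_inv (hd : d.IsElliptic) {g : GL (Fin 8) ℂ} {x : OutAut d.dual}
    (hx : InducesOut d.dual g x) : g * d.s * g⁻¹ = d.s ∨ g * d.s * g⁻¹ = d.s⁻¹ := by
  obtain ⟨g₀, hg₀, a, hga, -⟩ := hd.exists_conj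
  obtain ⟨f, hf, -⟩ := hx
  have hs : d.s ∈ d.dual := hd.mem_dual.2 ⟨d.s_mem, rfl⟩
  have h1 : g * d.s * g⁻¹ ∈ d.dual := by
    rw [← hf ⟨d.s, hs⟩]
    exact (f ⟨d.s, hs⟩).2
  have h2 : ∀ k ∈ d.dual, k * (g * d.s * g⁻¹) = g * d.s * g⁻¹ * k := fun k hk => by
    have h3 : g⁻¹ * k * g ∈ d.dual := by
      have := hf (f⁻¹ ⟨k, hk⟩)
      rw [MulAut.apply_inv_self] at this
      have e : g⁻¹ * k * g = (f⁻¹ ⟨k, hk⟩ : d.dual) := by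
        rw [eq_comm, ← mul_inv_eq_iff_eq_mul, eq_inv_mul_iff_mul_eq, ← mul_assoc]
        exact this.symm
      rw [e]
      exact (f⁻¹ ⟨k, hk⟩).2
    have h4 := (hd.mem_dual.1 h3).2
    calc k * (g * d.s * g⁻¹) = g * (g⁻¹ * k * g * d.s) * g⁻¹ := by group
      _ = _ := by rw [← h4]; group
  have hconn : connCentralizer (weightTorus octWeight ![a, a]) = conjSub g₀ d.dual := by
    rw [conjSub_connCentralizer hg₀, hga]
  have hm := hd.orderOf_mem
  rw [← orderOf_conj_pair hga] at hm
  obtain ⟨y, hy, hya⟩ := exists_eq_of_central (a := a) hm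
    (h := g₀ * (g * d.s * g⁻¹) * g₀⁻¹) (by
      rw [hconn, mem_conjSub]
      convert h1 using 1
      group) (fun k hk => by
      rw [hconn, mem_conjSub] at hk
      have := h2 _ hk
      calc k * (g₀ * (g * d.s * g⁻¹) * g₀⁻¹) = g₀ * (g₀⁻¹ * k * g₀ * (g * d.s * g⁻¹)) * g₀⁻¹ := by
            group
        _ = _ := by rw [this]; group)
  have ho : orderOf a = orderOf y := by
    rw [orderOf_conj_pair hga]
    refine (orderOf_conj_pair (g := g₀ * g) (s := d.s) ?_).symm
    rw [← hy]
    group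
  have e : g * d.s * g⁻¹ = g₀⁻¹ * weightTorus octWeight ![y, y] * g₀ := by rw [← hy]; group
  rw [e]
  rcases eq_or_eq_inv_of_orderOf hm hya ho with rfl | rfl
  · left; rw [← hga]; group
  · right; rw [← pair_inv, map_inv, ← hga]; group

/-- If `s` is its own inverse, the normalizer of `Ĥ` centralizes `s`, hence is `Ĥ`. -/
lemma IsElliptic.outerAut_eq_bot (hd : d.IsElliptic) (hs : d.s⁻¹ = d.s) : d.outerAut = ⊥ := by
  refine (Subgroup.eq_bot_iff_forall _).2 ?_
  rintro x ⟨⟨g, hg, hx⟩, -⟩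
  refine hx.unique (inducesOut_of_mem (hd.mem_dual.2 ⟨hg, ?_⟩))
  have := hd.conj_eq_or_eq_inv hx
  rw [hs, or_self] at this
  exact (mul_inv_eq_iff_eq_mul.1 this).symm

/-- If `s` is not its own inverse, the normalizer of `Ĥ` consists of `Ĥ` and of the elements which
invert `s`. -/
lemma IsElliptic.card_outerAut (hd : d.IsElliptic) (hs : d.s⁻¹ ≠ d.s) :
    Nat.card d.outerAut = 2 := by
  obtain ⟨g₀, hg₀, a, hga, -⟩ := hd.exists_conj
  -- an element which inverts `s`
  obtain ⟨w, hw⟩ : ∃ w, w = g₀⁻¹ * octSwap * g₀ := ⟨_, rfl⟩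
  have hwG : w ∈ G2Dual := by
    rw [hw]; exact mul_mem (mul_mem (inv_mem hg₀) octSwap_mem) hg₀
  have hws : w * d.s * w⁻¹ = d.s⁻¹ := by
    have e : d.s = g₀⁻¹ * weightTorus octWeight ![a, a] * g₀ := by rw [← hga]; group
    have e' := octSwap_conj ![a, a]
    rw [map_inv, ← hga] at e'
    have : g₀⁻¹ * (g₀ * d.s * g₀⁻¹)⁻¹ * g₀ = d.s⁻¹ := by group
    rw [hw, ← this, ← e']
    group
  have hinv : ∀ {w : GL (Fin 8) ℂ}, w * d.s * w⁻¹ = d.s⁻¹ → d.s = w * d.s⁻¹ * w⁻¹ :=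
    fun {w} hws => by
      calc d.s = (d.s⁻¹)⁻¹ := (inv_inv _).symm
        _ = (w * d.s * w⁻¹)⁻¹ := by rw [hws]
        _ = _ := by group
  have hnorm : ∀ {w : GL (Fin 8) ℂ}, w ∈ G2Dual → w * d.s * w⁻¹ = d.s⁻¹ →
      ∀ k ∈ d.dual, w * k * w⁻¹ ∈ d.dual := fun {w} hwG hws k hk => by
    have hk' := hd.mem_dual.1 hk
    refine hd.mem_dual.2 ⟨mul_mem (mul_mem hwG hk'.1) (inv_mem hwG), ?_⟩
    have e := hinv hws
    have hk2 : d.s⁻¹ * k = k * d.s⁻¹ := ((Commute.inv_left (show Commute d.s k from hk'.2)))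
    calc d.s * (w * k * w⁻¹) = w * d.s⁻¹ * w⁻¹ * (w * k * w⁻¹) := by rw [← e]
      _ = w * (d.s⁻¹ * k) * w⁻¹ := by group
      _ = w * k * w⁻¹ * (w * d.s⁻¹ * w⁻¹) := by rw [hk2]; group
      _ = _ := by rw [← e]
  have hwi : w⁻¹ * d.s * w⁻¹⁻¹ = d.s⁻¹ := by
    have e := hinv hws
    rw [inv_inv]
    conv_lhs => rw [e]
    group
  obtain ⟨x₀, hx₀⟩ := exists_inducesOut (H := d.dual) (hnorm hwG hws) fun k hk => by
    have := hnorm (inv_mem hwG) hwi k hk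
    rwa [inv_inv] at this
  have hs' : d.s ∈ d.dual := hd.mem_dual.2 ⟨d.s_mem, rfl⟩
  have hx₀1 : x₀ ≠ 1 := by
    rintro rfl
    have := hx₀.conj_eq_of_central (InducesOut.one _) hs' fun k hk => ((hd.mem_dual.1 hk).2).symm
    rw [hws, one_mul, inv_one, mul_one] at this
    exact hs this
  refine Nat.card_eq_two_iff.2 ⟨1, ⟨x₀, ⟨w, hwG, hx₀⟩, fun σ => by
    rw [hd.ρ_eq_one, mul_one, one_mul]⟩, fun h => hx₀1 (congrArg Subtype.val h).symm, ?_⟩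
  refine Set.eq_univ_of_forall ?_
  rintro ⟨x, ⟨g, hg, hx⟩, hx'⟩
  rcases hd.conj_eq_or_eq_inv hx with h | h
  · left
    exact Subtype.ext (hx.unique (inducesOut_of_mem
      (hd.mem_dual.2 ⟨hg, (mul_inv_eq_iff_eq_mul.1 h).symm⟩)))
  · right
    refine Subtype.ext ?_
    have h1 : w⁻¹ * g ∈ d.dual := hd.mem_dual.2 ⟨mul_mem (inv_mem hwG) hg, by
      have h2 : g * d.s = w * d.s * w⁻¹ * g := by rw [hws, ← h]; group
      calc d.s * (w⁻¹ * g) = w⁻¹ * (w * d.s * w⁻¹ * g) := by group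
        _ = _ := by rw [← h2]; group⟩
    have h3 := hx₀.mul (inducesOut_of_mem h1)
    rw [mul_inv_cancel_left, mul_one] at h3
    exact hx.unique h3

end EndoPair

/-! ### Elliptic endoscopic groups are neither tori nor forms of `GL_2` -/

/-- The centralizer of a matrix of size `2` is commutative unless the matrix is scalar. -/
lemma commute_of_commute_not_scalar {K : Type*} [Field K] {M X Y : Matrix (Fin 2) (Fin 2) K}
    (hM : ∀ c : K, M ≠ c • 1) (hX : M * X = X * M) (hY : M * Y = Y * M) : X * Y = Y * X := by
  have key : ∀ {X : Matrix (Fin 2) (Fin 2) K}, M * X = X * M →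
      M 0 1 * X 1 0 = X 0 1 * M 1 0 ∧
      M 0 1 * (X 0 0 - X 1 1) = X 0 1 * (M 0 0 - M 1 1) ∧
      M 1 0 * (X 0 0 - X 1 1) = X 1 0 * (M 0 0 - M 1 1) := fun {X} h => by
    simp only [← Matrix.ext_iff, Fin.forall_fin_two, Matrix.mul_apply, Fin.sum_univ_two] at h
    obtain ⟨⟨h1, h2⟩, h3, h4⟩ := h
    exact ⟨by linear_combination h1, by linear_combination -h2, by linear_combination h3⟩
  obtain ⟨x1, x2, x3⟩ := key hX
  obtain ⟨y1, y2, y3⟩ := key hY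
  suffices h : X 0 1 * Y 1 0 = Y 0 1 * X 1 0 ∧
      X 0 1 * (Y 0 0 - Y 1 1) = Y 0 1 * (X 0 0 - X 1 1) ∧
      X 1 0 * (Y 0 0 - Y 1 1) = Y 1 0 * (X 0 0 - X 1 1) by
    simp only [← Matrix.ext_iff, Fin.forall_fin_two, Matrix.mul_apply, Fin.sum_univ_two]
    obtain ⟨h1, h2, h3⟩ := h
    exact ⟨⟨by linear_combination h1, by linear_combination -h2⟩,
      by linear_combination h3, by linear_combination -h1⟩
  by_cases hq : M 0 1 = 0
  · by_cases hr : M 1 0 = 0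
    · by_cases hp : M 0 0 - M 1 1 = 0
      · exact absurd (by
          simp only [← Matrix.ext_iff, Fin.forall_fin_two]
          simp [hq, hr, sub_eq_zero.1 hp]) (hM (M 1 1))
      · refine ⟨mul_left_cancel₀ hp ?_, mul_left_cancel₀ hp ?_, mul_left_cancel₀ hp ?_⟩
        · linear_combination -Y 1 0 * x2 + X 1 0 * y2 +
            (Y 1 0 * (X 0 0 - X 1 1) - X 1 0 * (Y 0 0 - Y 1 1)) * hq
        · linear_combination -(Y 0 0 - Y 1 1) * x2 + (X 0 0 - X 1 1) * y2
        · linear_combination -(Y 0 0 - Y 1 1) * x3 + (X 0 0 - X 1 1) * y3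
    · have h1 : X 0 1 * Y 1 0 = Y 0 1 * X 1 0 := mul_left_cancel₀ hr (by
        linear_combination -Y 1 0 * x1 + X 1 0 * y1)
      refine ⟨h1, mul_left_cancel₀ hr ?_, mul_left_cancel₀ hr ?_⟩
      · linear_combination X 0 1 * y3 - Y 0 1 * x3 + (M 0 0 - M 1 1) * h1
      · linear_combination X 1 0 * y3 - Y 1 0 * x3
  · have h1 : X 0 1 * Y 1 0 = Y 0 1 * X 1 0 := mul_left_cancel₀ hq (by
      linear_combination X 0 1 * y1 - Y 0 1 * x1)
    refine ⟨h1, mul_left_cancel₀ hq ?_, mul_left_cancel₀ hq ?_⟩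
    · linear_combination X 0 1 * y2 - Y 0 1 * x2
    · linear_combination X 1 0 * y2 - Y 1 0 * x2 - (M 0 0 - M 1 1) * h1

section Exclusion

variable {F : Type u} [Field F] [CharZero F] {d : EndoPair F}

/-- An elliptic endoscopic group has two linearly independent roots, separated by a cocharacter `n`. -/
lemma EndoPair.IsElliptic.exists_independent_roots (hd : d.IsElliptic) {H : AlgGrp F}
    {K : Type u} [Field K] [Algebra F K] {r : ℕ} {a : (Fin r → Kˣ) →* GL H.ι K}
    {b : (Fin r → ℂˣ) →* GL (Fin 8) ℂ} (hb : IsMaxTorusParam d.dual b)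
    (hab : ∀ m n, (m, n) ∈ rootPairs (H.pts K) a ↔ (n, m) ∈ rootPairs d.dual b) :
    ∃ p ∈ rootPairs (H.pts K) a, ∃ q ∈ rootPairs (H.pts K) a, ∃ n : Fin r → ℤ,
      p.1 ⬝ᵥ n = 0 ∧ q.1 ⬝ᵥ n ≠ 0 := by
  obtain ⟨rfl, g, hg, a', hga, C, C', hC, h⟩ := hd.exists_conj_param hb
  have e1 : conjHom g b = (weightTorus octWeight).comp (matTorusHom C) := MonoidHom.ext fun z => by
    rw [conjHom_apply, h]; rfl
  have hC' : C' * C = 1 := mul_eq_one_comm.1 hC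
  have h2 : Cᵀ * C'ᵀ = 1 := by rw [← transpose_mul, hC', transpose_one]
  have h3 : C'ᵀ * Cᵀ = 1 := by rw [← transpose_mul, hC, transpose_one]
  have hmem : ∀ p ∈ dualRoots (orderOf d.s), (C' *ᵥ p.2, Cᵀ *ᵥ p.1) ∈ rootPairs (H.pts K) a := by
    rintro ⟨m, n⟩ hp
    rw [hab, ← rootPairs_conj _ b g, conjSub_connCentralizer hg, e1, hga,
      mem_rootPairs_comp_matTorusHom _ _ hC]
    simp only [mulVec_mulVec, h3, hC, one_mulVec]
    rw [← EndoPair.orderOf_conj_pair hga, dualRoots, Finset.mem_filter, ← monomialChar_pair,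
      ← Finset.mem_coe, ← rootPairs_oct (K := ℂ)] at hp
    exact (mem_rootPairs_idComp_centralizer isSplitModel_G2Dual.closed ![a', a'] m n).2 hp
  -- the coroots of `Ĥ` are the roots of `H`; in each case some but not all are orthogonal to `(1, 1)`
  have key : ∃ p ∈ dualRoots (orderOf d.s), ∃ q ∈ dualRoots (orderOf d.s),
      p.2 ⬝ᵥ ![1, 1] = 0 ∧ q.2 ⬝ᵥ ![1, 1] ≠ 0 := by
    rcases hd.orderOf_mem with h | h | h <;> rw [h] <;> decide
  obtain ⟨p, hp, q, hq, h0, h1⟩ := key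
  have e : ∀ v : Fin 2 → ℤ, (C' *ᵥ v) ⬝ᵥ (Cᵀ *ᵥ ![1, 1]) = v ⬝ᵥ ![1, 1] := fun v => by
    rw [dotProduct_mulVec, vecMul_transpose, mulVec_mulVec, hC, one_mulVec]
  exact ⟨_, hmem p hp, _, hmem q hq, Cᵀ *ᵥ ![1, 1], by rw [e, h0], by rwa [e]⟩

/-- If `a z` commutes with the image of the homomorphism attached to a root, the root is trivial
on `z`. -/
lemma monomialChar_eq_one_of_commute {K : Type*} [Field K] [IsAlgClosed K] {ι : Type} [Fintype ι]
    [DecidableEq ι] {r : ℕ} {H : Subgroup (GL ι K)} {a : (Fin r → Kˣ) →* GL ι K}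
    {p : (Fin r → ℤ) × (Fin r → ℤ)} (hp : p ∈ rootPairs H a) {z : Fin r → Kˣ}
    (hz : ∀ h ∈ H, a z * h = h * a z) : monomialChar p.1 z = 1 := by
  obtain ⟨f, -, hf, hr, h1, -, -⟩ := hp
  have h2 := h1 z 1
  rw [hz _ (hr ⟨_, rfl⟩), mul_inv_cancel_right] at h2
  have := map_upperUni_injective hf h2
  rw [mul_one] at this
  exact Units.ext this.symm

/-- A group with a nonzero root is not commutative. -/
lemma not_isTorus_of_rootPairs {K : Type*} [Field K] [IsAlgClosed K] [CharZero K] {ι : Type}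
    [Fintype ι] [DecidableEq ι] {r : ℕ} {H : Subgroup (GL ι K)} {a : (Fin r → Kˣ) →* GL ι K}
    (ha : a.range ≤ H) {p : (Fin r → ℤ) × (Fin r → ℤ)} (hp : p ∈ rootPairs H a) {n : Fin r → ℤ}
    (hn : p.1 ⬝ᵥ n ≠ 0) : ¬ IsTorus H := by
  rintro ⟨-, -, P, hP⟩
  obtain ⟨c, hc⟩ := exists_unit_not_root_of_unity (K := K) _ hn
  refine hc ?_
  rw [← monomialChar_cochar]
  refine monomialChar_eq_one_of_commute hp fun h hh => ?_
  have key : ∀ t ∈ H, t * h = h * t := fun t ht => by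
    have h1 : P * t * P⁻¹ * (P * h * P⁻¹) = P * h * P⁻¹ * (P * t * P⁻¹) :=
      commute_of_mem_diagSub (mem_diagSub.2 (hP t ht)) (mem_diagSub.2 (hP h hh))
    calc t * h = P⁻¹ * (P * t * P⁻¹ * (P * h * P⁻¹)) * P := by group
      _ = _ := by rw [h1]; group
  exact key _ (ha ⟨_, rfl⟩)

/-- In `GL_2`, the kernel of a root is central, because it commutes with a nonabelian
subgroup; hence all roots are proportional. -/
lemma not_algIsomorphic_GL2 {K : Type*} [Field K] [IsAlgClosed K] [CharZero K] {ι : Type}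
    [Fintype ι] [DecidableEq ι] {r : ℕ} {H : Subgroup (GL ι K)} {a : (Fin r → Kˣ) →* GL ι K}
    (ha : a.range ≤ H) {p q : (Fin r → ℤ) × (Fin r → ℤ)} (hp : p ∈ rootPairs H a)
    (hq : q ∈ rootPairs H a) {n : Fin r → ℤ} (hpn : p.1 ⬝ᵥ n = 0) (hn : q.1 ⬝ᵥ n ≠ 0) :
    ¬ AlgIsomorphic H (⊤ : Subgroup (GL (Fin 2) K)) := by
  rintro ⟨φ, -, -⟩
  obtain ⟨c, hc⟩ := exists_unit_not_root_of_unity (K := K) _ hn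
  refine hc ?_
  rw [← monomialChar_cochar]
  obtain ⟨z, hz⟩ : ∃ z : Fin r → Kˣ, z = fun i => c ^ n i := ⟨_, rfl⟩
  have hz1 : monomialChar p.1 z = 1 := by rw [hz, monomialChar_cochar, hpn, zpow_zero]
  rw [← hz]
  refine monomialChar_eq_one_of_commute hq ?_
  obtain ⟨f, -, hf, hr, h1, h2, -⟩ := hp
  have hcomm : ∀ A, a z * f A = f A * a z := by
    intro A
    have : A ∈ (Subgroup.centralizer {a z}).comap f := by
      refine sl2_mem_of_unipotents (fun x => ?_) (fun x => ?_) A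
      · refine mem_centralizer_singleton.2 (mul_inv_eq_iff_eq_mul.1 ?_)
        rw [h1, hz1, Units.val_one, one_mul]
      · refine mem_centralizer_singleton.2 (mul_inv_eq_iff_eq_mul.1 ?_)
        rw [h2, hz1, inv_one, Units.val_one, one_mul]
    exact mem_centralizer_singleton.1 this
  -- two elements which do not commute, although both commute with `a z`
  obtain ⟨D, hD⟩ : ∃ D : H, D.1 = f (diagSL2 (Units.mk0 2 two_ne_zero)) := ⟨⟨_, hr ⟨_, rfl⟩⟩, rfl⟩
  obtain ⟨U, hU⟩ : ∃ U : H, U.1 = f (upperUni 1) := ⟨⟨_, hr ⟨_, rfl⟩⟩, rfl⟩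
  obtain ⟨Z, hZ⟩ : ∃ Z : H, Z.1 = a z := ⟨⟨_, ha ⟨_, rfl⟩⟩, rfl⟩
  have hDU : D * U ≠ U * D := by
    intro h
    have h3 := congrArg Subtype.val h
    simp only [Subgroup.coe_mul, hD, hU, ← map_mul] at h3
    rw [map_mul, map_mul, ← mul_inv_eq_iff_eq_mul, ← map_inv, ← map_mul, ← map_mul,
      diagSL2_conj] at h3
    have h4 : ((Units.mk0 (2 : K) two_ne_zero : Kˣ) : K) ^ 2 * 1 = 1 :=
      map_upperUni_injective hf h3
    norm_num at h4
  have hmat : ∀ {X Y : H}, X * Y = Y * X ↔ (φ X).1.1 * (φ Y).1.1 = (φ Y).1.1 * (φ X).1.1 :=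
    fun {X Y} => by
      rw [← φ.injective.eq_iff, map_mul, map_mul, Subtype.ext_iff, Units.ext_iff]; rfl
  have hscal : ∃ c : K, (φ Z).1.1 = c • 1 := by
    by_contra! hM
    refine hDU (hmat.2 (commute_of_commute_not_scalar hM (hmat.1 ?_) (hmat.1 ?_)))
    · exact Subtype.ext (by rw [Subgroup.coe_mul, Subgroup.coe_mul, hZ, hD, hcomm])
    · exact Subtype.ext (by rw [Subgroup.coe_mul, Subgroup.coe_mul, hZ, hU, hcomm])
  obtain ⟨c, hc⟩ := hscal
  intro h hh
  have h3 : Z * ⟨h, hh⟩ = ⟨h, hh⟩ * Z := hmat.2 (by rw [hc]; simp)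
  have := congrArg Subtype.val h3
  rwa [Subgroup.coe_mul, Subgroup.coe_mul, hZ] at this

lemma EndoPair.IsElliptic.not_isTorus_and_not_GL2 (hd : d.IsElliptic) {H : AlgGrp F}
    (hH : IsEndoscopicGroup H d) : ¬ IsTorus (H.pts (AlgebraicClosure F)) ∧
      ¬ AlgIsomorphic (H.pts (AlgebraicClosure F))
        (⊤ : Subgroup (GL (Fin 2) (AlgebraicClosure F))) := by
  obtain ⟨-, r, a, b, Δ, ha, hb, hab, -, -⟩ := hH
  obtain ⟨p, hp, q, hq, n, h0, h1⟩ := hd.exists_independent_roots hb hab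
  exact ⟨not_isTorus_of_rootPairs ha.2.2.1 hq h1,
    not_algIsomorphic_GL2 ha.2.2.1 hp hq h0 h1⟩

end Exclusion

/-! ### Real points -/

section RealPoints

variable {ι : Type} [Fintype ι] [DecidableEq ι]

lemma AlgGrp.map_mem (H : AlgGrp ℚ) {R S : Type} [CommRing R] [Algebra ℚ R] [CommRing S]
    [Algebra ℚ S] (f : R →+* S) {g : GL H.ι R} (hg : g ∈ H.pts R) :
    GeneralLinearGroup.map f g ∈ H.pts S := by
  rw [H.mem_pts] at hg ⊢
  intro p hp
  have h := DFunLike.congr_fun (MvPolynomial.comp_aeval (fun ij : H.ι × H.ι => g.1 ij.1 ij.2)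
    f.toRatAlgHom) p
  rw [AlgHom.comp_apply, hg p hp, map_zero] at h
  exact h.symm

lemma AlgGrp.mem_of_map_mem (H : AlgGrp ℚ) {R S : Type} [CommRing R] [Algebra ℚ R] [CommRing S]
    [Algebra ℚ S] (f : R →+* S) (hf : Function.Injective f) {g : GL H.ι R}
    (hg : GeneralLinearGroup.map f g ∈ H.pts S) : g ∈ H.pts R := by
  rw [H.mem_pts] at hg ⊢
  intro p hp
  have h := DFunLike.congr_fun (MvPolynomial.comp_aeval (fun ij : H.ι × H.ι => g.1 ij.1 ij.2)
    f.toRatAlgHom) p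
  refine hf ((h.trans ?_).trans (map_zero f).symm)
  exact hg p hp

/-- Complex conjugation on matrices. -/
noncomputable abbrev glConj : GL ι ℂ →* GL ι ℂ := GeneralLinearGroup.map (starRingEnd ℂ)

lemma glConj_glConj (g : GL ι ℂ) : glConj (glConj g) = g :=
  Units.ext (Matrix.ext fun i j => by simp)

lemma glConj_ofReal (g : GL ι ℝ) : glConj (GeneralLinearGroup.map Complex.ofRealHom g) =
    GeneralLinearGroup.map Complex.ofRealHom g :=
  Units.ext (Matrix.ext fun i j => by simp)

/-- A complex matrix fixed by complex conjugation is real. -/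
lemma exists_real_of_glConj_eq {g : GL ι ℂ} (hg : glConj g = g) :
    ∃ g₀ : GL ι ℝ, GeneralLinearGroup.map Complex.ofRealHom g₀ = g := by
  have key : ∀ {g : GL ι ℂ}, glConj g = g → (g.1.map Complex.re).map Complex.ofRealHom = g.1 :=
    fun {g} hg => by
      ext i j
      have := congrArg (fun x : GL ι ℂ => x.1 i j) hg
      simp only [GeneralLinearGroup.map_apply] at this
      simpa using Complex.conj_eq_iff_re.1 this
  have hi : glConj g⁻¹ = g⁻¹ := by rw [map_inv, hg]
  have inj : Function.Injective fun M : Matrix ι ι ℝ => M.map Complex.ofRealHom :=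
    Matrix.map_injective Complex.ofRealHom.injective
  refine ⟨⟨g.1.map Complex.re, (g⁻¹).1.map Complex.re, inj ?_, inj ?_⟩, Units.ext (key hg)⟩
  · simp only
    rw [Matrix.map_mul, key hg, key hi, ← Units.val_mul, mul_inv_cancel]
    simp
  · simp only
    rw [Matrix.map_mul, key hg, key hi, ← Units.val_mul, inv_mul_cancel]
    simp

lemma glConj_weightTorus {r : ℕ} (χ : ι → Fin r → ℤ) (z : Fin r → ℂˣ) :
    glConj (weightTorus χ z) = weightTorus χ fun i => Units.map (starRingEnd ℂ).toMonoidHom (z i) := by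
  refine Units.ext (Matrix.ext fun i j => ?_)
  rw [GeneralLinearGroup.map_apply, weightTorus_val, weightTorus_val, diagonal_apply,
    diagonal_apply]
  split_ifs
  · simp [monomialChar]
  · simp

/-- Matrices with bounded entries and bounded inverse form a compact set. -/
lemma isCompact_bounded_gl (B : ℝ) :
    IsCompact {g : GL ι ℝ | ∀ i j, |g.1 i j| ≤ B ∧ |(g⁻¹).1 i j| ≤ B} := by
  have hK : IsCompact {M : Matrix ι ι ℝ | ∀ i j, |M i j| ≤ B} := by
    have h := isCompact_univ_pi fun _ : ι => isCompact_univ_pi fun _ : ι =>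
      isCompact_Icc (a := -B) (b := B)
    change IsCompact {M : ι → ι → ℝ | ∀ i j, |M i j| ≤ B}
    convert h using 1
    ext M
    exact ⟨fun h i _ j _ => abs_le.1 (h i j), fun h i j => abs_le.2 (h i trivial j trivial)⟩
  have h := (Units.isClosedEmbedding_embedProduct (α := Matrix ι ι ℝ)).isCompact_preimage
    (hK.prod (hK.image MulOpposite.continuous_op))
  convert h using 1
  ext g
  constructor
  · exact fun h => ⟨fun i j => (h i j).1, _, fun i j => (h i j).2, rfl⟩
  · rintro ⟨h1, M, h2, h3⟩ i j
    obtain rfl : M = (g⁻¹).1 := MulOpposite.op_injective h3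
    exact ⟨h1 i j, h2 i j⟩

end RealPoints

/-! ### Compact maximal tori of `G_2` and `SO_4` -/

section Elliptic

/-- The Cayley transform, which diagonalizes the rotations. -/
noncomputable def cayley : SpecialLinearGroup (Fin 2) ℂ :=
  ⟨!![(1 : ℂ) / (Real.sqrt 2 : ℝ), Complex.I / (Real.sqrt 2 : ℝ);
    Complex.I / (Real.sqrt 2 : ℝ), 1 / (Real.sqrt 2 : ℝ)], by
    have h : ((Real.sqrt 2 : ℝ) : ℂ) ^ 2 = 2 := by
      rw [← Complex.ofReal_pow, Real.sq_sqrt (by norm_num)]; norm_num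
    have h0 : ((Real.sqrt 2 : ℝ) : ℂ) ≠ 0 := fun h0 => by rw [h0] at h; norm_num at h
    rw [det_fin_two_of]
    field_simp
    rw [h, Complex.I_sq]
    norm_num⟩

/-- Complex conjugation on `SL_n`. -/
noncomputable abbrev slConj {n : ℕ} :
    SpecialLinearGroup (Fin n) ℂ →* SpecialLinearGroup (Fin n) ℂ :=
  SpecialLinearGroup.map (starRingEnd ℂ)

lemma slConj_val {n : ℕ} (g : SpecialLinearGroup (Fin n) ℂ) (i j : Fin n) :
    (slConj g).1 i j = starRingEnd ℂ (g.1 i j) := rfl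

lemma cayley_conj : slConj cayley = cayley⁻¹ := by
  refine Subtype.ext (Matrix.ext fun i j => ?_)
  rw [slConj_val, sl2_inv_val]
  fin_cases i <;> fin_cases j <;> simp [cayley, neg_div]

/-- The square of the Cayley transform inverts the diagonal torus. -/
lemma cayley_sq_conj (a : ℂˣ) :
    (cayley * cayley)⁻¹ * diagSL2 a * (cayley * cayley) = (diagSL2 a)⁻¹ := by
  have h : ((Real.sqrt 2 : ℝ) : ℂ) ^ 2 = 2 := by
    rw [← Complex.ofReal_pow, Real.sq_sqrt (by norm_num)]; norm_num
  have h0 : ((Real.sqrt 2 : ℝ) : ℂ) ≠ 0 := fun h0 => by rw [h0] at h; norm_num at h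
  have hI := Complex.I_sq
  have e : cayley.1 * cayley.1 = !![0, Complex.I; Complex.I, 0] := by
    ext i j
    fin_cases i <;> fin_cases j <;> simp [cayley, Matrix.mul_apply, Fin.sum_univ_two] <;> field_simp <;>
      simp [h] <;> ring
  rw [mul_assoc, inv_mul_eq_iff_eq_mul]
  refine Subtype.ext (show (diagSL2 a).1 * (cayley.1 * cayley.1) =
    (cayley.1 * cayley.1) * ((diagSL2 a)⁻¹).1 from ?_)
  rw [e, sl2_inv_val, diagSL2_val]
  ext i j
  fin_cases i <;> fin_cases j <;> simp [Matrix.mul_apply, Fin.sum_univ_two, mul_comm]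

/-- If the maximal torus is the image of the diagonal torus of `SL_2 × SL_2` under a homomorphism
over `ℝ`, then the image of the torus of pairs of rotations is a compact maximal torus. -/
lemma hasRealEllipticMaximalTorus_of_hom (H : AlgGrp ℚ) {χ : H.ι → Fin 2 → ℤ} {e : Fin 2 → H.ι}
    (hH : IsSplitModel (H.pts ℂ) χ e)
    (f : SpecialLinearGroup (Fin 2) ℂ × SpecialLinearGroup (Fin 2) ℂ →* GL H.ι ℂ)
    (hf : ∀ g, f g ∈ H.pts ℂ)
    (hconj : ∀ g h, glConj (f (g, h)) =
      f (slConj g, slConj h))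
    (hdiag : ∀ z, ∃ a b, f (diagSL2 a, diagSL2 b) = weightTorus χ z) :
    HasRealEllipticMaximalTorus H := by
  -- the torus conjugated by the Cayley element `P` is stable under complex conjugation, which acts
  -- on it as `z ↦ z̄⁻¹`, so its real points have coordinates of absolute value `1`
  obtain ⟨P, hP⟩ : ∃ P, P = f (cayley, cayley) := ⟨_, rfl⟩
  have hPH : P ∈ H.pts ℂ := hP ▸ hf _
  have hPc : glConj P = P⁻¹ := by
    rw [hP, hconj, cayley_conj, ← map_inv]; rfl
  have hinv : ∀ z, (P * P)⁻¹ * weightTorus χ z * (P * P) = weightTorus χ z⁻¹ := fun z => by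
    obtain ⟨a, b, h⟩ := hdiag z
    rw [map_inv, ← h, hP, ← map_inv, ← map_mul, ← map_inv, ← map_mul, ← map_mul]
    refine congrArg f (Prod.ext ?_ ?_)
    · exact cayley_sq_conj a
    · exact cayley_sq_conj b
  have hconjT : ∀ z : Fin 2 → ℂˣ, glConj (P * weightTorus χ z * P⁻¹) =
      P * weightTorus χ (fun i => Units.map (starRingEnd ℂ).toMonoidHom (z i))⁻¹ * P⁻¹ :=
    fun z => by
      rw [map_mul, map_mul, map_inv, hPc, glConj_weightTorus, ← hinv]
      group
  have hmax := (hH.isMaxTorusParam le_rfl hH.mem).2.2.conj P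
  rw [conjSub_of_mem hPH] at hmax
  have hT : ∀ t, t ∈ conjSub P (weightTorus χ).range ↔ ∃ z, P * weightTorus χ z * P⁻¹ = t := by
    intro t
    rw [mem_conjSub]
    constructor
    · rintro ⟨z, hz⟩
      exact ⟨z, by rw [hz]; group⟩
    · rintro ⟨z, rfl⟩
      exact ⟨z, by group⟩
  obtain ⟨B, hB⟩ : ∃ B : ℝ, ∀ z : Fin 2 → ℂˣ, (∀ i, ‖(z i : ℂ)‖ = 1) → ∀ i j,
      ‖(P * weightTorus χ z * P⁻¹).1 i j‖ ≤ B := by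
    refine ⟨∑ i, ∑ j, ∑ k, ‖P.1 i k‖ * ‖(P⁻¹).1 k j‖, fun z hz i j => ?_⟩
    have h1 : (P * weightTorus χ z * P⁻¹).1 i j =
        ∑ k, P.1 i k * ((monomialChar (χ k) z : ℂˣ) : ℂ) * (P⁻¹).1 k j := by
      rw [Units.val_mul, Units.val_mul, weightTorus_val, Matrix.mul_apply]
      simp only [mul_diagonal]
    have h2 : ∀ k, ‖((monomialChar (χ k) z : ℂˣ) : ℂ)‖ = 1 := fun k => by
      simp [monomialChar, hz]
    have h3 : ‖(P * weightTorus χ z * P⁻¹).1 i j‖ ≤ ∑ k, ‖P.1 i k‖ * ‖(P⁻¹).1 k j‖ := by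
      rw [h1]
      refine (norm_sum_le _ _).trans (Finset.sum_le_sum fun k _ => ?_)
      rw [norm_mul, norm_mul, h2, mul_one]
    have h4 : ∀ i j, 0 ≤ ∑ k, ‖P.1 i k‖ * ‖(P⁻¹).1 k j‖ := fun i j =>
      Finset.sum_nonneg fun k _ => by positivity
    refine h3.trans ((Finset.single_le_sum (f := fun j => ∑ k, ‖P.1 i k‖ * ‖(P⁻¹).1 k j‖)
      (fun j _ => h4 i j) (Finset.mem_univ j)).trans ?_)
    exact Finset.single_le_sum (f := fun i => ∑ j, ∑ k, ‖P.1 i k‖ * ‖(P⁻¹).1 k j‖)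
      (fun i _ => Finset.sum_nonneg fun j _ => h4 i j) (Finset.mem_univ i)
  refine ⟨conjSub P (weightTorus χ).range, hmax, ?_, _, isCompact_bounded_gl B, ?_⟩
  · intro t ht
    obtain ⟨z, rfl⟩ := (hT t).1 ht
    exact (hT _).2 ⟨_, (hconjT z).symm⟩
  · intro t ht htT
    refine ⟨t, ?_, 1, one_mem _, fun h _ => by rw [mul_one, one_mul], (mul_one t).symm⟩
    obtain ⟨z, hz⟩ := (hT _).1 htT
    have h1 := glConj_ofReal t
    rw [← hz, hconjT] at h1
    have h2 := hH.injective (mul_left_cancel (mul_right_cancel h1))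
    have hz1 : ∀ i, ‖(z i : ℂ)‖ = 1 := fun i => by
      have h3 : (starRingEnd ℂ) (z i : ℂ) * z i = 1 := by
        have := congrFun h2 i
        rw [Pi.inv_apply, inv_eq_iff_mul_eq_one] at this
        exact congrArg Units.val this
      have h4 := congrArg norm h3
      rw [norm_mul, RCLike.norm_conj, norm_one, ← sq] at h4
      exact (pow_eq_one_iff_of_nonneg (norm_nonneg _) two_ne_zero).1 h4
    have hreal : ∀ {t : GL H.ι ℝ} {z : Fin 2 → ℂˣ}, (∀ i, ‖(z i : ℂ)‖ = 1) →
        P * weightTorus χ z * P⁻¹ = GeneralLinearGroup.map Complex.ofRealHom t →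
        ∀ i j, |t.1 i j| ≤ B := fun {t z} hz h i j => by
      have := hB z hz i j
      rw [h, GeneralLinearGroup.map_apply] at this
      simpa using this
    refine fun i j => ⟨hreal hz1 hz i j, hreal (t := t⁻¹) (z := z⁻¹) (fun i => ?_) ?_ i j⟩
    · simp [hz1 i]
    · rw [map_inv, map_inv, ← hz]
      group

lemma soHom_diagSL2 (a b : ℂˣ) :
    soHom (diagSL2 a, diagSL2 b) = weightTorus soWeight ![a * b⁻¹, a * b] := by
  refine Units.ext (Matrix.ext fun i j => ?_)
  rw [soHom_val, weightTorus_val, sl2_inv_val, diagSL2_val, diagSL2_val]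
  obtain ⟨i1, i2⟩ := i
  obtain ⟨j1, j2⟩ := j
  fin_cases i1 <;> fin_cases i2 <;> fin_cases j1 <;> fin_cases j2 <;>
    simp [kroneckerMap_apply, diagonal_apply, soWeight, monomialChar_two, mul_comm]

lemma glConj_soHom (g h : SpecialLinearGroup (Fin 2) ℂ) :
    glConj (soHom (g, h)) = soHom (slConj g, slConj h) := by
  refine Units.ext (Matrix.ext fun i j => ?_)
  rw [GeneralLinearGroup.map_apply, soHom_val, soHom_val, kroneckerMap_apply, kroneckerMap_apply,
    map_mul, transpose_apply, transpose_apply, ← map_inv, slConj_val, slConj_val]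

/-- The torus of pairs of rotations is compact in `SO_4`. A coordinate of the diagonal torus of
`SL_2 × SL_2` is a square root of a character of the torus of `SO_4`. -/
lemma hasRealEllipticMaximalTorus_SO4 : HasRealEllipticMaximalTorus (grpSO4 ℚ) := by
  refine hasRealEllipticMaximalTorus_of_hom (grpSO4 ℚ) (isSplitModel_so4 (K := ℂ)) soHom
    (fun g => soHom_mem g.1 g.2) glConj_soHom fun z => ?_
  obtain ⟨y, hy⟩ := exists_torus_pow (fun _ : Fin 1 => z 0 * z 1) 2 two_pos
  have hy0 : y 0 ^ 2 = z 0 * z 1 := congrFun hy 0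
  refine ⟨y 0, (z 0)⁻¹ * y 0, (soHom_diagSL2 _ _).trans (congrArg _ ?_)⟩
  ext i
  fin_cases i
  · simp [_root_.mul_inv_rev]
  · have : y 0 * ((z 0)⁻¹ * y 0) = z 1 := by
      rw [mul_left_comm, ← sq, hy0, inv_mul_cancel_left]
    exact congrArg Units.val this

/-- The embedding of `SL_2` in `SL_3` as the lower right block. -/
def lowerBlockSL3 {K : Type*} [Field K] :
    SpecialLinearGroup (Fin 2) K →* SpecialLinearGroup (Fin 3) K :=
  (MulAut.conj (cycleSL3 K)).toMonoidHom.comp blockSL3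

lemma lowerBlockSL3_val {K : Type*} [Field K] (A : SpecialLinearGroup (Fin 2) K) :
    (lowerBlockSL3 A).1 = !![1, 0, 0; 0, A.1 0 0, A.1 0 1; 0, A.1 1 0, A.1 1 1] := by
  show (cycleSL3 K).1 * (blockSL3 A).1 * ((cycleSL3 K)⁻¹).1 = _
  rw [cycleSL3_val, cycleSL3_inv_val, blockSL3_val]
  ext i j
  fin_cases i <;> fin_cases j <;> simp [Matrix.mul_apply, Fin.sum_univ_three]

lemma lowerBlockSL3_inv_val {K : Type*} [Field K] (A : SpecialLinearGroup (Fin 2) K) :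
    ((lowerBlockSL3 A)⁻¹).1 = !![1, 0, 0; 0, A.1 1 1, -A.1 0 1; 0, -A.1 1 0, A.1 0 0] := by
  rw [lowerBlockSL3, MonoidHom.comp_apply, ← map_inv]
  show (cycleSL3 K).1 * ((blockSL3 A)⁻¹).1 * ((cycleSL3 K)⁻¹).1 = _
  rw [cycleSL3_val, cycleSL3_inv_val, blockSL3_inv_val]
  ext i j
  fin_cases i <;> fin_cases j <;> simp [Matrix.mul_apply, Fin.sum_univ_three]

lemma octSL_lowerBlockSL3_mulVec {K : Type*} [Field K] (A : SpecialLinearGroup (Fin 2) K)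
    (x : Fin 8 → K) : (octSL (lowerBlockSL3 A)).1 *ᵥ x = oct (x 0) (x 1)
      ![x 2, A.1 0 0 * x 3 + A.1 0 1 * x 4, A.1 1 0 * x 3 + A.1 1 1 * x 4]
      ![x 5, A.1 1 1 * x 6 - A.1 1 0 * x 7, -(A.1 0 1 * x 6) + A.1 0 0 * x 7] := by
  conv_lhs => rw [← oct_eta x]
  rw [octSL_mulVec, lowerBlockSL3_val, lowerBlockSL3_inv_val, oct_inj]
  refine ⟨rfl, rfl, ?_, ?_⟩ <;> (ext i; fin_cases i <;>
    simp [mulVec, vec3_dotProduct, octV, octW, sub_eq_add_neg])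

/-- The subgroups `SL_2` of a long root and of the orthogonal short root commute. -/
lemma commute_lowerBlock_octShort {K : Type*} [Field K] (A B : SpecialLinearGroup (Fin 2) K) :
    octSL (lowerBlockSL3 A) * octShort B = octShort B * octSL (lowerBlockSL3 A) := by
  refine gl_ext_mulVec fun x => ?_
  rw [gl_mul_mulVec, gl_mul_mulVec, octSL_lowerBlockSL3_mulVec, octShort_mulVec,
    octSL_lowerBlockSL3_mulVec, octShort_mulVec, octShortLin_apply, octShortLin_apply]
  ext i; fin_cases i <;> simp <;> ring

/-- The product of the commuting subgroups `SL_2` of `G_2` given by orthogonal roots. -/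
noncomputable def octPair : SpecialLinearGroup (Fin 2) ℂ × SpecialLinearGroup (Fin 2) ℂ →*
    GL (Fin 8) ℂ :=
  MonoidHom.noncommCoprod (octSL.comp lowerBlockSL3) octShort commute_lowerBlock_octShort

lemma octPair_apply (g h : SpecialLinearGroup (Fin 2) ℂ) :
    octPair (g, h) = octSL (lowerBlockSL3 g) * octShort h := rfl

lemma glConj_mulVec {ι : Type} [Fintype ι] [DecidableEq ι] (g : GL ι ℂ) (x : ι → ℂ) :
    (glConj g).1 *ᵥ x = fun i => starRingEnd ℂ ((g.1 *ᵥ fun j => starRingEnd ℂ (x j)) i) := by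
  ext i
  simp [mulVec, dotProduct]

lemma glConj_octPair (g h : SpecialLinearGroup (Fin 2) ℂ) :
    glConj (octPair (g, h)) = octPair (slConj g, slConj h) := by
  rw [octPair_apply, octPair_apply, map_mul]
  congr 1
  · refine gl_ext_mulVec fun x => ?_
    rw [glConj_mulVec, octSL_lowerBlockSL3_mulVec, octSL_lowerBlockSL3_mulVec]
    ext i; fin_cases i <;> simp [slConj_val, oct]
  · refine gl_ext_mulVec fun x => ?_
    rw [glConj_mulVec, octShort_mulVec, octShort_mulVec, octShortLin_apply, octShortLin_apply]
    ext i; fin_cases i <;> simp [slConj_val, oct]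

lemma octPair_diagSL2 (a b : ℂˣ) :
    octPair (diagSL2 a, diagSL2 b) = weightTorus octWeight ![b ^ 2, a * b⁻¹] := by
  have e : octSL (lowerBlockSL3 (diagSL2 a)) = weightTorus octWeight ![1, a] := by
    refine gl_ext_mulVec fun x => ?_
    rw [octSL_lowerBlockSL3_mulVec]
    conv_rhs => rw [← oct_eta x]
    rw [octWeight_mulVec, diagSL2_val]
    ext i; fin_cases i <;> simp [octV, octW]
  rw [octPair_apply, e, octShort_diagSL2, ← map_mul]
  refine congrArg _ ?_
  ext i; fin_cases i <;> simp

/-- A compact maximal torus of `G_2` in the image of `SL_2 × SL_2`. -/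
lemma hasRealEllipticMaximalTorus_G2 : HasRealEllipticMaximalTorus (grpG2 ℚ) := by
  refine hasRealEllipticMaximalTorus_of_hom (grpG2 ℚ) (isSplitModel_oct (K := ℂ)) octPair
    (fun g => mul_mem (octSL_mem _) (octShort_mem _)) glConj_octPair fun z => ?_
  obtain ⟨y, hy⟩ := exists_torus_pow (fun _ : Fin 1 => z 0) 2 two_pos
  have hy0 : y 0 ^ 2 = z 0 := congrFun hy 0
  refine ⟨z 1 * y 0, y 0, (octPair_diagSL2 _ _).trans (congrArg _ ?_)⟩
  ext i
  fin_cases i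
  · simp [← hy0]
  · simp

end Elliptic

/-! ### `PGL_3` has no elliptic maximal torus over the real numbers -/

section NoElliptic

lemma exists_gl_of_det_ne_zero {ι K : Type*} [Fintype ι] [DecidableEq ι] [Field K]
    (M : Matrix ι ι K) (h : M.det ≠ 0) : ∃ g : GL ι K, g.1 = M :=
  ⟨Matrix.GeneralLinearGroup.mkOfDetNeZero M h, rfl⟩

/-- The centre of `PGL_3` is trivial. -/
lemma eq_one_of_central_mat3 {K : Type*} [Field K] [CharZero K] {z : GL (Fin 3 × Fin 3) K}
    (hz : z ∈ autPts mat3Const K) (hc : ∀ h ∈ autPts mat3Const K, h * z = z * h) : z = 1 := by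
  obtain ⟨g, rfl⟩ := mem_autPts_mat3.1 hz
  -- an element of nonzero trace cannot be conjugate to a nontrivial multiple of itself
  have key : ∀ h : GL (Fin 3) K, h.1.trace ≠ 0 → g.1 * h.1 = h.1 * g.1 := by
    intro h ht
    have h1 : adHom (g * h * g⁻¹ * h⁻¹) = 1 := by
      simp only [map_mul, map_inv]
      rw [← hc _ (adHom_mem h)]
      group
    obtain ⟨c, hcc⟩ := adHom_eq_one.1 h1
    have h2 : (g * h * g⁻¹).1 = c • h.1 := by
      have : g * h * g⁻¹ = g * h * g⁻¹ * h⁻¹ * h := by group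
      rw [this, Units.val_mul, hcc, smul_mul_assoc, one_mul]
    have h3 := congrArg Matrix.trace h2
    rw [Units.val_mul, Units.val_mul, Matrix.trace_mul_comm, ← Matrix.mul_assoc, gl_inv_mul_val,
      Matrix.one_mul, trace_smul, smul_eq_mul] at h3
    have hc1 : c = 1 := mul_right_cancel₀ ht (by rw [← h3, one_mul])
    rw [hc1, one_smul] at h2
    have h4 : g * h = h * g := mul_inv_eq_iff_eq_mul.1 (Units.ext h2)
    exact congrArg Units.val h4
  have off : ∀ i j, i ≠ j → g.1 i j = 0 := by
    intro i j hij
    obtain ⟨h, hh⟩ : ∃ h : GL (Fin 3) K, h.1 = diagonal (fun k => if k = i then 2 else 1) := by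
      refine exists_gl_of_det_ne_zero _ ?_
      rw [det_diagonal]
      exact Finset.prod_ne_zero_iff.2 fun k _ => by split_ifs <;> norm_num
    have h1 := key h (by
      rw [hh, trace_diagonal, Fin.sum_univ_three]
      fin_cases i <;> simp <;> norm_num)
    rw [hh] at h1
    have h2 := congrFun (congrFun h1 i) j
    rw [mul_diagonal, diagonal_mul, if_neg (Ne.symm hij), if_pos rfl] at h2
    linear_combination -h2
  have dia : ∀ i j, i ≠ j → g.1 i i = g.1 j j := by
    intro i j hij
    obtain ⟨h, hh⟩ : ∃ h : GL (Fin 3) K, h.1 = transvection i j (1 : K) := by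
      refine exists_gl_of_det_ne_zero _ ?_
      rw [det_transvection_of_ne _ _ hij]
      exact one_ne_zero
    have h1 := key h (by
      rw [hh, transvection, trace_add, trace_one, trace_single_eq_of_ne _ _ _ hij]
      simp)
    rw [hh, transvection, Matrix.mul_add, Matrix.add_mul, Matrix.mul_one, Matrix.one_mul] at h1
    have h2 := congrFun (congrFun h1 i) j
    rw [Matrix.add_apply, Matrix.add_apply] at h2
    simpa using add_left_cancel h2
  refine adHom_eq_one.2 ⟨g.1 0 0, Matrix.ext fun i j => ?_⟩
  by_cases hij : i = j
  · subst hij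
    by_cases h0 : i = 0
    · simp [h0]
    · rw [dia i 0 h0]; simp
  · rw [off i j hij]; simp [hij]

lemma le_one_of_pow_le {x B : ℝ} (h : ∀ k : ℕ, x ^ k ≤ B) : x ≤ 1 := by
  by_contra! hx
  obtain ⟨k, hk⟩ := pow_unbounded_of_one_lt B hx
  exact absurd (h k) (not_le.2 hk)

/-- A maximal torus of `PGL_3` with compact real points would be inverted by complex conjugation,
up to an element of `PGL_3(ℂ)`. But the diagonal torus of `PGL_3` is not inverted by any element,
because `diag(2, 1, 1)` and `diag(1/2, 1, 1)` are not conjugate up to scalars. -/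
lemma not_hasRealEllipticMaximalTorus_PGL3 : ¬ HasRealEllipticMaximalTorus (grpPGL3 ℚ) := by
  rintro ⟨T, hT, hTc, C, hC, hCT⟩
  change Subgroup (GL (Fin 3 × Fin 3) ℂ) at T
  change Set (GL (Fin 3 × Fin 3) ℝ) at C
  have hmodel := isSplitModel_mat3 (K := ℂ)
  have hTle : T ≤ autPts mat3Const ℂ := hT.1
  obtain ⟨g, hg, hgT, -⟩ := hmodel.exists_conj_torus hT.2.1 hTle (one_mem _)
    ⟨Polynomial.X - 1, (Polynomial.irreducible_X_sub_C 1).squarefree, by simp⟩ (by simp)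
  have hT' : IsMaximalTorus (autPts mat3Const ℂ) T := hT
  obtain ⟨u, hu⟩ : ∃ u, u = g⁻¹ := ⟨_, rfl⟩
  have huG : u ∈ autPts mat3Const ℂ := hu ▸ inv_mem hg
  have hTeq : conjSub u (weightTorus projWeight).range = T := by
    refine hT'.2.2 _ ?_ (hmodel.isTorus.conj u) ?_
    · have h := conjSub_mono (g := u) (show (weightTorus projWeight).range ≤ autPts mat3Const ℂ by
        rw [hmodel.range_eq]; exact inf_le_left)
      rwa [conjSub_of_mem huG] at h
    · have h := conjSub_mono (g := u) (show conjSub g T ≤ (weightTorus projWeight).range by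
        rw [hmodel.range_eq]
        refine le_inf ?_ hgT
        have h := conjSub_mono (g := g) hTle
        rwa [conjSub_of_mem hg] at h)
      rwa [conjSub_conjSub, hu, inv_mul_cancel, conjSub_one, ← hu] at h
  have hmem : ∀ t, t ∈ T ↔ ∃ z, u * weightTorus projWeight z * u⁻¹ = t := by
    intro t
    rw [← hTeq, mem_conjSub]
    constructor
    · rintro ⟨z, hz⟩
      exact ⟨z, by rw [hz]; group⟩
    · rintro ⟨z, rfl⟩
      exact ⟨z, by group⟩
  -- real elements of the torus have eigenvalues of absolute value `1`
  obtain ⟨B, hB⟩ : ∃ B : ℝ, ∀ t ∈ C, ∀ i j, |t.1 i j| ≤ B := by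
    have h : ∀ i j, ∃ B : ℝ, ∀ t ∈ C, |t.1 i j| ≤ B := fun i j => by
      obtain ⟨B, hB⟩ := hC.exists_bound_of_continuousOn
        (f := fun t : GL (Fin 3 × Fin 3) ℝ => t.1 i j)
        (Units.continuous_val.matrix_elem i j).continuousOn
      exact ⟨B, fun t ht => hB t ht⟩
    choose B hB using h
    refine ⟨∑ i, ∑ j, |B i j|, fun t ht i j => (hB i j t ht).trans ((le_abs_self _).trans ?_)⟩
    exact (Finset.single_le_sum (f := fun j => |B i j|) (fun j _ => abs_nonneg _)
      (Finset.mem_univ j)).trans (Finset.single_le_sum (f := fun i => ∑ j, |B i j|)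
        (fun i _ => Finset.sum_nonneg fun j _ => abs_nonneg _) (Finset.mem_univ i))
  have hreal : ∀ w, glConj (u * weightTorus projWeight w * u⁻¹) =
      u * weightTorus projWeight w * u⁻¹ → ∀ i j,
      ‖(u * weightTorus projWeight w * u⁻¹).1 i j‖ ≤ B := by
    intro w hw i j
    obtain ⟨t, ht⟩ := exists_real_of_glConj_eq hw
    have htT : GeneralLinearGroup.map Complex.ofRealHom t ∈ T := by
      rw [ht]; exact (hmem _).2 ⟨w, rfl⟩
    have htG : t ∈ (grpPGL3 ℚ).pts ℝ := (grpPGL3 ℚ).mem_of_map_mem Complex.ofRealHom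
      Complex.ofRealHom.injective (hTle htT)
    obtain ⟨c, hcC, z, hz, hzc, htz⟩ := hCT t htG htT
    have hz1 : z = 1 := eq_one_of_central_mat3 hz hzc
    have htc : t = c := by rw [htz, hz1]; exact mul_one c
    have := hB c hcC i j
    rw [← htc] at this
    rw [← ht, GeneralLinearGroup.map_apply]
    simpa using this
  -- a coordinate of absolute value above `1` would have unbounded powers
  have hle : ∀ w, glConj (u * weightTorus projWeight w * u⁻¹) =
      u * weightTorus projWeight w * u⁻¹ → ∀ l, ‖(w l : ℂ)‖ ≤ 1 := by
    intro w hw l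
    refine le_one_of_pow_le (B := ∑ k, ∑ k', ‖(u⁻¹).1 (![(0, 2), (1, 2)] l) k‖ * B *
      ‖u.1 k' (![(0, 2), (1, 2)] l)‖) fun k => ?_
    have h1 : glConj (u * weightTorus projWeight (w ^ k) * u⁻¹) =
        u * weightTorus projWeight (w ^ k) * u⁻¹ := by
      have e : u * weightTorus projWeight (w ^ k) * u⁻¹ =
          (u * weightTorus projWeight w * u⁻¹) ^ k := by rw [map_pow, conj_pow]
      rw [e, map_pow, hw]
    have h2 := hreal _ h1
    have h3 : (w l : ℂ) ^ k =
        (u⁻¹ * (u * weightTorus projWeight (w ^ k) * u⁻¹) * u).1 (![(0, 2), (1, 2)] l)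
          (![(0, 2), (1, 2)] l) := by
      rw [show u⁻¹ * (u * weightTorus projWeight (w ^ k) * u⁻¹) * u =
        weightTorus projWeight (w ^ k) by group, hmodel.coord_apply]
      simp
    rw [← norm_pow, h3, Units.val_mul, Units.val_mul, Matrix.mul_apply]
    rw [Finset.sum_comm]
    refine (norm_sum_le _ _).trans (Finset.sum_le_sum fun k' _ => ?_)
    rw [Matrix.mul_apply, Finset.sum_mul]
    refine (norm_sum_le _ _).trans (Finset.sum_le_sum fun k _ => ?_)
    rw [norm_mul, norm_mul]
    gcongr
    exact h2 _ _
  have heq : ∀ w, glConj (u * weightTorus projWeight w * u⁻¹) =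
      u * weightTorus projWeight w * u⁻¹ → ∀ l, ‖(w l : ℂ)‖ = 1 := by
    intro w hw l
    refine le_antisymm (hle w hw l) ?_
    have h1 : glConj (u * weightTorus projWeight w⁻¹ * u⁻¹) =
        u * weightTorus projWeight w⁻¹ * u⁻¹ := by
      have e : u * weightTorus projWeight w⁻¹ * u⁻¹ =
          (u * weightTorus projWeight w * u⁻¹)⁻¹ := by rw [map_inv]; group
      rw [e, map_inv, hw]
    have h2 := hle _ h1 l
    rw [Pi.inv_apply, Units.val_inv_eq_inv_val, norm_inv] at h2
    exact (inv_le_one₀ (norm_pos_iff.2 (Units.ne_zero _))).1 h2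
  -- the element `diag(2, 1, 1)` of the torus and its complex conjugate
  obtain ⟨z, hz⟩ : ∃ z : Fin 2 → ℂˣ, z = ![Units.mk0 2 two_ne_zero, 1] := ⟨_, rfl⟩
  have hzc : glConj (weightTorus projWeight z) = weightTorus projWeight z := by
    rw [glConj_weightTorus]
    refine congrArg _ ?_
    ext l
    rw [hz]
    fin_cases l
    · simp only [Fin.zero_eta, cons_val_zero]
      exact map_ofNat (starRingEnd ℂ) 2
    · simp
  obtain ⟨y, hy⟩ := (hmem _).1 (hTc _ ((hmem _).2 ⟨z, rfl⟩))
  replace hy : u * weightTorus projWeight y * u⁻¹ =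
    glConj (u * weightTorus projWeight z * u⁻¹) := hy
  have hcomm : ∀ a b, u * weightTorus projWeight a * u⁻¹ * (u * weightTorus projWeight b * u⁻¹) =
      u * weightTorus projWeight (a * b) * u⁻¹ := fun a b => by rw [map_mul]; group
  have hzy : u * weightTorus projWeight (z * y) * u⁻¹ = u * weightTorus projWeight z * u⁻¹ *
      glConj (u * weightTorus projWeight z * u⁻¹) := by rw [← hy, hcomm]
  -- the product of an element and its conjugate is real
  have hyz := heq (z * y) (by
    rw [hzy, map_mul, glConj_glConj, ← hy, hcomm, hcomm, mul_comm y z])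
  have hun : glConj u ∈ autPts mat3Const ℂ := (grpPGL3 ℚ).map_mem (starRingEnd ℂ) huG
  -- `N` conjugates `diag(2, 1, 1)` to an element with the inverse absolute values, up to a scalar
  obtain ⟨N, hN⟩ := mem_autPts_mat3.1 (mul_mem (inv_mem huG) hun)
  have hNz : adHom N * weightTorus projWeight z = weightTorus projWeight y * adHom N := by
    rw [map_mul, map_mul, map_inv, hzc] at hy
    rw [hN]
    calc u⁻¹ * glConj u * weightTorus projWeight z
        = u⁻¹ * (glConj u * weightTorus projWeight z * (glConj u)⁻¹) * glConj u := by group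
      _ = _ := by rw [← hy]; group
  rw [← adHom_weightTorus, ← adHom_weightTorus, ← map_mul, ← map_mul, ← mul_inv_eq_one, ← map_inv,
    ← map_mul, adHom_eq_one] at hNz
  obtain ⟨c, hc⟩ := hNz
  have hc' : (N * weightTorus stdWeight z).1 = c • (weightTorus stdWeight y * N).1 := by
    have : N * weightTorus stdWeight z = N * weightTorus stdWeight z *
      (weightTorus stdWeight y * N)⁻¹ * (weightTorus stdWeight y * N) := by group
    rw [this, Units.val_mul, hc, smul_mul_assoc, one_mul]
  -- the nonzero entries of `N` lie in positions `(i, j)` with a fixed value of `d i * d j`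
  obtain ⟨dd, hdd⟩ : ∃ dd : Fin 3 → ℝ, dd = ![2, 1, 1] := ⟨_, rfl⟩
  have hzd : ∀ j, ‖((monomialChar (stdWeight j) z : ℂˣ) : ℂ)‖ = dd j := by
    intro j
    rw [hz, hdd]
    fin_cases j <;> simp [stdWeight, monomialChar_two]
  have hyd : ∀ j, ‖((monomialChar (stdWeight j) y : ℂˣ) : ℂ)‖ * dd j = 1 := by
    intro j
    have h0 := hyz 0
    have h1 := hyz 1
    rw [hz] at h0 h1
    rw [hdd]
    fin_cases j
    · simpa [stdWeight, monomialChar_two, mul_comm] using h0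
    · simpa [stdWeight, monomialChar_two, mul_comm] using h1
    · simp [stdWeight, monomialChar_two]
  have hent : ∀ i j, N.1 i j ≠ 0 → dd i * dd j = ‖c‖ := by
    intro i j hij
    have h1 := congrArg norm (congrFun (congrFun hc' i) j)
    rw [Units.val_mul, Units.val_mul, weightTorus_val, weightTorus_val, mul_diagonal,
      Matrix.smul_apply, diagonal_mul, norm_mul, norm_smul, norm_mul, hzd] at h1
    have h2 : dd j = ‖c‖ * ‖((monomialChar (stdWeight i) y : ℂˣ) : ℂ)‖ :=
      mul_left_cancel₀ (norm_ne_zero_iff.2 hij) (by rw [h1]; ring)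
    rw [h2]
    linear_combination ‖c‖ * hyd i
  have hdet : N.1.det ≠ 0 := by
    have := (Matrix.isUnit_iff_isUnit_det _).1 N.isUnit
    exact this.ne_zero
  have hzero : ∀ i j, dd i * dd j ≠ ‖c‖ → N.1 i j = 0 := fun i j h => by
    by_contra h0
    exact h (hent i j h0)
  apply hdet
  -- the possible values `4`, `2`, `1` of `d i * d j` each leave a matrix of determinant zero
  rw [det_fin_three]
  by_cases h1 : ‖c‖ = 1
  · have e : ∀ j, N.1 0 j = 0 := fun j => hzero 0 j (by
      rw [h1, hdd]; fin_cases j <;> norm_num)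
    rw [e 0, e 1, e 2]; ring
  · have hd1 : ∀ i, i ≠ 0 → dd i = 1 := fun i hi => by
      rw [hdd]
      fin_cases i
      exacts [absurd rfl hi, rfl, rfl]
    have e : ∀ i j, i ≠ 0 → j ≠ 0 → N.1 i j = 0 := fun i j hi hj => hzero i j fun h => h1 (by
      rw [← h, hd1 i hi, hd1 j hj, one_mul])
    rw [e 1 1 (by decide) (by decide), e 1 2 (by decide) (by decide),
      e 2 1 (by decide) (by decide), e 2 2 (by decide) (by decide)]
    ring

end NoElliptic

/-! ### The classification -/

/-- Elliptic pairs are isomorphic exactly if their endoscopic groups have the same type. -/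
lemma EndoPair.IsElliptic.exists_conj_iff {F : Type u} [Field F] [CharZero F] {d d' : EndoPair F}
    {t t' : EllType} (hd : d.IsElliptic) (hd' : d'.IsElliptic)
    (h : IsEndoscopicGroup (t.grp F) d) (h' : IsEndoscopicGroup (t'.grp F) d') :
    ((∃ g, EndoPair.IsIso d d' g) ↔ t = t') ∧
      (t = t' → ∃ g, EndoPair.IsIso d d' g ∧ g * d.s * g⁻¹ = d'.s) := by
  have key : t = t' → ∃ g, EndoPair.IsIso d d' g ∧ g * d.s * g⁻¹ = d'.s := by
    rintro rfl
    obtain ⟨g, hg, hgs⟩ := hd.exists_conj_eq hd' ((hd.ord_eq h).symm.trans (hd'.ord_eq h'))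
    exact ⟨g, hd.isIso hd' hg hgs, hgs⟩
  refine ⟨⟨fun ⟨g, hg⟩ => ?_, fun e => ?_⟩, key⟩
  · exact EllType.ord_injective ((hd.ord_eq h).trans ((hg.orderOf_eq hd hd').trans
      (hd'.ord_eq h').symm))
  · obtain ⟨g, hg, -⟩ := key e
    exact ⟨g, hg⟩

lemma EndoPair.IsElliptic.existsUnique_type {F : Type u} [Field F] [CharZero F] {d : EndoPair F}
    (hd : d.IsElliptic) : ∃! t : EllType, IsEndoscopicGroup (t.grp F) d := by
  obtain ⟨t, ht⟩ := EllType.exists_ord_eq hd.orderOf_mem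
  exact ⟨t, EndoPair.isEndoscopicGroup_of_conj hd ht, fun t' h' =>
    EllType.ord_injective ((hd.ord_eq h').trans ht.symm)⟩

lemma inv_eq_self_iff_orderOf {G : Type*} [Group G] (x : G) : x⁻¹ = x ↔ orderOf x ∣ 2 := by
  rw [orderOf_dvd_iff_pow_eq_one, sq, inv_eq_iff_mul_eq_one]

theorem mainTheorem9 (F : Type u) [Field F] [NumberField F] :
    -- the concrete models: `PGL_3 = GL_3 / scalars` and `SO_4 = (SL_2 × SL_2) / {±1}`
    ((∀ M : GL (Fin 3 × Fin 3) (AlgebraicClosure F),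
        M ∈ (grpPGL3 F).pts (AlgebraicClosure F) ↔ ∃ g : GL (Fin 3) (AlgebraicClosure F),
          M.1 = kroneckerMap (· * ·) g.1 ((g⁻¹).1)ᵀ) ∧
      (∀ g : GL (Fin 3) (AlgebraicClosure F), kroneckerMap (· * ·) g.1 ((g⁻¹).1)ᵀ = 1 ↔
        ∃ c : AlgebraicClosure F, g.1 = c • 1)) ∧
    ((∀ M : GL (Fin 2 × Fin 2) (AlgebraicClosure F),
        M ∈ (grpSO4 F).pts (AlgebraicClosure F) ↔
          ∃ g h : SpecialLinearGroup (Fin 2) (AlgebraicClosure F),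
            M.1 = kroneckerMap (· * ·) g.1 ((h⁻¹).1)ᵀ) ∧
      (∀ g h : SpecialLinearGroup (Fin 2) (AlgebraicClosure F),
        kroneckerMap (· * ·) g.1 ((h⁻¹).1)ᵀ = 1 ↔
          (g.1 = 1 ∧ h.1 = 1) ∨ (g.1 = -1 ∧ h.1 = -1))) ∧
    -- every elliptic pair has trivial `ρ` and endoscopic group exactly one of the three
    (∀ d : EndoPair F, d.IsElliptic →
      (∀ σ, d.ρ σ = 1) ∧ ∃! t : EllType, IsEndoscopicGroup (t.grp F) d) ∧
    -- each of the three occurs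
    (∀ t : EllType, ∃ d : EndoPair F, d.IsElliptic ∧ IsEndoscopicGroup (t.grp F) d) ∧
    -- it occurs for exactly one isomorphism class of elliptic pairs
    (∀ (d d' : EndoPair F) (t t' : EllType), d.IsElliptic → d'.IsElliptic →
      IsEndoscopicGroup (t.grp F) d → IsEndoscopicGroup (t'.grp F) d' →
        ((∃ g, EndoPair.IsIso d d' g) ↔ t = t') ∧
        (t = t' → ∃ g, EndoPair.IsIso d d' g ∧ g * d.s * g⁻¹ = d'.s)) ∧
    -- no elliptic endoscopic group is a torus or a form of `GL_2`
    (∀ d : EndoPair F, d.IsElliptic → ∀ H : AlgGrp F, IsEndoscopicGroup H d →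
      ¬ IsTorus (H.pts (AlgebraicClosure F)) ∧
      ¬ AlgIsomorphic (H.pts (AlgebraicClosure F))
        (⊤ : Subgroup (GL (Fin 2) (AlgebraicClosure F)))) ∧
    -- the groups `Λ`
    (∀ d : EndoPair F, d.IsElliptic →
      (IsEndoscopicGroup (EllType.G2.grp F) d → d.outerAut = ⊥) ∧
      (IsEndoscopicGroup (EllType.PGL3.grp F) d → Nat.card d.outerAut = 2) ∧
      (IsEndoscopicGroup (EllType.SO4.grp F) d → d.outerAut = ⊥)) ∧
    -- over `ℚ`: unramified at all primes, with an elliptic maximal torus at infinity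
    (∀ (d : EndoPair ℚ) (t : EllType), d.IsElliptic → IsEndoscopicGroup (t.grp ℚ) d →
      ((d.IsUnramified ∧ HasRealEllipticMaximalTorus (t.grp ℚ)) ↔
        t = EllType.G2 ∨ t = EllType.SO4)) := by
  refine ⟨⟨fun M => ?_, fun g => ?_⟩, ⟨fun M => ?_, fun g h => ?_⟩, fun d hd => ⟨hd.ρ_eq_one,
    hd.existsUnique_type⟩, EndoPair.exists_isElliptic,
    fun d d' t t' hd hd' h h' => hd.exists_conj_iff hd' h h',
    fun d hd H hH => hd.not_isTorus_and_not_GL2 hH, fun d hd => ⟨fun h => ?_, fun h => ?_, fun h => ?_⟩,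
    fun d t hd _ => ?_⟩
  · refine (mem_autPts_mat3 (M := M)).trans (exists_congr fun g => ?_)
    exact ⟨fun h => by rw [← h]; exact adHom_val g,
      fun h => Units.ext ((adHom_val g).trans h.symm)⟩
  · rw [← adHom_eq_one, Units.ext_iff, adHom_val]
    rfl
  · refine (mem_so4Pts (M := M)).trans (exists_congr fun g => exists_congr fun h => ?_)
    exact ⟨fun e => by rw [← e]; exact soHom_val g h,
      fun e => Units.ext ((soHom_val g h).trans e.symm)⟩
  · rw [← soHom_val]
    exact Units.ext_iff.symm.trans soHom_eq_one
  · refine hd.outerAut_eq_bot ((inv_eq_self_iff_orderOf _).2 ?_)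
    rw [← hd.ord_eq h]
    exact one_dvd 2
  · refine hd.card_outerAut fun e => ?_
    rw [inv_eq_self_iff_orderOf, ← hd.ord_eq h] at e
    revert e
    decide
  · refine hd.outerAut_eq_bot ((inv_eq_self_iff_orderOf _).2 ?_)
    rw [← hd.ord_eq h]
    exact dvd_rfl
  · have hunr : d.IsUnramified := fun P _ _ σ _ => hd.ρ_eq_one σ
    cases t
    · exact ⟨fun _ => Or.inl rfl, fun _ => ⟨hunr, hasRealEllipticMaximalTorus_G2⟩⟩
    · exact ⟨fun h => absurd h.2 not_hasRealEllipticMaximalTorus_PGL3,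
        fun h => by rcases h with h | h <;> cases h⟩
    · exact ⟨fun _ => Or.inr rfl, fun _ => ⟨hunr, hasRealEllipticMaximalTorus_SO4⟩⟩
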